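/- Let $R$ be a reduced irreducible root system in a finite-dimensional $\mathbb{Q}$-vector space $V$, with positive roots $R^+$, simple roots $\Delta$, coroots $\alpha^\vee\in V^*$ and highest root $\tilde\alpha$. For $\alpha\in R$, $n\in\mathbb{Z}$ let $s_{\alpha,n}(v)=v-(\langle\alpha,v\rangle-n)\alpha^\vee$ on $V^*$, the reflection in $H_{\alpha,n}=\{v\mid\langle\alpha,v\rangle=n\}$, and let $H_{\alpha,n}^{-}$, $H_{\alpha,n}^{+}$ be the half-spaces $\langle\alpha,v\rangle<n$ and $\langle\alpha,v\rangle>n$. Let $\widehat{\mathcal S}=\{s_{\alpha,0}\mid\alpha\in\Delta\}\cup\{s_{\tilde\alpha,1}\}$, let $\widehat{\mathcal W}$ be the affine Weyl group generated by $\widehat{\mathcal S}$, with length function $l$, and let $w_0$ be the longest element of the finite Weyl group $\mathcal W=\langle s_{\alpha,0}\mid\alpha\in\Delta\rangle$. Let $\mathscr F$ be the coarsest partition of $V^*$ refining all $V^*=H_{\alpha,n}^-\,\dot\cup\,H_{\alpha,n}\,\dot\cup\,H_{\alpha,n}^+$. Its components that meet no hyperplane $H_{\alpha,n}$ form the set $\mathscr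 A$ of alcoves; those contained in exactly one hyperplane are the walls. Put $A_e=\{v\mid 0<\langle\alpha,v\rangle<1\ \forall\alpha\in R^+\}$ and $A_w=w.A_e$. For $\beta\in R^+$ and $F\in\mathscr F$ let $\beta\uparrow F=s_{\beta,m}.F$ with $m$ minimal such that $F\subset H_{\beta,m}^-\cup H_{\beta,m}$, and let $\beta\downarrow$ be the inverse of $\beta\uparrow$. For $s\in\widehat{\mathcal S}$ and $A\in\mathscr A$ let $A^{(s)}$ be the wall in the closure of $A$ that lies in the $\widehat{\mathcal W}$-orbit of the common wall of $A_e$ and $A_s$; let $A^{(s)}_-$ and $A^{(s)}_+$ be the two alcoves with wall $A^{(s)}$, on the negative and on the positive side of the hyperplane $H_{\beta,n}$, $\beta\in R^+$, that contains it. The anti-fundamental box $\Pi^-$ consists of the alcoves contained in $H^-_{\alpha,0}\cap H^+_{\alpha,-1}$ for all $\alpha\in\Delta$. Let $k$ be an algebraically closed field with $\operatorname{char}k\ne2$ and, if $R$ is of type $G_2$ or $A_2$, $\operatorname{char}k\neq3$. Let $X=\{x\in V\mid\langle x,\alpha^\vee\rangle\in\mathbb{Z}\ \forall\alpha\in R\}$,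 let $S_k$ be the symmetric algebra of $X\otimes_{\mathbb Z}k$, graded with $X\otimes_{\mathbb Z}k$ in degree $2$, and put $S_k^\emptyset=S_k[\alpha^{-1}\mid\alpha\in R^+]$ and $S_k^\beta=S_k[\alpha^{-1}\mid\alpha\in R^+,\alpha\ne\beta]$. An object $M$ of the category $\mathcal K_k$ consists of $\mathbb{Z}$-graded $S_k^\emptyset$-modules $M(A)$ $(A\in\mathscr A)$ and graded $S_k^\beta$-submodules $M(A,\beta)\subseteq M(A)\oplus M(\beta\uparrow A)$ $(A\in\mathscr A,\beta\in R^+)$; a morphism $M\to N$ is a family of $S_k^\emptyset$-linear maps $f_A:M(A)\to N(A)$ of degree $0$ such that $f_A\oplus f_{\beta\uparrow A}$ maps $M(A,\beta)$ into $N(A,\beta)$. The support is $\operatorname{supp}M=\{A\mid M(A)\ne0\}$, and $M\{n\}$ denotes the shift with $M\{n\}_m=M_{m-n}$. The unit object $P_0$ has $P_0(A_e)=S_k^\emptyset$, $P_0(A_e,\beta)=S_k^\beta\oplus0$, $P_0(\beta\downarrow A_e,\beta)=0\oplus S_k^\beta$, and all its other modules are $0$. For $s\in\widehat{\mathcal S}$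 the translation functor is given by $\mathcal T_sM(A)=M(A^{(s)}_-)\oplus M(A^{(s)}_+)$ and $$\mathcal T_sM(A,\beta)=\begin{cases}\{(\beta x+y,y)\mid x,y\in M(A,\beta)\}&\text{if }\beta\uparrow A^{(s)}=A^{(s)},\ A=A^{(s)}_-,\\ \beta M(\beta\downarrow A,\beta)\oplus M(\beta\uparrow A,\beta)&\text{if }\beta\uparrow A^{(s)}=A^{(s)},\ A=A^{(s)}_+,\\ M(A^{(s)}_-,\beta)\oplus M(A^{(s)}_+,\beta)&\text{if }\beta\uparrow A^{(s)}\ne A^{(s)},\end{cases}$$ where in the first two cases the first entry (summand) lies in $\mathcal T_sM(A)$ and the second in $\mathcal T_sM(\beta\uparrow A)$, and in the third case each summand $M(A^{(s)}_\pm,\beta)\subseteq M(A^{(s)}_\pm)\oplus M(\beta\uparrow A^{(s)}_\pm)$ lies crosswise in $\mathcal T_sM(A)\oplus\mathcal T_sM(\beta\uparrow A)$. The duality $\mathcal D$ is given by $\mathcal DM(A)=\operatorname{Hom}^\bullet_{S_k^\emptyset}(M(A),S_k^\emptyset)$ and $\mathcal DM(A,\beta)=\operatorname{Hom}^\bullet_{S_k^\beta}(M(A,\beta),S_k^\beta)$,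 where for objects $M$ whose $M(A,\beta)$ generate $M(A)\oplus M(\beta\uparrow A)$ over $S_k^\emptyset$ (in particular for direct summands of objects $\mathcal T_{s_r}\circ\dots\circ\mathcal T_{s_1}P_0$) the latter is identified with the set of pairs $(\varphi,\psi)\in\mathcal DM(A)\oplus\mathcal DM(\beta\uparrow A)$ with $\varphi(m)+\psi(m')\in S_k^\beta$ for all $(m,m')\in M(A,\beta)$. The tilting functor $\mathcal C=\mathcal C_{w_0}$ is given by $\mathcal CM(A)=M(w_0.A)$ and $\mathcal CM(A,\beta)=M(w_0.(\beta\uparrow A),-w_0(\beta))\subseteq M(w_0.(\beta\uparrow A))\oplus M(w_0.A)$ with the two entries interchanged, where in both cases $c\in S_k^\emptyset$, respectively $c\in S_k^\beta$, acts as $w_0(c)$. **Theorem.** Let $w\in\widehat{\mathcal W}$ with $A_w\in\Pi^-$, and let $(s_1,\dots,s_l,s_{l+1},\dots,s_j)$ be a reduced expression of $w$ such that $(s_1,\dots,s_l)$ is a reduced expression of $w_0$. Put $M=\mathcal T_{s_j}\circ\dots\circ\mathcal T_{s_1}P_0$. Then $M$ has an indecomposable direct summand $N$ in $\mathcal K_k$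 with $A_w\in\operatorname{supp}N$; any two such summands are isomorphic; and every such $N$ is tilting self-dual up to a shift: $$\mathcal C\circ\mathcal D(N)\cong N\{-2l(w)\}.$$ -/

import Mathlib

set_option linter.unusedSectionVars false

open CategoryTheory

noncomputable section

namespace AJS

/-! ### Alcoves -/

section Alcoves

variable {ι V N : Type*} [AddCommGroup V] [Module ℚ V] [AddCommGroup N] [Module ℚ N]
variable (P : RootPairing ι ℚ V N)

/-- The affine reflection `s_{α,n}(v) = v - (⟨α, v⟩ - n) α^∨`. -/
def affRefl (i : ι) (n : ℤ) : N ≃ᵃ[ℚ] N :=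
  (P.coreflection i).toAffineEquiv.trans (AffineEquiv.constVAdd ℚ N ((n : ℚ) • P.coroot i))

lemma affRefl_apply (i : ι) (n : ℤ) (v : N) :
    affRefl P i n v = v - (P.root' i v - n) • P.coroot i := by
  simp [affRefl, P.coreflection_apply, sub_smul]
  abel

lemma root_affRefl [P.IsCrystallographic] (j i : ι) (n : ℤ) (v : N) :
    P.root' j (affRefl P i n v) =
      P.root' (P.reflectionPerm i j) v + ((n * P.pairingIn ℤ j i : ℤ) : ℚ) := by
  have h1 : ((P.pairingIn ℤ j i : ℤ) : ℚ) = P.pairing j i := by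
    simpa using P.algebraMap_pairingIn ℤ j i
  have h2 : P.toLinearMap (P.root j) (P.coroot i) = P.pairing j i := rfl
  have h3 : P.toLinearMap.flip (P.coroot i) (P.root j) = P.pairing j i := rfl
  rw [affRefl_apply]
  push_cast
  rw [h1]
  simp only [RootPairing.root', map_sub, map_smul, smul_eq_mul, RootPairing.root_reflectionPerm,
    RootPairing.reflection_apply, LinearMap.sub_apply, LinearMap.smul_apply]
  rw [h2, RootPairing.coroot', h3]
  ring

/-- The component through `v` of the coarsest partition of `V^*` that refines all the partitions
`H_{α,n}^- ∪ H_{α,n} ∪ H_{α,n}^+`. (Both `α` and `-α` occur as indices, so the condition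
determines the sign of `⟨α, v⟩ - n` in `{-1, 0, 1}`.) -/
def facet (v : N) : Set N := {u | ∀ (i : ι) (n : ℤ), P.root' i u < n ↔ P.root' i v < n}

/-- Alcoves: the components that meet none of the hyperplanes `H_{α,n}`. -/
def IsAlcove (A : Set N) : Prop :=
  ∃ v : N, (∀ (i : ι) (n : ℤ), P.root' i v ≠ n) ∧ A = facet P v

/-- The set of alcoves. -/
def Alcove : Type _ := {A : Set N // IsAlcove P A}

instance : SetLike (Alcove P) N where
  coe A := A.1
  coe_injective := Subtype.val_injective

/-- The affine transformations that permute the hyperplanes `H_{α,n}`; they act on alcoves. -/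
def hypGroup : Subgroup (N ≃ᵃ[ℚ] N) where
  carrier := {g | (∀ i, ∃ j, ∃ n : ℤ, ∀ v, P.root' i (g v) = P.root' j v + n) ∧
    (∀ i, ∃ j, ∃ n : ℤ, ∀ v, P.root' i (g⁻¹ v) = P.root' j v + n)}
  one_mem' := ⟨fun i => ⟨i, 0, by simp⟩, fun i => ⟨i, 0, by simp⟩⟩
  mul_mem' := by
    rintro g h ⟨g1, g2⟩ ⟨h1, h2⟩
    constructor
    · intro i
      obtain ⟨j, n, hj⟩ := g1 i
      obtain ⟨l, m, hl⟩ := h1 j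
      refine ⟨l, m + n, fun v => ?_⟩
      rw [AffineEquiv.mul_def, AffineEquiv.trans_apply, hj, hl]
      push_cast; ring
    · intro i
      obtain ⟨j, n, hj⟩ := h2 i
      obtain ⟨l, m, hl⟩ := g2 j
      refine ⟨l, m + n, fun v => ?_⟩
      rw [mul_inv_rev, AffineEquiv.mul_def, AffineEquiv.trans_apply, hj, hl]
      push_cast; ring
  inv_mem' := by
    rintro g ⟨g1, g2⟩
    exact ⟨g2, by simpa using g1⟩

lemma image_facet {g : N ≃ᵃ[ℚ] N} (hg : g ∈ hypGroup P) (v : N) :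
    g '' facet P v = facet P (g v) := by
  have key : ∀ {g : N ≃ᵃ[ℚ] N}, g ∈ hypGroup P → ∀ u v, u ∈ facet P v → g u ∈ facet P (g v) := by
    intro g hg u v hu i n
    obtain ⟨j, m, hj⟩ := hg.1 i
    rw [hj, hj]
    have := hu j (n - m)
    push_cast at this
    rw [← lt_sub_iff_add_lt, ← lt_sub_iff_add_lt]
    exact this
  have hinv : ∀ u, g (g⁻¹ u) = u := fun u => by
    rw [AffineEquiv.inv_def]; simp
  have hinv' : ∀ u, g⁻¹ (g u) = u := fun u => by
    rw [AffineEquiv.inv_def]; simp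
  ext u
  constructor
  · rintro ⟨u, hu, rfl⟩
    exact key hg _ _ hu
  · intro hu
    refine ⟨g⁻¹ u, ?_, hinv u⟩
    have := key (inv_mem hg) _ _ hu
    rwa [hinv'] at this

lemma IsAlcove.image {g : N ≃ᵃ[ℚ] N} (hg : g ∈ hypGroup P) {A : Set N} (hA : IsAlcove P A) :
    IsAlcove P (g '' A) := by
  obtain ⟨v, hv, rfl⟩ := hA
  refine ⟨g v, fun i n h => ?_, image_facet P hg v⟩
  obtain ⟨j, m, hj⟩ := hg.1 i
  refine hv j (n - m) ?_
  push_cast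
  linarith [hj v]

/-- The action on alcoves: `A ↦ g.A`. -/
def move (g : N ≃ᵃ[ℚ] N) (hg : g ∈ hypGroup P) (A : Alcove P) : Alcove P :=
  ⟨g '' A.1, A.2.image P hg⟩

lemma affRefl_self (i : ι) (n : ℤ) (v : N) : affRefl P i n (affRefl P i n v) = v := by
  have h2 : P.toLinearMap (P.root i) (P.coroot i) = 2 := P.root_coroot_two i
  have h : P.root' i (affRefl P i n v) = 2 * n - P.root' i v := by
    rw [affRefl_apply]
    simp only [RootPairing.root', map_sub, map_smul, smul_eq_mul]
    rw [h2]; ring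
  rw [affRefl_apply P i n (affRefl P i n v), h, affRefl_apply]
  module

lemma affRefl_inv (i : ι) (n : ℤ) : (affRefl P i n)⁻¹ = affRefl P i n := by
  rw [inv_eq_iff_mul_eq_one]
  ext v
  exact affRefl_self P i n v

lemma affRefl_mem [P.IsCrystallographic] (i : ι) (n : ℤ) : affRefl P i n ∈ hypGroup P := by
  have h : ∀ j, ∃ j', ∃ m : ℤ, ∀ v, P.root' j (affRefl P i n v) = P.root' j' v + m :=
    fun j => ⟨_, _, fun v => root_affRefl P j i n v⟩
  refine ⟨h, ?_⟩
  rw [affRefl_inv]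
  exact h

/-- The element `w` of the finite Weyl group, acting on `V^*`: `⟨w x, w v⟩ = ⟨x, v⟩`. -/
def weylAff (w : P.weylGroup) : N ≃ᵃ[ℚ] N :=
  (RootPairing.Equiv.coweightEquiv P P (w : P.Aut)⁻¹).toAffineEquiv

/-- The action `i ↦ w i` of the finite Weyl group on the (index set of the) roots. -/
def weylIdx (w : P.weylGroup) (i : ι) : ι := (w : P.Aut).indexEquiv i

lemma weyl_transpose (w : P.Aut) (x : V) (v : N) :
    P.toLinearMap x (w.coweightMap v) = P.toLinearMap (w.weightMap x) v :=
  by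
  have h := RootPairing.Hom.weight_coweight_transpose_apply P P v w.toHom
  exact (LinearMap.congr_fun h x).symm

lemma weylAff_apply (w : P.weylGroup) (v : N) :
    weylAff P w v = ((w : P.Aut)⁻¹).coweightMap v := rfl

lemma weylAff_inv (w : P.weylGroup) : (weylAff P w)⁻¹ = weylAff P w⁻¹ := by
  rw [inv_eq_iff_mul_eq_one]
  ext v
  have h : ((w : P.Aut) * (w : P.Aut)⁻¹).coweightMap v = v := by
    rw [mul_inv_cancel]; rfl
  have h' : weylAff P w⁻¹ v = (w : P.Aut).coweightMap v := by
    rw [weylAff_apply]; simp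
  rw [AffineEquiv.mul_def, AffineEquiv.trans_apply, h', weylAff_apply]
  exact h

lemma weylAff_mem (w : P.weylGroup) : weylAff P w ∈ hypGroup P := by
  have key : ∀ (w : P.weylGroup) i, ∃ j, ∃ n : ℤ, ∀ v,
      P.root' i (weylAff P w v) = P.root' j v + n := by
    intro w i
    refine ⟨((w : P.Aut)⁻¹).indexEquiv i, 0, fun v => ?_⟩
    rw [weylAff_apply]
    have h := weyl_transpose P ((w : P.Aut)⁻¹) (P.root i) v
    simp only [RootPairing.root', Int.cast_zero, add_zero]
    rw [h, RootPairing.Hom.root_weightMap_apply]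
  refine ⟨key _, ?_⟩
  rw [weylAff_inv]
  exact key _

/-- For a component `F`, the smallest integer `m` with `F ⊆ H_{β,m}^- ∪ H_{β,m}`. -/
def upIdx (i : ι) (F : Set N) : ℤ := sInf {m : ℤ | ∀ v ∈ F, P.root' i v ≤ m}

/-- `β ↑ F` for a component `F`. -/
def upSet (i : ι) (F : Set N) : Set N := affRefl P i (upIdx P i F) '' F

lemma upIdx_eq {i : ι} {A : Set N} (hA : IsAlcove P A) {v : N} (hv : v ∈ A) :
    upIdx P i A = ⌊P.root' i v⌋ + 1 := by
  obtain ⟨v0, hv0, rfl⟩ := hA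
  have hle : ∀ (u : N), u ∈ facet P v0 → P.root' i u < (⌊P.root' i v⌋ + 1 : ℤ) := by
    intro u hu
    rw [hu i, ← hv i]
    push_cast
    exact Int.lt_floor_add_one _
  refine IsLeast.csInf_eq ⟨fun u hu => (hle u hu).le, fun m hm => ?_⟩
  have h1 := hm v hv
  have h2 : P.root' i v ≠ m := by
    intro h
    have a1 := hv i m
    have a2 := hv i (m + 1)
    rw [h] at a1 a2
    have b1 : ¬ P.root' i v0 < m := by rw [← a1]; exact lt_irrefl _
    have b0 := hm v0 (fun _ _ => Iff.rfl)
    exact hv0 i m (le_antisymm b0 (not_lt.mp b1))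
  have h3 : P.root' i v < m := lt_of_le_of_ne h1 h2
  have : ⌊P.root' i v⌋ < m := Int.floor_lt.mpr h3
  omega

lemma root_affRefl_self (i : ι) (n : ℤ) (v : N) :
    P.root' i (affRefl P i n v) = 2 * n - P.root' i v := by
  have h2 : P.toLinearMap (P.root i) (P.coroot i) = 2 := P.root_coroot_two i
  rw [affRefl_apply]
  simp only [RootPairing.root', map_sub, map_smul, smul_eq_mul]
  rw [h2]; ring

lemma upIdx_reflect {i : ι} {A : Set N} (hA : IsAlcove P A) (m : ℤ)
    (hA' : IsAlcove P (affRefl P i m '' A)) :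
    upIdx P i (affRefl P i m '' A) = 2 * m - upIdx P i A + 1 := by
  obtain ⟨v, hv, rfl⟩ := hA
  have hmem : v ∈ facet P v := fun _ _ => Iff.rfl
  rw [upIdx_eq P ⟨v, hv, rfl⟩ hmem, upIdx_eq P hA' ⟨v, hmem, rfl⟩, root_affRefl_self]
  have h : ⌊2 * (m : ℚ) - P.root' i v⌋ = 2 * m - ⌊P.root' i v⌋ - 1 := by
    rw [Int.floor_eq_iff]
    have h1 := Int.lt_floor_add_one (P.root' i v)
    have h2 := lt_of_le_of_ne (Int.floor_le (P.root' i v)) (Ne.symm (hv i _))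
    push_cast
    constructor <;> linarith
  rw [h]; ring

lemma image_affRefl_twice (i : ι) (n : ℤ) (A : Set N) :
    affRefl P i n '' (affRefl P i n '' A) = A := by
  rw [Set.image_image]
  simp [affRefl_self]

variable [P.IsCrystallographic]

/-- The bijection `β ↑ ·` on alcoves; its inverse is `β ↓ ·`. -/
def upEquiv (i : ι) : Alcove P ≃ Alcove P where
  toFun A := move P (affRefl P i (upIdx P i A.1)) (affRefl_mem P _ _) A
  invFun A := move P (affRefl P i (upIdx P i A.1 - 1)) (affRefl_mem P _ _) A
  left_inv A := by
    apply Subtype.ext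
    have h := upIdx_reflect P (i := i) A.2 (upIdx P i A.1) (A.2.image P (affRefl_mem P _ _))
    change affRefl P i (upIdx P i (affRefl P i (upIdx P i A.1) '' A.1) - 1) ''
      (affRefl P i (upIdx P i A.1) '' A.1) = A.1
    rw [h]
    have e : 2 * upIdx P i A.1 - upIdx P i A.1 + 1 - 1 = upIdx P i A.1 := by ring
    rw [e, image_affRefl_twice]
  right_inv A := by
    apply Subtype.ext
    have h := upIdx_reflect P (i := i) A.2 (upIdx P i A.1 - 1) (A.2.image P (affRefl_mem P _ _))
    change affRefl P i (upIdx P i (affRefl P i (upIdx P i A.1 - 1) '' A.1)) ''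
      (affRefl P i (upIdx P i A.1 - 1) '' A.1) = A.1
    rw [h]
    have e : 2 * (upIdx P i A.1 - 1) - upIdx P i A.1 + 1 = upIdx P i A.1 - 1 := by ring
    rw [e, image_affRefl_twice]

/-- `β ↑ A` for an alcove `A`. -/
def up (i : ι) (A : Alcove P) : Alcove P := upEquiv P i A

/-- `β ↓ A` for an alcove `A`, where `β ↓ ·` is the inverse of `β ↑ ·`. -/
def down (i : ι) (A : Alcove P) : Alcove P := (upEquiv P i).symm A

/-- The closure of an alcove (or of any component): all defining inequalities become weak. -/
def cl (F : Set N) : Set N :=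
  {u | ∀ (i : ι) (n : ℤ), (∀ v ∈ F, P.root' i v < n) → P.root' i u ≤ n}

variable {P} (b : P.Base)

/-- The (indices of the) positive roots `R^+`. -/
abbrev PosRoot : Type _ := {i : ι // b.IsPos i}

/-- The highest root `α`: `α - β` is a sum of simple roots for every positive root `β`. -/
def IsHighestRoot (i : ι) : Prop :=
  ∀ β : PosRoot b, P.root i - P.root β ∈ AddSubmonoid.closure (P.root '' b.support)

/-- The set of simple affine reflections. -/
def simpleRefl : Set (N ≃ᵃ[ℚ] N) :=
  {g | ∃ i ∈ b.support, g = affRefl P i 0} ∪ {g | ∃ i, IsHighestRoot b i ∧ g = affRefl P i 1}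

/-- The affine Weyl group. -/
def affineWeyl : Subgroup (N ≃ᵃ[ℚ] N) := Subgroup.closure (simpleRefl b)

/-- The product of a word in the simple affine reflections. -/
def wordProd (u : List (simpleRefl b)) : N ≃ᵃ[ℚ] N := (u.map Subtype.val).prod

/-- The length function `l` of the affine Weyl group. -/
def len (g : N ≃ᵃ[ℚ] N) : ℕ := sInf {n | ∃ u : List (simpleRefl b), wordProd b u = g ∧ u.length = n}

/-- `u` is a reduced expression of `g`. -/
def IsReducedExpr (u : List (simpleRefl b)) (g : N ≃ᵃ[ℚ] N) : Prop :=
  wordProd b u = g ∧ u.length = len b g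

/-- `w` is the element of maximal length of the finite Weyl group. -/
def IsLongest (w : P.weylGroup) : Prop :=
  ∀ w' : P.weylGroup, len b (weylAff P w') ≤ len b (weylAff P w)

lemma affineWeyl_le : affineWeyl b ≤ hypGroup P := by
  rw [affineWeyl, Subgroup.closure_le]
  rintro g (⟨i, -, rfl⟩ | ⟨i, -, rfl⟩)
  · exact affRefl_mem P _ _
  · exact affRefl_mem P _ _

/-- The underlying set of the fundamental alcove `A_e`. -/
def fundSet : Set N := {v | ∀ β : PosRoot b, 0 < P.root' β v ∧ P.root' β v < 1}

lemma fundSet_nonempty [P.IsRootSystem] [Finite ι] : (fundSet b).Nonempty := by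
  let f : V →ₗ[ℚ] ℚ := b.toWeightBasis.constr ℚ (fun _ => (1 : ℚ))
  have hf : ∀ i ∈ b.support, f (P.root i) = 1 := by
    intro i hi
    have := b.toWeightBasis.constr_basis ℚ (fun _ => (1 : ℚ)) ⟨i, hi⟩
    simpa [f] using this
  obtain ⟨v, hv⟩ := (LinearMap.IsPerfPair.bijective_right P.toLinearMap).2 f
  have hh : ∀ i, P.root' i v = b.height i := by
    intro i
    obtain ⟨c, -, -, hc⟩ := b.exists_root_eq_sum_int i
    have h1 : P.root' i v = f (P.root i) := by rw [← hv]; rfl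
    rw [h1, RootPairing.Base.height_eq_sum hc, hc, map_sum]
    push_cast
    refine Finset.sum_congr rfl fun j hj => ?_
    rw [map_zsmul, hf j hj]
    simp
  obtain ⟨m, hm⟩ : ∃ m : ℤ, ∀ i, b.height i ≤ m := by
    obtain ⟨m, hm⟩ := (Set.finite_range b.height).bddAbove
    exact ⟨m, fun i => hm ⟨i, rfl⟩⟩
  refine ⟨((|m| + 1 : ℤ) : ℚ)⁻¹ • v, fun β => ?_⟩
  have hpos : (0 : ℚ) < ((|m| + 1 : ℤ) : ℚ) := by exact_mod_cast (by positivity)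
  have hβ : 0 < b.height β := β.2
  have h2 : b.height β < |m| + 1 := by
    have := hm β; have := le_abs_self m; omega
  rw [map_smul, hh, smul_eq_mul]
  constructor
  · have : (0 : ℚ) < b.height β := by exact_mod_cast hβ
    positivity
  · rw [inv_mul_lt_iff₀ hpos, mul_one]
    exact_mod_cast h2

lemma fundSet_isAlcove [P.IsRootSystem] [Finite ι] : IsAlcove P (fundSet b) := by
  obtain ⟨v, hv⟩ := fundSet_nonempty b
  have hneg : ∀ i (u : N), P.root' (P.reflectionPerm i i) u = - P.root' i u := by
    intro i u
    simp [RootPairing.root']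
  have hcase : ∀ i, b.IsPos i ∨ b.IsPos (P.reflectionPerm i i) := fun i =>
    RootPairing.Base.IsPos.or_neg b i
  have hgen : ∀ u ∈ fundSet b, ∀ i (n : ℤ),
      (P.root' i u < n ↔ (b.IsPos i ∧ 1 ≤ n) ∨ (¬ b.IsPos i ∧ 0 ≤ n)) := by
    intro u hu i n
    by_cases hi : b.IsPos i
    · obtain ⟨h1, h2⟩ := hu ⟨i, hi⟩
      simp only [hi, true_and, not_true, false_and, or_false]
      constructor
      · intro h
        have : (0 : ℚ) < n := h1.trans h
        have : 0 < n := by exact_mod_cast this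
        omega
      · intro h
        have : (1 : ℚ) ≤ n := by exact_mod_cast h
        exact h2.trans_le this
    · obtain ⟨h1, h2⟩ := hu ⟨_, (hcase i).resolve_left hi⟩
      rw [hneg] at h1 h2
      simp only [hi, false_and, not_false_eq_true, true_and, false_or]
      constructor
      · intro h
        have : (-1 : ℚ) < n := by linarith
        have : -1 < n := by exact_mod_cast this
        omega
      · intro h
        have : (0 : ℚ) ≤ n := by exact_mod_cast h
        linarith
  refine ⟨v, fun i n h => ?_, Set.Subset.antisymm (fun u hu i n => ?_) fun u hu β => ?_⟩
  · have h1 := (hgen v hv i n).not.mp (by rw [h]; exact lt_irrefl _)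
    have h2 := (hgen v hv i (n + 1)).mp (by rw [h]; push_cast; linarith)
    have h0 : b.IsPos i ∨ ¬ b.IsPos i := em _
    rcases h0 with h0 | h0
    · obtain ⟨a1, a2⟩ := hv ⟨i, h0⟩
      simp only at a1 a2
      rw [h] at a1 a2
      have : 0 < n := by exact_mod_cast a1
      have : n < 1 := by exact_mod_cast a2
      omega
    · obtain ⟨a1, a2⟩ := hv ⟨_, (hcase i).resolve_left h0⟩
      rw [hneg, h] at a1 a2
      have : 0 < -n := by exact_mod_cast a1
      have : -n < 1 := by exact_mod_cast a2
      omega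
  · rw [hgen u hu, hgen v hv]
  · obtain ⟨h1, h2⟩ := hv β
    constructor
    · have := (hu (P.reflectionPerm β β) 0).mpr (by rw [hneg]; push_cast; linarith)
      rw [hneg] at this
      push_cast at this
      linarith
    · have := (hu β 1).mpr (by push_cast; exact h2)
      exact_mod_cast this

variable [P.IsRootSystem] [Finite ι]

/-- The fundamental alcove `A_e`. -/
def fundAlcove : Alcove P := ⟨fundSet b, fundSet_isAlcove b⟩

/-- The alcove `A_w = w.A_e`. -/
def alcoveOf (w : affineWeyl b) : Alcove P := move P w (affineWeyl_le b w.2) (fundAlcove b)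

/-- The wall `A_{s,e}` of the fundamental alcove: it lies in the closures of `A_e` and of `A_s`,
and in exactly one hyperplane. -/
def fundWall (s : simpleRefl b) : Set N :=
  {u | u ∈ cl P (fundSet b) ∧ u ∈ cl P (s.1 '' fundSet b) ∧
    ∃! p : PosRoot b × ℤ, P.root' p.1 u = p.2}

/-- The wall `A^{(s)}`: the part of the closure of `A` that lies in the orbit of `A_{s,e}` under
the affine Weyl group. -/
def wall (s : simpleRefl b) (A : Alcove P) : Set N :=
  {u | u ∈ cl P A.1 ∧ ∃ g ∈ affineWeyl b, u ∈ g '' fundWall b s}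

/-- `C` has the wall `B` and lies in the negative half-space corresponding to `B`. -/
def IsNegAlcove (B : Set N) (C : Alcove P) : Prop :=
  B ⊆ cl P C.1 ∧ ∃ (β : PosRoot b) (n : ℤ),
    (∀ v ∈ B, P.root' β v = n) ∧ ∀ v ∈ C.1, P.root' β v < n

/-- `C` has the wall `B` and lies in the positive half-space corresponding to `B`. -/
def IsPosAlcove (B : Set N) (C : Alcove P) : Prop :=
  B ⊆ cl P C.1 ∧ ∃ (β : PosRoot b) (n : ℤ),
    (∀ v ∈ B, P.root' β v = n) ∧ ∀ v ∈ C.1, n < P.root' β v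

/-- The unique alcove `A^{(s)}_-` with wall `A^{(s)}` in the negative half-space. -/
def negAlcove (s : simpleRefl b) (A : Alcove P) : Alcove P :=
  @Classical.epsilon _ ⟨A⟩ (IsNegAlcove b (wall b s A))

/-- The unique alcove `A^{(s)}_+` with wall `A^{(s)}` in the positive half-space. -/
def posAlcove (s : simpleRefl b) (A : Alcove P) : Alcove P :=
  @Classical.epsilon _ ⟨A⟩ (IsPosAlcove b (wall b s A))

/-- The anti-fundamental box `Π^-`. -/
def antiFundBox : Set (Alcove P) :=
  {A | ∀ i ∈ b.support, ∀ v ∈ A.1, -1 < P.root' i v ∧ P.root' i v < 0}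

/-- `R` is of type `A₂`. -/
def IsTypeA2 : Prop :=
  ∃ e : b.support ≃ Fin 2, b.cartanMatrix.reindex e e = !![2, -1; -1, 2]

end Alcoves
/-! ### Graded pieces -/

section Graded

variable {M : Type*} [AddCommGroup M] {deg : ℤ → AddSubgroup M}

/-- The homogeneous component of degree `n` of an element of a `ℤ`-graded group. -/
def comp (h : DirectSum.IsInternal deg) (n : ℤ) : M →+ M :=
  (deg n).subtype.comp ((DFinsupp.evalAddMonoidHom n).comp
    (AddEquiv.ofBijective (DirectSum.coeAddMonoidHom deg) h).symm.toAddMonoidHom)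

lemma comp_mem (h : DirectSum.IsInternal deg) (n : ℤ) (x : M) : comp h n x ∈ deg n :=
  Subtype.property _

lemma comp_of_mem (h : DirectSum.IsInternal deg) {m : ℤ} {x : M} (hx : x ∈ deg m) (n : ℤ) :
    comp h n x = if m = n then x else 0 := by
  have h1 : (AddEquiv.ofBijective (DirectSum.coeAddMonoidHom deg) h).symm x =
      DirectSum.of (fun i => deg i) m ⟨x, hx⟩ := by
    rw [AddEquiv.symm_apply_eq]
    exact (DirectSum.coeAddMonoidHom_of deg m ⟨x, hx⟩).symm
  change (((AddEquiv.ofBijective (DirectSum.coeAddMonoidHom deg) h).symm x) n : M) = _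
  rw [h1]
  by_cases hmn : m = n
  · subst hmn
    simp
  · rw [DirectSum.of_eq_of_ne _ _ _ (Ne.symm hmn), if_neg hmn]
    rfl

lemma mem_iSup_deg (h : DirectSum.IsInternal deg) (x : M) : x ∈ ⨆ n, deg n := by
  obtain ⟨f, rfl⟩ := h.2 x
  induction f using DirectSum.induction_on with
  | zero => simp
  | of i y =>
    rw [DirectSum.coeAddMonoidHom_of]
    exact AddSubgroup.mem_iSup_of_mem i y.2
  | add f g hf hg => rw [map_add]; exact add_mem hf hg

/-- Induction on the homogeneous components. -/
lemma graded_induction (h : DirectSum.IsInternal deg) {p : M → Prop} (x : M)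
    (hom : ∀ n, ∀ y ∈ deg n, p y) (zero : p 0) (add : ∀ y z, p y → p z → p (y + z)) : p x :=
  AddSubgroup.iSup_induction deg (C := p) (mem_iSup_deg h x) hom zero add

lemma internal_of_indep (h1 : ∀ f : DirectSum ℤ fun n => deg n,
    DirectSum.coeAddMonoidHom deg f = 0 → f = 0) (h2 : ∀ x : M, x ∈ ⨆ n, deg n) :
    DirectSum.IsInternal deg := by
  refine ⟨(injective_iff_map_eq_zero _).mpr h1, fun x => ?_⟩
  refine AddSubgroup.iSup_induction deg (C := fun x => ∃ f, DirectSum.coeAddMonoidHom deg f = x)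
    (h2 x) (fun n y hy => ⟨DirectSum.of (fun i => deg i) n ⟨y, hy⟩, by simp⟩)
    ⟨0, by simp⟩ ?_
  rintro _ _ ⟨f, rfl⟩ ⟨g, rfl⟩
  exact ⟨f + g, map_add _ _ _⟩

/-- A grading can be recognised from a family of component maps. -/
lemma internal_of_comp (c : ℤ → M →+ M)
    (h1 : ∀ m n x, x ∈ deg m → c n x = if m = n then x else 0) (h2 : ∀ x : M, x ∈ ⨆ n, deg n) :
    DirectSum.IsInternal deg := by
  refine internal_of_indep (fun f hf => ?_) h2
  ext n
  have key : ∀ f : DirectSum ℤ fun n => deg n, c n (DirectSum.coeAddMonoidHom deg f) = f n := by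
    intro f
    induction f using DirectSum.induction_on with
    | zero => simp
    | of i y =>
      rw [DirectSum.coeAddMonoidHom_of, h1 i n _ y.2]
      by_cases hin : i = n
      · subst hin; simp
      · rw [DirectSum.of_eq_of_ne _ _ _ (Ne.symm hin), if_neg hin]; rfl
    | add f g hf hg => rw [map_add, map_add, hf, hg]; rfl
  rw [← key f, hf, map_zero]
  rfl

lemma comp_eq_of_comp (h : DirectSum.IsInternal deg) (c : M →+ M) (n : ℤ)
    (h1 : ∀ m x, x ∈ deg m → c x = if m = n then x else 0) (x : M) : comp h n x = c x := by
  induction x using graded_induction h with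
  | hom m y hy => rw [comp_of_mem h hy, h1 m y hy]
  | zero => simp
  | add y z hy hz => rw [map_add, map_add, hy, hz]

end Graded

/-! ### The rings `S_k`, `S_k^∅` and `S_k^β` -/

section Rings

universe u v

variable {ι N : Type*} {V : Type v} [AddCommGroup V] [Module ℚ V] [AddCommGroup N] [Module ℚ N]
variable (k : Type u) [Field k] (P : RootPairing ι ℚ V N)

/-- The weight lattice `X`. -/
def weightLattice : AddSubgroup V where
  carrier := {x | ∀ i, ∃ n : ℤ, P.coroot' i x = n}
  zero_mem' := fun i => ⟨0, by simp⟩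
  add_mem' := by
    intro x y hx hy i
    obtain ⟨m, hm⟩ := hx i
    obtain ⟨n, hn⟩ := hy i
    exact ⟨m + n, by rw [map_add, hm, hn]; push_cast; rfl⟩
  neg_mem' := by
    intro x hx i
    obtain ⟨m, hm⟩ := hx i
    exact ⟨-m, by rw [map_neg, hm]; push_cast; rfl⟩

/-- `X_k = X ⊗ k`. -/
abbrev Xk : Type _ := TensorProduct ℤ k (weightLattice P)

/-- The symmetric algebra `S_k` of `X_k`. -/
abbrev Sk : Type _ := SymmetricAlgebra k (Xk k P)

/-- A weight as an element of `S_k`. -/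
def weightS (x : weightLattice P) : Sk k P := SymmetricAlgebra.ι k (Xk k P) (1 ⊗ₜ[ℤ] x)

/-- A root as an element of the weight lattice. -/
def rootX [P.IsCrystallographic] (i : ι) : weightLattice P :=
  ⟨P.root i, fun j => ⟨P.pairingIn ℤ i j, by
    have h1 : ((P.pairingIn ℤ i j : ℤ) : ℚ) = P.pairing i j := by
      simpa using P.algebraMap_pairingIn ℤ i j
    rw [h1]; simp⟩⟩

/-- A root as an element of `S_k`. -/
def rootS [P.IsCrystallographic] (i : ι) : Sk k P := weightS k P (rootX P i)

variable {P} [P.IsCrystallographic] (b : P.Base)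

/-- The multiplicative set generated by the positive roots. -/
def rootMonoid : Submonoid (Sk k P) :=
  Submonoid.closure (Set.range fun β : PosRoot b => rootS k P β.1)

/-- `S_k^∅ = S_k[α⁻¹ ∣ α ∈ R^+]`. -/
def S0 : Type (max u v) := Localization (rootMonoid k b)

instance : CommRing (S0 k b) := inferInstanceAs (CommRing (Localization (rootMonoid k b)))

instance : Algebra (Sk k P) (S0 k b) :=
  inferInstanceAs (Algebra (Sk k P) (Localization (rootMonoid k b)))

instance : IsLocalization (rootMonoid k b) (S0 k b) :=
  inferInstanceAs (IsLocalization (rootMonoid k b) (Localization (rootMonoid k b)))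

instance : Algebra k (S0 k b) :=
  ((algebraMap (Sk k P) (S0 k b)).comp (algebraMap k (Sk k P))).toAlgebra

/-- A positive (or arbitrary) root as an element of `S_k^∅`. -/
def root0 (i : ι) : S0 k b := algebraMap (Sk k P) (S0 k b) (rootS k P i)

/-- `S_k^β = S_k[α⁻¹ ∣ α ∈ R^+, α ≠ β]`, as an `S_k`-subalgebra of `S_k^∅`. -/
def Sβ (β : PosRoot b) : Subalgebra (Sk k P) (S0 k b) :=
  Algebra.adjoin (Sk k P) {x | ∃ α : PosRoot b, α ≠ β ∧ x * root0 k b α = 1}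

/-- The elements of degree `n` of `S_k^∅`, where the degree of `X` is `2`: sums of fractions
`c ξ₁ ⋯ ξ_d / (α₁ ⋯ α_e)` with `c ∈ k`, `ξ_i ∈ X_k`, `α_j ∈ R^+` and `n = 2d - 2e`. -/
def deg0 (n : ℤ) : AddSubgroup (S0 k b) :=
  AddSubgroup.closure {x | ∃ (c : k) (ξ : List (Xk k P)) (α : List (PosRoot b)),
    x * (α.map fun a : PosRoot b => root0 k b a.1).prod =
        algebraMap (Sk k P) (S0 k b) (c • (ξ.map (SymmetricAlgebra.ι k (Xk k P))).prod) ∧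
      n = 2 * ξ.length - 2 * α.length}

open LaurentPolynomial in
/-- The ring homomorphism `S_k → S_k^∅[T, T⁻¹]` with `ξ ↦ ξ T²` for `ξ ∈ X_k`. -/
def coactS : Sk k P →ₐ[k] LaurentPolynomial (S0 k b) :=
  SymmetricAlgebra.lift
    { toFun := fun ξ => LaurentPolynomial.C
        (algebraMap (Sk k P) (S0 k b) (SymmetricAlgebra.ι k (Xk k P) ξ)) * LaurentPolynomial.T 2
      map_add' := fun x y => by simp [add_mul]
      map_smul' := fun c x => by
        rw [map_smul, Algebra.smul_def, Algebra.smul_def, map_mul, map_mul, mul_assoc]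
        rfl }

lemma isUnit_root0 (β : PosRoot b) : IsUnit (root0 k b β) :=
  IsLocalization.map_units (S0 k b)
    (⟨_, Submonoid.subset_closure ⟨β, rfl⟩⟩ : rootMonoid k b)

lemma coactS_ι (ξ : Xk k P) : coactS k b (SymmetricAlgebra.ι k (Xk k P) ξ) =
    LaurentPolynomial.C (algebraMap (Sk k P) (S0 k b) (SymmetricAlgebra.ι k (Xk k P) ξ)) *
      LaurentPolynomial.T 2 := by
  rw [coactS, SymmetricAlgebra.lift_ι_apply]
  rfl

lemma coactS_unit (y : rootMonoid k b) : IsUnit (coactS k b y) := by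
  obtain ⟨y, hy⟩ := y
  simp only [rootMonoid] at hy
  refine Submonoid.closure_induction (motive := fun y _ => IsUnit (coactS k b y)) ?_ ?_ ?_ hy
  · rintro _ ⟨β, rfl⟩
    change IsUnit (coactS k b (SymmetricAlgebra.ι k (Xk k P) (1 ⊗ₜ[ℤ] rootX P β.1)))
    rw [coactS_ι]
    exact ((isUnit_root0 k b β).map LaurentPolynomial.C).mul (LaurentPolynomial.isUnit_T 2)
  · rw [map_one]; exact isUnit_one
  · intro x y _ _ hx hy
    rw [map_mul]; exact hx.mul hy

/-- The extension of `coactS` to `S_k^∅`. -/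
def coact : S0 k b →+* LaurentPolynomial (S0 k b) :=
  IsLocalization.lift (M := rootMonoid k b) (g := (coactS k b : Sk k P →+* _)) (coactS_unit k b)

lemma coact_of (x : Sk k P) : coact k b (algebraMap _ _ x) = coactS k b x :=
  IsLocalization.lift_eq _ _

lemma coact_ι (ξ : Xk k P) :
    coact k b (algebraMap _ _ (SymmetricAlgebra.ι k (Xk k P) ξ)) =
    LaurentPolynomial.C (algebraMap (Sk k P) (S0 k b) (SymmetricAlgebra.ι k (Xk k P) ξ)) *
      LaurentPolynomial.T 2 := by
  rw [coact_of, coactS_ι]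

lemma coact_root (i : ι) : coact k b (root0 k b i) =
    LaurentPolynomial.C (root0 k b i) * LaurentPolynomial.T 2 := coact_ι k b _

lemma coact_deg0 {n : ℤ} {x : S0 k b} (hx : x ∈ deg0 k b n) :
    coact k b x = LaurentPolynomial.C x * LaurentPolynomial.T n := by
  induction hx using AddSubgroup.closure_induction with
  | mem x hx =>
    obtain ⟨c, ξ, α, h, rfl⟩ := hx
    have hα : coact k b (α.map fun a : PosRoot b => root0 k b a.1).prod =
        LaurentPolynomial.C (α.map fun a : PosRoot b => root0 k b a.1).prod *
          LaurentPolynomial.T (2 * α.length) := by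
      clear h
      induction α with
      | nil => simp
      | cons a α ih =>
        rw [List.map_cons, List.prod_cons, map_mul, ih, coact_root, map_mul, mul_mul_mul_comm,
          ← LaurentPolynomial.T_add]
        congr 2
        rw [List.length_cons]; push_cast; ring
    have hξ : coact k b (algebraMap _ _ (ξ.map (SymmetricAlgebra.ι k (Xk k P))).prod) =
        LaurentPolynomial.C (algebraMap _ _ (ξ.map (SymmetricAlgebra.ι k (Xk k P))).prod) *
          LaurentPolynomial.T (2 * ξ.length) := by
      clear h
      induction ξ with
      | nil => simp
      | cons a α ih =>
        rw [List.map_cons, List.prod_cons, map_mul, map_mul, ih, coact_ι, map_mul,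
          mul_mul_mul_comm, ← LaurentPolynomial.T_add]
        congr 2
        rw [List.length_cons]; push_cast; ring
    have hc : coact k b (algebraMap _ _ (algebraMap k (Sk k P) c)) =
        LaurentPolynomial.C (algebraMap _ _ (algebraMap k (Sk k P) c)) := by
      rw [coact_of, AlgHom.commutes]
      rfl
    have hu : IsUnit (α.map fun a : PosRoot b => root0 k b a.1).prod := by
      clear h hα
      induction α with
      | nil => simp
      | cons a α ih => rw [List.map_cons, List.prod_cons]; exact (isUnit_root0 k b a).mul ih
    have hu' : IsUnit (LaurentPolynomial.C (α.map fun a : PosRoot b => root0 k b a.1).prod *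
          LaurentPolynomial.T (2 * α.length)) :=
      (hu.map LaurentPolynomial.C).mul (LaurentPolynomial.isUnit_T _)
    rw [← hu'.mul_left_inj]
    conv_lhs => rw [← hα, ← map_mul, h, Algebra.smul_def, map_mul, map_mul, hξ, hc]
    rw [mul_mul_mul_comm, ← map_mul, h, ← LaurentPolynomial.T_add, Algebra.smul_def, map_mul,
      map_mul, mul_assoc]
    congr 3
    ring
  | zero => simp
  | add x y _ _ hx hy => rw [map_add, hx, hy, map_add, add_mul]
  | neg x _ hx => rw [map_neg, hx, map_neg, neg_mul]

lemma one_mem_deg0 : (1 : S0 k b) ∈ deg0 k b 0 :=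
  AddSubgroup.subset_closure ⟨1, [], [], by simp, by simp⟩

lemma mul_mem_deg0 {m n : ℤ} {x y : S0 k b} (hx : x ∈ deg0 k b m) (hy : y ∈ deg0 k b n) :
    x * y ∈ deg0 k b (m + n) := by
  induction hx using AddSubgroup.closure_induction with
  | mem x hx =>
    induction hy using AddSubgroup.closure_induction with
    | mem y hy =>
      obtain ⟨c, ξ, α, h, rfl⟩ := hx
      obtain ⟨c', ξ', α', h', rfl⟩ := hy
      refine AddSubgroup.subset_closure ⟨c * c', ξ ++ ξ', α ++ α', ?_, ?_⟩
      · rw [List.map_append, List.prod_append, mul_mul_mul_comm, h, h', List.map_append,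
          List.prod_append, ← map_mul, smul_mul_smul_comm]
      · simp only [List.length_append]; push_cast; ring
    | zero => rw [mul_zero]; exact zero_mem _
    | add y z _ _ hy hz => rw [mul_add]; exact add_mem hy hz
    | neg y _ h => rw [mul_neg]; exact neg_mem h
  | zero => rw [zero_mul]; exact zero_mem _
  | add x z _ _ hx hz => rw [add_mul]; exact add_mem hx hz
  | neg x _ h => rw [neg_mul]; exact neg_mem h

lemma inv_mem_deg0 {x : S0 k b} {α : PosRoot b} (hx : x * root0 k b α = 1) :
    x ∈ deg0 k b (-2) :=
  AddSubgroup.subset_closure ⟨1, [], [α], by simpa using hx, by simp⟩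

/-- Every subalgebra generated by inverses of positive roots is homogeneous. -/
lemma adjoin_homogeneous (Q : Set (PosRoot b)) {x : S0 k b}
    (hx : x ∈ Algebra.adjoin (Sk k P) {x : S0 k b | ∃ α ∈ Q, x * root0 k b α = 1}) :
    x ∈ AddSubgroup.closure {y : S0 k b | (∃ n, y ∈ deg0 k b n) ∧
      y ∈ Algebra.adjoin (Sk k P) {x : S0 k b | ∃ α ∈ Q, x * root0 k b α = 1}} := by
  set R := Algebra.adjoin (Sk k P) {x : S0 k b | ∃ α ∈ Q, x * root0 k b α = 1} with hR
  set H := AddSubgroup.closure {y : S0 k b | (∃ n, y ∈ deg0 k b n) ∧ y ∈ R} with hH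
  have hmul : ∀ x ∈ H, ∀ y ∈ H, x * y ∈ H := by
    intro x hx y hy
    induction hx using AddSubgroup.closure_induction with
    | mem x hx =>
      induction hy using AddSubgroup.closure_induction with
      | mem y hy =>
        obtain ⟨⟨m, hm⟩, hx⟩ := hx
        obtain ⟨⟨n, hn⟩, hy⟩ := hy
        exact AddSubgroup.subset_closure ⟨⟨m + n, mul_mem_deg0 k b hm hn⟩, mul_mem hx hy⟩
      | zero => rw [mul_zero]; exact zero_mem _
      | add y z _ _ hy hz => rw [mul_add]; exact add_mem hy hz
      | neg y _ h => rw [mul_neg]; exact neg_mem h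
    | zero => rw [zero_mul]; exact zero_mem _
    | add x z _ _ hx hz => rw [add_mul]; exact add_mem hx hz
    | neg x _ h => rw [neg_mul]; exact neg_mem h
  induction hx using Algebra.adjoin_induction with
  | mem x hx =>
    obtain ⟨α, hα, h⟩ := hx
    exact AddSubgroup.subset_closure
      ⟨⟨-2, inv_mem_deg0 k b h⟩, Algebra.subset_adjoin ⟨α, hα, h⟩⟩
  | algebraMap r =>
    induction r using SymmetricAlgebra.induction with
    | algebraMap c =>
      refine AddSubgroup.subset_closure ⟨⟨0, AddSubgroup.subset_closure ⟨c, [], [], ?_, by simp⟩⟩,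
        Subalgebra.algebraMap_mem _ _⟩
      simp [Algebra.smul_def]
    | ι ξ =>
      refine AddSubgroup.subset_closure ⟨⟨2, AddSubgroup.subset_closure ⟨1, [ξ], [], ?_, by simp⟩⟩,
        Subalgebra.algebraMap_mem _ _⟩
      simp
    | mul x y hx hy => rw [map_mul]; exact hmul _ hx _ hy
    | add x y hx hy => rw [map_add]; exact add_mem hx hy
  | add x y _ _ hx hy => exact add_mem hx hy
  | mul x y _ _ hx hy => exact hmul _ hx _ hy

lemma mem_adjoin_univ (x : S0 k b) :
    x ∈ Algebra.adjoin (Sk k P) {x : S0 k b | ∃ α ∈ (Set.univ : Set (PosRoot b)), x * root0 k b α = 1} := by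
  obtain ⟨⟨f, y⟩, h⟩ := IsLocalization.surj (rootMonoid k b) x
  obtain ⟨y, hy⟩ := y
  have hinv : ∀ y ∈ rootMonoid k b, ∃ z ∈ Algebra.adjoin (Sk k P)
      {x : S0 k b | ∃ α ∈ (Set.univ : Set (PosRoot b)), x * root0 k b α = 1}, algebraMap _ _ y * z = 1 := by
    intro y hy
    induction hy using Submonoid.closure_induction with
    | mem y hy =>
      obtain ⟨β, rfl⟩ := hy
      obtain ⟨z, hz⟩ := (isUnit_root0 k b β).exists_right_inv
      exact ⟨z, Algebra.subset_adjoin ⟨β, trivial, by rw [mul_comm]; exact hz⟩, hz⟩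
    | one => exact ⟨1, one_mem _, by simp⟩
    | mul x y _ _ hx hy =>
      obtain ⟨z, hz, h⟩ := hx
      obtain ⟨z', hz', h'⟩ := hy
      exact ⟨z * z', mul_mem hz hz', by rw [map_mul, mul_mul_mul_comm, h, h', one_mul]⟩
  obtain ⟨z, hz, hyz⟩ := hinv y hy
  have : x = algebraMap _ _ f * z := by
    rw [← h, mul_assoc]
    change x = x * (algebraMap _ _ y * z)
    rw [hyz, mul_one]
  rw [this]
  exact mul_mem (Subalgebra.algebraMap_mem _ _) hz

/-- The grading of `S_k^∅`. -/
lemma internal0 : DirectSum.IsInternal (deg0 k b) := by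
  refine internal_of_indep (fun f hf => ?_) fun x => ?_
  · have key : ∀ f : DirectSum ℤ fun n => deg0 k b n, ∀ n,
        (coact k b (DirectSum.coeAddMonoidHom (deg0 k b) f)).coeff n = f n := by
      intro f n
      induction f using DirectSum.induction_on with
      | zero => simp
      | of i y =>
        rw [DirectSum.coeAddMonoidHom_of, coact_deg0 k b y.2,
          ← LaurentPolynomial.single_eq_C_mul_T, AddMonoidAlgebra.coeff_single]
        by_cases hin : i = n
        · subst hin; rw [Finsupp.single_eq_same, DirectSum.of_eq_same]
        · rw [DirectSum.of_eq_of_ne _ _ _ (Ne.symm hin), Finsupp.single_apply, if_neg hin]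
          rfl
      | add f g hf hg =>
        rw [map_add, map_add, AddMonoidAlgebra.coeff_add, Finsupp.add_apply, hf, hg]; rfl
    ext n
    rw [← key f, hf]
    simp
  · have h := adjoin_homogeneous k b Set.univ (mem_adjoin_univ k b x)
    refine (AddSubgroup.closure_le _).mpr ?_ h
    rintro y ⟨⟨n, hn⟩, -⟩
    exact AddSubgroup.mem_iSup_of_mem n hn

/-- `S_k^β` is a homogeneous subring of `S_k^∅`. -/
lemma Sβ_homog (β : PosRoot b) {x : S0 k b} (hx : x ∈ Sβ k b β) (n : ℤ) :
    comp (internal0 k b) n x ∈ Sβ k b β := by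
  have h := adjoin_homogeneous k b {α | α ≠ β} hx
  have hsub : ∀ y ∈ AddSubgroup.closure {y : S0 k b | (∃ n, y ∈ deg0 k b n) ∧
      y ∈ Algebra.adjoin (Sk k P) {x : S0 k b | ∃ α ∈ {α : PosRoot b | α ≠ β},
        x * root0 k b α = 1}}, y ∈ Sβ k b β := by
    intro y hy
    exact (AddSubgroup.closure_le (Sβ k b β).toSubring.toAddSubgroup).mpr (fun z hz => hz.2) hy
  induction h using AddSubgroup.closure_induction with
  | mem y hy =>
    obtain ⟨⟨m, hm⟩, hy⟩ := hy
    rw [comp_of_mem _ hm]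
    split_ifs
    · exact hy
    · exact zero_mem _
  | zero => rw [map_zero]; exact zero_mem _
  | add x y _ _ hx' hy' =>
    rw [map_add]
    exact add_mem (hx' (hsub x ‹_›)) (hy' (hsub y ‹_›))
  | neg x _ hx' => rw [map_neg]; exact neg_mem (hx' (hsub x ‹_›))

/-! #### The action of the finite Weyl group on `S_k^∅` -/

variable (P) in
/-- The action of the finite Weyl group on the weight lattice. -/
def weylX (w : P.weylGroup) : weightLattice P →+ weightLattice P where
  toFun x := ⟨(w : P.Aut).weightMap x, fun i => by
    obtain ⟨n, hn⟩ := x.2 ((w : P.Aut).indexEquiv.symm i)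
    refine ⟨n, ?_⟩
    rw [← hn]
    have h := weyl_transpose P (w : P.Aut) x (P.coroot i)
    rw [RootPairing.Hom.coroot_coweightMap_apply] at h
    exact h.symm⟩
  map_zero' := by ext; simp
  map_add' x y := by ext; simp

variable (P) in
/-- The action of the finite Weyl group on `S_k`. -/
def weylS (w : P.weylGroup) : Sk k P →ₐ[k] Sk k P :=
  SymmetricAlgebra.lift
    (SymmetricAlgebra.ι k (Xk k P) ∘ₗ (weylX P w).toIntLinearMap.baseChange k)

lemma weylS_root (w : P.weylGroup) (i : ι) :
    weylS k P w (rootS k P i) = rootS k P (weylIdx P w i) := by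
  change weylS k P w (SymmetricAlgebra.ι k (Xk k P) (1 ⊗ₜ[ℤ] rootX P i)) = _
  rw [weylS, SymmetricAlgebra.lift_ι_apply]
  change SymmetricAlgebra.ι k (Xk k P) (1 ⊗ₜ[ℤ] (weylX P w (rootX P i))) = _
  have : weylX P w (rootX P i) = rootX P (weylIdx P w i) :=
    Subtype.ext (RootPairing.Hom.root_weightMap_apply P P i (w : P.Aut).toHom)
  rw [this]
  rfl

open Classical in
/-- The positive root among `α` and `-α`. -/
def posOf (i : ι) : PosRoot b :=
  if h : b.IsPos i then ⟨i, h⟩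
  else ⟨P.reflectionPerm i i, (RootPairing.Base.IsPos.or_neg b i).resolve_left h⟩

lemma root_posOf (i : ι) : P.root (posOf b i) = P.root i ∨ P.root (posOf b i) = - P.root i := by
  unfold posOf
  split_ifs with h
  · exact Or.inl rfl
  · right; simp

lemma rootS_posOf (i : ι) :
    rootS k P (posOf b i) = rootS k P i ∨ rootS k P (posOf b i) = - rootS k P i := by
  rcases root_posOf b i with h | h
  · left
    have : rootX P (posOf b i) = rootX P i := Subtype.ext h
    rw [rootS, this, rootS]
  · right
    have : rootX P (posOf b i) = - rootX P i := Subtype.ext h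
    rw [rootS, this, rootS, weightS, weightS, TensorProduct.tmul_neg, map_neg]

lemma root0_posOf (i : ι) :
    root0 k b (posOf b i) = root0 k b i ∨ root0 k b (posOf b i) = - root0 k b i := by
  rcases rootS_posOf k b i with h | h
  · left; rw [root0, h, root0]
  · right; rw [root0, h, root0, map_neg]

lemma isUnit_root0' (i : ι) : IsUnit (root0 k b i) := by
  rcases root0_posOf k b i with h | h
  · rw [← h]; exact isUnit_root0 k b _
  · rw [← neg_neg (root0 k b i), ← h]; exact (isUnit_root0 k b _).neg

lemma weyl_unit (w : P.weylGroup) (y : rootMonoid k b) :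
    IsUnit ((algebraMap (Sk k P) (S0 k b)).comp (weylS k P w : Sk k P →+* Sk k P) y) := by
  obtain ⟨y, hy⟩ := y
  simp only [rootMonoid] at hy
  refine Submonoid.closure_induction (motive := fun y _ =>
    IsUnit ((algebraMap (Sk k P) (S0 k b)).comp (weylS k P w : Sk k P →+* Sk k P) y)) ?_ ?_ ?_ hy
  · rintro _ ⟨β, rfl⟩
    change IsUnit (algebraMap (Sk k P) (S0 k b) (weylS k P w (rootS k P β.1)))
    rw [weylS_root]
    exact isUnit_root0' k b _
  · rw [map_one]; exact isUnit_one
  · intro x y _ _ hx hy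
    rw [map_mul]; exact hx.mul hy

/-- The action of the finite Weyl group on `S_k^∅`, with `α ↦ w(α)`. -/
def weyl0 (w : P.weylGroup) : S0 k b →+* S0 k b :=
  IsLocalization.lift (M := rootMonoid k b)
    (g := (algebraMap (Sk k P) (S0 k b)).comp (weylS k P w : Sk k P →+* Sk k P)) (weyl_unit k b w)

lemma weyl0_of (w : P.weylGroup) (x : Sk k P) :
    weyl0 k b w (algebraMap _ _ x) = algebraMap _ _ (weylS k P w x) :=
  IsLocalization.lift_eq _ _

lemma weyl0_root (w : P.weylGroup) (i : ι) :
    weyl0 k b w (root0 k b i) = root0 k b (weylIdx P w i) := by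
  rw [root0, weyl0_of, weylS_root, root0]

lemma posOf_injOn (w : P.weylGroup) {α β : PosRoot b}
    (h : posOf b (weylIdx P w α) = posOf b (weylIdx P w β)) : α = β := by
  have h1 : P.root (weylIdx P w α) = P.root (weylIdx P w β) ∨
      P.root (weylIdx P w α) = - P.root (weylIdx P w β) := by
    rcases root_posOf b (weylIdx P w α) with h1 | h1 <;>
      rcases root_posOf b (weylIdx P w β) with h2 | h2
    · left; rw [← h1, h, h2]
    · right; rw [← h1, h, h2]
    · right; rw [← h2, ← h, h1, neg_neg]
    · left; rw [← neg_inj, ← h1, h, h2]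
  rcases h1 with h1 | h1
  · exact Subtype.ext ((w : P.Aut).indexEquiv.injective (P.root.injective h1))
  · exfalso
    have hr : ∀ i, P.root (weylIdx P w i) = RootPairing.Equiv.weightEquiv P P (w : P.Aut) (P.root i) := fun i =>
      (RootPairing.Hom.root_weightMap_apply P P i (w : P.Aut).toHom).symm
    rw [hr, hr, ← map_neg, (RootPairing.Equiv.weightEquiv P P (w : P.Aut)).injective.eq_iff] at h1
    have h2 : P.reflectionPerm β.1 β.1 = α.1 := P.root.injective (by rw [h1]; simp)
    have h3 := (RootPairing.Base.IsPos.neg_iff_not b β.1).not.mpr (not_not.mpr β.2)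
    apply h3
    have h4 := α.2
    rw [← h2] at h4
    exact h4

lemma weyl0_Sβ (w : P.weylGroup) (β : PosRoot b) {x : S0 k b} (hx : x ∈ Sβ k b β) :
    weyl0 k b w x ∈ Sβ k b (posOf b (weylIdx P w β)) := by
  induction hx using Algebra.adjoin_induction with
  | mem x hx =>
    obtain ⟨α, hα, h⟩ := hx
    have h1 := congrArg (weyl0 k b w) h
    rw [map_mul, map_one, weyl0_root] at h1
    have hne : posOf b (weylIdx P w α) ≠ posOf b (weylIdx P w β) := fun h => hα (posOf_injOn b w h)
    rcases root0_posOf k b (weylIdx P w α) with h2 | h2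
    · exact Algebra.subset_adjoin ⟨_, hne, by rw [h2, h1]⟩
    · rw [← neg_neg (weyl0 k b w x)]
      exact neg_mem (Algebra.subset_adjoin ⟨_, hne, by rw [h2, neg_mul_neg, h1]⟩)
  | algebraMap r => rw [weyl0_of]; exact Subalgebra.algebraMap_mem _ _
  | add x y _ _ hx hy => rw [map_add]; exact add_mem hx hy
  | mul x y _ _ hx hy => rw [map_mul]; exact mul_mem hx hy

lemma weyl0_deg (w : P.weylGroup) {n : ℤ} {x : S0 k b} (hx : x ∈ deg0 k b n) :
    weyl0 k b w x ∈ deg0 k b n := by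
  induction hx using AddSubgroup.closure_induction with
  | mem x hx =>
    obtain ⟨c, ξ, α, h, rfl⟩ := hx
    have hα : ∃ ε : k, (weyl0 k b w (α.map fun a : PosRoot b => root0 k b a.1).prod) =
        algebraMap (Sk k P) (S0 k b) (algebraMap k _ ε) *
        ((α.map fun a => posOf b (weylIdx P w a.1)).map fun a : PosRoot b => root0 k b a.1).prod
        ∧ ε * ε = 1 := by
      clear h
      induction α with
      | nil => exact ⟨1, by simp, by simp⟩
      | cons a α ih =>
        obtain ⟨ε, h1, h2⟩ := ih
        simp only [List.map_cons, List.prod_cons, map_mul, h1, weyl0_root]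
        rcases root0_posOf k b (weylIdx P w a.1) with h3 | h3
        · exact ⟨ε, by rw [h3]; ring, h2⟩
        · exact ⟨-ε, by rw [h3, map_neg, map_neg]; ring, by rw [neg_mul_neg, h2]⟩
    obtain ⟨ε, h1, h2⟩ := hα
    refine AddSubgroup.subset_closure ⟨ε * c, ξ.map ((weylX P w).toIntLinearMap.baseChange k),
      α.map fun a => posOf b (weylIdx P w a.1), ?_, by simp⟩
    have h3 := congrArg (weyl0 k b w) h
    rw [map_mul, h1, weyl0_of, map_smul, map_list_prod] at h3
    have h4 : (List.map (weylS k P w) (List.map (SymmetricAlgebra.ι k (Xk k P)) ξ)) =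
        List.map (SymmetricAlgebra.ι k (Xk k P))
          (ξ.map ((weylX P w).toIntLinearMap.baseChange k)) := by
      rw [List.map_map, List.map_map]
      refine List.map_congr_left fun a _ => ?_
      change weylS k P w (SymmetricAlgebra.ι k (Xk k P) a) = _
      rw [weylS, SymmetricAlgebra.lift_ι_apply]
      rfl
    rw [h4] at h3
    have h5 : algebraMap (Sk k P) (S0 k b) (algebraMap k _ ε) *
        algebraMap (Sk k P) (S0 k b) (algebraMap k _ ε) = 1 := by
      rw [← map_mul, ← map_mul, h2, map_one, map_one]
    rw [mul_smul, Algebra.smul_def ε, map_mul, ← h3]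
    linear_combination (-(weyl0 k b w x * (((α.map fun a => posOf b (weylIdx P w a.1)).map
      fun a : PosRoot b => root0 k b a.1).prod))) * h5
  | zero => rw [map_zero]; exact zero_mem _
  | add x y _ _ hx hy => rw [map_add]; exact add_mem hx hy
  | neg x _ hx => rw [map_neg]; exact neg_mem hx

end Rings

/-! ### The category `𝒦_k` -/

section Category

universe u v

variable {ι N : Type*} {V : Type v} [AddCommGroup V] [Module ℚ V] [AddCommGroup N] [Module ℚ N]
variable (k : Type u) [Field k] {P : RootPairing ι ℚ V N} [P.IsCrystallographic] (b : P.Base)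

/-- Objects of `𝒦_k`: graded `S_k^∅`-modules `M(A)` and graded `S_k^β`-submodules
`M(A, β) ⊆ M(A) ⊕ M(β ↑ A)`. -/
structure Obj where
  /-- The modules `M(A)`. -/
  carrier : Alcove P → Type (max u v)
  [acg : ∀ A, AddCommGroup (carrier A)]
  [mod : ∀ A, Module (S0 k b) (carrier A)]
  /-- The homogeneous elements of `M(A)` of degree `n`. -/
  deg : ∀ A, ℤ → AddSubgroup (carrier A)
  internal : ∀ A, DirectSum.IsInternal (deg A)
  smul_mem_deg : ∀ A (m n : ℤ) (c : S0 k b) (x : carrier A),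
    c ∈ deg0 k b m → x ∈ deg A n → c • x ∈ deg A (m + n)
  /-- The submodules `M(A, β)`. -/
  edge : ∀ A (β : PosRoot b), Submodule (Sβ k b β) (carrier A × carrier (up P β A))
  edge_homog : ∀ A (β : PosRoot b) p, p ∈ edge A β → ∀ n,
    (comp (internal A) n p.1, comp (internal (up P β A)) n p.2) ∈ edge A β

attribute [instance] Obj.acg Obj.mod

variable {k b}

/-- Morphisms of `𝒦_k`. -/
@[ext]
structure Obj.Hom (M M' : Obj k b) where
  /-- The components `f_A`. -/
  app : ∀ A, M.carrier A →ₗ[S0 k b] M'.carrier A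
  map_deg : ∀ A n x, x ∈ M.deg A n → app A x ∈ M'.deg A n
  map_edge : ∀ A (β : PosRoot b) p, p ∈ M.edge A β → (app A p.1, app (up P β A) p.2) ∈ M'.edge A β

instance : Category (Obj k b) where
  Hom M M' := Obj.Hom M M'
  id M := ⟨fun A => LinearMap.id, fun _ _ _ h => h, fun _ _ _ h => h⟩
  comp f g := ⟨fun A => (g.app A).comp (f.app A),
    fun A n x h => g.map_deg A n _ (f.map_deg A n x h),
    fun A β p h => g.map_edge A β _ (f.map_edge A β p h)⟩

namespace Obj

variable (M M' : Obj k b)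

lemma comp_smul {A : Alcove P} {m : ℤ} {c : S0 k b} (hc : c ∈ deg0 k b m) (n : ℤ)
    (x : M.carrier A) :
    comp (M.internal A) n (c • x) = c • comp (M.internal A) (n - m) x := by
  induction x using graded_induction (M.internal A) with
  | hom l y hy =>
    rw [comp_of_mem _ hy, comp_of_mem _ (M.smul_mem_deg A m l c y hc hy)]
    by_cases h : l = n - m
    · rw [if_pos h, if_pos (by omega)]
    · rw [if_neg h, if_neg (by omega), smul_zero]
  | zero => simp
  | add y z hy hz => rw [smul_add, map_add, hy, hz, map_add, smul_add]

lemma prod_internal (A B : Alcove P) : DirectSum.IsInternal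
    (fun n => (M.deg A n).prod (M'.deg B n)) := by
  refine internal_of_comp (fun n => (comp (M.internal A) n).prodMap (comp (M'.internal B) n)) ?_ ?_
  · rintro m n ⟨x, y⟩ ⟨hx, hy⟩
    simp only at hx hy
    simp only [AddMonoidHom.coe_prodMap, Prod.map_apply]
    rw [comp_of_mem _ hx, comp_of_mem _ hy]
    split_ifs <;> rfl
  · rintro ⟨x, y⟩
    have h1 : ∀ x, (x, (0 : M'.carrier B)) ∈ ⨆ n, (M.deg A n).prod (M'.deg B n) := by
      intro x
      induction x using graded_induction (M.internal A) with
      | hom l y hy => exact AddSubgroup.mem_iSup_of_mem l ⟨hy, zero_mem _⟩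
      | zero => exact zero_mem _
      | add y z hy hz => simpa using add_mem hy hz
    have h2 : ∀ y, ((0 : M.carrier A), y) ∈ ⨆ n, (M.deg A n).prod (M'.deg B n) := by
      intro x
      induction x using graded_induction (M'.internal B) with
      | hom l y hy => exact AddSubgroup.mem_iSup_of_mem l ⟨zero_mem _, hy⟩
      | zero => exact zero_mem _
      | add y z hy hz => simpa using add_mem hy hz
    simpa using add_mem (h1 x) (h2 y)

lemma comp_prod {A B : Alcove P} (h : DirectSum.IsInternal
    (fun n => (M.deg A n).prod (M'.deg B n))) (n : ℤ) (x : M.carrier A × M'.carrier B) :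
    comp h n x = (comp (M.internal A) n x.1, comp (M'.internal B) n x.2) := by
  refine comp_eq_of_comp h ((comp (M.internal A) n).prodMap (comp (M'.internal B) n)) n ?_ x
  rintro m ⟨x, y⟩ ⟨hx, hy⟩
  simp only at hx hy
  simp only [AddMonoidHom.coe_prodMap, Prod.map_apply]
  rw [comp_of_mem _ hx, comp_of_mem _ hy]
  split_ifs <;> rfl

/-- The direct sum of two objects. -/
def sum : Obj k b where
  carrier A := M.carrier A × M'.carrier A
  deg A n := (M.deg A n).prod (M'.deg A n)
  internal A := M.prod_internal M' A A
  smul_mem_deg A m n c x hc hx :=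
    ⟨M.smul_mem_deg A m n c _ hc hx.1, M'.smul_mem_deg A m n c _ hc hx.2⟩
  edge A β :=
    { carrier := {p | (p.1.1, p.2.1) ∈ M.edge A β ∧ (p.1.2, p.2.2) ∈ M'.edge A β}
      zero_mem' := ⟨zero_mem _, zero_mem _⟩
      add_mem' := fun hp hq => ⟨add_mem hp.1 hq.1, add_mem hp.2 hq.2⟩
      smul_mem' := fun c _ hp =>
        ⟨Submodule.smul_mem _ c hp.1, Submodule.smul_mem _ c hp.2⟩ }
  edge_homog A β p hp n := by
    rw [M.comp_prod M', M.comp_prod M']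
    exact ⟨M.edge_homog A β _ hp.1 n, M'.edge_homog A β _ hp.2 n⟩

lemma shift_internal (l : ℤ) (A : Alcove P) :
    DirectSum.IsInternal (fun n => M.deg A (n - l)) := by
  refine internal_of_comp (fun n => comp (M.internal A) (n - l)) ?_ ?_
  · intro m n x hx
    rw [comp_of_mem _ hx]
    by_cases h : m = n
    · rw [if_pos h, if_pos (by omega)]
    · rw [if_neg h, if_neg (by omega)]
  · intro x
    induction x using graded_induction (M.internal A) with
    | hom j y hy =>
      refine AddSubgroup.mem_iSup_of_mem (j + l) ?_
      rwa [add_sub_cancel_right]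
    | zero => exact zero_mem _
    | add y z hy hz => exact add_mem hy hz

lemma comp_shift (l : ℤ) {A : Alcove P} (h : DirectSum.IsInternal fun n => M.deg A (n - l))
    (n : ℤ) (x : M.carrier A) : comp h n x = comp (M.internal A) (n - l) x := by
  refine comp_eq_of_comp h _ n ?_ x
  intro m x hx
  rw [comp_of_mem _ hx]
  by_cases h : m = n
  · rw [if_pos h, if_pos (by omega)]
  · rw [if_neg h, if_neg (by omega)]

/-- The shift `M{l}`, with `M{l}_n = M_{n-l}`. -/
def shift (l : ℤ) : Obj k b where
  carrier := M.carrier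
  deg A n := M.deg A (n - l)
  internal := M.shift_internal l
  smul_mem_deg A m n c x hc hx := by
    rw [add_sub_assoc]
    exact M.smul_mem_deg A m (n - l) c x hc hx
  edge := M.edge
  edge_homog A β p hp n := by
    rw [M.comp_shift, M.comp_shift]
    exact M.edge_homog A β p hp _

open Classical in
/-- The inclusion of `M(A) ⊕ M(B)`, for alcoves `A ≠ B`, into the product of all `M(C)`. It is used
to identify elements of sums of components that are indexed by equal alcoves. -/
def emb (A B : Alcove P) : M.carrier A × M.carrier B →ₗ[S0 k b] (∀ C, M.carrier C) :=
  (LinearMap.single (S0 k b) M.carrier A).coprod (LinearMap.single (S0 k b) M.carrier B)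

/-- The submodule `M(A, β)`, inside the product of all `M(C)`. -/
def hat (A : Alcove P) (β : PosRoot b) : Submodule (Sβ k b β) (∀ C, M.carrier C) :=
  (M.edge A β).map ((M.emb A (up P β A)).restrictScalars (Sβ k b β))

lemma mem_hat {A : Alcove P} {β : PosRoot b} {f : ∀ C, M.carrier C} :
    f ∈ M.hat A β ↔ ∃ p ∈ M.edge A β, M.emb A (up P β A) p = f := Iff.rfl

/-- Homogeneous components in the product of all `M(C)`. -/
def compPi (n : ℤ) (f : ∀ C, M.carrier C) : ∀ C, M.carrier C := fun C => comp (M.internal C) n (f C)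

lemma compPi_add (n : ℤ) (f g : ∀ C, M.carrier C) :
    M.compPi n (f + g) = M.compPi n f + M.compPi n g := funext fun _ => map_add _ _ _

lemma compPi_smul {m : ℤ} {c : S0 k b} (hc : c ∈ deg0 k b m) (n : ℤ) (f : ∀ C, M.carrier C) :
    M.compPi n (c • f) = c • M.compPi (n - m) f := funext fun _ => M.comp_smul hc _ _

lemma compPi_emb (n : ℤ) {A B : Alcove P} (p : M.carrier A × M.carrier B) :
    M.compPi n (M.emb A B p) =
      M.emb A B (comp (M.internal A) n p.1, comp (M.internal B) n p.2) := by
  classical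
  have h : ∀ A (x : M.carrier A), M.compPi n (Pi.single A x) =
      Pi.single A (comp (M.internal A) n x) := by
    intro A x
    funext C
    by_cases hC : C = A
    · subst hC; simp [compPi]
    · simp [compPi, Pi.single_eq_of_ne hC]
  obtain ⟨x, y⟩ := p
  simp only [emb, LinearMap.coprod_apply, LinearMap.coe_single]
  rw [compPi_add, Subsingleton.elim (fun a b : Alcove P => Classical.propDecidable (a = b))
    (fun a b => inferInstance)]
  exact congrArg₂ (· + ·) (h A x) (h B y)

lemma hat_homog {A : Alcove P} {β : PosRoot b} {f : ∀ C, M.carrier C} (hf : f ∈ M.hat A β)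
    (n : ℤ) : M.compPi n f ∈ M.hat A β := by
  obtain ⟨p, hp, rfl⟩ := hf
  exact ⟨_, M.edge_homog A β p hp n, (M.compPi_emb n p).symm⟩

lemma root_mem_deg0 (i : ι) : root0 k b i ∈ deg0 k b 2 :=
  AddSubgroup.subset_closure ⟨1, [1 ⊗ₜ[ℤ] rootX P i], [], by simp [root0, rootS, weightS], by simp⟩

section Translation

variable [P.IsRootSystem] [Finite ι] (s : simpleRefl b)

/-- The module `𝒯_s M(A) = M(A^{(s)}_-) ⊕ M(A^{(s)}_+)`. -/
abbrev transCarrier (A : Alcove P) : Type (max u v) :=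
  M.carrier (negAlcove b s A) × M.carrier (posAlcove b s A)

/-- The inclusion of `𝒯_s M(A)` into the product of all `M(C)`. -/
abbrev transEmb (A : Alcove P) : M.transCarrier s A →ₗ[S0 k b] (∀ C, M.carrier C) :=
  M.emb (negAlcove b s A) (posAlcove b s A)

/-- `{(βx + y, y) ∣ x, y ∈ M(A, β)}`. -/
def edgeNeg (A : Alcove P) (β : PosRoot b) :
    Submodule (Sβ k b β) (M.transCarrier s A × M.transCarrier s (up P β A)) where
  carrier := {p | ∃ x ∈ M.hat A β, ∃ y ∈ M.hat A β,
    M.transEmb s A p.1 = root0 k b β • x + y ∧ M.transEmb s (up P β A) p.2 = y}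
  zero_mem' := ⟨0, zero_mem _, 0, zero_mem _, by simp, by simp⟩
  add_mem' := by
    rintro p q ⟨x, hx, y, hy, h1, h2⟩ ⟨x', hx', y', hy', h1', h2'⟩
    refine ⟨x + x', add_mem hx hx', y + y', add_mem hy hy', ?_, ?_⟩
    · rw [Prod.fst_add, map_add, h1, h1', smul_add]; abel
    · rw [Prod.snd_add, map_add, h2, h2']
  smul_mem' := by
    rintro c p ⟨x, hx, y, hy, h1, h2⟩
    refine ⟨c • x, Submodule.smul_mem _ _ hx, c • y, Submodule.smul_mem _ _ hy, ?_, ?_⟩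
    · have : M.transEmb s A (c • p).1 = (c : S0 k b) • M.transEmb s A p.1 := map_smul _ (c : S0 k b) _
      rw [this, h1, smul_add, smul_comm]
      rfl
    · have : M.transEmb s (up P β A) (c • p).2 = (c : S0 k b) • M.transEmb s (up P β A) p.2 :=
        map_smul _ (c : S0 k b) _
      rw [this, h2]
      rfl

/-- `β M(β ↓ A, β) ⊕ M(β ↑ A, β)`. -/
def edgePos (A : Alcove P) (β : PosRoot b) :
    Submodule (Sβ k b β) (M.transCarrier s A × M.transCarrier s (up P β A)) where
  carrier := {p | ∃ x ∈ M.hat (down P β A) β, ∃ y ∈ M.hat (up P β A) β,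
    M.transEmb s A p.1 = root0 k b β • x ∧ M.transEmb s (up P β A) p.2 = y}
  zero_mem' := ⟨0, zero_mem _, 0, zero_mem _, by simp, by simp⟩
  add_mem' := by
    rintro p q ⟨x, hx, y, hy, h1, h2⟩ ⟨x', hx', y', hy', h1', h2'⟩
    refine ⟨x + x', add_mem hx hx', y + y', add_mem hy hy', ?_, ?_⟩
    · rw [Prod.fst_add, map_add, h1, h1', smul_add]
    · rw [Prod.snd_add, map_add, h2, h2']
  smul_mem' := by
    rintro c p ⟨x, hx, y, hy, h1, h2⟩
    refine ⟨c • x, Submodule.smul_mem _ _ hx, c • y, Submodule.smul_mem _ _ hy, ?_, ?_⟩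
    · have : M.transEmb s A (c • p).1 = (c : S0 k b) • M.transEmb s A p.1 := map_smul _ (c : S0 k b) _
      rw [this, h1, smul_comm]
      rfl
    · have : M.transEmb s (up P β A) (c • p).2 = (c : S0 k b) • M.transEmb s (up P β A) p.2 :=
        map_smul _ (c : S0 k b) _
      rw [this, h2]
      rfl

/-- `M(A^{(s)}_-, β) ⊕ M(A^{(s)}_+, β)`; both summands lie crosswise in
`𝒯_s M(A) ⊕ 𝒯_s M(β ↑ A)`. -/
def edgeCross (A : Alcove P) (β : PosRoot b) :
    Submodule (Sβ k b β) (M.transCarrier s A × M.transCarrier s (up P β A)) where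
  carrier := {p | ∃ x ∈ M.edge (negAlcove b s A) β, ∃ y ∈ M.edge (posAlcove b s A) β,
    p.1 = (x.1, y.1) ∧
    M.transEmb s (up P β A) p.2 =
      M.emb (up P β (negAlcove b s A)) (up P β (posAlcove b s A)) (x.2, y.2)}
  zero_mem' := ⟨0, zero_mem _, 0, zero_mem _, rfl, by
    rw [Prod.snd_zero, map_zero]; exact (map_zero _).symm⟩
  add_mem' := by
    rintro p q ⟨x, hx, y, hy, h1, h2⟩ ⟨x', hx', y', hy', h1', h2'⟩
    refine ⟨x + x', add_mem hx hx', y + y', add_mem hy hy', ?_, ?_⟩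
    · rw [Prod.fst_add, h1, h1']; rfl
    · rw [Prod.snd_add, map_add, h2, h2', ← map_add]; rfl
  smul_mem' := by
    rintro c p ⟨x, hx, y, hy, h1, h2⟩
    refine ⟨c • x, Submodule.smul_mem _ _ hx, c • y, Submodule.smul_mem _ _ hy, ?_, ?_⟩
    · rw [Prod.smul_fst, h1]; rfl
    · have : M.transEmb s (up P β A) (c • p).2 = (c : S0 k b) • M.transEmb s (up P β A) p.2 :=
        map_smul _ (c : S0 k b) _
      rw [this, h2, ← map_smul]
      rfl

open Classical in
/-- The submodule `𝒯_s M(A, β)`. -/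
def transEdge (A : Alcove P) (β : PosRoot b) :
    Submodule (Sβ k b β) (M.transCarrier s A × M.transCarrier s (up P β A)) :=
  if upSet P β (wall b s A) = wall b s A then
    if A = negAlcove b s A then M.edgeNeg s A β else M.edgePos s A β
  else M.edgeCross s A β

/-- The translation functor `𝒯_s` on objects. -/
def trans : Obj k b where
  carrier A := M.transCarrier s A
  deg A n := (M.deg (negAlcove b s A) n).prod (M.deg (posAlcove b s A) n)
  internal A := M.prod_internal M _ _
  smul_mem_deg A m n c x hc hx :=
    ⟨M.smul_mem_deg _ m n c _ hc hx.1, M.smul_mem_deg _ m n c _ hc hx.2⟩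
  edge := M.transEdge s
  edge_homog A β p hp n := by
    rw [M.comp_prod M, M.comp_prod M]
    unfold transEdge at hp ⊢
    split_ifs at hp ⊢
    · obtain ⟨x, hx, y, hy, h1, h2⟩ := hp
      refine ⟨_, M.hat_homog hx (n - 2), _, M.hat_homog hy n, ?_, ?_⟩
      · rw [transEmb, ← compPi_emb, ← M.compPi_smul (root_mem_deg0 _), ← compPi_add, ← h1]
      · rw [transEmb, ← compPi_emb, ← h2]
    · obtain ⟨x, hx, y, hy, h1, h2⟩ := hp
      refine ⟨_, M.hat_homog hx (n - 2), _, M.hat_homog hy n, ?_, ?_⟩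
      · rw [transEmb, ← compPi_emb, ← M.compPi_smul (root_mem_deg0 _), ← h1]
      · rw [transEmb, ← compPi_emb, ← h2]
    · obtain ⟨x, hx, y, hy, h1, h2⟩ := hp
      refine ⟨_, M.edge_homog _ _ x hx n, _, M.edge_homog _ _ y hy n, ?_, ?_⟩
      · rw [h1]
      · rw [transEmb, ← M.compPi_emb n p.2]
        refine (congrArg (M.compPi n) h2).trans ?_
        rw [compPi_emb]

open Classical in
/-- `S_k^∅` for `A = A_e` and `0` otherwise. -/
def unitSub (k : Type u) [Field k] (b : P.Base) (A : Alcove P) : Submodule (S0 k b) (S0 k b) :=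
  if A = fundAlcove b then ⊤ else ⊥

lemma unitSub_comp (A : Alcove P) (n : ℤ) {x : S0 k b} (hx : x ∈ unitSub k b A) :
    comp (internal0 k b) n x ∈ unitSub k b A := by
  unfold unitSub at hx ⊢
  split_ifs at hx ⊢
  · trivial
  · rw [(Submodule.mem_bot _).mp hx, map_zero]
    exact zero_mem _

lemma unit_internal (A : Alcove P) : DirectSum.IsInternal (fun n =>
    (deg0 k b n).comap (unitSub k b A).subtype.toAddMonoidHom) := by
  refine internal_of_comp (fun n => ((comp (internal0 k b) n).comp
    (unitSub k b A).subtype.toAddMonoidHom).codRestrict (unitSub k b A).toAddSubgroup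
      (fun x => unitSub_comp A n x.2)) ?_ ?_
  · intro m n x hx
    apply Subtype.ext
    refine (comp_of_mem (internal0 k b) (hx : (x : S0 k b) ∈ deg0 k b m) n).trans ?_
    split_ifs <;> rfl
  · rintro ⟨x, hx⟩
    unfold unitSub at hx
    split_ifs at hx with h
    · have htop : ∀ x : S0 k b, x ∈ unitSub k b A := fun x => by
        unfold unitSub; rw [if_pos h]; trivial
      have : ∀ x : S0 k b, (⟨x, htop x⟩ : unitSub k b A) ∈ ⨆ n,
          (deg0 k b n).comap (unitSub k b A).subtype.toAddMonoidHom := by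
        intro x
        induction x using graded_induction (internal0 k b) with
        | hom l y hy => exact AddSubgroup.mem_iSup_of_mem l hy
        | zero => exact zero_mem _
        | add y z hy hz => exact add_mem hy hz
      exact this x
    · have : x = 0 := hx
      subst this
      exact zero_mem _

lemma comp_unit {A : Alcove P} (h : DirectSum.IsInternal (fun n =>
    (deg0 k b n).comap (unitSub k b A).subtype.toAddMonoidHom)) (n : ℤ) (x : unitSub k b A) :
    (comp h n x : S0 k b) = comp (internal0 k b) n x := by
  induction x using graded_induction h with
  | hom l y hy =>
    have h2 : (y : S0 k b) ∈ deg0 k b l := hy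
    rw [comp_of_mem h hy]
    refine Eq.trans ?_ (comp_of_mem (internal0 k b) h2 n).symm
    split_ifs <;> rfl
  | zero => simp
  | add y z hy hz => simp only [map_add, Submodule.coe_add, hy, hz]

/-- The unit object `P_0`. Here `P_0(A, β)` consists of the pairs with entries in `S_k^β`, that is
`S_k^β ⊕ 0` for `A = A_e`, `0 ⊕ S_k^β` for `β ↑ A = A_e`, and `0` otherwise. -/
def unit (k : Type u) [Field k] (b : P.Base) : Obj k b where
  carrier A := unitSub k b A
  deg A n := (deg0 k b n).comap (unitSub k b A).subtype.toAddMonoidHom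
  internal A := unit_internal A
  smul_mem_deg A m n c x hc hx := mul_mem_deg0 k b hc hx
  edge A β :=
    { carrier := {p | (p.1 : S0 k b) ∈ Sβ k b β ∧ (p.2 : S0 k b) ∈ Sβ k b β}
      zero_mem' := ⟨zero_mem _, zero_mem _⟩
      add_mem' := fun hp hq => ⟨add_mem hp.1 hq.1, add_mem hp.2 hq.2⟩
      smul_mem' := fun c _ hp => ⟨mul_mem c.2 hp.1, mul_mem c.2 hp.2⟩ }
  edge_homog A β p hp n := by
    refine ⟨?_, ?_⟩
    · simp only [comp_unit]
      exact Sβ_homog k b β hp.1 n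
    · simp only [comp_unit]
      exact Sβ_homog k b β hp.2 n

/-- The Bott-Samelson object `𝒯_{s_j} ∘ ⋯ ∘ 𝒯_{s_1} P_0` of the word `(s_1, …, s_j)`. -/
def bottSamelson (k : Type u) [Field k] (b : P.Base) (u : List (simpleRefl b)) : Obj k b :=
  u.foldl (fun M s => M.trans s) (unit k b)

end Translation

section Dual

/-- `φ` is homogeneous of degree `l`. -/
def IsHomogHom {A : Alcove P} (l : ℤ) (φ : M.carrier A →ₗ[S0 k b] S0 k b) : Prop :=
  ∀ n x, x ∈ M.deg A n → φ x ∈ deg0 k b (l + n)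

/-- `Hom^•(M(A), S_k^∅)`: the sums of homogeneous homomorphisms. (If `M(A)` is finitely generated,
these are all homomorphisms.) -/
def gradedHom (A : Alcove P) : Submodule (S0 k b) (M.carrier A →ₗ[S0 k b] S0 k b) :=
  Submodule.span _ {φ | ∃ l, M.IsHomogHom l φ}

/-- `Hom^l(M(A), S_k^∅)`. -/
def homDeg (A : Alcove P) (l : ℤ) : AddSubgroup (M.gradedHom A) where
  carrier := {φ | M.IsHomogHom l φ.1}
  zero_mem' := fun _ _ _ => zero_mem _
  add_mem' := fun hφ hψ n x hx => add_mem (hφ n x hx) (hψ n x hx)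
  neg_mem' := fun hφ n x hx => neg_mem (hφ n x hx)

lemma IsHomogHom.smul {A : Alcove P} {l m : ℤ} {φ : M.carrier A →ₗ[S0 k b] S0 k b}
    (hφ : M.IsHomogHom l φ) {c : S0 k b} (hc : c ∈ deg0 k b m) :
    M.IsHomogHom (m + l) (c • φ) := by
  intro n x hx
  rw [add_assoc]
  exact mul_mem_deg0 k b hc (hφ n x hx)

lemma homDeg_smul {A : Alcove P} (c : S0 k b) {ψ : M.gradedHom A} (hψ : ψ ∈ ⨆ l, M.homDeg A l) :
    c • ψ ∈ ⨆ l, M.homDeg A l := by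
  refine AddSubgroup.iSup_induction (M.homDeg A) (C := fun ψ =>
    c • ψ ∈ ⨆ l, M.homDeg A l) hψ ?_ ?_ ?_
  · intro l ψ hψ
    induction c using graded_induction (internal0 k b) with
    | hom m c hc => exact AddSubgroup.mem_iSup_of_mem (m + l) (IsHomogHom.smul M hψ hc)
    | zero => rw [zero_smul]; exact zero_mem _
    | add c d hc hd => rw [add_smul]; exact add_mem hc hd
  · rw [smul_zero]; exact zero_mem _
  · intro x y hx hy
    rw [smul_add]; exact add_mem hx hy

lemma homDeg_iSup (A : Alcove P) (φ : M.gradedHom A) : φ ∈ ⨆ l, M.homDeg A l := by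
  let T : Submodule (S0 k b) (M.gradedHom A) :=
    { (⨆ l, M.homDeg A l) with
      smul_mem' := fun c _ h => M.homDeg_smul c h }
  have hle : M.gradedHom A ≤ T.map (M.gradedHom A).subtype := by
    refine Submodule.span_le.mpr ?_
    rintro φ ⟨l, hl⟩
    refine ⟨⟨φ, Submodule.subset_span ⟨l, hl⟩⟩, ?_, rfl⟩
    exact AddSubgroup.mem_iSup_of_mem (S := M.homDeg A) l hl
  obtain ⟨ψ, hψ, h⟩ := hle φ.2
  have : ψ = φ := Subtype.ext h
  rw [← this]
  exact hψ

lemma homDeg_key (A : Alcove P) (f : DirectSum ℤ fun l => M.homDeg A l) (l n : ℤ)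
    (x : M.carrier A) (hx : x ∈ M.deg A n) :
    comp (internal0 k b) (l + n) ((DirectSum.coeAddMonoidHom (M.homDeg A) f).1 x) =
      (f l).1.1 x := by
  induction f using DirectSum.induction_on with
  | zero =>
    rw [map_zero, Submodule.coe_zero, LinearMap.zero_apply, map_zero]
    rfl
  | of i y =>
    rw [DirectSum.coeAddMonoidHom_of, comp_of_mem (internal0 k b) (y.2 n x hx)]
    by_cases hil : i = l
    · subst hil; rw [if_pos rfl, DirectSum.of_eq_same]
    · rw [if_neg (fun h => hil (add_right_cancel h)), DirectSum.of_eq_of_ne _ _ _ (Ne.symm hil)]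
      exact (LinearMap.zero_apply x).symm
  | add f g hf hg =>
    have h : ∀ φ ψ : M.gradedHom A, (φ + ψ).1 x = φ.1 x + ψ.1 x := fun φ ψ => rfl
    have h3 : ∀ φ ψ : M.homDeg A l, (φ + ψ).1.1 x = φ.1.1 x + ψ.1.1 x := fun φ ψ => rfl
    have h1 := (DirectSum.coeAddMonoidHom (M.homDeg A)).map_add f g
    have h4 := congrArg (fun φ => comp (internal0 k b) (l + n) (φ.1 x)) h1
    have h5 := (comp (internal0 k b) (l + n)).map_add
      ((DirectSum.coeAddMonoidHom (M.homDeg A) f).1 x) ((DirectSum.coeAddMonoidHom (M.homDeg A) g).1 x)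
    exact h4.trans (h5.trans ((congrArg₂ (· + ·) hf hg).trans (h3 (f l) (g l)).symm))

lemma dual_internal (A : Alcove P) : DirectSum.IsInternal (M.homDeg A) := by
  refine internal_of_indep (fun f hf => ?_) (M.homDeg_iSup A)
  have hz : ∀ l (x : M.carrier A), (f l).1.1 x = 0 := by
    intro l x
    induction x using graded_induction (M.internal A) with
    | hom n y hy =>
      rw [← M.homDeg_key A f l n y hy, hf, Submodule.coe_zero, LinearMap.zero_apply, map_zero]
    | zero => rw [map_zero]
    | add y z hy hz => rw [map_add, hy, hz, add_zero]
  refine DFinsupp.ext fun l => Subtype.ext (Subtype.ext (LinearMap.ext fun x => ?_))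
  exact hz l x

lemma comp_dual (A : Alcove P) (l n : ℤ) (φ : M.gradedHom A) {x : M.carrier A}
    (hx : x ∈ M.deg A n) :
    (comp (M.dual_internal A) l φ).1 x = comp (internal0 k b) (l + n) (φ.1 x) := by
  induction φ using graded_induction (M.dual_internal A) with
  | hom i y hy =>
    rw [comp_of_mem _ hy, comp_of_mem _ (hy n x hx)]
    by_cases h : i = l
    · rw [if_pos h, if_pos (by omega)]
    · rw [if_neg h, if_neg (by omega)]; rfl
  | zero => simp
  | add y z hy hz =>
    rw [map_add, Submodule.coe_add, LinearMap.add_apply, hy, hz, Submodule.coe_add,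
      LinearMap.add_apply, map_add]

lemma exists_sum_comp {X : Type*} [AddCommGroup X] {D : ℤ → AddSubgroup X}
    (h : DirectSum.IsInternal D) (x : X) :
    ∃ s : Finset ℤ, ∀ t, s ⊆ t → ∑ n ∈ t, comp h n x = x := by
  classical
  induction x using graded_induction h with
  | hom l y hy =>
    refine ⟨{l}, fun t ht => ?_⟩
    have hl : l ∈ t := ht (Finset.mem_singleton_self l)
    simp only [comp_of_mem h hy]
    rw [Finset.sum_ite_eq, if_pos hl]
  | zero => exact ⟨∅, fun t _ => by simp⟩
  | add y z hy hz =>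
    obtain ⟨s1, h1⟩ := hy
    obtain ⟨s2, h2⟩ := hz
    refine ⟨s1 ∪ s2, fun t ht => ?_⟩
    simp only [map_add, Finset.sum_add_distrib]
    rw [h1 t (Finset.subset_union_left.trans ht), h2 t (Finset.subset_union_right.trans ht)]

lemma edge_induction {A : Alcove P} {β : PosRoot b}
    {p : M.carrier A × M.carrier (up P β A) → Prop} (zero : p 0) (add : ∀ x y, p x → p y → p (x + y))
    (hom : ∀ n, ∀ x ∈ M.edge A β, x.1 ∈ M.deg A n → x.2 ∈ M.deg (up P β A) n → p x)
    (x) (hx : x ∈ M.edge A β) : p x := by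
  obtain ⟨s1, h1⟩ := exists_sum_comp (M.internal A) x.1
  obtain ⟨s2, h2⟩ := exists_sum_comp (M.internal (up P β A)) x.2
  classical
  have h : x = ∑ n ∈ s1 ∪ s2, (comp (M.internal A) n x.1, comp (M.internal (up P β A)) n x.2) := by
    refine Prod.ext ?_ ?_
    · rw [Prod.fst_sum]; exact (h1 _ Finset.subset_union_left).symm
    · rw [Prod.snd_sum]; exact (h2 _ Finset.subset_union_right).symm
  rw [h]
  refine Finset.sum_induction _ p add zero fun n _ => ?_
  exact hom n _ (M.edge_homog A β x hx n) (comp_mem _ _ _) (comp_mem _ _ _)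

/-- The duality `𝒟` on objects: `𝒟M(A) = Hom^•(M(A), S_k^∅)`, and `𝒟M(A, β)` consists of the
pairs `(φ, ψ)` for which `φ + ψ : M(A) ⊕ M(β ↑ A) → S_k^∅` maps `M(A, β)` to `S_k^β`. If
`M(A, β)` generates `M(A) ⊕ M(β ↑ A)` over `S_k^∅`, in particular if `M` is special,
then restriction to `M(A, β)` identifies it with `Hom^•(M(A, β), S_k^β)`. -/
def dual : Obj k b where
  carrier A := M.gradedHom A
  deg := M.homDeg
  internal := M.dual_internal
  smul_mem_deg A m n c φ hc hφ := IsHomogHom.smul M hφ hc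
  edge A β :=
    { carrier := {p | ∀ m ∈ M.edge A β, p.1.1 m.1 + p.2.1 m.2 ∈ Sβ k b β}
      zero_mem' := fun m _ => by simp
      add_mem' := fun {p q} hp hq m hm => by
        have := add_mem (hp m hm) (hq m hm)
        rw [add_add_add_comm] at this
        exact this
      smul_mem' := fun c p hp m hm => by
        have := mul_mem c.2 (hp m hm)
        rw [mul_add] at this
        exact this }
  edge_homog A β p hp l := by
    intro m hm
    refine M.edge_induction (p := fun m => (comp (M.dual_internal A) l p.1).1 m.1 +
      (comp (M.dual_internal (up P β A)) l p.2).1 m.2 ∈ Sβ k b β) ?_ ?_ ?_ m hm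
    · simp
    · intro x y hx hy
      have := add_mem hx hy
      rw [add_add_add_comm, ← map_add, ← map_add] at this
      exact this
    · intro n x hx h1 h2
      rw [comp_dual _ _ _ _ _ h1, comp_dual _ _ _ _ _ h2, ← map_add]
      exact Sβ_homog k b β (hp x hx) _

end Dual

section Tilt

/-- `w.A` for `w` in the finite Weyl group. -/
def weylMove (w : P.weylGroup) (A : Alcove P) : Alcove P := move P (weylAff P w) (weylAff_mem P w) A

open Classical in
/-- The alcove `w.A` if `w(β)` is positive, and `w.(β ↑ A)` if `w(β)` is negative. -/
def tiltBase (b : P.Base) (w : P.weylGroup) (A : Alcove P) (β : PosRoot b) : Alcove P :=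
  if b.IsPos (weylIdx P w β) then weylMove w A else weylMove w (up P β A)

lemma tilt_zero (w : P.weylGroup) (A : Alcove P) (β : PosRoot b) :
    M.emb (weylMove w A) (weylMove w (up P β A)) 0 ∈
      M.hat (tiltBase b w A β) (posOf b (weylIdx P w β)) := by
  rw [map_zero]
  exact zero_mem _

lemma tilt_add (w : P.weylGroup) (A : Alcove P) (β : PosRoot b)
    {p q : M.carrier (weylMove w A) × M.carrier (weylMove w (up P β A))}
    (hp : M.emb _ _ p ∈ M.hat (tiltBase b w A β) (posOf b (weylIdx P w β)))
    (hq : M.emb _ _ q ∈ M.hat (tiltBase b w A β) (posOf b (weylIdx P w β))) :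
    M.emb _ _ (p + q) ∈ M.hat (tiltBase b w A β) (posOf b (weylIdx P w β)) := by
  rw [map_add]
  exact add_mem hp hq

lemma tilt_smul (w : P.weylGroup) (A : Alcove P) (β : PosRoot b) {c : S0 k b}
    (hc : c ∈ Sβ k b β)
    {p : M.carrier (weylMove w A) × M.carrier (weylMove w (up P β A))}
    (hp : M.emb _ _ p ∈ M.hat (tiltBase b w A β) (posOf b (weylIdx P w β))) :
    M.emb _ _ (weyl0 k b w c • p) ∈ M.hat (tiltBase b w A β) (posOf b (weylIdx P w β)) := by
  rw [map_smul]
  exact Submodule.smul_mem _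
    (⟨weyl0 k b w c, weyl0_Sβ k b w β hc⟩ : Sβ k b (posOf b (weylIdx P w β))) hp

/-- The tilting functor `𝒞_w` on objects: `𝒞_w M(A)` is `M(w.A)` on which `c ∈ S_k^∅` acts as
`w(c)`, and `𝒞_w M(A, β)` is `M(w.A, w(β)^+)` if `w(β)` is positive and
`M(w.(β ↑ A), w(β)^+)` if `w(β)` is negative, twisted in the same way. -/
def tilt (w : P.weylGroup) : Obj k b where
  carrier A := M.carrier (weylMove w A)
  mod A := Module.compHom (M.carrier (weylMove w A)) (weyl0 k b w)
  deg A := M.deg (weylMove w A)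
  internal A := M.internal (weylMove w A)
  smul_mem_deg A m n c x hc hx := M.smul_mem_deg _ m n _ x (weyl0_deg k b w hc) hx
  edge A β :=
    letI : ∀ A, Module (S0 k b) (M.carrier (weylMove w A)) := fun A =>
      Module.compHom (M.carrier (weylMove w A)) (weyl0 k b w)
    { carrier := {p | M.emb (weylMove w A) (weylMove w (up P β A)) p ∈
        M.hat (tiltBase b w A β) (posOf b (weylIdx P w β))}
      zero_mem' := M.tilt_zero w A β
      add_mem' := fun {p q} hp hq => M.tilt_add w A β hp hq
      smul_mem' := fun c p hp => M.tilt_smul w A β c.2 hp }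
  edge_homog A β p hp n := by
    have := M.hat_homog hp n
    rw [compPi_emb] at this
    exact this

end Tilt

/-- The support of an object. -/
def supp : Set (Alcove P) := {A | Nontrivial (M.carrier A)}

/-- The zero objects. -/
def IsZeroObj : Prop := ∀ A, Subsingleton (M.carrier A)

/-- `M` is indecomposable. -/
def Indecomposable : Prop :=
  ¬ M.IsZeroObj ∧ ∀ K L : Obj k b, Nonempty (M ≅ K.sum L) → K.IsZeroObj ∨ L.IsZeroObj

/-- `M` is (isomorphic to) a direct summand of `M'`. -/
def IsSummand : Prop := ∃ K : Obj k b, Nonempty (M' ≅ M.sum K)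

end Obj

end Category

end AJS

end

/-!
# Tilting self-duality of summands of Bott-Samelson objects

Write `A_w` for the top alcove and `M` for the Bott-Samelson object of the reduced word of `w`.

*Existence and uniqueness.* Since the word is reduced, `M(A_w)` has rank `1` (`rankOne_unit`). An
endomorphism of `M` preserves the finitely generated lattices `M(A, β)`, so it is integral over
every `S_k^β`. Its minimal polynomial then has coefficients in the intersection of these rings,
which is `S_k`, and the parts of degree `0` of the coefficients give an equation over `k`
(`FinObj.algEnd`). This suffices for Fitting's lemma (`Indecomposable.fitting`). If `X` and `Y` are
indecomposable summands that do not vanish at `A_w`, the composition `X ⟶ M ⟶ Y ⟶ M ⟶ X` is the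
identity at `A_w`, so it is not nilpotent, so it is an isomorphism (`iso_of_rankOne`). A summand of
this kind exists by induction on the total rank (`TorsionFreeObj.exists_indecomposable`).

*A self-dual summand of `M`.* The star object `Obj.star` is `S_k^∅` at the alcoves `v.A_e` with `v`
in the finite Weyl group, and its submodules are given by congruences modulo `β`. It is a direct
summand of the Bott-Samelson object of a reduced word of `w₀` (`star_retract`). The inclusion is the
section that is generated by the generator of `P_0`. The projection starts with the multiplication
of `P_0` by the product of the positive roots and passes through each translation functor as a
divided difference. The composition of the two has degree `0` and is a constant by the congruences,
and it is a unit at `A_{w₀}`. Hence `M' = 𝒯_{s_j} ∘ ⋯ ∘ 𝒯_{s_{l+1}} (star)` is a direct summand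
of `M`. An isomorphism with the twisted dual amounts to a `SelfPairing`: perfect `w₀`-semilinear
pairings of `M'(A)` with `M'(w₀.A)` for which `M'(A, β)` and `M'(w₀.(β ↑ A), -w₀(β))` are dual
to each other. The star object has such pairings, `(x, y) ↦ ± w₀(x) y / ∏ α`, with shift twice the
number of positive roots. The sum of the pairings on the two summands of `𝒯_s M'(A)`, divided by the
root of the wall, is again of this kind, with the shift raised by `2` (`SelfPairing.trans`). Thus
`M' ≅ 𝒞 𝒟 M'` up to the shift by `2 l(w)` (`nonempty_iso_twist_star`).

*Passing to the indecomposable summand.* By uniqueness one may take `N` to be a summand of `M'`. The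
modules of `M'` at all `v.A_w` have rank `1`, so the idempotent of `N` is `0` or `1` at each of
these alcoves. As `A_w` lies in the anti-fundamental box, the alcoves `v.A_w` and `v s_α.A_w`, with
`α` simple and `v(α) > 0`, are `A` and `v(α) ↑ A`. Between them `M'` has a submodule that is not a
direct sum, which the idempotent must respect. So `N` is nonzero at all `v.A_w`
(`weylMove_mem_supp`), in particular at `w₀.A_w`. Then the map `N ⟶ M' ≅ 𝒞 𝒟 M' ⟶ 𝒞 𝒟 N`, followed
by the analogous map back to `N`, is the identity at `A_w`. By Fitting's lemma the first map is a
split monomorphism, and a comparison of ranks along the orbits of `w₀` shows that it is an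
isomorphism (`nonempty_iso_twist_of_retract`).

The condition on the characteristic enters through `gkm_of_char`: the positive roots are nonzero and
pairwise non-proportional in `X ⊗ k`, so they are pairwise non-associated primes of `S_k`.

An alcove is handled through the integers `fl i A` with `fl i A < ⟨α_i, v⟩ < fl i A + 1` on `A`, and
elements of `M(A)` as values of families in the product of all `M(C)`, so that an equation between
alcoves never requires a transport of module elements.
-/

noncomputable section

namespace AJS

universe u v

/-! ### Roots, heights and the highest root -/

section Roots

variable {ι V N : Type*} [AddCommGroup V] [Module ℚ V] [AddCommGroup N] [Module ℚ N]
variable (P : RootPairing ι ℚ V N)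

/-- The index of the root `-α`. -/
abbrev negIdx (i : ι) : ι := P.reflectionPerm i i

lemma root'_injective {i j : ι} (h : ∀ v, P.root' i v = P.root' j v) : i = j := by
  apply P.root.injective
  apply (LinearMap.IsPerfPair.bijective_left P.toLinearMap).1
  exact LinearMap.ext h

lemma root'_negIdx (i : ι) (v : N) : P.root' (negIdx P i) v = -P.root' i v := by
  simp [RootPairing.root']

lemma root_negIdx (i : ι) : P.root (negIdx P i) = -P.root i := by simp

lemma coroot_negIdx (i : ι) : P.coroot (negIdx P i) = -P.coroot i := by simp

lemma negIdx_negIdx (i : ι) : negIdx P (negIdx P i) = i :=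
  P.root.injective (by rw [root_negIdx, root_negIdx, neg_neg])

lemma negIdx_ne (i : ι) : negIdx P i ≠ i := by
  intro h
  have h1 := root_negIdx P i
  rw [h, eq_neg_iff_add_eq_zero, ← two_smul ℚ, smul_eq_zero] at h1
  exact P.ne_zero i (h1.resolve_left two_ne_zero)

lemma root'_coroot (i j : ι) [P.IsCrystallographic] :
    P.root' i (P.coroot j) = (P.pairingIn ℤ i j : ℚ) := by
  have h1 : ((P.pairingIn ℤ i j : ℤ) : ℚ) = P.pairing i j := by
    simpa using P.algebraMap_pairingIn ℤ i j
  rw [h1]; rfl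

lemma affRefl_negIdx (i : ι) (n : ℤ) : affRefl P (negIdx P i) (-n) = affRefl P i n := by
  ext v
  rw [affRefl_apply, affRefl_apply, root'_negIdx, coroot_negIdx]
  push_cast
  module

variable {P} (b : P.Base) [P.IsCrystallographic]

lemma isPos_negIdx (i : ι) : b.IsPos (negIdx P i) ↔ ¬ b.IsPos i :=
  RootPairing.Base.IsPos.neg_iff_not b i

lemma height_negIdx (i : ι) : b.height (negIdx P i) = - b.height i :=
  b.height_reflectionPerm_self i

variable [Finite ι]

/-- A positive root is a sum of simple roots. -/
lemma root_mem_closure {i : ι} (hi : b.IsPos i) :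
    P.root i ∈ AddSubmonoid.closure (P.root '' b.support) := by
  refine RootPairing.Base.IsPos.induction_on_add hi
    (p := fun i => P.root i ∈ AddSubmonoid.closure (P.root '' b.support))
    (fun j hj => AddSubmonoid.subset_closure ⟨j, hj, rfl⟩) ?_
  intro j l m hm hj hl
  rw [hm]
  exact add_mem hj (AddSubmonoid.subset_closure ⟨l, hl, rfl⟩)

variable [P.IsRootSystem]

/-- A coweight that pairs with each root to its height. -/
lemma exists_heightVec : ∃ v : N, ∀ i, P.root' i v = b.height i := by
  let f : V →ₗ[ℚ] ℚ := b.toWeightBasis.constr ℚ (fun _ => (1 : ℚ))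
  have hf : ∀ i ∈ b.support, f (P.root i) = 1 := by
    intro i hi
    have := b.toWeightBasis.constr_basis ℚ (fun _ => (1 : ℚ)) ⟨i, hi⟩
    simpa [f] using this
  obtain ⟨v, hv⟩ := (LinearMap.IsPerfPair.bijective_right P.toLinearMap).2 f
  refine ⟨v, fun i => ?_⟩
  obtain ⟨c, -, -, hc⟩ := b.exists_root_eq_sum_int i
  have h1 : P.root' i v = f (P.root i) := by rw [← hv]; rfl
  rw [h1, RootPairing.Base.height_eq_sum hc, hc, map_sum]
  push_cast
  refine Finset.sum_congr rfl fun j hj => ?_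
  rw [map_zsmul, hf j hj]
  simp

lemma nonneg_of_mem_closure {v : N} (hv : ∀ i ∈ b.support, 0 ≤ P.root' i v) {x : V}
    (hx : x ∈ AddSubmonoid.closure (P.root '' b.support)) : 0 ≤ P.toLinearMap x v := by
  induction hx using AddSubmonoid.closure_induction with
  | mem x hx =>
    obtain ⟨i, hi, rfl⟩ := hx
    exact hv i hi
  | zero => simp
  | add x y _ _ hx hy => rw [map_add, LinearMap.add_apply]; exact add_nonneg hx hy

lemma eq_zero_of_mem_closure {v : N} (hv : ∀ i ∈ b.support, 0 < P.root' i v) {x : V}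
    (hx : x ∈ AddSubmonoid.closure (P.root '' b.support)) (h0 : P.toLinearMap x v = 0) :
    x = 0 := by
  have key : P.toLinearMap x v = 0 → x = 0 := by
    clear h0
    induction hx using AddSubmonoid.closure_induction with
    | mem x hx =>
      obtain ⟨i, hi, rfl⟩ := hx
      intro h
      exact absurd h (hv i hi).ne'
    | zero => simp
    | add x y hx' hy' hx hy =>
      intro h
      rw [map_add, LinearMap.add_apply] at h
      have h1 := nonneg_of_mem_closure b (fun i hi => (hv i hi).le) hx'
      have h2 := nonneg_of_mem_closure b (fun i hi => (hv i hi).le) hy'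
      rw [hx (by linarith), hy (by linarith), add_zero]
  exact key h0

lemma height_le_of_sub_mem {i j : ι}
    (h : P.root i - P.root j ∈ AddSubmonoid.closure (P.root '' b.support)) :
    b.height j ≤ b.height i ∧ (b.height j = b.height i → i = j) := by
  obtain ⟨v, hv⟩ := exists_heightVec b
  have hpos : ∀ i ∈ b.support, 0 < P.root' i v := by
    intro i hi
    rw [hv, RootPairing.Base.height_one_of_mem_support hi]
    norm_num
  have e : P.toLinearMap (P.root i - P.root j) v = b.height i - b.height j := by
    rw [map_sub, LinearMap.sub_apply, ← hv, ← hv]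
  constructor
  · have := nonneg_of_mem_closure b (fun i hi => (hpos i hi).le) h
    rw [e] at this
    have : (b.height j : ℚ) ≤ b.height i := by linarith
    exact_mod_cast this
  · intro h1
    have := eq_zero_of_mem_closure b hpos h (by rw [e, h1, sub_self])
    exact P.root.injective (sub_eq_zero.mp this)

variable {b} in
lemma IsHighestRoot.isPos {θ : ι} (hθ : IsHighestRoot b θ) [Nonempty ι] : b.IsPos θ := by
  obtain ⟨i, hi⟩ := b.support_nonempty
  have h := hθ ⟨i, RootPairing.Base.isPos_of_mem_support hi⟩
  have h1 := (height_le_of_sub_mem b h).1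
  rw [RootPairing.Base.height_one_of_mem_support hi] at h1
  exact h1

variable {b} in
/-- The highest root is long: it pairs with every other positive root to `0` or `1`. -/
lemma IsHighestRoot.pairingIn {θ : ι} (hθ : IsHighestRoot b θ) {i : ι} (hi : b.IsPos i)
    (hne : i ≠ θ) : P.pairingIn ℤ i θ = 0 ∨ P.pairingIn ℤ i θ = 1 := by
  have : Nonempty ι := ⟨i⟩
  have hθp : 0 < b.height θ := hθ.isPos
  have hip : 0 < b.height i := hi
  have h1 := height_le_of_sub_mem b (hθ ⟨i, hi⟩)
  have e : P.root (P.reflectionPerm θ i) = P.root i + (-P.pairingIn ℤ i θ) • P.root θ := by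
    rw [RootPairing.root_reflectionPerm, P.reflection_apply_root' ℤ, neg_smul, sub_eq_add_neg]
  have e2 := b.height_add_zsmul e
  have h1' : b.height i ≠ b.height θ := fun h => hne (h1.2 h).symm
  have h1'' : b.height i ≤ b.height θ := h1.1
  by_contra hcon
  push Not at hcon
  rcases lt_or_ge (P.pairingIn ℤ i θ) 0 with hk | hk
  · have hp : b.IsPos (P.reflectionPerm θ i) := by
      change 0 < _
      rw [e2, smul_eq_mul]
      nlinarith
    have h2 := (height_le_of_sub_mem b (hθ ⟨_, hp⟩)).1
    simp only [e2, smul_eq_mul] at h2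
    nlinarith
  · have hk2 : 2 ≤ P.pairingIn ℤ i θ := by omega
    have hp : b.IsPos (negIdx P (P.reflectionPerm θ i)) := by
      change 0 < _
      rw [height_negIdx, e2, smul_eq_mul]
      nlinarith
    have h2 := (height_le_of_sub_mem b (hθ ⟨_, hp⟩)).1
    simp only [height_negIdx, e2, smul_eq_mul] at h2
    nlinarith [lt_of_le_of_ne h1'' h1']

lemma pairingIn_sum {c : ι → ℤ} {i : ι} (hc : P.root i = ∑ j ∈ b.support, c j • P.root j) (l : ι) :
    P.pairingIn ℤ i l = ∑ j ∈ b.support, c j * P.pairingIn ℤ j l := by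
  have h1 : P.root' i (P.coroot l) = ∑ j ∈ b.support, (c j : ℚ) * P.root' j (P.coroot l) := by
    simp only [RootPairing.root', hc, map_sum, map_zsmul, LinearMap.sum_apply, LinearMap.smul_apply,
      zsmul_eq_mul]
  simp only [root'_coroot] at h1
  exact_mod_cast h1

variable [P.IsReduced] [P.IsIrreducible]

/-- The highest root exists: a root `θ` of maximal height is dominant, by irreducibility all its
coefficients are positive, and for every dominant root `γ` the difference `θ - γ` is a nonnegative
combination of simple roots. -/
lemma exists_isHighestRoot : ∃ θ, IsHighestRoot b θ := by
  have : Nontrivial V := RootPairing.IsIrreducible.nontrivial (P := P)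
  have : Nonempty ι := by
    by_contra h
    rw [not_nonempty_iff] at h
    have h1 := P.toLinearMap.flip
    have : (⊤ : Submodule ℚ V) = ⊥ := by
      have := RootPairing.IsRootSystem.span_root_eq_top (P := P)
      rw [← this, Set.range_eq_empty, Submodule.span_empty]
    exact top_ne_bot this
  obtain ⟨θ, hθ⟩ := Finite.exists_max b.height
  have hθpos : b.IsPos θ := by
    obtain ⟨i, hi⟩ := b.support_nonempty
    have := hθ i
    rw [RootPairing.Base.height_one_of_mem_support hi] at this
    exact this
  -- a root of maximal height is dominant, and all its coefficients are positive
  have hdom : ∀ j ∈ b.support, 0 ≤ P.pairingIn ℤ θ j := by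
    intro j hj
    by_contra! hneg
    have hjp := RootPairing.Base.isPos_of_mem_support (b := b) hj
    obtain ⟨l, hl⟩ := P.root_add_root_mem_of_pairingIn_neg hneg (by
      intro h
      rw [← root_negIdx] at h
      rw [P.root.injective h, isPos_negIdx] at hθpos
      exact hθpos hjp)
    have h1 := b.height_add hl
    have h2 := hθ l
    rw [RootPairing.Base.height_one_of_mem_support hj] at h1
    omega
  obtain ⟨c, hc0, hc1, hc⟩ := b.exists_root_eq_sum_int θ
  have hcpos : 0 < c := by
    refine hc1.resolve_right fun h => ?_
    have := hθpos
    rw [RootPairing.Base.isPos_iff, RootPairing.Base.height_eq_sum hc] at this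
    exact absurd (Finset.sum_nonpos fun i _ => h.le i) (not_le.mpr this)
  -- if the coefficient of `j` vanished, but not that of a neighbour `i` of `j` in the Dynkin
  -- diagram, then `⟨θ, j^∨⟩` would be negative
  have hfull : ∀ j : b.support, c j ≠ 0 := by
    obtain ⟨i, hi⟩ : ∃ i : b.support, c i ≠ 0 := by
      by_contra! h
      refine hcpos.ne' (funext fun i => ?_)
      by_contra hi
      exact hi (h ⟨i, hc0 hi⟩)
    intro j
    refine b.induction_on_cartanMatrix (fun j => c j ≠ 0) (i := i) (j := j) hi fun i j hi hij hj => ?_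
    have h1 := hdom j j.2
    rw [pairingIn_sum b hc] at h1
    have hij' : i ≠ j := fun h => hi (by rw [h]; exact hj)
    have h2 : P.pairingIn ℤ i j < 0 := by
      refine lt_of_le_of_ne (b.pairingIn_le_zero_of_ne (fun h => hij' (Subtype.ext h)) i.2 j.2) ?_
      intro h
      exact hij ((RootPairing.Base.cartanMatrix_apply_eq_zero_iff_symm b).mp h)
    refine absurd h1 (not_le.mpr (Finset.sum_neg' (fun l hl => ?_) ⟨i, i.2, ?_⟩))
    · by_cases hlj : l = j
      · rw [hlj, hj, zero_mul]
      · exact mul_nonpos_of_nonneg_of_nonpos (hcpos.le l)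
          (b.pairingIn_le_zero_of_ne hlj hl j.2)
    · exact mul_neg_of_pos_of_neg (lt_of_le_of_ne (hcpos.le i) (Ne.symm hi)) h2
  refine ⟨θ, fun β => ?_⟩
  -- a root `γ ≥ β` of maximal height is dominant, and `⟨θ, γ^∨⟩ > 0`, so `θ - γ` is a root or `0`
  let T := {γ : ι // P.root γ - P.root β ∈ AddSubmonoid.closure (P.root '' b.support)}
  have : Nonempty T := ⟨⟨β, by rw [sub_self]; exact zero_mem _⟩⟩
  obtain ⟨⟨γ, hγ⟩, hmax⟩ := Finite.exists_max fun γ : T => b.height γ.1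
  have hγpos : b.IsPos γ := lt_of_lt_of_le β.2 (height_le_of_sub_mem b hγ).1
  have hdom2 : ∀ j ∈ b.support, 0 ≤ P.pairingIn ℤ j γ := by
    intro j hj
    by_contra! hneg
    have hjp := RootPairing.Base.isPos_of_mem_support (b := b) hj
    obtain ⟨l, hl⟩ := P.root_add_root_mem_of_pairingIn_neg hneg (by
      intro h
      rw [← root_negIdx] at h
      rw [P.root.injective h, isPos_negIdx] at hjp
      exact hjp hγpos)
    have h1 := b.height_add hl
    have h3 : P.root l - P.root β ∈ AddSubmonoid.closure (P.root '' b.support) := by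
      rw [hl, add_sub_assoc]
      exact add_mem (AddSubmonoid.subset_closure ⟨j, hj, rfl⟩) hγ
    have h2 := hmax ⟨l, h3⟩
    rw [RootPairing.Base.height_one_of_mem_support hj] at h1
    simp only at h2
    omega
  have hp : 0 < P.pairingIn ℤ θ γ := by
    rw [pairingIn_sum b hc]
    obtain ⟨j, hj, hjp⟩ := hγpos.exists_mem_support_pos_pairingIn
    refine Finset.sum_pos' (fun l hl => mul_nonneg (hcpos.le l) (hdom2 l hl)) ⟨j, hj, ?_⟩
    exact mul_pos (lt_of_le_of_ne (hcpos.le j) (Ne.symm (hfull ⟨j, hj⟩))) hjp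
  by_cases hθγ : θ = γ
  · rw [hθγ]; exact hγ
  obtain ⟨l, hl⟩ := P.root_sub_root_mem_of_pairingIn_pos hp hθγ
  have hlpos : b.IsPos l := by
    rw [RootPairing.Base.isPos_iff', b.height_sub hl]
    have := hθ γ
    omega
  have := add_mem (root_mem_closure b hlpos) hγ
  rw [hl, sub_add_sub_cancel] at this
  exact this

end Roots


/-! ### Alcoves as families of integers -/

section Floors

variable {ι V N : Type*} [AddCommGroup V] [Module ℚ V] [AddCommGroup N] [Module ℚ N]
variable {P : RootPairing ι ℚ V N}

lemma alcove_nonempty (A : Alcove P) : ∃ v, v ∈ A.1 := by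
  obtain ⟨v, -, h⟩ := A.2
  exact ⟨v, by rw [h]; exact fun _ _ => Iff.rfl⟩

lemma root'_ne_of_mem {A : Alcove P} {v : N} (hv : v ∈ A.1) (i : ι) (n : ℤ) : P.root' i v ≠ n := by
  obtain ⟨v0, hv0, h⟩ := A.2
  rw [h] at hv
  intro he
  have h1 := hv i n
  have h2 := hv (negIdx P i) (-n)
  rw [root'_negIdx, root'_negIdx, he] at h2
  rw [he] at h1
  push_cast at h2
  rcases lt_trichotomy (P.root' i v0) n with h3 | h3 | h3
  · exact lt_irrefl _ (h1.mpr h3)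
  · exact hv0 i n h3
  · exact lt_irrefl _ (h2.mpr (by linarith))

/-- The integer `n` with `n < ⟨α, v⟩ < n + 1` for all `v` in the alcove. -/
def fl (i : ι) (A : Alcove P) : ℤ := upIdx P i A.1 - 1

lemma fl_eq_floor {A : Alcove P} {v : N} (hv : v ∈ A.1) (i : ι) : fl i A = ⌊P.root' i v⌋ := by
  rw [fl, upIdx_eq P A.2 hv]; ring

lemma fl_lt {A : Alcove P} {v : N} (hv : v ∈ A.1) (i : ι) : (fl i A : ℚ) < P.root' i v := by
  rw [fl_eq_floor hv]
  exact lt_of_le_of_ne (Int.floor_le _) (root'_ne_of_mem hv i _).symm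

lemma lt_fl {A : Alcove P} {v : N} (hv : v ∈ A.1) (i : ι) : P.root' i v < fl i A + 1 := by
  rw [fl_eq_floor hv]
  exact Int.lt_floor_add_one _

lemma fl_eq_of_lt {A : Alcove P} {v : N} (hv : v ∈ A.1) {i : ι} {n : ℤ} (h1 : (n : ℚ) < P.root' i v)
    (h2 : P.root' i v < n + 1) : fl i A = n := by
  rw [fl_eq_floor hv, Int.floor_eq_iff]
  exact ⟨h1.le, h2⟩

lemma fl_negIdx (i : ι) (A : Alcove P) : fl (negIdx P i) A = -fl i A - 1 := by
  obtain ⟨v, hv⟩ := alcove_nonempty A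
  have h1 := fl_lt hv i
  have h2 := lt_fl hv i
  refine fl_eq_of_lt hv ?_ ?_ <;> rw [root'_negIdx] <;> push_cast <;> linarith

lemma mem_alcove_iff {A : Alcove P} {u : N} :
    u ∈ A.1 ↔ ∀ i, (fl i A : ℚ) < P.root' i u ∧ P.root' i u < fl i A + 1 := by
  refine ⟨fun hu i => ⟨fl_lt hu i, lt_fl hu i⟩, fun h => ?_⟩
  obtain ⟨v, hv⟩ := alcove_nonempty A
  obtain ⟨v0, hv0, he⟩ := A.2
  have hv' := hv
  rw [he] at hv' ⊢
  intro i n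
  rw [← hv' i n]
  have key : ∀ w, (fl i A : ℚ) < P.root' i w ∧ P.root' i w < fl i A + 1 →
      (P.root' i w < n ↔ fl i A < n) := by
    rintro w ⟨h1, h2⟩
    constructor
    · intro h3
      have : (fl i A : ℚ) < n := h1.trans h3
      exact_mod_cast this
    · intro h3
      have : (fl i A : ℚ) + 1 ≤ n := by exact_mod_cast h3
      exact h2.trans_le this
  rw [key u (h i), key v ⟨fl_lt hv i, lt_fl hv i⟩]

lemma alcove_ext {A B : Alcove P} (h : ∀ i, fl i A = fl i B) : A = B := by
  apply Subtype.ext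
  ext u
  rw [mem_alcove_iff, mem_alcove_iff]
  simp only [h]

lemma fl_move {g : N ≃ᵃ[ℚ] N} (hg : g ∈ hypGroup P) {i j : ι} {n : ℤ}
    (h : ∀ v, P.root' j (g v) = P.root' i v + n) (A : Alcove P) :
    fl j (move P g hg A) = fl i A + n := by
  obtain ⟨v, hv⟩ := alcove_nonempty A
  have h1 := fl_lt hv i
  have h2 := lt_fl hv i
  refine fl_eq_of_lt (A := move P g hg A) (v := g v) ⟨v, hv, rfl⟩ ?_ ?_ <;> rw [h] <;> push_cast <;> linarith

lemma move_mul {g h : N ≃ᵃ[ℚ] N} (hg : g ∈ hypGroup P) (hh : h ∈ hypGroup P) (A : Alcove P) :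
    move P (g * h) (mul_mem hg hh) A = move P g hg (move P h hh A) := by
  apply Subtype.ext
  change (g * h) '' A.1 = g '' (h '' A.1)
  rw [Set.image_image]
  rfl

lemma move_one (A : Alcove P) : move P 1 (one_mem _) A = A := by
  apply Subtype.ext
  change (1 : N ≃ᵃ[ℚ] N) '' A.1 = A.1
  simp

variable [Finite ι]

/-- Twice the number of hyperplanes that separate two alcoves. -/
def dist (A B : Alcove P) : ℤ :=
  letI := Fintype.ofFinite ι
  ∑ i, |fl i A - fl i B|

lemma dist_self (A : Alcove P) : dist A A = 0 := by simp [dist]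

lemma dist_nonneg (A B : Alcove P) : 0 ≤ dist A B := by
  unfold dist
  exact Finset.sum_nonneg fun _ _ => abs_nonneg _

lemma dist_comm (A B : Alcove P) : dist A B = dist B A := by
  simp only [dist, abs_sub_comm]

/-- Crossing a single hyperplane changes the distance to a third alcove by `2`, since each
hyperplane is counted for both of its roots. -/
lemma dist_of_adjacent (A : Alcove P) {B B' : Alcove P} {j : ι} {n : ℤ} (h1 : fl j B = n)
    (h2 : fl j B' = n - 1) (h3 : ∀ i, i ≠ j → i ≠ negIdx P j → fl i B' = fl i B) :
    dist A B' = dist A B + if n ≤ fl j A then 2 else -2 := by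
  classical
  let := Fintype.ofFinite ι
  have hne : j ≠ negIdx P j := (negIdx_ne P j).symm
  have e : ∀ C : Alcove P, dist A C = |fl j A - fl j C| + (|fl (negIdx P j) A - fl (negIdx P j) C| +
      ∑ i ∈ (Finset.univ.erase j).erase (negIdx P j), |fl i A - fl i C|) := by
    intro C
    unfold dist
    rw [Finset.add_sum_erase _ (fun i => |fl i A - fl i C|)
      (Finset.mem_erase.mpr ⟨negIdx_ne P j, Finset.mem_univ _⟩),
      Finset.add_sum_erase _ (fun i => |fl i A - fl i C|) (Finset.mem_univ _)]
  have e2 : ∑ i ∈ (Finset.univ.erase j).erase (negIdx P j), |fl i A - fl i B'| =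
      ∑ i ∈ (Finset.univ.erase j).erase (negIdx P j), |fl i A - fl i B| := by
    refine Finset.sum_congr rfl fun i hi => ?_
    simp only [Finset.mem_erase, Finset.mem_univ, and_true] at hi
    rw [h3 i hi.2 hi.1]
  rw [e B', e B, e2, fl_negIdx, fl_negIdx, fl_negIdx, h1, h2]
  have a1 : |-fl j A - 1 - (-(n - 1) - 1)| = |fl j A - (n - 1)| := by
    rw [← abs_neg]; congr 1; ring
  have a2 : |-fl j A - 1 - (-n - 1)| = |fl j A - n| := by
    rw [← abs_neg]; congr 1; ring
  rw [a1, a2]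
  split_ifs with h
  · rw [abs_of_nonneg (by omega), abs_of_nonneg (by omega)]; ring
  · rw [abs_of_nonpos (by omega), abs_of_neg (by omega)]; ring

end Floors

/-! ### Affine maps that permute the hyperplanes -/

section Action

variable {ι V N : Type*} [AddCommGroup V] [Module ℚ V] [AddCommGroup N] [Module ℚ N]
variable {P : RootPairing ι ℚ V N} [P.IsCrystallographic]

/-- `g` carries the hyperplanes `H_{i, m}` to the hyperplanes `H_{π i, m + n i}`, and its linear
part carries the coroot of `i` to that of `π i`. -/
def ActsBy (g : N ≃ᵃ[ℚ] N) (π : ι ≃ ι) (n : ι → ℤ) : Prop :=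
  (∀ i v, P.root' (π i) (g v) = P.root' i v + n i) ∧
    ∀ i v (c : ℚ), g (v + c • P.coroot i) = g v + c • P.coroot (π i)

lemma ActsBy.mul {g h : N ≃ᵃ[ℚ] N} {π ρ : ι ≃ ι} {m n : ι → ℤ} (hg : ActsBy (P := P) g π m)
    (hh : ActsBy (P := P) h ρ n) :
    ActsBy (P := P) (g * h) (ρ.trans π) (fun i => n i + m (ρ i)) := by
  refine ⟨fun i v => ?_, fun i v c => ?_⟩
  · change P.root' (π (ρ i)) (g (h v)) = _
    rw [hg.1, hh.1]; push_cast; ring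
  · change g (h (v + c • P.coroot i)) = g (h v) + c • P.coroot (π (ρ i))
    rw [hh.2, hg.2]

lemma ActsBy.inv {g : N ≃ᵃ[ℚ] N} {π : ι ≃ ι} {m : ι → ℤ} (hg : ActsBy (P := P) g π m) :
    ActsBy (P := P) g⁻¹ π.symm (fun i => -m (π.symm i)) := by
  have hinv : ∀ u, g (g⁻¹ u) = u := fun u => by rw [AffineEquiv.inv_def]; simp
  refine ⟨fun i v => ?_, fun i v c => ?_⟩
  · have := hg.1 (π.symm i) (g⁻¹ v)
    rw [hinv, π.apply_symm_apply] at this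
    push_cast
    linarith
  · apply g.injective
    rw [hinv, hg.2, hinv, π.apply_symm_apply]

lemma ActsBy.conj {g : N ≃ᵃ[ℚ] N} {π : ι ≃ ι} {n : ι → ℤ} (hg : ActsBy (P := P) g π n) (i : ι)
    (m : ℤ) : g * affRefl P i m * g⁻¹ = affRefl P (π i) (m + n i) := by
  rw [mul_inv_eq_iff_eq_mul]
  ext v
  change g (affRefl P i m v) = affRefl P (π i) (m + n i) (g v)
  rw [affRefl_apply, affRefl_apply, hg.1, sub_eq_add_neg, ← neg_smul, hg.2]
  push_cast
  module

lemma actsBy_affRefl (i : ι) (m : ℤ) : ActsBy (P := P) (affRefl P i m) (P.reflectionPerm i)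
    (fun j => -(m * P.pairingIn ℤ j i)) := by
  refine ⟨fun j v => ?_, fun j v c => ?_⟩
  · rw [root_affRefl, RootPairing.reflectionPerm_self, ← RootPairing.pairingIn_reflectionPerm]
    congr 2
    rw [RootPairing.pairingIn_reflectionPerm_self_right]; ring
  · rw [affRefl_apply, affRefl_apply, map_add, map_smul, RootPairing.coroot_reflectionPerm,
      RootPairing.coreflection_apply_coroot]
    have h1 : P.pairing i j = P.root' i (P.coroot j) := rfl
    rw [h1, smul_eq_mul]
    module

lemma actsBy_weylAff (w : P.weylGroup) :
    ActsBy (P := P) (weylAff P w) ((w : P.Aut).indexEquiv) (fun _ => 0) := by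
  have hcancel : ∀ v, (w : P.Aut).coweightMap (((w : P.Aut)⁻¹).coweightMap v) = v := by
    intro v
    change (((w : P.Aut)⁻¹) * (w : P.Aut)).coweightMap v = v
    rw [inv_mul_cancel]; rfl
  have hcancel' : ∀ v, ((w : P.Aut)⁻¹).coweightMap ((w : P.Aut).coweightMap v) = v := by
    intro v
    change ((w : P.Aut) * ((w : P.Aut)⁻¹)).coweightMap v = v
    rw [mul_inv_cancel]; rfl
  refine ⟨fun i v => ?_, fun i v c => ?_⟩
  · have h := weyl_transpose P (w : P.Aut) (P.root i) (weylAff P w v)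
    rw [weylAff_apply, hcancel] at h
    rw [weylAff_apply]
    change P.toLinearMap (P.root ((w : P.Aut).indexEquiv i)) _ = _
    rw [← RootPairing.Hom.root_weightMap_apply, ← h]
    simp
  · rw [weylAff_apply, weylAff_apply, map_add, map_smul]
    congr 2
    have := RootPairing.Hom.coroot_coweightMap_apply P P ((w : P.Aut).indexEquiv i) (w : P.Aut).toHom
    rw [← hcancel' (P.coroot ((w : P.Aut).indexEquiv i))]
    erw [this]
    simp

lemma fl_move_of_actsBy {g : N ≃ᵃ[ℚ] N} (hg : g ∈ hypGroup P) {π : ι ≃ ι} {n : ι → ℤ}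
    (h : ActsBy (P := P) g π n) (i : ι) (A : Alcove P) :
    fl (π i) (move P g hg A) = fl i A + n i := fl_move hg (h.1 i) A

lemma dist_move [Finite ι] {g : N ≃ᵃ[ℚ] N} (hg : g ∈ hypGroup P) {π : ι ≃ ι} {n : ι → ℤ}
    (h : ActsBy (P := P) g π n) (A B : Alcove P) :
    dist (move P g hg A) (move P g hg B) = dist A B := by
  let := Fintype.ofFinite ι
  unfold dist
  rw [← Equiv.sum_comp π]
  refine Finset.sum_congr rfl fun i _ => ?_
  rw [fl_move_of_actsBy hg h, fl_move_of_actsBy hg h]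
  congr 1; ring

lemma ActsBy.negIdx {g : N ≃ᵃ[ℚ] N} {π : ι ≃ ι} {n : ι → ℤ}
    (h : ActsBy (P := P) g π n) (i : ι) : π (negIdx P i) = negIdx P (π i) := by
  have hinv : ∀ u, g (g⁻¹ u) = u := fun u => by rw [AffineEquiv.inv_def]; simp
  have key : ∀ v, P.root' (π (AJS.negIdx P i)) v + P.root' (π i) v =
      ((n i + n (AJS.negIdx P i) : ℤ) : ℚ) := by
    intro v
    have h1 := h.1 i (g⁻¹ v)
    have h2 := h.1 (AJS.negIdx P i) (g⁻¹ v)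
    rw [hinv] at h1 h2
    rw [root'_negIdx] at h2
    push_cast
    linarith
  refine root'_injective P fun v => ?_
  have h1 := key v
  have h2 := key 0
  rw [map_zero, map_zero] at h2
  rw [root'_negIdx]
  linarith

variable (b : P.Base)

lemma exists_actsBy {g : N ≃ᵃ[ℚ] N} (hg : g ∈ affineWeyl b) : ∃ π n, ActsBy (P := P) g π n := by
  induction hg using Subgroup.closure_induction with
  | mem g hg =>
    rcases hg with ⟨i, -, rfl⟩ | ⟨i, -, rfl⟩ <;> exact ⟨_, _, actsBy_affRefl _ _⟩
  | one => exact ⟨Equiv.refl _, fun _ => 0, fun i v => by simp, fun i v c => rfl⟩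
  | mul g h _ _ hg hh =>
    obtain ⟨_, _, hg⟩ := hg
    obtain ⟨_, _, hh⟩ := hh
    exact ⟨_, _, hg.mul hh⟩
  | inv g _ hg =>
    obtain ⟨_, _, hg⟩ := hg
    exact ⟨_, _, hg.inv⟩

end Action


/-! ### The affine Weyl group and its length function -/

section AffineWeyl

variable {ι V N : Type*} [Finite ι] [AddCommGroup V] [Module ℚ V] [AddCommGroup N] [Module ℚ N]
variable {P : RootPairing ι ℚ V N} [P.IsRootSystem] [P.IsCrystallographic] (b : P.Base)

lemma fl_fund_of_pos {i : ι} (hi : b.IsPos i) : fl i (fundAlcove b) = 0 := by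
  obtain ⟨v, hv⟩ := alcove_nonempty (fundAlcove b)
  have := hv ⟨i, hi⟩
  exact fl_eq_of_lt hv (by simpa using this.1) (by simpa using this.2)

lemma fl_fund_of_not_pos {i : ι} (hi : ¬ b.IsPos i) : fl i (fundAlcove b) = -1 := by
  have h := fl_fund_of_pos b ((isPos_negIdx b i).mpr hi)
  rw [fl_negIdx] at h
  omega

/-- The action of the affine Weyl group on the alcoves. -/
def act (g : affineWeyl b) (A : Alcove P) : Alcove P := move P g (affineWeyl_le b g.2) A

lemma act_mul (g h : affineWeyl b) (A : Alcove P) : act b (g * h) A = act b g (act b h A) :=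
  move_mul _ _ A

lemma act_one (A : Alcove P) : act b 1 A = A := move_one A

lemma act_inv_act (g : affineWeyl b) (A : Alcove P) : act b g⁻¹ (act b g A) = A := by
  rw [← act_mul, inv_mul_cancel, act_one]

lemma alcoveOf_eq_act (g : affineWeyl b) : alcoveOf b g = act b g (fundAlcove b) := rfl

lemma alcoveOf_mul (g h : affineWeyl b) : alcoveOf b (g * h) = act b g (alcoveOf b h) :=
  act_mul b g h _

lemma alcoveOf_one : alcoveOf b 1 = fundAlcove b := act_one b _

lemma dist_act (g : affineWeyl b) (A B : Alcove P) : dist (act b g A) (act b g B) = dist A B := by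
  obtain ⟨π, n, h⟩ := exists_actsBy b g.2
  exact dist_move _ h A B

variable {b} in
/-- A simple affine reflection as an element of the affine Weyl group. -/
def sEl (s : simpleRefl b) : affineWeyl b := ⟨s.1, Subgroup.subset_closure s.2⟩

lemma simpleRefl_eq (s : simpleRefl b) : ∃ i n, s.1 = affRefl P i n := by
  obtain ⟨s, ⟨i, -, rfl⟩ | ⟨i, -, rfl⟩⟩ := s <;> exact ⟨i, _, rfl⟩

lemma sEl_mul_self (s : simpleRefl b) : sEl s * sEl s = 1 := by
  apply Subtype.ext
  obtain ⟨i, n, h⟩ := simpleRefl_eq b s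
  change s.1 * s.1 = 1
  rw [h, ← inv_eq_iff_mul_eq_one, affRefl_inv]

/-- The element of the affine Weyl group with the given expression. -/
def wordEl (u : List (simpleRefl b)) : affineWeyl b := (u.map sEl).prod

lemma coe_wordEl (u : List (simpleRefl b)) : (wordEl b u : N ≃ᵃ[ℚ] N) = wordProd b u := by
  induction u with
  | nil => rfl
  | cons s u ih =>
    change s.1 * (wordEl b u : N ≃ᵃ[ℚ] N) = s.1 * wordProd b u
    rw [ih]

lemma wordEl_append (u v : List (simpleRefl b)) : wordEl b (u ++ v) = wordEl b u * wordEl b v := by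
  simp [wordEl]

lemma wordEl_cons (s : simpleRefl b) (u : List (simpleRefl b)) :
    wordEl b (s :: u) = sEl s * wordEl b u := by simp [wordEl]

lemma wordEl_concat (u : List (simpleRefl b)) (s : simpleRefl b) :
    wordEl b (u ++ [s]) = wordEl b u * sEl s := by simp [wordEl]

lemma exists_word (g : affineWeyl b) : ∃ u, wordEl b u = g := by
  obtain ⟨g, hg⟩ := g
  induction hg using Subgroup.closure_induction with
  | mem g hg => exact ⟨[⟨g, hg⟩], by simp [wordEl, sEl]⟩
  | one => exact ⟨[], rfl⟩
  | mul g h hg' hh' hg hh =>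
    obtain ⟨u, hu⟩ := hg
    obtain ⟨v, hv⟩ := hh
    exact ⟨u ++ v, by rw [wordEl_append, hu, hv]; rfl⟩
  | inv g hg' hg =>
    obtain ⟨u, hu⟩ := hg
    refine ⟨u.reverse, ?_⟩
    have key : ∀ u : List (simpleRefl b), wordEl b u.reverse = (wordEl b u)⁻¹ := by
      intro u
      induction u with
      | nil => simp [wordEl]
      | cons s u ih =>
        rw [List.reverse_cons, wordEl_concat, ih, wordEl_cons, mul_inv_rev]
        congr 1
        rw [eq_comm, inv_eq_iff_mul_eq_one, sEl_mul_self]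
    rw [key, hu]
    rfl

lemma len_wordEl_le (u : List (simpleRefl b)) : len b (wordEl b u) ≤ u.length :=
  Nat.sInf_le ⟨u, (coe_wordEl b u).symm, rfl⟩

lemma exists_reduced (g : affineWeyl b) : ∃ u, wordEl b u = g ∧ u.length = len b g := by
  obtain ⟨u, hu⟩ := exists_word b g
  obtain ⟨v, hv, h⟩ := Nat.sInf_mem (s := {n | ∃ u : List (simpleRefl b), wordProd b u = g ∧
    u.length = n}) ⟨_, u, by rw [← coe_wordEl, hu], rfl⟩
  exact ⟨v, Subtype.ext (by rw [coe_wordEl, hv]), h⟩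

/-- The simple reflection `s` is the reflection in `H_{i,m}`, where `⟨α_i, ·⟩ > m` on the fundamental
alcove, and `H_{i,m}` is the only hyperplane that separates `A_e` from `A_s`. -/
structure IsWallOf (s : simpleRefl b) (i : ι) (m : ℤ) : Prop where
  eq : s.1 = affRefl P i m
  fl_fund : fl i (fundAlcove b) = m
  fl_other : ∀ j, j ≠ i → j ≠ negIdx P i → fl j (alcoveOf b (sEl s)) = fl j (fundAlcove b)

variable {b}

lemma IsWallOf.fl_self {s : simpleRefl b} {i : ι} {m : ℤ} (h : IsWallOf b s i m) :
    fl i (alcoveOf b (sEl s)) = m - 1 := by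
  have e : ∀ v, P.root' i (s.1 v) = P.root' (negIdx P i) v + ((2 * m : ℤ) : ℚ) := by
    intro v
    rw [h.eq, root_affRefl_self, root'_negIdx]; push_cast; ring
  have := fl_move (affineWeyl_le b (sEl s).2) e (fundAlcove b)
  rw [fl_negIdx, h.fl_fund] at this
  refine this.trans ?_
  ring

lemma fl_act {g : affineWeyl b} {π : ι ≃ ι} {n : ι → ℤ} (hg : ActsBy (P := P) g π n) (i : ι)
    (A : Alcove P) : fl (π i) (act b g A) = fl i A + n i := fl_move_of_actsBy _ hg i A

/-- `g.A_e` and `g.A_s` are separated by a single hyperplane. -/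
lemma IsWallOf.translate {s : simpleRefl b} {i : ι} {m : ℤ} (h : IsWallOf b s i m)
    {g : affineWeyl b} {π : ι ≃ ι} {n : ι → ℤ} (hg : ActsBy (P := P) g π n) :
    fl (π i) (alcoveOf b g) = m + n i ∧ fl (π i) (alcoveOf b (g * sEl s)) = m + n i - 1 ∧
    ∀ j, j ≠ π i → j ≠ negIdx P (π i) → fl j (alcoveOf b (g * sEl s)) = fl j (alcoveOf b g) := by
  refine ⟨?_, ?_, fun j h1 h2 => ?_⟩
  · rw [alcoveOf_eq_act, fl_act hg, h.fl_fund]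
  · rw [alcoveOf_mul, fl_act hg, h.fl_self]; ring
  · obtain ⟨j, rfl⟩ := π.surjective j
    rw [alcoveOf_mul, fl_act hg, alcoveOf_eq_act b g, fl_act hg, h.fl_other j (fun e => h1 (e ▸ rfl))]
    intro e
    exact h2 (by rw [e, hg.negIdx])

lemma IsWallOf.conj {s : simpleRefl b} {i : ι} {m : ℤ} (h : IsWallOf b s i m)
    {g : affineWeyl b} {π : ι ≃ ι} {n : ι → ℤ} (hg : ActsBy (P := P) g π n) :
    ((g * sEl s * g⁻¹ : affineWeyl b) : N ≃ᵃ[ℚ] N) = affRefl P (π i) (m + n i) := by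
  change (g : N ≃ᵃ[ℚ] N) * s.1 * (g : N ≃ᵃ[ℚ] N)⁻¹ = _
  rw [h.eq, hg.conj]

lemma IsWallOf.dist_translate {s : simpleRefl b} {i : ι} {m : ℤ} (h : IsWallOf b s i m)
    {g : affineWeyl b} {π : ι ≃ ι} {n : ι → ℤ} (hg : ActsBy (P := P) g π n) (A : Alcove P) :
    dist A (alcoveOf b (g * sEl s)) = dist A (alcoveOf b g) +
      if m + n i ≤ fl (π i) A then 2 else -2 :=
  let ⟨h1, h2, h3⟩ := h.translate hg
  dist_of_adjacent A h1 h2 h3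

variable [P.IsReduced]

/-- The reflection in a simple root permutes the other positive roots, so `A_e` and `A_s` are
separated only by the hyperplane of the simple root. -/
lemma isWallOf_simple {s : simpleRefl b} {i : ι} (hi : i ∈ b.support) (hs : s.1 = affRefl P i 0) :
    IsWallOf b s i 0 := by
  have hip := RootPairing.Base.isPos_of_mem_support (b := b) hi
  refine ⟨hs, fl_fund_of_pos b hip, ?_⟩
  have key : ∀ j, b.IsPos j → j ≠ i → fl j (alcoveOf b (sEl s)) = fl j (fundAlcove b) := by
    intro j hj hji
    have hact : ActsBy (P := P) (sEl s : affineWeyl b) (P.reflectionPerm i)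
        (fun j => -(0 * P.pairingIn ℤ j i)) := by
      change ActsBy (P := P) s.1 _ _
      rw [hs]; exact actsBy_affRefl i 0
    have h := fl_act hact (P.reflectionPerm i j) (fundAlcove b)
    rw [RootPairing.reflectionPerm_self, fl_fund_of_pos b (hj.reflectionPerm hi hji)] at h
    rw [alcoveOf_eq_act, h, fl_fund_of_pos b hj]
    ring
  intro j h1 h2
  by_cases hj : b.IsPos j
  · exact key j hj h1
  · have h3 := key (negIdx P j) ((isPos_negIdx b j).mpr hj)
      (fun h => h2 (by rw [← h, negIdx_negIdx]))
    rw [fl_negIdx, fl_negIdx] at h3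
    omega

/-- A positive root `α` other than the highest root `θ` satisfies `⟨α, θ^∨⟩ = 0` or `⟨α, θ^∨⟩ = 1`.
In the first case the reflection in `θ` fixes it, in the second it makes it negative, and the
translation part compensates for this. The root is taken as `-θ` at level `-1`, so that `A_e` lies
on its positive side. -/
lemma isWallOf_affine {s : simpleRefl b} {θ : ι} (hθ : IsHighestRoot b θ)
    (hs : s.1 = affRefl P θ 1) : IsWallOf b s (negIdx P θ) (-1) := by
  have : Nonempty ι := ⟨θ⟩
  have hθp := hθ.isPos
  refine ⟨by rw [hs, affRefl_negIdx], by rw [fl_negIdx, fl_fund_of_pos b hθp]; rfl, ?_⟩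
  have key : ∀ j, b.IsPos j → j ≠ θ → fl j (alcoveOf b (sEl s)) = fl j (fundAlcove b) := by
    intro j hj hji
    have hact : ActsBy (P := P) (sEl s : affineWeyl b) (P.reflectionPerm θ)
        (fun j => -(1 * P.pairingIn ℤ j θ)) := by
      change ActsBy (P := P) s.1 _ _
      rw [hs]; exact actsBy_affRefl θ 1
    have h := fl_act hact (P.reflectionPerm θ j) (fundAlcove b)
    rw [RootPairing.reflectionPerm_self, ← RootPairing.pairingIn_reflectionPerm,
      RootPairing.pairingIn_reflectionPerm_self_right] at h
    rw [alcoveOf_eq_act, h, fl_fund_of_pos b hj]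
    have e : P.root (P.reflectionPerm θ j) = P.root j + (-P.pairingIn ℤ j θ) • P.root θ := by
      rw [RootPairing.root_reflectionPerm, P.reflection_apply_root' ℤ, neg_smul, sub_eq_add_neg]
    rcases hθ.pairingIn hj hji with h0 | h0
    · have : P.reflectionPerm θ j = j := P.root.injective (by rw [e, h0]; simp)
      rw [this, fl_fund_of_pos b hj, h0]; rfl
    · have : ¬ b.IsPos (P.reflectionPerm θ j) := by
        have h1 := (height_le_of_sub_mem b (hθ ⟨j, hj⟩)).1
        simp only at h1
        have h2 := b.height_add_zsmul e
        rw [h0] at h2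
        rw [RootPairing.Base.isPos_iff, h2, smul_eq_mul]
        omega
      rw [fl_fund_of_not_pos b this, h0]; rfl
  intro j h1 h2
  rw [negIdx_negIdx] at h2
  by_cases hj : b.IsPos j
  · exact key j hj h2
  · have h3 := key (negIdx P j) ((isPos_negIdx b j).mpr hj)
      (fun h => h1 (by rw [← h, negIdx_negIdx]))
    rw [fl_negIdx, fl_negIdx] at h3
    omega

lemma exists_isWallOf (s : simpleRefl b) : ∃ i m, IsWallOf b s i m := by
  have h := s.2
  rcases h with ⟨i, hi, hs⟩ | ⟨i, hi, hs⟩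
  · exact ⟨_, _, isWallOf_simple hi hs⟩
  · exact ⟨_, _, isWallOf_affine hi hs⟩

lemma dist_mul_sEl (A : Alcove P) (g : affineWeyl b) (s : simpleRefl b) :
    dist A (alcoveOf b (g * sEl s)) = dist A (alcoveOf b g) + 2 ∨
    dist A (alcoveOf b (g * sEl s)) = dist A (alcoveOf b g) - 2 := by
  obtain ⟨i, m, h⟩ := exists_isWallOf s
  obtain ⟨π, n, hg⟩ := exists_actsBy b g.2
  rw [h.dist_translate hg]
  split_ifs
  · exact Or.inl rfl
  · exact Or.inr rfl

/-- The exchange condition. -/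
lemma exchange (u : List (simpleRefl b)) (s : simpleRefl b)
    (h : dist (fundAlcove b) (alcoveOf b (wordEl b u * sEl s)) <
      dist (fundAlcove b) (alcoveOf b (wordEl b u))) :
    ∃ u', u'.length + 1 = u.length ∧ wordEl b u' = wordEl b u * sEl s := by
  induction u with
  | nil =>
    exfalso
    change _ < dist _ (alcoveOf b 1) at h
    rw [alcoveOf_one, dist_self] at h
    exact absurd h (not_lt.mpr (dist_nonneg _ _))
  | cons t u ih =>
    have htt : ∀ X Y, dist X (act b (sEl t) Y) = dist (act b (sEl t) X) Y := by
      intro X Y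
      rw [← dist_act b (sEl t) X, ← act_mul, sEl_mul_self, act_one]
    by_cases hlt : dist (fundAlcove b) (alcoveOf b (wordEl b u * sEl s)) <
        dist (fundAlcove b) (alcoveOf b (wordEl b u))
    · obtain ⟨u', h1, h2⟩ := ih hlt
      refine ⟨t :: u', by rw [List.length_cons, List.length_cons, h1], ?_⟩
      rw [wordEl_cons, wordEl_cons, h2, mul_assoc]
    · -- now `u.A_e` and `u.A_s` lie on different sides of the wall of `t`
      refine ⟨u, rfl, ?_⟩
      obtain ⟨i, m, hs⟩ := exists_isWallOf s
      obtain ⟨j, l, ht⟩ := exists_isWallOf t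
      obtain ⟨π, n, hu⟩ := exists_actsBy b (wordEl b u).2
      rw [wordEl_cons, mul_assoc, alcoveOf_mul, htt, alcoveOf_mul b (sEl t) (wordEl b u), htt,
        hs.dist_translate hu] at h
      rw [hs.dist_translate hu] at hlt
      have h1 : m + n i ≤ fl (π i) (fundAlcove b) := by
        by_contra hc
        rw [if_neg hc] at hlt
        omega
      have h2 : ¬ m + n i ≤ fl (π i) (alcoveOf b (sEl t)) := by
        intro hc
        rw [← alcoveOf_eq_act, if_pos hc] at h
        omega
      have hj : π i = j ∨ π i = negIdx P j := by
        by_contra! hc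
        rw [ht.fl_other _ hc.1 hc.2] at h2
        exact h2 h1
      have hj' : π i = j := by
        refine hj.resolve_right fun hc => ?_
        rw [hc, fl_negIdx, ht.fl_fund] at h1
        rw [hc, fl_negIdx, ht.fl_self] at h2
        omega
      rw [hj', ht.fl_fund] at h1
      rw [hj', ht.fl_self] at h2
      -- `u.A_s` and `A_t` lie across the same hyperplane, so `u s u⁻¹ = t`
      have hm : m + n i = l := by omega
      have hc := hs.conj hu
      rw [hj', hm, ← ht.eq] at hc
      have hc' : wordEl b u * sEl s * (wordEl b u)⁻¹ = sEl t := Subtype.ext hc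
      rw [wordEl_cons, ← hc', inv_mul_cancel_right, mul_assoc, sEl_mul_self, mul_one]

/-- The distance of `g.A_e` from `A_e` is twice the length of `g`: each hyperplane that separates
the two alcoves is counted for both of its roots. -/
lemma dist_alcoveOf (g : affineWeyl b) :
    dist (fundAlcove b) (alcoveOf b g) = 2 * (len b g : ℤ) := by
  obtain ⟨u, rfl, hu⟩ := exists_reduced b g
  rw [← hu]
  induction u using List.reverseRecOn with
  | nil =>
    change dist _ (alcoveOf b 1) = _
    rw [alcoveOf_one, dist_self]; rfl
  | append_singleton u s ih =>
    rw [List.length_append, List.length_singleton, wordEl_concat] at hu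
    have hred : u.length = len b (wordEl b u) := by
      refine le_antisymm ?_ (len_wordEl_le b u)
      obtain ⟨v, hv, hvl⟩ := exists_reduced b (wordEl b u)
      have := len_wordEl_le b (v ++ [s])
      rw [wordEl_concat, hv, List.length_append, List.length_singleton] at this
      omega
    have ih := ih hred
    rw [wordEl_concat]
    rcases dist_mul_sEl (fundAlcove b) (wordEl b u) s with h | h
    · rw [h, ih, List.length_append]; push_cast; simp; ring
    · exfalso
      obtain ⟨u', h1, h2⟩ := exchange u s (by omega)
      have := len_wordEl_le b u'
      rw [h2] at this
      omega

/-- The affine Weyl group acts freely on the alcoves. -/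
lemma alcoveOf_injective : Function.Injective (alcoveOf b) := by
  intro g h e
  have h1 : alcoveOf b (g⁻¹ * h) = fundAlcove b := by
    rw [alcoveOf_mul, ← e, alcoveOf_eq_act, act_inv_act]
  have h2 := dist_alcoveOf (g⁻¹ * h)
  rw [h1, dist_self] at h2
  have h3 : len b (g⁻¹ * h : affineWeyl b) = 0 := by omega
  obtain ⟨u, hu, hl⟩ := exists_reduced b (g⁻¹ * h)
  rw [h3, List.length_eq_zero_iff] at hl
  rw [hl] at hu
  have hu' : (1 : affineWeyl b) = g⁻¹ * h := hu
  rw [eq_inv_mul_iff_mul_eq, mul_one] at hu'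
  exact hu'

variable [P.IsIrreducible]

/-- An alcove other than `A_e` is separated from `A_e` by one of the walls of `A_e`: the
inequalities `0 < ⟨α, v⟩` for simple `α` and `⟨θ, v⟩ < 1` for the highest root imply all the others.
-/
lemma exists_separating {A : Alcove P} (hA : A ≠ fundAlcove b) :
    ∃ s i m, IsWallOf b s i m ∧ fl i A < m := by
  by_contra! hcon
  apply hA
  obtain ⟨θ, hθ⟩ := exists_isHighestRoot b
  have hsimple : ∀ i ∈ b.support, 0 ≤ fl i A := fun i hi =>
    hcon ⟨affRefl P i 0, Or.inl ⟨i, hi, rfl⟩⟩ i 0 (isWallOf_simple hi rfl)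
  have haff : fl θ A ≤ 0 := by
    have := hcon ⟨affRefl P θ 1, Or.inr ⟨θ, hθ, rfl⟩⟩ _ _ (isWallOf_affine hθ rfl)
    rw [fl_negIdx] at this
    omega
  obtain ⟨v, hv⟩ := alcove_nonempty A
  have hs : ∀ i ∈ b.support, 0 < P.root' i v := fun i hi =>
    lt_of_le_of_lt (by exact_mod_cast hsimple i hi) (fl_lt hv i)
  have hpos : ∀ i, b.IsPos i → fl i A = 0 := by
    intro i hi
    have h1 := nonneg_of_mem_closure b (fun i hi => (hs i hi).le) (root_mem_closure b hi)
    have h2 := nonneg_of_mem_closure b (fun i hi => (hs i hi).le) (hθ ⟨i, hi⟩)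
    rw [map_sub, LinearMap.sub_apply] at h2
    have h3 := lt_fl hv θ
    have h4 : (fl θ A : ℚ) ≤ 0 := by exact_mod_cast haff
    have h5 : P.root' i v ≤ P.root' θ v := by
      have : (0 : ℚ) ≤ P.root' θ v - P.root' i v := h2
      linarith
    refine fl_eq_of_lt hv ?_ ?_
    · push_cast
      exact lt_of_le_of_ne h1 (by have := root'_ne_of_mem hv i 0; push_cast at this; exact this.symm)
    · push_cast; linarith
  refine alcove_ext fun i => ?_
  by_cases hi : b.IsPos i
  · rw [hpos i hi, fl_fund_of_pos b hi]
  · have := hpos _ ((isPos_negIdx b i).mpr hi)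
    rw [fl_negIdx] at this
    rw [fl_fund_of_not_pos b hi]
    omega

variable (b) in
/-- The affine Weyl group acts transitively on the alcoves. -/
lemma alcoveOf_surjective : Function.Surjective (alcoveOf b) := by
  have key : ∀ (n : ℕ) (A : Alcove P), dist (fundAlcove b) A ≤ n → ∃ g, alcoveOf b g = A := by
    intro n
    induction n using Nat.strong_induction_on with
    | _ n ih =>
      intro A hA
      by_cases he : A = fundAlcove b
      · exact ⟨1, by rw [he, alcoveOf_one]⟩
      obtain ⟨s, i, m, hw, hlt⟩ := exists_separating he
      have h1 : dist A (alcoveOf b (sEl s)) = dist A (fundAlcove b) +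
          if m ≤ fl i A then 2 else -2 := dist_of_adjacent A hw.fl_fund hw.fl_self hw.fl_other
      rw [if_neg (not_le.mpr hlt)] at h1
      have h2 : dist (fundAlcove b) (act b (sEl s) A) = dist A (alcoveOf b (sEl s)) := by
        rw [← dist_act b (sEl s), ← act_mul, sEl_mul_self, act_one, dist_comm]
        rfl
      have h3 := dist_nonneg A (alcoveOf b (sEl s))
      rw [dist_comm A (fundAlcove b)] at h1
      obtain ⟨g, hg⟩ := ih (n - 2) (by omega) (act b (sEl s) A) (by omega)
      refine ⟨sEl s * g, ?_⟩
      rw [alcoveOf_mul, hg, ← act_mul, sEl_mul_self, act_one]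
  intro A
  exact key (dist (fundAlcove b) A).toNat A (by have := dist_nonneg (fundAlcove b) A; omega)

end AffineWeyl


/-! ### Reflections, neighbours and walls -/

section Walls

variable {ι V N : Type*} [Finite ι] [AddCommGroup V] [Module ℚ V] [AddCommGroup N] [Module ℚ N]
variable {P : RootPairing ι ℚ V N} [P.IsRootSystem] [P.IsCrystallographic] [P.IsReduced]
  [P.IsIrreducible] (b : P.Base)

lemma fl_affRefl (i : ι) (n : ℤ) (A : Alcove P) :
    fl i (move P (affRefl P i n) (affRefl_mem P i n) A) = 2 * n - 1 - fl i A := by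
  have e : ∀ v, P.root' i (affRefl P i n v) = P.root' (negIdx P i) v + ((2 * n : ℤ) : ℚ) := by
    intro v
    rw [root_affRefl_self, root'_negIdx]; push_cast; ring
  rw [fl_move _ e, fl_negIdx]; ring

/-- A gallery that crosses `H_{i,n}` exhibits its reflection as a conjugate of a simple one. -/
lemma affRefl_mem_of_crossing {i : ι} {n : ℤ} (u : List (simpleRefl b)) :
    ∀ g : affineWeyl b, n ≤ fl i (alcoveOf b g) → fl i (alcoveOf b (g * wordEl b u)) < n →
      affRefl P i n ∈ affineWeyl b := by
  induction u with
  | nil =>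
    intro g h1 h2
    change fl i (alcoveOf b (g * 1)) < n at h2
    rw [mul_one] at h2
    omega
  | cons s u ih =>
    intro g h1 h2
    rw [wordEl_cons, ← mul_assoc] at h2
    by_cases h3 : n ≤ fl i (alcoveOf b (g * sEl s))
    · exact ih _ h3 h2
    obtain ⟨j, m, hs⟩ := exists_isWallOf s
    obtain ⟨π, c, hg⟩ := exists_actsBy b g.2
    obtain ⟨a1, a2, a3⟩ := hs.translate hg
    have hi : i = π j ∨ i = negIdx P (π j) := by
      by_contra! hc
      rw [a3 i hc.1 hc.2] at h3
      exact h3 h1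
    have hi' : i = π j := by
      refine hi.resolve_right fun hc => ?_
      rw [hc, fl_negIdx] at h1 h3
      omega
    have hn : n = m + c j := by rw [hi'] at h1 h3; omega
    rw [hi', hn, ← hs.conj hg]
    exact Subtype.property _

/-- The affine Weyl group contains all the reflections `s_{α,n}`. -/
lemma affRefl_mem_affineWeyl (i : ι) (n : ℤ) : affRefl P i n ∈ affineWeyl b := by
  obtain ⟨g, hg⟩ := alcoveOf_surjective b
    (move P (affRefl P i n) (affRefl_mem P i n) (fundAlcove b))
  have h1 := fl_affRefl i n (fundAlcove b)
  rw [← hg] at h1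
  by_cases h : n ≤ fl i (fundAlcove b)
  · obtain ⟨u, hu⟩ := exists_word b g
    refine affRefl_mem_of_crossing b u 1 (by rwa [alcoveOf_one]) ?_
    rw [one_mul, hu]
    omega
  · obtain ⟨u, hu⟩ := exists_word b g⁻¹
    refine affRefl_mem_of_crossing b u g (by omega) ?_
    rw [hu, mul_inv_cancel, alcoveOf_one]
    omega

/-- The reflection `s_{α,n}` as an element of the affine Weyl group. -/
def refl (i : ι) (n : ℤ) : affineWeyl b := ⟨affRefl P i n, affRefl_mem_affineWeyl b i n⟩

lemma weylAff_reflection (i : ι) :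
    weylAff P ⟨_, P.reflection_mem_weylGroup i⟩ = affRefl P i 0 := by
  ext v
  rw [weylAff_apply, affRefl_apply]
  change ((RootPairing.Equiv.reflection P i)⁻¹).coweightMap v = _
  rw [RootPairing.Equiv.reflection_inv]
  change P.coreflection i v = _
  rw [RootPairing.coreflection_apply]
  simp

lemma weylAff_one : weylAff P 1 = 1 := by
  ext v
  rw [weylAff_apply]
  change ((1 : P.Aut)⁻¹).coweightMap v = v
  rw [inv_one]
  rfl

lemma weylAff_mul (x y : P.weylGroup) : weylAff P (x * y) = weylAff P x * weylAff P y := by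
  ext v
  change weylAff P _ v = weylAff P _ (weylAff P _ v)
  rw [weylAff_apply, weylAff_apply, weylAff_apply]
  change (((x : P.Aut) * (y : P.Aut))⁻¹).coweightMap v = _
  rw [mul_inv_rev]
  rfl

lemma weylAff_mem_affineWeyl (w : P.weylGroup) : weylAff P w ∈ affineWeyl b := by
  obtain ⟨w, hw⟩ := w
  induction hw using RootPairing.weylGroup.induction with
  | mem i =>
    rw [weylAff_reflection]
    exact affRefl_mem_affineWeyl b i 0
  | one =>
    rw [show (⟨1, one_mem _⟩ : P.weylGroup) = 1 from rfl, weylAff_one]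
    exact one_mem (affineWeyl b)
  | mul x y hx hy h1 h2 =>
    rw [show (⟨x * y, mul_mem hx hy⟩ : P.weylGroup) = ⟨x, hx⟩ * ⟨y, hy⟩ from rfl, weylAff_mul]
    exact mul_mem h1 h2

/-- The element of the finite Weyl group as an element of the affine Weyl group. -/
def weylEl (w : P.weylGroup) : affineWeyl b := ⟨weylAff P w, weylAff_mem_affineWeyl b w⟩

lemma weylMove_eq (w : P.weylGroup) (A : Alcove P) : Obj.weylMove w A = act b (weylEl b w) A := rfl

lemma up_eq (i : ι) (A : Alcove P) : up P i A = act b (refl b i (fl i A + 1)) A := by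
  apply Subtype.ext
  change affRefl P i (upIdx P i A.1) '' A.1 = affRefl P i (fl i A + 1) '' A.1
  rw [fl, sub_add_cancel]

lemma down_eq (i : ι) (A : Alcove P) : down P i A = act b (refl b i (fl i A)) A := rfl

lemma fl_up (i : ι) (A : Alcove P) : fl i (up P i A) = fl i A + 1 := by
  have h := fl_affRefl i (upIdx P i A.1) A
  change fl i (up P i A) = _ at h
  rw [h, fl]; ring

lemma fl_down (i : ι) (A : Alcove P) : fl i (down P i A) = fl i A - 1 := by
  have h := fl_affRefl i (upIdx P i A.1 - 1) A
  change fl i (down P i A) = _ at h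
  rw [h, fl]; ring

lemma up_down (i : ι) (A : Alcove P) : up P i (down P i A) = A := (upEquiv P i).apply_symm_apply A

lemma down_up (i : ι) (A : Alcove P) : down P i (up P i A) = A := (upEquiv P i).symm_apply_apply A

/-- The element `g` with `A = g.A_e`. -/
def elOf (A : Alcove P) : affineWeyl b := (alcoveOf_surjective b A).choose

lemma alcoveOf_elOf (A : Alcove P) : alcoveOf b (elOf b A) = A := (alcoveOf_surjective b A).choose_spec

lemma elOf_alcoveOf (g : affineWeyl b) : elOf b (alcoveOf b g) = g :=
  alcoveOf_injective (alcoveOf_elOf b _)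

lemma elOf_act (g : affineWeyl b) (A : Alcove P) : elOf b (act b g A) = g * elOf b A := by
  apply alcoveOf_injective
  rw [alcoveOf_elOf, alcoveOf_mul, alcoveOf_elOf]

variable {b}

/-- The neighbour of `A` across its wall of type `s`. -/
def nbr (s : simpleRefl b) (A : Alcove P) : Alcove P := alcoveOf b (elOf b A * sEl s)

lemma nbr_alcoveOf (s : simpleRefl b) (g : affineWeyl b) :
    nbr s (alcoveOf b g) = alcoveOf b (g * sEl s) := by rw [nbr, elOf_alcoveOf]

lemma nbr_nbr (s : simpleRefl b) (A : Alcove P) : nbr s (nbr s A) = A := by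
  rw [← alcoveOf_elOf b A, nbr_alcoveOf, nbr_alcoveOf, mul_assoc, sEl_mul_self, mul_one]

lemma nbr_act (s : simpleRefl b) (g : affineWeyl b) (A : Alcove P) :
    nbr s (act b g A) = act b g (nbr s A) := by
  rw [nbr, elOf_act, mul_assoc, alcoveOf_mul, nbr]

/-- The wall of type `s` of `A` lies in `H_{j,n}`, and `A` lies on the side `⟨α_j, ·⟩ > n`. -/
structure IsWallAt (s : simpleRefl b) (A : Alcove P) (j : ι) (n : ℤ) : Prop where
  fl_self : fl j A = n
  fl_nbr : fl j (nbr s A) = n - 1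
  fl_other : ∀ i, i ≠ j → i ≠ negIdx P j → fl i (nbr s A) = fl i A
  refl_eq : act b (refl b j n) A = nbr s A

lemma exists_isWallAt (s : simpleRefl b) (A : Alcove P) : ∃ j n, IsWallAt s A j n := by
  obtain ⟨i, m, h⟩ := exists_isWallOf s
  obtain ⟨π, c, hg⟩ := exists_actsBy b (elOf b A).2
  obtain ⟨h1, h2, h3⟩ := h.translate hg
  rw [alcoveOf_elOf] at h1 h3
  refine ⟨_, _, h1, h2, h3, ?_⟩
  have h4 : elOf b A * sEl s * (elOf b A)⁻¹ = refl b (π i) (m + c i) := Subtype.ext (h.conj hg)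
  rw [← h4]
  conv_lhs => rw [← alcoveOf_elOf b A]
  rw [← alcoveOf_mul, alcoveOf_elOf, inv_mul_cancel_right]
  rfl

/-- The root `α_j` for which the wall of type `s` of `A` lies in some `H_{j,n}`, with `A` on the
positive side. -/
def wallIdx (s : simpleRefl b) (A : Alcove P) : ι := (exists_isWallAt s A).choose

/-- The level of the hyperplane `H_{j,n}` that contains the wall of type `s` of `A`. -/
def wallLev (s : simpleRefl b) (A : Alcove P) : ℤ := (exists_isWallAt s A).choose_spec.choose

lemma isWallAt (s : simpleRefl b) (A : Alcove P) : IsWallAt s A (wallIdx s A) (wallLev s A) :=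
  (exists_isWallAt s A).choose_spec.choose_spec

lemma IsWallAt.eq {s : simpleRefl b} {A : Alcove P} {j : ι} {n : ℤ} (h : IsWallAt s A j n) :
    wallIdx s A = j ∧ wallLev s A = n := by
  have h0 := isWallAt s A
  have h1 : wallIdx s A = j ∨ wallIdx s A = negIdx P j := by
    by_contra! hc
    have := h.fl_other _ hc.1 hc.2
    rw [h0.fl_self, h0.fl_nbr] at this
    omega
  have h2 : wallIdx s A = j := by
    refine h1.resolve_right fun hc => ?_
    have a1 := h0.fl_self
    have a2 := h0.fl_nbr
    rw [hc, fl_negIdx] at a1 a2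
    have a3 := h.fl_self
    have a4 := h.fl_nbr
    omega
  refine ⟨h2, ?_⟩
  rw [← h0.fl_self, ← h.fl_self, h2]

lemma IsWallAt.nbr {s : simpleRefl b} {A : Alcove P} {j : ι} {n : ℤ} (h : IsWallAt s A j n) :
    IsWallAt s (nbr s A) (negIdx P j) (-n) where
  fl_self := by rw [fl_negIdx, h.fl_nbr]; ring
  fl_nbr := by rw [nbr_nbr, fl_negIdx, h.fl_self]
  fl_other i h1 h2 := by
    rw [negIdx_negIdx] at h2
    rw [nbr_nbr, h.fl_other i h2 h1]
  refl_eq := by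
    have : refl b (negIdx P j) (-n) = refl b j n := Subtype.ext (affRefl_negIdx P j n)
    rw [nbr_nbr, this, ← h.refl_eq, ← act_mul]
    have : refl b j n * refl b j n = 1 := Subtype.ext (by
      change affRefl P j n * affRefl P j n = 1
      rw [← inv_eq_iff_mul_eq_one, affRefl_inv])
    rw [this, act_one]

lemma wallIdx_nbr (s : simpleRefl b) (A : Alcove P) :
    wallIdx s (nbr s A) = negIdx P (wallIdx s A) := (isWallAt s A).nbr.eq.1

lemma wallLev_nbr (s : simpleRefl b) (A : Alcove P) :
    wallLev s (nbr s A) = - wallLev s A := (isWallAt s A).nbr.eq.2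

lemma IsWallAt.act {s : simpleRefl b} {A : Alcove P} {j : ι} {n : ℤ} (h : IsWallAt s A j n)
    {g : affineWeyl b} {π : ι ≃ ι} {c : ι → ℤ} (hg : ActsBy (P := P) g π c) :
    IsWallAt s (act b g A) (π j) (n + c j) where
  fl_self := by rw [fl_act hg, h.fl_self]
  fl_nbr := by rw [nbr_act, fl_act hg, h.fl_nbr]; ring
  fl_other i h1 h2 := by
    obtain ⟨i, rfl⟩ := π.surjective i
    rw [nbr_act, fl_act hg, fl_act hg, h.fl_other i (fun e => h1 (e ▸ rfl))]
    intro e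
    exact h2 (by rw [e, hg.negIdx])
  refl_eq := by
    have : g * refl b j n * g⁻¹ = refl b (π j) (n + c j) := Subtype.ext (hg.conj j n)
    rw [← this, ← act_mul, inv_mul_cancel_right, act_mul, h.refl_eq, nbr_act]

lemma wallIdx_act (s : simpleRefl b) (A : Alcove P) {g : affineWeyl b} {π : ι ≃ ι} {c : ι → ℤ}
    (hg : ActsBy (P := P) g π c) : wallIdx s (act b g A) = π (wallIdx s A) :=
  ((isWallAt s A).act hg).eq.1

lemma wallIdx_weylMove (s : simpleRefl b) (A : Alcove P) (w : P.weylGroup) :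
    wallIdx s (Obj.weylMove w A) = weylIdx P w (wallIdx s A) :=
  wallIdx_act (g := weylEl b w) s A (actsBy_weylAff w)

lemma wallIdx_up (s : simpleRefl b) (A : Alcove P) (i : ι) :
    wallIdx s (up P i A) = P.reflectionPerm i (wallIdx s A) := by
  rw [up_eq b]
  exact wallIdx_act (g := refl b i _) s A (actsBy_affRefl i _)

lemma nbr_up {s : simpleRefl b} {A : Alcove P} {i : ι} (h1 : i ≠ wallIdx s A)
    (h2 : i ≠ negIdx P (wallIdx s A)) : nbr s (up P i A) = up P i (nbr s A) := by
  rw [up_eq b, nbr_act, up_eq b i (nbr s A), (isWallAt s A).fl_other i h1 h2]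

lemma down_of_wallIdx {s : simpleRefl b} {A : Alcove P} {i : ι} (h : i = wallIdx s A) :
    down P i A = nbr s A := by
  rw [down_eq b, h, (isWallAt s A).fl_self, (isWallAt s A).refl_eq]

lemma up_of_negIdx_wallIdx {s : simpleRefl b} {A : Alcove P} {i : ι}
    (h : i = negIdx P (wallIdx s A)) : up P i A = nbr s A := by
  have h1 : i = wallIdx s (nbr s A) := by rw [wallIdx_nbr, h]
  have h2 := down_of_wallIdx h1
  rw [nbr_nbr] at h2
  conv_lhs => rw [← h2]
  rw [up_down]

/-! ### The sets `A^{(s)}` -/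

lemma mem_cl_iff {A : Alcove P} {u : N} :
    u ∈ cl P A.1 ↔ ∀ i, (fl i A : ℚ) ≤ P.root' i u ∧ P.root' i u ≤ fl i A + 1 := by
  obtain ⟨v, hv⟩ := alcove_nonempty A
  have key : ∀ i (n : ℤ), (∀ v ∈ A.1, P.root' i v < n) ↔ fl i A + 1 ≤ n := by
    intro i n
    constructor
    · intro h
      have : (fl i A : ℚ) < n := (fl_lt hv i).trans (h v hv)
      exact_mod_cast this
    · intro h v hv
      exact (lt_fl hv i).trans_le (by exact_mod_cast h)
  constructor
  · intro hu i
    have h1 := hu i (fl i A + 1) ((key _ _).mpr le_rfl)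
    have h2 := hu (negIdx P i) (fl (negIdx P i) A + 1) ((key _ _).mpr le_rfl)
    rw [root'_negIdx, fl_negIdx] at h2
    push_cast at h1 h2
    exact ⟨by linarith, h1⟩
  · intro h i n hn
    have := (key i n).mp hn
    exact (h i).2.trans (by exact_mod_cast this)

/-- A point of the wall of type `s` of `A`, in coordinates. -/
def OnWall (s : simpleRefl b) (A : Alcove P) (u : N) : Prop :=
  P.root' (wallIdx s A) u = wallLev s A ∧ ∀ i, i ≠ wallIdx s A → i ≠ negIdx P (wallIdx s A) →
    (fl i A : ℚ) < P.root' i u ∧ P.root' i u < fl i A + 1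

lemma onWall_nbr {s : simpleRefl b} {A : Alcove P} {u : N} (h : OnWall s A u) :
    OnWall s (nbr s A) u := by
  constructor
  · rw [wallIdx_nbr, wallLev_nbr, root'_negIdx, h.1]; push_cast; rfl
  · intro i h1 h2
    rw [wallIdx_nbr] at h1 h2
    rw [negIdx_negIdx] at h2
    rw [(isWallAt s A).fl_other i h2 h1]
    exact h.2 i h2 h1

lemma OnWall.mem_cl {s : simpleRefl b} {A : Alcove P} {u : N} (h : OnWall s A u) :
    u ∈ cl P A.1 := by
  rw [mem_cl_iff]
  intro i
  have h0 := (isWallAt s A).fl_self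
  by_cases h1 : i = wallIdx s A
  · rw [h1, h.1, h0]; exact ⟨le_rfl, by linarith⟩
  by_cases h2 : i = negIdx P (wallIdx s A)
  · rw [h2, root'_negIdx, h.1, fl_negIdx, h0]; push_cast; exact ⟨by linarith, by linarith⟩
  · exact ⟨(h.2 i h1 h2).1.le, (h.2 i h1 h2).2.le⟩

lemma int_between {n m : ℤ} {q : ℚ} (h1 : (m : ℚ) < q) (h2 : q < m + 1) : q ≠ n := by
  rintro rfl
  have a1 : m < n := by exact_mod_cast h1
  have a2 : n < m + 1 := by exact_mod_cast h2
  omega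

lemma int_between' {n m : ℤ} {q : ℚ} (h1 : (m : ℚ) < q) (h2 : q < m + 1) (h3 : (n : ℚ) ≤ q)
    (h4 : q ≤ n + 1) : n = m := by
  have a1 : (m : ℚ) < n + 1 := h1.trans_le h4
  have a2 : (n : ℚ) < m + 1 := h3.trans_lt h2
  have a1 : m < n + 1 := by exact_mod_cast a1
  have a2 : n < m + 1 := by exact_mod_cast a2
  omega

/-- The only alcoves whose closure meets the wall of type `s` of `B` are `B` and its neighbour. -/
lemma OnWall.eq_or_eq {s : simpleRefl b} {A B : Alcove P} {u : N} (h : OnWall s B u)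
    (hA : u ∈ cl P A.1) : A = B ∨ A = nbr s B := by
  rw [mem_cl_iff] at hA
  have hB := isWallAt s B
  have h1 : ∀ i, i ≠ wallIdx s B → i ≠ negIdx P (wallIdx s B) → fl i A = fl i B := fun i h1 h2 =>
    int_between' (h.2 i h1 h2).1 (h.2 i h1 h2).2 (hA i).1 (hA i).2
  have h2 := hA (wallIdx s B)
  rw [h.1] at h2
  have h3 : fl (wallIdx s B) A ≤ wallLev s B := by exact_mod_cast h2.1
  have h4 : wallLev s B ≤ fl (wallIdx s B) A + 1 := by exact_mod_cast h2.2
  rcases eq_or_ne (fl (wallIdx s B) A) (wallLev s B) with h5 | h5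
  · left
    refine alcove_ext fun i => ?_
    by_cases a1 : i = wallIdx s B
    · rw [a1, h5, hB.fl_self]
    by_cases a2 : i = negIdx P (wallIdx s B)
    · rw [a2, fl_negIdx, fl_negIdx, h5, hB.fl_self]
    · exact h1 i a1 a2
  · right
    refine alcove_ext fun i => ?_
    by_cases a1 : i = wallIdx s B
    · rw [a1, hB.fl_nbr]; omega
    by_cases a2 : i = negIdx P (wallIdx s B)
    · rw [a2, fl_negIdx, fl_negIdx, hB.fl_nbr]; omega
    · rw [hB.fl_other i a1 a2]; exact h1 i a1 a2

lemma onWall_act {s : simpleRefl b} {A : Alcove P} {g : affineWeyl b} {u : N} :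
    OnWall s (act b g A) ((g : N ≃ᵃ[ℚ] N) u) ↔ OnWall s A u := by
  obtain ⟨π, c, hg⟩ := exists_actsBy b g.2
  obtain ⟨e1, e2⟩ := ((isWallAt s A).act hg).eq
  unfold OnWall
  rw [e1, e2, hg.1]
  have e3 : ∀ i, π i ≠ negIdx P (π (wallIdx s A)) ↔ i ≠ negIdx P (wallIdx s A) := fun i => by
    rw [← hg.negIdx, ne_eq, π.apply_eq_iff_eq]
  refine and_congr (by push_cast; constructor <;> intro h <;> linarith)
    (π.forall_congr_right.symm.trans ?_)
  simp only [ne_eq, π.apply_eq_iff_eq, hg.1, fl_act hg] at e3 ⊢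
  refine forall_congr' fun i => imp_congr Iff.rfl (imp_congr (e3 i) ?_)
  push_cast
  constructor <;> rintro ⟨h1, h2⟩ <;> constructor <;> linarith

/-- The common wall of `A_e` and `A_s` consists of the points at which the value of the root of `s`
is the level of the wall, whereas all other roots that are not proportional to it take values
strictly between two consecutive integers. -/
lemma mem_fundWall_iff {s : simpleRefl b} {u : N} :
    u ∈ fundWall b s ↔ OnWall s (fundAlcove b) u := by
  have hw := isWallAt s (fundAlcove b)
  have hn : nbr s (fundAlcove b) = alcoveOf b (sEl s) := by
    rw [← alcoveOf_one b, nbr_alcoveOf, one_mul]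
  have hset : s.1 '' fundSet b = (nbr s (fundAlcove b)).1 := by rw [hn]; rfl
  set j := wallIdx s (fundAlcove b) with hj
  set n := wallLev s (fundAlcove b) with hn'
  constructor
  · rintro ⟨h1, h2, p, hp, hu⟩
    rw [hset, mem_cl_iff] at h2
    change u ∈ cl P (fundAlcove b).1 at h1
    rw [mem_cl_iff] at h1
    have e : P.root' j u = n := by
      have a1 := (h1 j).1
      have a2 := (h2 j).2
      rw [hw.fl_self] at a1
      rw [hw.fl_nbr] at a2
      push_cast at a2
      exact le_antisymm (by linarith) a1
    refine ⟨e, fun i hi hi' => ?_⟩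
    -- an integral value at `u` would give a second hyperplane through `u`
    have key : ∀ i, (∃ m : ℤ, P.root' i u = m) → posOf b i = p.1 := by
      rintro i ⟨m, hm⟩
      rcases root_posOf b i with h | h
      · have : (posOf b i).1 = i := P.root.injective h
        have := hu (posOf b i, m) (by simp only; rw [this, hm])
        rw [← this]
      · have : (posOf b i).1 = negIdx P i := P.root.injective (by rw [h, root_negIdx])
        have := hu (posOf b i, -m) (by simp only; rw [this, root'_negIdx, hm]; push_cast; rfl)
        rw [← this]
    have hnot : ∀ m : ℤ, P.root' i u ≠ m := by
      intro m hm
      have a1 := (key i ⟨m, hm⟩).trans (key j ⟨n, e⟩).symm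
      have a2 : P.root i = P.root j ∨ P.root i = - P.root j := by
        rcases root_posOf b i with h | h <;> rcases root_posOf b j with h' | h' <;>
          rw [a1, h'] at h
        · exact Or.inl h.symm
        · exact Or.inr h.symm
        · right; rw [h, neg_neg]
        · left; exact (neg_injective h).symm
      rcases a2 with h | h
      · exact hi (P.root.injective h)
      · exact hi' (P.root.injective (by rw [h, root_negIdx]))
    refine ⟨lt_of_le_of_ne (h1 i).1 (hnot _).symm, lt_of_le_of_ne (h1 i).2 ?_⟩
    have := hnot (fl i (fundAlcove b) + 1)
    push_cast at this
    exact this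
  · intro h
    refine ⟨h.mem_cl, ?_, ?_⟩
    · rw [hset]; exact (onWall_nbr h).mem_cl
    · have key : ∀ (β : PosRoot b) (m : ℤ), P.root' β u = m → β.1 = j ∨ β.1 = negIdx P j := by
        intro β m hm
        by_contra! hc
        exact int_between (h.2 β hc.1 hc.2).1 (h.2 β hc.1 hc.2).2 hm
      have huniq : ∀ p q : PosRoot b × ℤ, P.root' p.1 u = p.2 → P.root' q.1 u = q.2 → p = q := by
        rintro ⟨β, m⟩ ⟨γ, l⟩ hp hq
        simp only at hp hq
        have : β.1 = γ.1 := by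
          rcases key β m hp with h1 | h1 <;> rcases key γ l hq with h2 | h2
          · rw [h1, h2]
          · exfalso
            have := β.2; have h3 := γ.2
            rw [h2, isPos_negIdx, ← h1] at h3
            exact h3 this
          · exfalso
            have := β.2; have h3 := γ.2
            rw [h1, isPos_negIdx, ← h2] at this
            exact this h3
          · rw [h1, h2]
        have h3 : β = γ := Subtype.ext this
        subst h3
        rw [hp] at hq
        exact Prod.ext rfl (by exact_mod_cast hq)
      -- the hyperplane of the wall, with its equation written for a positive root
      obtain ⟨q, hq⟩ : ∃ q : PosRoot b × ℤ, P.root' q.1 u = q.2 := by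
        rcases root_posOf b j with h' | h'
        · exact ⟨(posOf b j, n), by rw [P.root.injective h']; exact h.1⟩
        · refine ⟨(posOf b j, -n), ?_⟩
          have : (posOf b j).1 = negIdx P j := P.root.injective (by rw [h', root_negIdx])
          simp only
          rw [this, root'_negIdx]
          push_cast
          rw [h.1]
      exact ⟨q, hq, fun p hp => huniq p q hp hq⟩

/-- The wall of type `s` of an alcove, in coordinates. -/
lemma mem_wall_iff {s : simpleRefl b} {A : Alcove P} {u : N} : u ∈ wall b s A ↔ OnWall s A u := by
  constructor
  · rintro ⟨h1, g, hg, f, hf, rfl⟩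
    rw [mem_fundWall_iff, ← onWall_act (g := ⟨g, hg⟩)] at hf
    rcases hf.eq_or_eq h1 with h | h
    · rw [h]; exact hf
    · rw [h]; exact onWall_nbr hf
  · intro h
    refine ⟨h.mem_cl, elOf b A, (elOf b A).2, (elOf b A)⁻¹.1 u, ?_, ?_⟩
    · rw [mem_fundWall_iff, ← onWall_act (g := elOf b A), ← alcoveOf_eq_act, alcoveOf_elOf]
      change OnWall s A ((elOf b A * (elOf b A)⁻¹ : affineWeyl b).1 u)
      rw [mul_inv_cancel]
      exact h
    · change (elOf b A * (elOf b A)⁻¹ : affineWeyl b).1 u = u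
      rw [mul_inv_cancel]
      rfl

lemma wall_nonempty (s : simpleRefl b) (A : Alcove P) : ∃ u, u ∈ wall b s A := by
  obtain ⟨v, hv⟩ := alcove_nonempty A
  have hw := isWallAt s A
  have hv' : affRefl P (wallIdx s A) (wallLev s A) v ∈ (nbr s A).1 := by
    rw [← hw.refl_eq]; exact ⟨v, hv, rfl⟩
  -- the midpoint of a point and its mirror image
  refine ⟨v - ((P.root' (wallIdx s A) v - wallLev s A) / 2) • P.coroot (wallIdx s A),
    mem_wall_iff.mpr ⟨?_, fun i h1 h2 => ?_⟩⟩
  · rw [map_sub, map_smul, root'_coroot, RootPairing.pairingIn_same, smul_eq_mul]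
    push_cast; ring
  · have a1 := fl_lt hv i
    have a2 := lt_fl hv i
    have a3 := fl_lt hv' i
    have a4 := lt_fl hv' i
    rw [hw.fl_other i h1 h2] at a3 a4
    rw [affRefl_apply, map_sub, map_smul, smul_eq_mul] at a3 a4
    rw [map_sub, map_smul, smul_eq_mul]
    constructor <;> linarith

lemma wall_nbr (s : simpleRefl b) (A : Alcove P) : wall b s (nbr s A) = wall b s A := by
  ext u
  rw [mem_wall_iff, mem_wall_iff]
  exact ⟨fun h => by simpa only [nbr_nbr] using onWall_nbr h, onWall_nbr⟩

lemma eq_or_eq_of_wall_subset {s : simpleRefl b} {A C : Alcove P} (h : wall b s A ⊆ cl P C.1) :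
    C = A ∨ C = nbr s A := by
  obtain ⟨u, hu⟩ := wall_nonempty s A
  exact (mem_wall_iff.mp hu).eq_or_eq (h hu)

lemma wall_subset_cl (s : simpleRefl b) (A : Alcove P) : wall b s A ⊆ cl P A.1 := fun _ hu => hu.1

/-- If the wall of type `s` of `A` lies in `H_{i,m}`, then `H_{i,m}` is the hyperplane between `A` and
its neighbour. -/
lemma eq_wallIdx_of_const {s : simpleRefl b} {A : Alcove P} {i : ι} {m : ℤ}
    (h : ∀ v ∈ wall b s A, P.root' i v = m) :
    (i = wallIdx s A ∧ m = wallLev s A) ∨ (i = negIdx P (wallIdx s A) ∧ m = -wallLev s A) := by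
  obtain ⟨u, hu⟩ := wall_nonempty s A
  have h1 := mem_wall_iff.mp hu
  have h2 := h u hu
  by_cases a1 : i = wallIdx s A
  · left
    refine ⟨a1, ?_⟩
    rw [a1, h1.1] at h2
    exact_mod_cast h2.symm
  by_cases a2 : i = negIdx P (wallIdx s A)
  · right
    refine ⟨a2, ?_⟩
    rw [a2, root'_negIdx, h1.1] at h2
    exact_mod_cast h2.symm
  · exact absurd h2 (int_between (h1.2 i a1 a2).1 (h1.2 i a1 a2).2)

/-- If `A` lies on the positive side of its wall with respect to a positive root, then the alcove on
the negative side is the neighbour of `A`. -/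
lemma isNegAlcove_iff_of_pos {s : simpleRefl b} {A C : Alcove P} (h : b.IsPos (wallIdx s A)) :
    IsNegAlcove b (wall b s A) C ↔ C = nbr s A := by
  have hw := isWallAt s A
  constructor
  · rintro ⟨h1, β, n, h2, h3⟩
    refine (eq_or_eq_of_wall_subset h1).resolve_left ?_
    rintro rfl
    rcases eq_wallIdx_of_const h2 with ⟨e1, e2⟩ | ⟨e1, -⟩
    · obtain ⟨v, hv⟩ := alcove_nonempty C
      have a1 := h3 v hv
      have a2 := fl_lt hv β
      rw [e1, hw.fl_self] at a2
      rw [e1, e2] at a1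
      linarith
    · have := β.2
      rw [e1, isPos_negIdx] at this
      exact this h
  · rintro rfl
    refine ⟨by rw [← wall_nbr]; exact wall_subset_cl s _, ⟨_, h⟩, wallLev s A,
      fun v hv => (mem_wall_iff.mp hv).1, fun v hv => ?_⟩
    have := lt_fl hv (wallIdx s A)
    rw [hw.fl_nbr] at this
    push_cast at this
    linarith

lemma isPosAlcove_iff_of_pos {s : simpleRefl b} {A C : Alcove P} (h : b.IsPos (wallIdx s A)) :
    IsPosAlcove b (wall b s A) C ↔ C = A := by
  have hw := isWallAt s A
  constructor
  · rintro ⟨h1, β, n, h2, h3⟩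
    refine (eq_or_eq_of_wall_subset h1).resolve_right ?_
    rintro rfl
    rcases eq_wallIdx_of_const h2 with ⟨e1, e2⟩ | ⟨e1, -⟩
    · obtain ⟨v, hv⟩ := alcove_nonempty (nbr s A)
      have a1 := h3 v hv
      have a2 := lt_fl hv β
      rw [e1, hw.fl_nbr] at a2
      rw [e1, e2] at a1
      push_cast at a2
      linarith
    · have := β.2
      rw [e1, isPos_negIdx] at this
      exact this h
  · rintro rfl
    refine ⟨wall_subset_cl s _, ⟨_, h⟩, wallLev s C,
      fun v hv => (mem_wall_iff.mp hv).1, fun v hv => ?_⟩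
    have := fl_lt hv (wallIdx s C)
    rwa [hw.fl_self] at this

lemma negAlcove_of_pos {s : simpleRefl b} {A : Alcove P} (h : b.IsPos (wallIdx s A)) :
    negAlcove b s A = nbr s A := by
  have : ∃ C, IsNegAlcove b (wall b s A) C := ⟨_, (isNegAlcove_iff_of_pos h).mpr rfl⟩
  exact (isNegAlcove_iff_of_pos h).mp (@Classical.epsilon_spec_aux _ ⟨A⟩ _ this)

lemma posAlcove_of_pos {s : simpleRefl b} {A : Alcove P} (h : b.IsPos (wallIdx s A)) :
    posAlcove b s A = A := by
  have : ∃ C, IsPosAlcove b (wall b s A) C := ⟨_, (isPosAlcove_iff_of_pos h).mpr rfl⟩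
  exact (isPosAlcove_iff_of_pos h).mp (@Classical.epsilon_spec_aux _ ⟨A⟩ _ this)

lemma isPos_wallIdx_nbr {s : simpleRefl b} {A : Alcove P} :
    b.IsPos (wallIdx s (nbr s A)) ↔ ¬ b.IsPos (wallIdx s A) := by
  rw [wallIdx_nbr, isPos_negIdx]

lemma negAlcove_nbr (s : simpleRefl b) (A : Alcove P) : negAlcove b s (nbr s A) = negAlcove b s A := by
  unfold negAlcove
  rw [wall_nbr]

lemma posAlcove_nbr (s : simpleRefl b) (A : Alcove P) : posAlcove b s (nbr s A) = posAlcove b s A := by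
  unfold posAlcove
  rw [wall_nbr]

lemma negAlcove_of_not_pos {s : simpleRefl b} {A : Alcove P} (h : ¬ b.IsPos (wallIdx s A)) :
    negAlcove b s A = A := by
  rw [← negAlcove_nbr, negAlcove_of_pos (isPos_wallIdx_nbr.mpr h), nbr_nbr]

lemma posAlcove_of_not_pos {s : simpleRefl b} {A : Alcove P} (h : ¬ b.IsPos (wallIdx s A)) :
    posAlcove b s A = nbr s A := by
  rw [← posAlcove_nbr, posAlcove_of_pos (isPos_wallIdx_nbr.mpr h)]

lemma nbr_ne (s : simpleRefl b) (A : Alcove P) : nbr s A ≠ A := by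
  intro h
  have h1 := (isWallAt s A).fl_self
  have h2 := (isWallAt s A).fl_nbr
  rw [h] at h2
  omega

/-- The reflection `β ↑` fixes the wall of type `s` of `A` exactly if this wall lies in some
`H_{β,n}`. -/
lemma upSet_wall_eq_iff {s : simpleRefl b} {A : Alcove P} {i : ι} :
    upSet P i (wall b s A) = wall b s A ↔ i = wallIdx s A ∨ i = negIdx P (wallIdx s A) := by
  obtain ⟨u, hu⟩ := wall_nonempty s A
  have hconst : ∀ n : ℤ, (∀ v ∈ wall b s A, P.root' i v = n) →
      upSet P i (wall b s A) = wall b s A := by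
    intro n h
    have h1 : upIdx P i (wall b s A) = n := by
      refine IsLeast.csInf_eq ⟨fun v hv => (h v hv).le, fun m hm => ?_⟩
      have := hm u hu
      rw [h u hu] at this
      exact_mod_cast this
    rw [upSet, h1]
    have h2 : ∀ v ∈ wall b s A, affRefl P i n v = v := by
      intro v hv
      rw [affRefl_apply, h v hv, sub_self, zero_smul, sub_zero]
    ext v
    constructor
    · rintro ⟨v, hv, rfl⟩; rw [h2 v hv]; exact hv
    · intro hv; exact ⟨v, hv, h2 v hv⟩
  constructor
  · intro h
    by_contra! hc
    have hin := fun v (hv : v ∈ wall b s A) => (mem_wall_iff.mp hv).2 i hc.1 hc.2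
    have h1 : upIdx P i (wall b s A) = fl i A + 1 := by
      refine IsLeast.csInf_eq ⟨fun v hv => by push_cast; exact (hin v hv).2.le, fun m hm => ?_⟩
      have h2 : (fl i A : ℚ) < m := (hin u hu).1.trans_le (hm u hu)
      exact_mod_cast h2
    have h2 : affRefl P i (fl i A + 1) u ∈ wall b s A := by
      rw [← h, upSet, h1]
      exact ⟨u, hu, rfl⟩
    have h3 := (hin _ h2).2
    rw [root_affRefl_self] at h3
    have h4 := (hin u hu).2
    push_cast at h3
    linarith
  · rintro (h | h)
    · exact hconst (wallLev s A) fun v hv => by rw [h]; exact (mem_wall_iff.mp hv).1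
    · refine hconst (-wallLev s A) fun v hv => ?_
      rw [h, root'_negIdx, (mem_wall_iff.mp hv).1]; push_cast; rfl

end Walls


/-! ### Roots modulo the characteristic -/

section GKM

variable {ι V N : Type*} [Finite ι] [AddCommGroup V] [Module ℚ V] [AddCommGroup N] [Module ℚ N]
variable {P : RootPairing ι ℚ V N} [P.IsRootSystem] [P.IsCrystallographic] [P.IsReduced]
  [P.IsIrreducible] (b : P.Base)

lemma pairingIn_of_root {i j m n : ι} {x y : ℤ} (h : P.root m = x • P.root i + y • P.root j) :
    P.pairingIn ℤ m n = x * P.pairingIn ℤ i n + y * P.pairingIn ℤ j n := by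
  have e : ∀ i, ((P.pairingIn ℤ i n : ℤ) : ℚ) = P.root' i (P.coroot n) := fun i => by
    simpa using P.algebraMap_pairingIn ℤ i n
  have : ((P.pairingIn ℤ m n : ℤ) : ℚ) = ((x * P.pairingIn ℤ i n + y * P.pairingIn ℤ j n : ℤ) : ℚ) := by
    push_cast
    rw [e, e, e, RootPairing.root', h]
    simp [RootPairing.root']
  exact_mod_cast this

lemma pairingIn_of_coroot {i j m n : ι} {x y : ℤ}
    (h : P.coroot m = x • P.coroot i + y • P.coroot j) :
    P.pairingIn ℤ n m = x * P.pairingIn ℤ n i + y * P.pairingIn ℤ n j := by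
  have e : ∀ i, ((P.pairingIn ℤ n i : ℤ) : ℚ) = P.root' n (P.coroot i) := fun i => by
    simpa using P.algebraMap_pairingIn ℤ n i
  have : ((P.pairingIn ℤ n m : ℤ) : ℚ) = ((x * P.pairingIn ℤ n i + y * P.pairingIn ℤ n j : ℤ) : ℚ) := by
    push_cast
    rw [e, e, e, h]
    simp
  exact_mod_cast this

/-- Two roots whose pairings are `-1` span a system of type `A₂`. -/
lemma rank_two_sum {a c : ι} (h1 : P.pairingIn ℤ a c = -1) (h2 : P.pairingIn ℤ c a = -1) :
    P.root (P.reflectionPerm a c) = (1 : ℤ) • P.root a + (1 : ℤ) • P.root c ∧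
    P.coroot (P.reflectionPerm a c) = (1 : ℤ) • P.coroot a + (1 : ℤ) • P.coroot c := by
  have e1 : P.pairing c a = -1 := by
    rw [← P.algebraMap_pairingIn ℤ, h2]; simp
  have e2 : P.pairing a c = -1 := by
    rw [← P.algebraMap_pairingIn ℤ, h1]; simp
  constructor
  · rw [RootPairing.root_reflectionPerm, RootPairing.reflection_apply_root, e1]; module
  · rw [RootPairing.coroot_reflectionPerm, RootPairing.coreflection_apply_coroot, e2]; module

/-- The admissible pairs of pairings `(⟨a, n^∨⟩, ⟨n, a^∨⟩)`, `(⟨c, n^∨⟩, ⟨n, c^∨⟩)` and those of `a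
+ c`, outside type `G₂`, are compatible with a congruence modulo `3` only if both vanish. -/
lemma two_root_relation {x u y v : ℤ}
    (h1 : (x, u) ∈ ({(0, 0), (1, 1), (-1, -1), (1, 2), (2, 1), (-1, -2), (-2, -1), (1, 3), (3, 1),
      (-1, -3), (-3, -1)} : Set (ℤ × ℤ)))
    (h2 : (y, v) ∈ ({(0, 0), (1, 1), (-1, -1), (1, 2), (2, 1), (-1, -2), (-2, -1), (1, 3), (3, 1),
      (-1, -3), (-3, -1)} : Set (ℤ × ℤ)))
    (h3 : (x + y, u + v) ∈ ({(0, 0), (1, 1), (-1, -1), (1, 2), (2, 1), (-1, -2), (-2, -1), (1, 3),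
      (3, 1), (-1, -3), (-3, -1)} : Set (ℤ × ℤ)))
    (hx : x ≠ 3 ∧ x ≠ -3) (hxy : x + y ≠ 3 ∧ x + y ≠ -3)
    (hd : (3 : ℤ) ∣ x - y) : x = 0 ∧ y = 0 := by
  simp only [Set.mem_insert_iff, Set.mem_singleton_iff, Prod.mk.injEq] at h1 h2 h3
  rcases h1 with ⟨rfl, rfl⟩ | ⟨rfl, rfl⟩ | ⟨rfl, rfl⟩ | ⟨rfl, rfl⟩ | ⟨rfl, rfl⟩ | ⟨rfl, rfl⟩ |
    ⟨rfl, rfl⟩ | ⟨rfl, rfl⟩ | ⟨rfl, rfl⟩ | ⟨rfl, rfl⟩ | ⟨rfl, rfl⟩ <;> omega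

lemma not_three_of_not_isG2 (hG : ¬ P.IsG2) (i j : ι) :
    P.pairingIn ℤ i j ≠ 3 ∧ P.pairingIn ℤ i j ≠ -3 := by
  have := (P.not_isG2_iff_isNotG2.mp hG).pairingIn_mem_zero_one_two i j
  simp only [Set.mem_insert_iff, Set.mem_singleton_iff] at this
  omega

/-- A root outside the `A₂`-subsystem spanned by `α_a` and `α_c` is orthogonal to it, if all coroots
take congruent values modulo `3` on `α_a` and `α_c`. -/
lemma orthogonal_of_congruent (hG : ¬ P.IsG2) {a c : ι} (h1 : P.pairingIn ℤ a c = -1)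
    (h2 : P.pairingIn ℤ c a = -1) (h3 : ∀ n, (3 : ℤ) ∣ P.pairingIn ℤ a n - P.pairingIn ℤ c n) {n : ι}
    (ha : P.root n ≠ P.root a ∧ P.root n ≠ - P.root a)
    (hc : P.root n ≠ P.root c ∧ P.root n ≠ - P.root c)
    (hac : P.root n ≠ P.root a + P.root c ∧ P.root n ≠ -(P.root a + P.root c)) :
    P.pairingIn ℤ a n = 0 ∧ P.pairingIn ℤ c n = 0 := by
  obtain ⟨e1, e2⟩ := rank_two_sum h1 h2
  have key : ∀ i, P.root n ≠ P.root i ∧ P.root n ≠ - P.root i → _ := fun i hi =>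
    P.pairingIn_pairingIn_mem_set_of_isCrystal_of_isRed' (i := i) (j := n) hi.1.symm
      (fun h => hi.2 (by rw [h, neg_neg]))
  have t1 := key a ha
  have t2 := key c hc
  have t3 := key (P.reflectionPerm a c) (by rw [e1, one_smul, one_smul]; exact hac)
  have n3 := not_three_of_not_isG2 hG (P.reflectionPerm a c) n
  rw [pairingIn_of_root e1, one_mul, one_mul] at n3 t3
  rw [pairingIn_of_coroot e2, one_mul, one_mul] at t3
  exact two_root_relation t1 t2 t3 (not_three_of_not_isG2 hG a n)
    n3 (h3 n)

/-- If all coroots take congruent values modulo `3` on two roots `α_a` and `α_c` with pairings `-1`,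
then the root system is of type `A₂`: by irreducibility,
no root is orthogonal to both.
-/
lemma isTypeA2_of_congruent (hG : ¬ P.IsG2) {a c : ι} (h1 : P.pairingIn ℤ a c = -1)
    (h2 : P.pairingIn ℤ c a = -1)
    (h3 : ∀ n, (3 : ℤ) ∣ P.pairingIn ℤ a n - P.pairingIn ℤ c n) : IsTypeA2 b := by
  set U : Submodule ℚ V := Submodule.span ℚ {P.root a, P.root c} with hU
  have haU : P.root a ∈ U := Submodule.subset_span (by simp)
  have hcU : P.root c ∈ U := Submodule.subset_span (by simp)
  have horth : ∀ n, P.root n ∉ U → P.pairingIn ℤ a n = 0 ∧ P.pairingIn ℤ c n = 0 := by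
    intro n hn
    refine orthogonal_of_congruent hG h1 h2 h3 ⟨?_, ?_⟩ ⟨?_, ?_⟩ ⟨?_, ?_⟩ <;> intro h <;>
      apply hn <;> rw [h]
    · exact haU
    · exact neg_mem haU
    · exact hcU
    · exact neg_mem hcU
    · exact add_mem haU hcU
    · exact neg_mem (add_mem haU hcU)
  -- the pairings are integers, but the reflections are stated over `ℚ`
  have hq : ∀ i j, ((P.pairingIn ℤ i j : ℤ) : ℚ) = P.pairing i j := fun i j => by
    simpa using P.algebraMap_pairingIn ℤ i j
  -- every reflection maps the span of the two roots to itself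
  have hUtop : U = ⊤ := by
    refine RootPairing.IsIrreducible.eq_top_of_invtSubmodule_reflection (P := P) U (fun n => ?_) ?_
    · rw [Module.End.mem_invtSubmodule, hU, Submodule.span_le]
      by_cases hn : P.root n ∈ U
      · rintro x (rfl | rfl)
        · change P.reflection n (P.root a) ∈ U
          rw [RootPairing.reflection_apply_root]
          exact sub_mem haU (Submodule.smul_mem _ _ hn)
        · change P.reflection n (P.root c) ∈ U
          rw [RootPairing.reflection_apply_root]
          exact sub_mem hcU (Submodule.smul_mem _ _ hn)
      · obtain ⟨e1, e2⟩ := horth n hn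
        rintro x (rfl | rfl)
        · change P.reflection n (P.root a) ∈ U
          rw [RootPairing.reflection_apply_root, ← hq, e1]
          simpa using haU
        · change P.reflection n (P.root c) ∈ U
          rw [RootPairing.reflection_apply_root, ← hq, e2]
          simpa using hcU
    · intro h
      rw [h, Submodule.mem_bot] at haU
      exact P.ne_zero a haU
  have hall : ∀ n, ¬ (P.pairingIn ℤ a n = 0 ∧ P.pairingIn ℤ c n = 0) := by
    rintro n ⟨e1, e2⟩
    have hker : U ≤ LinearMap.ker (P.coroot' n) := by
      rw [hU, Submodule.span_le]
      rintro x (rfl | rfl)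
      · change P.pairing a n = 0
        rw [← hq, e1]; simp
      · change P.pairing c n = 0
        rw [← hq, e2]; simp
    have h4 : P.root n ∈ LinearMap.ker (P.coroot' n) := hker (by rw [hUtop]; trivial)
    have h5 : P.coroot' n (P.root n) = 2 := P.root_coroot_two n
    rw [LinearMap.mem_ker, h5] at h4
    norm_num at h4
  have hli : LinearIndependent ℚ ![P.root a, P.root c] := by
    apply RootPairing.IsReduced.linearIndependent P
    · rintro rfl
      rw [RootPairing.pairingIn_same] at h1
      norm_num at h1
    · intro h
      have : a = negIdx P c := P.root.injective (by rw [h, root_negIdx])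
      have h5 : ((P.pairingIn ℤ a c : ℤ) : ℚ) = -2 := by
        rw [hq, ← P.root_coroot_eq_pairing, h, map_neg, LinearMap.neg_apply]
        have := P.root_coroot_two c
        rw [this]
      have : P.pairingIn ℤ a c = -2 := by exact_mod_cast h5
      omega
  have hrank : Module.finrank ℚ V = 2 := by
    have := finrank_span_eq_card hli
    rw [Matrix.range_cons, Matrix.range_cons, Matrix.range_empty, Set.union_empty,
      Set.singleton_union, ← hU, hUtop, finrank_top] at this
    simpa using this
  have hcard : Fintype.card b.support = 2 := by
    rw [← hrank, Module.finrank_eq_card_basis b.toWeightBasis]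
  -- a root is one of the six roots of the subsystem
  have hsix : ∀ n, (∃ x y : ℤ, P.root n = x • P.root a + y • P.root c ∧
      P.coroot n = x • P.coroot a + y • P.coroot c ∧
      ((x, y) = (1, 0) ∨ (x, y) = (-1, 0) ∨ (x, y) = (0, 1) ∨ (x, y) = (0, -1) ∨ (x, y) = (1, 1) ∨
        (x, y) = (-1, -1))) := by
    intro n
    obtain ⟨e1, e2⟩ := rank_two_sum h1 h2
    have hcor : ∀ i, P.root n = P.root i → P.coroot n = P.coroot i := fun i h => by
      rw [P.root.injective h]
    have hcor' : ∀ i, P.root n = - P.root i → P.coroot n = - P.coroot i := fun i h => by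
      have : n = negIdx P i := P.root.injective (by rw [h, root_negIdx])
      rw [this, coroot_negIdx]
    by_contra hc
    push Not at hc
    refine hall n (orthogonal_of_congruent hG h1 h2 h3 ⟨fun h => ?_, fun h => ?_⟩
      ⟨fun h => ?_, fun h => ?_⟩ ⟨fun h => ?_, fun h => ?_⟩)
    · exact (hc 1 0 (by rw [h]; module) (by rw [hcor _ h]; module)).1 rfl
    · exact (hc (-1) 0 (by rw [h]; module) (by rw [hcor' _ h]; module)).2.1 rfl
    · exact (hc 0 1 (by rw [h]; module) (by rw [hcor _ h]; module)).2.2.1 rfl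
    · exact (hc 0 (-1) (by rw [h]; module) (by rw [hcor' _ h]; module)).2.2.2.1 rfl
    · refine (hc 1 1 (by rw [h]; module) ?_).2.2.2.2.1 rfl
      rw [hcor (P.reflectionPerm a c) (by rw [h, e1]; module), e2]
    · refine (hc (-1) (-1) (by rw [h]; module) ?_).2.2.2.2.2 rfl
      rw [hcor' (P.reflectionPerm a c) (by rw [h, e1]; module), e2]; module
  have hoff : ∀ i j : b.support, i ≠ j → P.pairingIn ℤ i j = -1 := by
    intro i j hij
    obtain ⟨x, y, r1, -, hx⟩ := hsix i
    obtain ⟨z, w, r2, r3, hz⟩ := hsix j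
    have h6 : P.pairingIn ℤ i j = 2 * x * z - x * w - y * z + 2 * y * w := by
      rw [pairingIn_of_root r1, pairingIn_of_coroot r3, pairingIn_of_coroot r3, h1, h2,
        RootPairing.pairingIn_same, RootPairing.pairingIn_same]
      ring
    have h7 : P.pairingIn ℤ i j ≤ 0 := b.cartanMatrix_le_zero_of_ne i j hij
    have h8 : ¬ (x = z ∧ y = w) := by
      rintro ⟨rfl, rfl⟩
      exact hij (Subtype.ext (P.root.injective (by rw [r1, r2])))
    have h9 : ¬ (x = -z ∧ y = -w) := by
      rintro ⟨rfl, rfl⟩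
      have hn : i.1 = negIdx P j.1 := P.root.injective (by rw [root_negIdx, r1, r2]; module)
      have := b.isPos_of_mem_support i.2
      rw [hn, isPos_negIdx] at this
      exact this (b.isPos_of_mem_support j.2)
    rw [h6] at h7 ⊢
    simp only [Prod.mk.injEq] at hx hz
    rcases hx with ⟨rfl, rfl⟩ | ⟨rfl, rfl⟩ | ⟨rfl, rfl⟩ | ⟨rfl, rfl⟩ | ⟨rfl, rfl⟩ | ⟨rfl, rfl⟩ <;>
      rcases hz with ⟨rfl, rfl⟩ | ⟨rfl, rfl⟩ | ⟨rfl, rfl⟩ | ⟨rfl, rfl⟩ | ⟨rfl, rfl⟩ | ⟨rfl, rfl⟩ <;>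
      omega
  refine ⟨Fintype.equivFinOfCardEq hcard, ?_⟩
  set e := Fintype.equivFinOfCardEq hcard
  have hdiag : ∀ i j : Fin 2, b.cartanMatrix.reindex e e i j = if i = j then 2 else -1 := by
    intro i j
    change P.pairingIn ℤ (e.symm i) (e.symm j) = _
    split_ifs with h
    · rw [h, RootPairing.pairingIn_same]
    · exact hoff _ _ (fun hh => h (e.symm.injective hh))
  ext i j
  rw [hdiag]
  fin_cases i <;> fin_cases j <;> rfl

variable {k : Type*} [Field k]

/-- Distinct positive roots are linearly independent as functions on the coroots modulo the
characteristic. -/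
lemma independent_of_char (h2 : ringChar k ≠ 2) (h3 : P.IsG2 ∨ IsTypeA2 b → ringChar k ≠ 3) {i j : ι}
    (hij : P.root i ≠ P.root j) (hij' : P.root i ≠ - P.root j) {x y : k}
    (h : ∀ n, x * (P.pairingIn ℤ i n : k) + y * (P.pairingIn ℤ j n : k) = 0) : x = 0 ∧ y = 0 := by
  have two : (2 : k) ≠ 0 := fun h => h2 (CharP.ringChar_of_prime_eq_zero Nat.prime_two (by exact_mod_cast h))
  have e1 := h i
  have e2 := h j
  rw [RootPairing.pairingIn_same] at e1 e2
  have ht := P.pairingIn_pairingIn_mem_set_of_isCrystal_of_isRed' i j hij hij'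
  simp only [Set.mem_insert_iff, Set.mem_singleton_iff, Prod.mk.injEq] at ht
  set p := P.pairingIn ℤ i j
  set q := P.pairingIn ℤ j i
  -- the determinant of the two equations is `4 - p q`
  have e3 : (4 - (p * q : ℤ) : k) * y = 0 := by
    push_cast at e1 e2 ⊢
    linear_combination 2 * e2 - (p : k) * e1
  have fin : y = 0 → x = 0 ∧ y = 0 := fun hy => by
    rw [hy, zero_mul, add_zero] at e1
    exact ⟨(mul_eq_zero.mp e1).resolve_right (by exact_mod_cast two), hy⟩
  by_cases hpq : (4 - (p * q : ℤ) : k) = 0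
  swap
  · exact fin ((mul_eq_zero.mp e3).resolve_left hpq)
  by_contra hne
  have hy : y ≠ 0 := fun h => hne (fin h)
  -- only the value `1` of the product of the two pairings remains, in characteristic `3`
  have hcase : (p = 1 ∧ q = 1) ∨ (p = -1 ∧ q = -1) := by
    rcases ht with ⟨a1, a2⟩ | h | h | ⟨a1, a2⟩ | ⟨a1, a2⟩ | ⟨a1, a2⟩ | ⟨a1, a2⟩ | ⟨a1, a2⟩ |
      ⟨a1, a2⟩ | ⟨a1, a2⟩ | ⟨a1, a2⟩
    · rw [a1, a2] at hpq
      exfalso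
      apply two
      have : (2 : k) * 2 = 0 := by push_cast at hpq; linear_combination hpq
      exact mul_self_eq_zero.mp this
    · exact Or.inl h
    · exact Or.inr h
    all_goals
      exfalso
      rw [a1, a2] at hpq
      push_cast at hpq
      first
        | exact two (by linear_combination hpq)
        | exact one_ne_zero (α := k) (by linear_combination hpq)
  have three : (3 : k) = 0 := by
    rcases hcase with ⟨a1, a2⟩ | ⟨a1, a2⟩ <;> rw [a1, a2] at hpq <;> push_cast at hpq <;>
      linear_combination hpq
  have hc3 : ringChar k = 3 :=
    CharP.ringChar_of_prime_eq_zero Nat.prime_three (by exact_mod_cast three)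
  have hn : ¬ (P.IsG2 ∨ IsTypeA2 b) := fun h => h3 h hc3
  push Not at hn
  have : CharP k 3 := ringChar.of_eq hc3
  have hdvd : ∀ z : ℤ, y * (z : k) = 0 → (3 : ℤ) ∣ z := fun z hz => by
    have := (mul_eq_zero.mp hz).resolve_left hy
    exact (CharP.intCast_eq_zero_iff k 3 z).mp this
  rcases hcase with ⟨a1, a2⟩ | ⟨a1, a2⟩
  · -- replace `j` by its negative
    refine hn.2 (isTypeA2_of_congruent b hn.1 (a := i) (c := negIdx P j) ?_ ?_ fun n => hdvd _ ?_)
    · rw [pairingIn_of_coroot (m := negIdx P j) (i := j) (j := j) (x := -1) (y := 0)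
        (by rw [coroot_negIdx]; module)]
      change -1 * p + 0 * p = -1
      omega
    · rw [pairingIn_of_root (m := negIdx P j) (i := j) (j := j) (x := -1) (y := 0)
        (by rw [root_negIdx]; module)]
      change -1 * q + 0 * q = -1
      omega
    · rw [pairingIn_of_root (m := negIdx P j) (i := j) (j := j) (x := -1) (y := 0)
        (by rw [root_negIdx]; module)]
      have := h n
      rw [a2] at e1
      push_cast at e1 ⊢
      linear_combination this + (P.pairingIn ℤ i n : k) * (e1 - three * x)
  · refine hn.2 (isTypeA2_of_congruent b hn.1 a1 a2 fun n => hdvd _ ?_)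
    have := h n
    rw [a2] at e1
    push_cast at e1 ⊢
    linear_combination -this + (P.pairingIn ℤ i n : k) * (-e1 + three * x)

end GKM


/-! ### Linear forms in the symmetric algebra -/

section LinearForms


variable {ι N : Type*} {V : Type v} [AddCommGroup V] [Module ℚ V] [AddCommGroup N] [Module ℚ N]
variable (k : Type u) [Field k] (P : RootPairing ι ℚ V N)

/-- The functional `⟨·, α_n^∨⟩` on the weight lattice. -/
def corootX (n : ι) : weightLattice P →ₗ[ℤ] ℤ :=
  AddMonoidHom.toIntLinearMap
    { toFun := fun x => (x.2 n).choose
      map_zero' := by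
        have h := ((0 : weightLattice P).2 n).choose_spec
        have h' : P.coroot' n ((0 : weightLattice P) : V) = 0 := map_zero _
        exact_mod_cast h.symm.trans h'
      map_add' := fun x y => by
        have h1 := (x.2 n).choose_spec
        have h2 := (y.2 n).choose_spec
        have h3 := ((x + y).2 n).choose_spec
        have h4 : P.coroot' n ((x + y : weightLattice P) : V) = P.coroot' n x + P.coroot' n y :=
          map_add _ _ _
        rw [h1, h2] at h4
        exact_mod_cast h3.symm.trans h4 }

/-- The functional `⟨·, α_n^∨⟩` on `X_k`. -/
def corootK (n : ι) : Xk k P →ₗ[k] k :=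
  (TensorProduct.AlgebraTensorModule.rid ℤ k k).toLinearMap ∘ₗ (corootX P n).baseChange k

/-- A root as an element of `X_k`. -/
def rootK [P.IsCrystallographic] (i : ι) : Xk k P := 1 ⊗ₜ[ℤ] rootX P i

variable {k P}

lemma corootK_rootK [P.IsCrystallographic] (i n : ι) :
    corootK k P n (rootK k P i) = (P.pairingIn ℤ i n : k) := by
  have h1 : corootX P n (rootX P i) = P.pairingIn ℤ i n := by
    have h := ((rootX P i).2 n).choose_spec
    have h2 : ((P.pairingIn ℤ i n : ℤ) : ℚ) = P.pairing i n := by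
      simpa using P.algebraMap_pairingIn ℤ i n
    have h3 : P.coroot' n (P.root i) = P.pairing i n := rfl
    change P.coroot' n (P.root i) = _ at h
    rw [h3, ← h2] at h
    exact_mod_cast h.symm
  simp [corootK, rootK, h1]

/-- A nonzero linear form is a variable in suitable coordinates, hence prime. -/
lemma prime_ι {ξ : Xk k P} (h : ξ ≠ 0) : Prime (SymmetricAlgebra.ι k (Xk k P) ξ) := by
  have hs : LinearIndepOn k id ({ξ} : Set (Xk k P)) := LinearIndepOn.singleton (v := id) h
  have hmem : ξ ∈ hs.extend (Set.subset_univ _) := hs.subset_extend _ rfl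
  let B := Module.Basis.extend hs
  have hB : B ⟨ξ, hmem⟩ = ξ := by simp [B]
  rw [← MulEquiv.prime_iff (SymmetricAlgebra.equivMvPolynomial B)]
  have : (SymmetricAlgebra.equivMvPolynomial B) (SymmetricAlgebra.ι k (Xk k P) ξ) =
      MvPolynomial.X ⟨ξ, hmem⟩ := by
    have := SymmetricAlgebra.equivMvPolynomial_ι_apply B ⟨ξ, hmem⟩
    rwa [hB] at this
  exact this ▸ MvPolynomial.X_prime

lemma not_ι_dvd {ξ η : Xk k P} (h : LinearIndependent k ![ξ, η]) :
    ¬ SymmetricAlgebra.ι k (Xk k P) ξ ∣ SymmetricAlgebra.ι k (Xk k P) η := by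
  have hs : LinearIndepOn k id ({ξ, η} : Set (Xk k P)) := by
    have := h.linearIndepOn_id
    simpa [Set.pair_comm] using this
  have hne : ξ ≠ η := fun e => by
    have := h.injective (a₁ := 0) (a₂ := 1) (by simpa using e)
    exact absurd this (by decide)
  have h1 : ξ ∈ hs.extend (Set.subset_univ _) := hs.subset_extend _ (by simp)
  have h2 : η ∈ hs.extend (Set.subset_univ _) := hs.subset_extend _ (by simp)
  let B := Module.Basis.extend hs
  have hX : ∀ ζ (hζ : ζ ∈ hs.extend (Set.subset_univ _)),
      (SymmetricAlgebra.equivMvPolynomial B) (SymmetricAlgebra.ι k (Xk k P) ζ) =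
      MvPolynomial.X ⟨ζ, hζ⟩ := by
    intro ζ hζ
    have hB : B ⟨ζ, hζ⟩ = ζ := by simp [B]
    have := SymmetricAlgebra.equivMvPolynomial_ι_apply B ⟨ζ, hζ⟩
    rwa [hB] at this
  intro hd
  have := map_dvd (SymmetricAlgebra.equivMvPolynomial B) hd
  rw [hX ξ h1, hX η h2, MvPolynomial.X_dvd_X] at this
  exact hne (congrArg Subtype.val this)

instance : UniqueFactorizationMonoid (Sk k P) :=
  (SymmetricAlgebra.equivMvPolynomial (Module.Basis.ofVectorSpace k (Xk k P))).symm.toMulEquiv.uniqueFactorizationMonoid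
    inferInstance

end LinearForms

/-! ### The rings of fractions -/

section Rings


variable {ι N : Type*} {V : Type v} [Finite ι] [AddCommGroup V] [Module ℚ V] [AddCommGroup N]
  [Module ℚ N]
variable (k : Type u) [Field k] {P : RootPairing ι ℚ V N} [P.IsRootSystem] [P.IsCrystallographic]
  [P.IsReduced] [P.IsIrreducible] (b : P.Base)

/-- The assumption on the characteristic: distinct positive roots are nonzero and pairwise
non-proportional in `X_k`. -/
structure GKM : Prop where
  ne_zero : ∀ i : ι, rootK k P i ≠ 0
  indep : ∀ α β : PosRoot b, α ≠ β → LinearIndependent k ![rootK k P α.1, rootK k P β.1]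

variable {k b}

/-- The assumption on the characteristic implies that the roots are nonzero and the positive roots
pairwise non-proportional over `k`. The coroots are integral on `X`, so they define linear forms on
`X ⊗ k`, on which this is tested. -/
lemma gkm_of_char (h2 : ringChar k ≠ 2) (h3 : P.IsG2 ∨ IsTypeA2 b → ringChar k ≠ 3) : GKM k b where
  ne_zero i h := by
    have h1 := corootK_rootK (k := k) (P := P) i i
    rw [h, map_zero, RootPairing.pairingIn_same] at h1
    exact h2 (CharP.ringChar_of_prime_eq_zero Nat.prime_two (by exact_mod_cast h1.symm))
  indep α β hαβ := by
    rw [LinearIndependent.pair_iff]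
    intro x y h
    have hne : P.root α.1 ≠ P.root β.1 := fun e => hαβ (Subtype.ext (P.root.injective e))
    have hne' : P.root α.1 ≠ - P.root β.1 := fun e => by
      have hn : α.1 = negIdx P β.1 := P.root.injective (by rw [root_negIdx, e])
      have := α.2
      rw [hn, isPos_negIdx] at this
      exact this β.2
    refine independent_of_char b h2 h3 hne hne' fun n => ?_
    have := congrArg (corootK k P n) h
    simpa [corootK_rootK] using this

lemma rootS_eq (i : ι) : rootS k P i = SymmetricAlgebra.ι k (Xk k P) (rootK k P i) := rfl

lemma rootS_negIdx (i : ι) : rootS k P (negIdx P i) = - rootS k P i := by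
  have : rootX P (negIdx P i) = - rootX P i := Subtype.ext (root_negIdx P i)
  rw [rootS, this, rootS, weightS, weightS, TensorProduct.tmul_neg, map_neg]

lemma root0_negIdx (i : ι) : root0 k b (negIdx P i) = - root0 k b i := by
  rw [root0, rootS_negIdx, map_neg, root0]

variable (hk : GKM k b)

include hk

lemma GKM.prime_rootS (i : ι) : Prime (rootS k P i) := prime_ι (hk.ne_zero i)

lemma GKM.rootMonoid_le : rootMonoid k b ≤ nonZeroDivisors (Sk k P) := by
  rw [rootMonoid, Submonoid.closure_le]
  rintro _ ⟨β, rfl⟩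
  exact mem_nonZeroDivisors_of_ne_zero (hk.prime_rootS β.1).ne_zero

lemma GKM.algebraMap_injective : Function.Injective (algebraMap (Sk k P) (S0 k b)) :=
  IsLocalization.injective (S0 k b) hk.rootMonoid_le

lemma GKM.isDomain : IsDomain (S0 k b) :=
  IsLocalization.isDomain_of_le_nonZeroDivisors (S0 k b) hk.rootMonoid_le

omit hk in
variable (k) in
/-- The multiplicative set generated by the positive roots different from `β`. -/
def rootMonoidNe (β : PosRoot b) : Submonoid (Sk k P) :=
  Submonoid.closure ((fun α : PosRoot b => rootS k P α.1) '' {α | α ≠ β})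

/-- The root `β` does not divide a product of positive roots different from `β`. -/
lemma GKM.not_dvd (β : PosRoot b) {m : Sk k P} (hm : m ∈ rootMonoidNe k β) :
    ¬ rootS k P β.1 ∣ m := by
  induction hm using Submonoid.closure_induction with
  | mem x hx =>
    obtain ⟨α, hα, rfl⟩ := hx
    exact not_ι_dvd (hk.indep β α (Ne.symm hα))
  | one => exact (hk.prime_rootS β.1).not_dvd_one
  | mul x y _ _ hx hy =>
    intro h
    rcases (hk.prime_rootS β.1).dvd_or_dvd h with h | h
    · exact hx h
    · exact hy h

omit hk in
lemma exists_inv_of_mem_rootMonoidNe {β : PosRoot b} {m : Sk k P} (hm : m ∈ rootMonoidNe k β) :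
    ∃ z ∈ Sβ k b β, algebraMap (Sk k P) (S0 k b) m * z = 1 := by
  induction hm using Submonoid.closure_induction with
  | mem x hx =>
    obtain ⟨α, hα, rfl⟩ := hx
    obtain ⟨z, hz⟩ := (isUnit_root0 k b α).exists_right_inv
    exact ⟨z, Algebra.subset_adjoin ⟨α, hα, by rw [mul_comm]; exact hz⟩, hz⟩
  | one => exact ⟨1, one_mem _, by simp⟩
  | mul x y _ _ hx hy =>
    obtain ⟨z, hz, h⟩ := hx
    obtain ⟨z', hz', h'⟩ := hy
    exact ⟨z * z', mul_mem hz hz', by rw [map_mul, mul_mul_mul_comm, h, h', one_mul]⟩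

omit hk in
/-- The elements of `S_k^β` are the fractions whose denominators are products of positive roots
different from `β`. -/
lemma exists_fraction {β : PosRoot b} {x : S0 k b} (hx : x ∈ Sβ k b β) :
    ∃ f : Sk k P, ∃ m ∈ rootMonoidNe k β, x * algebraMap _ _ m = algebraMap _ _ f := by
  induction hx using Algebra.adjoin_induction with
  | mem x hx =>
    obtain ⟨α, hα, h⟩ := hx
    exact ⟨1, rootS k P α.1, Submonoid.subset_closure ⟨α, hα, rfl⟩, by rw [map_one]; exact h⟩
  | algebraMap r => exact ⟨r, 1, one_mem _, by simp⟩
  | add x y _ _ hx hy =>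
    obtain ⟨f, m, hm, h⟩ := hx
    obtain ⟨g, n, hn, h'⟩ := hy
    refine ⟨f * n + g * m, m * n, mul_mem hm hn, ?_⟩
    simp only [map_mul, map_add]
    rw [← h, ← h']
    ring
  | mul x y _ _ hx hy =>
    obtain ⟨f, m, hm, h⟩ := hx
    obtain ⟨g, n, hn, h'⟩ := hy
    refine ⟨f * g, m * n, mul_mem hm hn, ?_⟩
    simp only [map_mul]
    rw [← h, ← h']
    ring

/-- The rings `S_k^β` intersect in `S_k`. -/
lemma GKM.mem_range_of_forall_mem {x : S0 k b} (hx : ∀ β, x ∈ Sβ k b β) :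
    ∃ f : Sk k P, algebraMap _ _ f = x := by
  obtain ⟨⟨f, m, hm⟩, h⟩ := IsLocalization.surj (rootMonoid k b) x
  simp only at h
  induction hm using Submonoid.closure_induction_left generalizing f with
  | one => exact ⟨f, by rw [← h, map_one, mul_one]⟩
  | mul_left y hy m hm ih =>
    obtain ⟨β, rfl⟩ := hy
    obtain ⟨g, n, hn, hg⟩ := exists_fraction (hx β)
    have h1 : g * (rootS k P β.1 * m) = f * n := by
      apply hk.algebraMap_injective
      simp only [map_mul] at h ⊢
      linear_combination (-(algebraMap (Sk k P) (S0 k b) (rootS k P β.1) *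
        algebraMap (Sk k P) (S0 k b) m)) * hg + algebraMap (Sk k P) (S0 k b) n * h
    -- a root `β` in the denominator cancels, because it does not divide the denominator of the
    -- fraction in `S_k^β`
    have h2 : rootS k P β.1 ∣ f * n := ⟨g * m, by rw [← h1]; ring⟩
    obtain ⟨f', rfl⟩ := ((hk.prime_rootS β.1).dvd_or_dvd h2).resolve_right (hk.not_dvd β hn)
    refine ih f' ?_
    have hu := isUnit_root0 k b β
    rw [← hu.mul_right_inj]
    rw [map_mul, map_mul] at h
    change _ = root0 k b β.1 * _ at h
    rw [← h, root0]
    ring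

/-- The root `β` is not invertible in `S_k^β`. -/
lemma GKM.not_isUnit (β : PosRoot b) {y : S0 k b} (hy : y ∈ Sβ k b β) : root0 k b β * y ≠ 1 := by
  intro h
  obtain ⟨g, n, hn, hg⟩ := exists_fraction hy
  refine hk.not_dvd β hn ⟨g, hk.algebraMap_injective ?_⟩
  rw [map_mul, ← hg, ← mul_assoc]
  change _ = root0 k b β * y * _
  rw [h, one_mul]

/-! ### The elements of degree zero -/

omit hk

variable (k P) in
/-- The grading of `S_k` recorded by a formal variable: `ξ ↦ ξ X²` for `ξ ∈ X_k`. -/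
def gradePoly (b : P.Base) : Sk k P →ₐ[k] Polynomial (S0 k b) :=
  SymmetricAlgebra.lift
    { toFun := fun ξ => Polynomial.C
        (algebraMap (Sk k P) (S0 k b) (SymmetricAlgebra.ι k (Xk k P) ξ)) * Polynomial.X ^ 2
      map_add' := fun x y => by simp [add_mul]
      map_smul' := fun c x => by
        rw [map_smul, Algebra.smul_def, Algebra.smul_def, map_mul, map_mul, mul_assoc]
        rfl }

lemma coactS_eq (f : Sk k P) : coactS k b f = (gradePoly k P b f).toLaurent := by
  induction f using SymmetricAlgebra.induction with
  | algebraMap c =>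
    rw [AlgHom.commutes, AlgHom.commutes]
    change LaurentPolynomial.C (algebraMap k (S0 k b) c) = (Polynomial.C (algebraMap k (S0 k b) c)).toLaurent
    rw [Polynomial.toLaurent_C]
  | ι ξ =>
    rw [coactS_ι, gradePoly, SymmetricAlgebra.lift_ι_apply]
    change _ = Polynomial.toLaurent (Polynomial.C _ * Polynomial.X ^ 2)
    rw [map_mul, Polynomial.toLaurent_C, Polynomial.toLaurent_X_pow]
    rfl
  | mul x y hx hy => rw [map_mul, hx, hy, map_mul, map_mul]
  | add x y hx hy => rw [map_add, hx, hy, map_add, map_add]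

variable (k P) in
/-- The augmentation `S_k → k`. -/
def augm : Sk k P →ₐ[k] k := SymmetricAlgebra.algebraMapInv

lemma gradePoly_coeff_zero (f : Sk k P) :
    (gradePoly k P b f).coeff 0 = algebraMap k (S0 k b) (augm k P f) := by
  rw [Polynomial.coeff_zero_eq_eval_zero]
  induction f using SymmetricAlgebra.induction with
  | algebraMap c =>
    rw [AlgHom.commutes, AlgHom.commutes]
    change (Polynomial.C (algebraMap k (S0 k b) c)).eval 0 = _
    rw [Polynomial.eval_C]
    rfl
  | ι ξ =>
    rw [augm, SymmetricAlgebra.algebraMapInv_ι, gradePoly, SymmetricAlgebra.lift_ι_apply]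
    change (Polynomial.C (algebraMap (Sk k P) (S0 k b) (SymmetricAlgebra.ι k (Xk k P) ξ)) *
      Polynomial.X ^ 2).eval 0 = _
    simp
  | mul x y hx hy => rw [map_mul, Polynomial.eval_mul, hx, hy, map_mul, map_mul]
  | add x y hx hy => rw [map_add, Polynomial.eval_add, hx, hy, map_add, map_add]

lemma toLaurent_coeff {R : Type*} [CommRing R] (p : Polynomial R) (n : ℕ) :
    p.toLaurent.coeff n = p.coeff n := by
  induction p using Polynomial.induction_on' with
  | add p q hp hq => rw [map_add, AddMonoidAlgebra.coeff_add, Finsupp.add_apply, hp, hq,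
      Polynomial.coeff_add]
  | monomial m r =>
    rw [Polynomial.toLaurent_C_mul_T, ← LaurentPolynomial.single_eq_C_mul_T,
      AddMonoidAlgebra.coeff_single, Polynomial.coeff_monomial, Finsupp.single_apply]
    simp

lemma coact_coeff (x : S0 k b) (n : ℤ) : (coact k b x).coeff n = comp (internal0 k b) n x := by
  induction x using graded_induction (internal0 k b) with
  | hom m y hy =>
    rw [coact_deg0 k b hy, ← LaurentPolynomial.single_eq_C_mul_T, AddMonoidAlgebra.coeff_single,
      comp_of_mem _ hy, Finsupp.single_apply]
  | zero => simp
  | add y z hy hz =>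
    rw [map_add, AddMonoidAlgebra.coeff_add, Finsupp.add_apply, hy, hz, map_add]

/-- The component of degree `0` of an element of `S_k` is its constant term. -/
lemma comp_zero_algebraMap (f : Sk k P) :
    comp (internal0 k b) 0 (algebraMap _ _ f) = algebraMap k (S0 k b) (augm k P f) := by
  rw [← coact_coeff, coact_of, coactS_eq, ← gradePoly_coeff_zero]
  exact toLaurent_coeff _ 0

lemma algebraMap_mem_deg0 (c : k) : algebraMap k (S0 k b) c ∈ deg0 k b 0 :=
  AddSubgroup.subset_closure ⟨c, [], [], by simp [Algebra.smul_def]; rfl, by simp⟩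

lemma algebraMap_mem_Sβ (c : k) (β : PosRoot b) : algebraMap k (S0 k b) c ∈ Sβ k b β :=
  Subalgebra.algebraMap_mem (Sβ k b β) (algebraMap k (Sk k P) c)

/-- An element of degree `0` that lies in all the rings `S_k^β` is a constant. -/
lemma GKM.exists_const (hk : GKM k b) {x : S0 k b} (h0 : x ∈ deg0 k b 0)
    (hx : ∀ β, x ∈ Sβ k b β) : ∃ c : k, algebraMap k (S0 k b) c = x := by
  obtain ⟨f, rfl⟩ := hk.mem_range_of_forall_mem hx
  refine ⟨augm k P f, ?_⟩
  rw [← comp_zero_algebraMap, comp_of_mem _ h0, if_pos rfl]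

/-! ### Inverses of roots -/

variable (k b) in
/-- The inverse of a root in `S_k^∅`. -/
def rinv (i : ι) : S0 k b := ((isUnit_root0' k b i).unit⁻¹ : (S0 k b)ˣ)

lemma root_mul_rinv (i : ι) : root0 k b i * rinv k b i = 1 := (isUnit_root0' k b i).mul_val_inv

lemma rinv_mul_root (i : ι) : rinv k b i * root0 k b i = 1 := (isUnit_root0' k b i).val_inv_mul

lemma rinv_eq_of_mul {i : ι} {x : S0 k b} (h : root0 k b i * x = 1) : rinv k b i = x := by
  rw [← mul_one (rinv k b i), ← h, ← mul_assoc, rinv_mul_root, one_mul]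

lemma rinv_negIdx (i : ι) : rinv k b (negIdx P i) = - rinv k b i :=
  rinv_eq_of_mul (by rw [root0_negIdx, neg_mul_neg, root_mul_rinv])

lemma weyl0_rinv (w : P.weylGroup) (i : ι) :
    weyl0 k b w (rinv k b i) = rinv k b (weylIdx P w i) :=
  (rinv_eq_of_mul (by rw [← weyl0_root, ← map_mul, root_mul_rinv, map_one])).symm

lemma posOf_eq (i : ι) : (posOf b i).1 = i ∨ (posOf b i).1 = negIdx P i := by
  unfold posOf
  split_ifs
  · exact Or.inl rfl
  · exact Or.inr rfl

lemma rinv_mem_deg0 (i : ι) : rinv k b i ∈ deg0 k b (-2) := by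
  rcases posOf_eq (b := b) i with h | h
  · exact inv_mem_deg0 k b (α := posOf b i) (by rw [h, rinv_mul_root])
  · have := inv_mem_deg0 k b (α := posOf b i) (x := rinv k b (posOf b i).1) (rinv_mul_root _)
    rw [h, rinv_negIdx] at this
    exact neg_mem_iff.mp this

lemma root0_mem_Sβ (i : ι) (β : PosRoot b) : root0 k b i ∈ Sβ k b β :=
  Subalgebra.algebraMap_mem _ _

lemma rinv_mem_Sβ {i : ι} {β : PosRoot b} (h1 : i ≠ β) (h2 : i ≠ negIdx P β) :
    rinv k b i ∈ Sβ k b β := by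
  rcases posOf_eq (b := b) i with h | h
  · refine Algebra.subset_adjoin ⟨posOf b i, fun e => h1 (by rw [← e, h]), ?_⟩
    rw [h, rinv_mul_root]
  · rw [← neg_mem_iff, ← rinv_negIdx]
    refine Algebra.subset_adjoin ⟨posOf b i, fun e => h2 (by rw [← e, h, negIdx_negIdx]), ?_⟩
    rw [h, rinv_mul_root]

end Rings


/-! ### Integral endomorphisms -/

section Integrality


variable {ι N : Type*} {V : Type v} [Finite ι] [AddCommGroup V] [Module ℚ V] [AddCommGroup N]
  [Module ℚ N]
variable {k : Type u} [Field k] {P : RootPairing ι ℚ V N} [P.IsRootSystem] [P.IsCrystallographic]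
  [P.IsReduced] [P.IsIrreducible] {b : P.Base}

variable (hk : GKM k b)

include hk

lemma GKM.rootMonoidNe_le (β : PosRoot b) : rootMonoidNe k β ≤ nonZeroDivisors (Sk k P) := by
  rw [rootMonoidNe, Submonoid.closure_le]
  rintro _ ⟨α, -, rfl⟩
  exact mem_nonZeroDivisors_of_ne_zero (hk.prime_rootS α.1).ne_zero

lemma GKM.isLocalization_Sβ (β : PosRoot b) : IsLocalization (rootMonoidNe k β) (Sβ k b β) where
  map_units := by
    rintro ⟨m, hm⟩
    obtain ⟨z, hz, h⟩ := exists_inv_of_mem_rootMonoidNe hm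
    exact IsUnit.of_mul_eq_one ⟨z, hz⟩ (Subtype.ext h)
  surj := by
    rintro ⟨x, hx⟩
    obtain ⟨f, m, hm, h⟩ := exists_fraction hx
    exact ⟨(f, ⟨m, hm⟩), Subtype.ext h⟩
  exists_of_eq := by
    intro x y h
    exact ⟨1, by rw [hk.algebraMap_injective (congrArg Subtype.val h)]⟩

lemma GKM.isIntegrallyClosed (β : PosRoot b) : IsIntegrallyClosed (Sβ k b β) := by
  have := hk.isLocalization_Sβ β
  exact isIntegrallyClosed_of_isLocalization _ (rootMonoidNe k β) (hk.rootMonoidNe_le β)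

/-- The rings `S_k^β` and `S_k^∅` have the same field of fractions. -/
lemma GKM.isFractionRing (β : PosRoot b) [IsDomain (S0 k b)] :
    IsFractionRing (Sβ k b β) (FractionRing (S0 k b)) := by
  have hinj : Function.Injective (algebraMap (S0 k b) (FractionRing (S0 k b))) :=
    IsFractionRing.injective _ _
  have : FaithfulSMul (Sβ k b β) (FractionRing (S0 k b)) := by
    rw [faithfulSMul_iff_algebraMap_injective]
    intro x y h
    exact Subtype.ext (hinj h)
  refine IsFractionRing.of_field _ _ fun z => ?_
  obtain ⟨a, d, hd, rfl⟩ := IsFractionRing.div_surjective (A := S0 k b) z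
  obtain ⟨⟨f, m⟩, hf⟩ := IsLocalization.surj (rootMonoid k b) a
  obtain ⟨⟨g, n⟩, hg⟩ := IsLocalization.surj (rootMonoid k b) d
  have hd0 : d ≠ 0 := nonZeroDivisors.ne_zero hd
  have hm0 : algebraMap (Sk k P) (S0 k b) m ≠ 0 := (IsLocalization.map_units _ m).ne_zero
  have hn0 : algebraMap (Sk k P) (S0 k b) n ≠ 0 := (IsLocalization.map_units _ n).ne_zero
  refine ⟨algebraMap _ _ (f * n), algebraMap _ _ (g * m), ?_⟩
  change _ = algebraMap (S0 k b) (FractionRing (S0 k b)) (algebraMap (Sk k P) (S0 k b) (f * n)) /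
    algebraMap (S0 k b) (FractionRing (S0 k b)) (algebraMap (Sk k P) (S0 k b) (g * m))
  simp only at hf hg
  rw [map_mul _ f, map_mul _ g, ← hf, ← hg, div_eq_div_iff, ← map_mul, ← map_mul]
  · congr 1; ring
  · exact (map_ne_zero_iff _ hinj).mpr hd0
  · exact (map_ne_zero_iff _ hinj).mpr (mul_ne_zero (mul_ne_zero hd0 hn0) hm0)

open Polynomial in
/-- An endomorphism of a free `S_k^∅`-module that is integral over all the rings `S_k^β` is integral
over `S_k`: its minimal polynomial has coefficients in the intersection of these rings. -/
lemma GKM.exists_monic {W : Type*} [AddCommGroup W] [Module (S0 k b) W] [Module.Finite (S0 k b) W]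
    [Module.Free (S0 k b) W] (g : Module.End (S0 k b) W)
    (h : ∀ β, ∃ p : (Sβ k b β)[X], p.Monic ∧ aeval g (p.map (algebraMap _ (S0 k b))) = 0) :
    ∃ p : (Sk k P)[X], p.Monic ∧ aeval g (p.map (algebraMap _ (S0 k b))) = 0 := by
  have := hk.isDomain
  classical
  let K := FractionRing (S0 k b)
  have hinj : Function.Injective (algebraMap (S0 k b) K) := IsFractionRing.injective _ _
  let B := Module.Free.chooseBasis (S0 k b) W
  let T := LinearMap.toMatrixAlgEquiv B
  let G : Matrix _ _ K := (Algebra.ofId (S0 k b) K).mapMatrix (T g)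
  have hG : ∀ q : (S0 k b)[X], aeval G (q.map (algebraMap (S0 k b) K)) = 0 ↔ aeval g q = 0 := by
    intro q
    rw [Polynomial.aeval_map_algebraMap, Polynomial.aeval_algHom_apply,
      Polynomial.aeval_algHom_apply T]
    have h1 : Function.Injective ((Algebra.ofId (S0 k b) K).mapMatrix :
        Matrix (Module.Free.ChooseBasisIndex (S0 k b) W) (Module.Free.ChooseBasisIndex (S0 k b) W)
          (S0 k b) →ₐ[S0 k b] _) := Matrix.map_injective hinj
    rw [map_eq_zero_iff _ h1]
    exact map_eq_zero_iff _ T.injective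
  -- `S_k^β` is integrally closed, so a monic divisor over `K` of a monic polynomial has
  -- coefficients in it
  have hint : ∀ β, minpoly K G ∈ Polynomial.lifts (algebraMap (Sβ k b β) K) := by
    intro β
    obtain ⟨p, hp, hpg⟩ := h β
    have := hk.isIntegrallyClosed β
    have := hk.isFractionRing β
    rw [← hG, Polynomial.map_map] at hpg
    have hd : minpoly K G ∣ p.map (algebraMap (Sβ k b β) K) := minpoly.dvd K G hpg
    obtain ⟨q, hq⟩ := IsIntegrallyClosed.eq_map_mul_C_of_dvd K hp hd
    have hm : (minpoly K G).Monic := minpoly.monic (Algebra.IsIntegral.isIntegral G)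
    rw [hm.leadingCoeff, C_1, mul_one] at hq
    exact ⟨q, hq⟩
  have hm : (minpoly K G).Monic := minpoly.monic (Algebra.IsIntegral.isIntegral G)
  have hlift : minpoly K G ∈ Polynomial.lifts ((algebraMap (S0 k b) K).comp (algebraMap (Sk k P) _)) := by
    rw [Polynomial.lifts_iff_coeff_lifts]
    intro n
    have h1 : ∀ β, ∃ x ∈ Sβ k b β, algebraMap (S0 k b) K x = (minpoly K G).coeff n := by
      intro β
      obtain ⟨x, hx⟩ := (Polynomial.lifts_iff_coeff_lifts _).mp (hint β) n
      exact ⟨x, x.2, hx⟩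
    have hne : Nonempty (PosRoot b) := by
      obtain ⟨i, -⟩ := exists_isHighestRoot b
      exact ⟨posOf b i⟩
    obtain ⟨x, -, hx⟩ := h1 hne.some
    have h2 : ∀ β, x ∈ Sβ k b β := by
      intro β
      obtain ⟨y, hy, hxy⟩ := h1 β
      rwa [hinj (hx.trans hxy.symm)]
    obtain ⟨f, hf⟩ := hk.mem_range_of_forall_mem h2
    exact ⟨f, by rw [RingHom.comp_apply, hf, hx]⟩
  obtain ⟨p, hp, -, hpm⟩ := Polynomial.lifts_and_natDegree_eq_and_monic hlift hm
  refine ⟨p, hpm, ?_⟩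
  rw [← hG, Polynomial.map_map, hp]
  exact minpoly.aeval K G

omit hk

/-- The component of degree `n` of `c x`, for `x` of degree `n`. -/
lemma Obj.comp_smul_of_mem (M : Obj k b) {A : Alcove P} {n : ℤ} {x : M.carrier A} (hx : x ∈ M.deg A n)
    (c : S0 k b) : comp (M.internal A) n (c • x) = comp (internal0 k b) 0 c • x := by
  induction c using graded_induction (internal0 k b) with
  | hom m y hy =>
    rw [comp_of_mem _ (M.smul_mem_deg A m n y x hy hx), comp_of_mem _ hy]
    by_cases h : m = 0
    · rw [if_pos h, if_pos (by omega)]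
    · rw [if_neg h, if_neg (by omega), zero_smul]
  | zero => simp
  | add y z hy hz => rw [add_smul, map_add, hy, hz, map_add, add_smul]

open Polynomial in
/-- An endomorphism of degree `0` that is integral over `S_k` is integral over `k`. -/
lemma Obj.aeval_augm (M : Obj k b) {A : Alcove P} (g : Module.End (S0 k b) (M.carrier A))
    (hg : ∀ n x, x ∈ M.deg A n → g x ∈ M.deg A n) {p : (Sk k P)[X]}
    (h : aeval g (p.map (algebraMap _ (S0 k b))) = 0) :
    aeval g ((p.map (augm k P : Sk k P →+* k)).map (algebraMap k (S0 k b))) = 0 := by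
  have hpow : ∀ m n x, x ∈ M.deg A n → (g ^ m) x ∈ M.deg A n := by
    intro m
    induction m with
    | zero => exact fun n x hx => hx
    | succ m ih => intro n x hx; rw [pow_succ']; exact hg n _ (ih n x hx)
  have key : ∀ n x, x ∈ M.deg A n →
      comp (M.internal A) n (aeval g (p.map (algebraMap _ (S0 k b))) x) =
      aeval g ((p.map (augm k P : Sk k P →+* k)).map (algebraMap k (S0 k b))) x := by
    intro n x hx
    clear h
    induction p using Polynomial.induction_on' with
    | add p q hp hq =>
      simp only [Polynomial.map_add, map_add, LinearMap.add_apply, hp, hq]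
    | monomial m c =>
      simp only [Polynomial.map_monomial, Polynomial.aeval_monomial]
      change comp (M.internal A) n (algebraMap _ (S0 k b) c • (g ^ m) x) =
        algebraMap k (S0 k b) (augm k P c) • (g ^ m) x
      rw [M.comp_smul_of_mem (hpow m n x hx), comp_zero_algebraMap]
  refine LinearMap.ext fun x => ?_
  induction x using graded_induction (M.internal A) with
  | hom n y hy => rw [← key n y hy, h, LinearMap.zero_apply, map_zero]
  | zero => simp
  | add y z hy hz => simp only [map_add, hy, hz]

end Integrality



/-! ### Retracts and indecomposable objects -/

section Category

variable {ι N : Type*} {V : Type v} [AddCommGroup V] [Module ℚ V] [AddCommGroup N] [Module ℚ N]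
variable {k : Type u} [Field k] {P : RootPairing ι ℚ V N} [P.IsCrystallographic] {b : P.Base}

namespace Obj

variable {M M' X Y : Obj k b}

/-- The component at `A` of a morphism. -/
def ap (f : M ⟶ M') (A : Alcove P) : M.carrier A →ₗ[S0 k b] M'.carrier A := Hom.app f A

lemma ap_deg (f : M ⟶ M') {A : Alcove P} {n : ℤ} {x : M.carrier A} (hx : x ∈ M.deg A n) :
    ap f A x ∈ M'.deg A n := Hom.map_deg f A n x hx

lemma ap_edge (f : M ⟶ M') {A : Alcove P} {β : PosRoot b} {p : M.carrier A × M.carrier (up P β A)}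
    (hp : p ∈ M.edge A β) : (ap f A p.1, ap f (up P β A) p.2) ∈ M'.edge A β :=
  Hom.map_edge f A β p hp

@[simp] lemma ap_id (A : Alcove P) (x : M.carrier A) : ap (𝟙 M) A x = x := rfl

@[simp] lemma ap_comp (f : M ⟶ X) (g : X ⟶ Y) (A : Alcove P) (x : M.carrier A) :
    ap (f ≫ g) A x = ap g A (ap f A x) := rfl

lemma hom_ext {f g : M ⟶ M'} (h : ∀ A x, ap f A x = ap g A x) : f = g :=
  Hom.ext (funext fun A => LinearMap.ext (h A))

lemma ap_comp_deg (f : M ⟶ M') (A : Alcove P) (n : ℤ) (x : M.carrier A) :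
    comp (M'.internal A) n (ap f A x) = ap f A (comp (M.internal A) n x) := by
  induction x using graded_induction (M.internal A) with
  | hom m y hy =>
    rw [comp_of_mem _ hy, comp_of_mem _ (ap_deg f hy)]
    split_ifs
    · rfl
    · rw [map_zero]
  | zero => simp
  | add y z hy hz => simp only [map_add, hy, hz]

/-- A family of linear bijections that matches the gradings and the submodules `M(A, β)` is an
isomorphism. -/
def isoOfEquiv (e : ∀ A, M.carrier A ≃ₗ[S0 k b] M'.carrier A)
    (hd : ∀ A n x, x ∈ M.deg A n ↔ e A x ∈ M'.deg A n)
    (he : ∀ A (β : PosRoot b) p, p ∈ M.edge A β ↔ (e A p.1, e (up P β A) p.2) ∈ M'.edge A β) :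
    M ≅ M' where
  hom := ⟨fun A => e A, fun A n x => (hd A n x).mp, fun A β p => (he A β p).mp⟩
  inv := ⟨fun A => (e A).symm, fun A n x h => (hd A n _).mpr (by simpa using h),
    fun A β p h => (he A β _).mpr (by simpa using h)⟩
  hom_inv_id := hom_ext fun A x => (e A).symm_apply_apply x
  inv_hom_id := hom_ext fun A x => (e A).apply_symm_apply x

lemma ker_comp (f : M ⟶ M') (A : Alcove P) (n : ℤ) {x : M.carrier A}
    (hx : x ∈ LinearMap.ker (ap f A)) : comp (M.internal A) n x ∈ LinearMap.ker (ap f A) := by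
  rw [LinearMap.mem_ker] at hx ⊢
  rw [← ap_comp_deg, hx, map_zero]

lemma ker_internal (f : M ⟶ M') (A : Alcove P) : DirectSum.IsInternal (fun n =>
    (M.deg A n).comap (LinearMap.ker (ap f A)).subtype.toAddMonoidHom) := by
  refine internal_of_comp (fun n => ((comp (M.internal A) n).comp
    (LinearMap.ker (ap f A)).subtype.toAddMonoidHom).codRestrict
      (LinearMap.ker (ap f A)).toAddSubgroup (fun x => ker_comp f A n x.2)) ?_ ?_
  · intro m n x hx
    apply Subtype.ext
    refine (comp_of_mem (M.internal A) (hx : (x : M.carrier A) ∈ M.deg A m) n).trans ?_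
    split_ifs <;> rfl
  · intro x
    obtain ⟨s, hs⟩ := exists_sum_comp (M.internal A) x.1
    have : x = ∑ n ∈ s, ⟨comp (M.internal A) n x.1, ker_comp f A n x.2⟩ := by
      apply Subtype.ext
      rw [AddSubmonoidClass.coe_finsetSum]
      exact (hs s subset_rfl).symm
    rw [this]
    exact sum_mem fun n _ => AddSubgroup.mem_iSup_of_mem n (comp_mem _ n x.1)

lemma comp_ker (f : M ⟶ M') {A : Alcove P} (h : DirectSum.IsInternal (fun n =>
    (M.deg A n).comap (LinearMap.ker (ap f A)).subtype.toAddMonoidHom)) (n : ℤ)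
    (x : LinearMap.ker (ap f A)) : (comp h n x : M.carrier A) = comp (M.internal A) n x := by
  induction x using graded_induction h with
  | hom l y hy =>
    have h2 : (y : M.carrier A) ∈ M.deg A l := hy
    rw [comp_of_mem h hy]
    refine Eq.trans ?_ (comp_of_mem (M.internal A) h2 n).symm
    split_ifs <;> rfl
  | zero => simp
  | add y z hy hz => simp only [map_add, Submodule.coe_add, hy, hz]

/-- The kernel of a morphism. -/
def kerObj (f : M ⟶ M') : Obj k b where
  carrier A := LinearMap.ker (ap f A)
  deg A n := (M.deg A n).comap (LinearMap.ker (ap f A)).subtype.toAddMonoidHom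
  internal := ker_internal f
  smul_mem_deg A m n c x hc hx := M.smul_mem_deg A m n c _ hc hx
  edge A β :=
    { carrier := {p | (p.1.1, p.2.1) ∈ M.edge A β}
      zero_mem' := (M.edge A β).zero_mem
      add_mem' := fun hp hq => (M.edge A β).add_mem hp hq
      smul_mem' := fun c _ hp => (M.edge A β).smul_mem c hp }
  edge_homog A β p hp n := by
    simp only [Set.mem_ofPred_eq, Submodule.mem_mk, AddSubmonoid.mem_mk, AddSubsemigroup.mem_mk,
      comp_ker]
    exact M.edge_homog A β _ hp n

/-- A retract splits off as a direct summand. -/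
def retractIso (ρ : Retract X M) : M ≅ X.sum (kerObj ρ.r) where
  hom :=
    ⟨fun A => LinearMap.prod (ap ρ.r A) (LinearMap.codRestrict _ (LinearMap.id - (ap ρ.i A).comp (ap ρ.r A))
      fun x => by
        have h : ap ρ.r A (ap ρ.i A (ap ρ.r A x)) = ap ρ.r A x := by
          rw [← ap_comp, ρ.retract, ap_id]
        simp [LinearMap.mem_ker, h]),
    fun A n x h => ⟨ap_deg ρ.r h, by have h2 := sub_mem h (ap_deg ρ.i (ap_deg ρ.r h)); exact h2⟩,
    fun A β p h => ⟨ap_edge ρ.r h, by have h2 := sub_mem h (ap_edge ρ.i (ap_edge ρ.r h)); exact h2⟩⟩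
  inv :=
    ⟨fun A => LinearMap.coprod (ap ρ.i A) (LinearMap.ker (ap ρ.r A)).subtype,
    fun A n x h => add_mem (ap_deg ρ.i h.1) h.2,
    fun A β p h => add_mem (ap_edge ρ.i h.1) h.2⟩
  hom_inv_id := by
    refine hom_ext fun A x => ?_
    change ap ρ.i A (ap ρ.r A x) + (x - ap ρ.i A (ap ρ.r A x)) = x
    abel
  inv_hom_id := by
    refine hom_ext fun A x => ?_
    obtain ⟨x, y, hy⟩ := x
    have h : ap ρ.r A (ap ρ.i A x) = x := by
      rw [← ap_comp, ρ.retract, ap_id]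
    have hy' : ap ρ.r A y = 0 := hy
    refine Prod.ext ?_ (Subtype.ext ?_)
    · change ap ρ.r A (ap ρ.i A x + y) = x
      rw [map_add, h, hy', add_zero]
    · change ap ρ.i A x + y - ap ρ.i A (ap ρ.r A (ap ρ.i A x + y)) = y
      rw [map_add, h, hy', add_zero]
      abel

/-- Direct summands are the same as retracts, since idempotents split in `𝒦_k`. -/
lemma isSummand_iff : X.IsSummand M ↔ Nonempty (Retract X M) := by
  constructor
  · rintro ⟨K, ⟨e⟩⟩
    let i : X ⟶ X.sum K := ⟨fun A => LinearMap.inl _ _ _, fun A n x h => ⟨h, zero_mem _⟩,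
      fun A β p h => ⟨h, zero_mem _⟩⟩
    let r : X.sum K ⟶ X := ⟨fun A => LinearMap.fst _ _ _, fun A n x h => h.1, fun A β p h => h.1⟩
    have h : i ≫ r = 𝟙 X := rfl
    exact ⟨⟨i ≫ e.inv, e.hom ≫ r, by simp [h]⟩⟩
  · rintro ⟨ρ⟩
    exact ⟨_, ⟨retractIso ρ⟩⟩

/-- The complement `1 - e` of an endomorphism. -/
def oneSub (e : X ⟶ X) : X ⟶ X :=
  ⟨fun A => LinearMap.id - ap e A, fun _ _ _ h => sub_mem h (ap_deg e h),
    fun _ _ _ h => sub_mem h (ap_edge e h)⟩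

/-- The image of an idempotent endomorphism, as a retract. -/
def idemRetract (e : X ⟶ X) (he : e ≫ e = e) : Retract (kerObj (oneSub e)) X where
  i := ⟨fun A => Submodule.subtype _, fun _ _ _ h => h, fun _ _ _ h => h⟩
  r := ⟨fun A => LinearMap.codRestrict _ (ap e A) fun x => by
      change ap e A x - ap e A (ap e A x) = 0
      rw [← ap_comp, he, sub_self],
    fun _ _ _ h => ap_deg e h, fun _ _ _ h => ap_edge e h⟩
  retract := hom_ext fun A x => Subtype.ext <| by
    have h : x.1 - ap e A x.1 = 0 := x.2
    exact (sub_eq_zero.mp h).symm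

/-- An indecomposable object has only the trivial idempotent endomorphisms. -/
lemma Indecomposable.idem (hX : X.Indecomposable) {e : X ⟶ X} (he : e ≫ e = e) :
    (∀ A x, ap e A x = 0) ∨ e = 𝟙 X := by
  rcases hX.2 _ _ ⟨retractIso (idemRetract e he)⟩ with h | h
  · left
    intro A x
    have : Subsingleton (LinearMap.ker (ap (oneSub e) A)) := h A
    have h2 : ap e A x ∈ LinearMap.ker (ap (oneSub e) A) := by
      change ap e A x - ap e A (ap e A x) = 0
      rw [← ap_comp, he, sub_self]
    exact congrArg Subtype.val (Subsingleton.elim (⟨_, h2⟩ : LinearMap.ker (ap (oneSub e) A)) 0)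
  · right
    refine hom_ext fun A x => ?_
    have : Subsingleton (LinearMap.ker (ap (idemRetract e he).r A)) := h A
    have h2 : x - ap e A x ∈ LinearMap.ker (ap (idemRetract e he).r A) := by
      apply Subtype.ext
      change ap e A (x - ap e A x) = 0
      rw [map_sub, ← ap_comp, he, sub_self]
    have h3 := congrArg Subtype.val
      (Subsingleton.elim (⟨_, h2⟩ : LinearMap.ker (ap (idemRetract e he).r A)) 0)
    exact (sub_eq_zero.mp h3).symm

/-! ### Polynomials in an endomorphism -/

open scoped Polynomial

/-- A polynomial over `k` in the component at `A` of an endomorphism. -/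
def polyAt (f : X ⟶ X) (q : k[X]) (A : Alcove P) : Module.End (S0 k b) (X.carrier A) :=
  Polynomial.aeval (ap f A : Module.End (S0 k b) (X.carrier A)) (q.map (algebraMap k (S0 k b)))

lemma polyAt_add (f : X ⟶ X) (p q : k[X]) (A : Alcove P) (x : X.carrier A) :
    polyAt f (p + q) A x = polyAt f p A x + polyAt f q A x := by
  simp [polyAt]

lemma polyAt_mul (f : X ⟶ X) (p q : k[X]) (A : Alcove P) (x : X.carrier A) :
    polyAt f (p * q) A x = polyAt f p A (polyAt f q A x) := by
  simp [polyAt]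

lemma polyAt_X_mul (f : X ⟶ X) (q : k[X]) (A : Alcove P) (x : X.carrier A) :
    polyAt f (Polynomial.X * q) A x = ap f A (polyAt f q A x) := by
  rw [polyAt_mul]; simp [polyAt]

lemma polyAt_X (f : X ⟶ X) (A : Alcove P) (x : X.carrier A) :
    polyAt f Polynomial.X A x = ap f A x := by
  simp [polyAt]

lemma polyAt_C (f : X ⟶ X) (c : k) (A : Alcove P) (x : X.carrier A) :
    polyAt f (Polynomial.C c) A x = algebraMap k (S0 k b) c • x := by
  simp [polyAt]

/-- To prove a property of the values of polynomials in an endomorphism, it suffices to consider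
sums, scalar multiples, and powers. -/
lemma poly_induction {p : k[X] → Prop} (q : k[X]) (h0 : ∀ c : k, p (Polynomial.C c))
    (hadd : ∀ q r, p q → p r → p (q + r)) (hX : ∀ q, p q → p (Polynomial.X * q)) : p q := by
  induction q using Polynomial.induction_on with
  | C c => exact h0 c
  | add q r hq hr => exact hadd q r hq hr
  | monomial n c ih =>
    have : (Polynomial.C c * Polynomial.X ^ (n + 1) : k[X]) = Polynomial.X * (Polynomial.C c * Polynomial.X ^ n) := by ring
    rw [this]
    exact hX _ ih

variable [Finite ι] [P.IsRootSystem] [P.IsReduced] [P.IsIrreducible]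

/-- A polynomial over `k` in an endomorphism. -/
def polyHom (f : X ⟶ X) (q : k[X]) : X ⟶ X :=
  ⟨polyAt f q,
    fun A n x h => by
      induction q using poly_induction with
      | h0 c =>
        rw [polyAt_C]
        have := X.smul_mem_deg A 0 n _ x (algebraMap_mem_deg0 c) h
        rwa [zero_add] at this
      | hadd q r hq hr => rw [polyAt_add]; exact add_mem hq hr
      | hX q hq => rw [polyAt_X_mul]; exact ap_deg f hq,
    fun A β p h => by
      induction q using poly_induction with
      | h0 c =>
        rw [polyAt_C, polyAt_C]
        exact Submodule.smul_mem _ (⟨_, algebraMap_mem_Sβ c β⟩ : Sβ k b β) h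
      | hadd q r hq hr => rw [polyAt_add, polyAt_add]; exact add_mem hq hr
      | hX q hq => rw [polyAt_X_mul, polyAt_X_mul]; exact ap_edge f hq⟩

lemma ap_polyHom (f : X ⟶ X) (q : k[X]) (A : Alcove P) (x : X.carrier A) :
    ap (polyHom f q) A x = polyAt f q A x := rfl

/-- All endomorphisms are integral over `k`. -/
def AlgEnd (X : Obj k b) : Prop :=
  ∀ f : X ⟶ X, ∃ q : k[X], q.Monic ∧ ∀ A x, polyAt f q A x = 0

lemma AlgEnd.retract (hM : M.AlgEnd) (ρ : Retract X M) : X.AlgEnd := by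
  intro f
  obtain ⟨q, hq, h⟩ := hM (ρ.r ≫ f ≫ ρ.i)
  refine ⟨q, hq, fun A x => ?_⟩
  have hr : ∀ x, ap ρ.r A (ap ρ.i A x) = x := fun x => by rw [← ap_comp, ρ.retract, ap_id]
  have key : ∀ q : k[X], ap ρ.i A (polyAt f q A x) = polyAt (ρ.r ≫ f ≫ ρ.i) q A (ap ρ.i A x) := by
    intro q
    induction q using poly_induction with
    | h0 c => rw [polyAt_C, polyAt_C, map_smul]
    | hadd q r hq hr => rw [polyAt_add, polyAt_add, map_add, hq, hr]
    | hX q hq => rw [polyAt_X_mul, polyAt_X_mul, ← hq, ap_comp, ap_comp, hr]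
  rw [← hr (polyAt f q A x), key, h, map_zero]

/-- Fitting's lemma: an endomorphism of an indecomposable object that is integral over `k` is
nilpotent or an isomorphism. -/
lemma Indecomposable.fitting (hX : X.Indecomposable) (ha : X.AlgEnd) (f : X ⟶ X) :
    (∃ n : ℕ, ∀ A x, ((ap f A : Module.End (S0 k b) (X.carrier A)) ^ n) x = 0) ∨ IsIso f := by
  obtain ⟨q, hq, h⟩ := ha f
  obtain ⟨r, hr, hr'⟩ := Polynomial.exists_eq_pow_rootMultiplicity_mul_and_not_dvd q hq.ne_zero 0
  set m := q.rootMultiplicity 0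
  rw [Polynomial.C_0, sub_zero] at hr hr'
  have hco : IsCoprime (Polynomial.X ^ (m + 1) : k[X]) r :=
    ((Polynomial.irreducible_X (R := k)).coprime_iff_not_dvd.mpr hr').pow_left
  obtain ⟨u, v, huv⟩ := hco
  have hkill : ∀ s : k[X], ∀ A x, polyAt f (s * q) A x = 0 := fun s A x => by
    rw [polyAt_mul, h, map_zero]
  -- as `X ^ (m + 1)` and `r` are coprime and `f` satisfies `X ^ m * r`, the factor `u X ^ (m + 1)`
  -- of the Bezout identity is an idempotent
  have hidem : polyHom f (u * Polynomial.X ^ (m + 1)) ≫ polyHom f (u * Polynomial.X ^ (m + 1)) =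
      polyHom f (u * Polynomial.X ^ (m + 1)) := by
    refine hom_ext fun A x => ?_
    rw [ap_comp, ap_polyHom, ap_polyHom, ← polyAt_mul]
    have e : u * Polynomial.X ^ (m + 1) = u * Polynomial.X ^ (m + 1) * (u * Polynomial.X ^ (m + 1)) + (u * v * Polynomial.X) * q := by
      rw [hr]
      linear_combination (-(u * Polynomial.X ^ (m + 1))) * huv
    conv_rhs => rw [e, polyAt_add, hkill, add_zero]
  rcases hX.idem hidem with h0 | h1
  · left
    refine ⟨m, fun A x => ?_⟩
    -- if the idempotent is `0`, then `f ^ m = 0`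
    have e : (Polynomial.X ^ m : k[X]) = Polynomial.X ^ m * (u * Polynomial.X ^ (m + 1)) + v * q := by
      rw [hr]
      linear_combination (-(Polynomial.X ^ m)) * huv
    have e2 : polyAt f (Polynomial.X ^ m) A x = 0 := by
      rw [e, polyAt_add, hkill, polyAt_mul]
      have := h0 A x
      rw [ap_polyHom] at this
      rw [this, map_zero, add_zero]
    simpa [polyAt] using e2
  · right
    -- if the idempotent is `1`, then `u f ^ m` is an inverse of `f`
    have e : u * Polynomial.X ^ (m + 1) = Polynomial.X * (u * Polynomial.X ^ m) := by ring
    have e' : u * Polynomial.X ^ (m + 1) = (u * Polynomial.X ^ m) * Polynomial.X := by ring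
    refine ⟨polyHom f (u * Polynomial.X ^ m), hom_ext fun A x => ?_, hom_ext fun A x => ?_⟩
    · rw [← h1, ap_comp, ap_polyHom, ap_polyHom, e', polyAt_mul _ (u * _), polyAt_X]
    · rw [← h1, ap_comp, ap_polyHom, ap_polyHom, e, polyAt_X_mul]

/-- `M(A)` is free of rank `1`. -/
def RankOne (M : Obj k b) (A : Alcove P) : Prop :=
  ∃ x : M.carrier A, (∀ y, ∃ c : S0 k b, y = c • x) ∧ ∀ c : S0 k b, c • x = 0 → c = 0

/-- An idempotent on a module of rank `1` over a domain is `0` or `1`. -/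
lemma RankOne.idem [IsDomain (S0 k b)] {A : Alcove P} (h : M.RankOne A)
    {e : M.carrier A →ₗ[S0 k b] M.carrier A} (he : ∀ x, e (e x) = e x) {x : M.carrier A}
    (hx : e x ≠ 0) (y : M.carrier A) : e y = y := by
  obtain ⟨v, h1, h2⟩ := h
  obtain ⟨c, hc⟩ := h1 (e v)
  have h3 := he v
  rw [hc, map_smul, hc, smul_smul, ← sub_eq_zero, ← sub_smul] at h3
  have h4 : c * (c - 1) = 0 := by rw [mul_sub, mul_one]; exact h2 _ h3
  rcases mul_eq_zero.mp h4 with h5 | h5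
  · obtain ⟨d, rfl⟩ := h1 x
    rw [map_smul, hc, h5, zero_smul, smul_zero] at hx
    exact absurd rfl hx
  · obtain ⟨d, rfl⟩ := h1 y
    rw [map_smul, hc, sub_eq_zero.mp h5, one_smul]

/-- On a retract that is nonzero at an alcove where the object has rank `1`, the idempotent acts as
the identity. -/
lemma RankOne.retract_id [IsDomain (S0 k b)] {A : Alcove P} (h : M.RankOne A) (ρ : Retract X M)
    (hX : A ∈ X.supp) (y : M.carrier A) : ap ρ.i A (ap ρ.r A y) = y := by
  have hr : ∀ x, ap ρ.r A (ap ρ.i A x) = x := fun x => by rw [← ap_comp, ρ.retract, ap_id]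
  obtain ⟨x, hx⟩ := @exists_ne _ hX (0 : X.carrier A)
  refine h.idem (e := (ap ρ.i A).comp (ap ρ.r A)) (fun x => ?_) (x := ap ρ.i A x) (fun h0 => hx ?_) y
  · simp [hr]
  · have h0' : ap ρ.i A (ap ρ.r A (ap ρ.i A x)) = 0 := h0
    rw [hr] at h0'
    rw [← hr x, h0', map_zero]

lemma pow_eq_self_of_id {A : Alcove P} {f : Module.End (S0 k b) (X.carrier A)} (hf : ∀ x, f x = x)
    (n : ℕ) (x : X.carrier A) : (f ^ n) x = x := by
  have : f = 1 := LinearMap.ext hf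
  rw [this, one_pow]; rfl

/-- Two indecomposable retracts of an object that are both nonzero at an alcove where the object has
rank `1` are isomorphic. -/
lemma iso_of_rankOne [IsDomain (S0 k b)] (hM : M.AlgEnd) {A : Alcove P} (h : M.RankOne A)
    (ρ : Retract X M) (σ : Retract Y M) (hX : X.Indecomposable) (hY : Y.Indecomposable)
    (hXA : A ∈ X.supp) (hYA : A ∈ Y.supp) : Nonempty (X ≅ Y) := by
  have key : ∀ {X Y : Obj k b} (ρ : Retract X M) (σ : Retract Y M), X.Indecomposable →
      A ∈ X.supp → A ∈ Y.supp → IsIso ((ρ.i ≫ σ.r) ≫ (σ.i ≫ ρ.r)) := by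
    intro X Y ρ σ hX hXA hYA
    refine (hX.fitting (hM.retract ρ) _).resolve_left ?_
    rintro ⟨n, hn⟩
    obtain ⟨x, hx⟩ := @exists_ne _ hXA (0 : X.carrier A)
    apply hx
    -- the composition is the identity at `A`, hence not nilpotent
    rw [← hn A x, pow_eq_self_of_id]
    intro x
    rw [ap_comp, ap_comp, ap_comp, h.retract_id σ hYA, ← ap_comp, ρ.retract, ap_id]
  have h1 := key ρ σ hX hXA hYA
  have h2 := key σ ρ hY hYA hXA
  have : IsSplitMono (ρ.i ≫ σ.r) := by
    have := IsIso.hom_inv_id ((ρ.i ≫ σ.r) ≫ (σ.i ≫ ρ.r))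
    exact ⟨⟨⟨_, by rw [Category.assoc] at this; exact this⟩⟩⟩
  have : IsSplitEpi (ρ.i ≫ σ.r) := by
    have := IsIso.inv_hom_id ((σ.i ≫ ρ.r) ≫ (ρ.i ≫ σ.r))
    exact ⟨⟨⟨_, by rw [← Category.assoc] at this; exact this⟩⟩⟩
  have : IsIso (ρ.i ≫ σ.r) := isIso_of_mono_of_isSplitEpi _
  exact ⟨asIso (ρ.i ≫ σ.r)⟩

end Obj

end Category



/-! ### Translation functors in coordinates -/

section Translation

variable {ι N : Type*} {V : Type v} [Finite ι] [AddCommGroup V] [Module ℚ V] [AddCommGroup N]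
  [Module ℚ N]
variable {k : Type u} [Field k] {P : RootPairing ι ℚ V N} [P.IsRootSystem] [P.IsCrystallographic]
  [P.IsReduced] [P.IsIrreducible] {b : P.Base}

lemma up_ne (i : ι) (A : Alcove P) : up P i A ≠ A := fun h => by
  have := fl_up i A
  rw [h] at this
  omega

/-- `A^{(s)}_-` and `A^{(s)}_+` are `A` and its neighbour, in the order given by the sign of the
root of the wall. -/
lemma neg_pos_cases (s : simpleRefl b) (A : Alcove P) :
    (¬ b.IsPos (wallIdx s A) ∧ negAlcove b s A = A ∧ posAlcove b s A = nbr s A) ∨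
    (b.IsPos (wallIdx s A) ∧ negAlcove b s A = nbr s A ∧ posAlcove b s A = A) := by
  by_cases h : b.IsPos (wallIdx s A)
  · exact Or.inr ⟨h, negAlcove_of_pos h, posAlcove_of_pos h⟩
  · exact Or.inl ⟨h, negAlcove_of_not_pos h, posAlcove_of_not_pos h⟩

lemma neg_ne_pos (s : simpleRefl b) (A : Alcove P) : negAlcove b s A ≠ posAlcove b s A := by
  rcases neg_pos_cases s A with ⟨-, h1, h2⟩ | ⟨-, h1, h2⟩ <;> rw [h1, h2]
  · exact (nbr_ne s A).symm
  · exact nbr_ne s A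

namespace Obj

variable {M M' : Obj k b}

lemma emb_left {A B : Alcove P} (h : A ≠ B) (p : M.carrier A × M.carrier B) :
    M.emb A B p A = p.1 := by
  classical
  have e : M.emb A B p = Pi.single A p.1 + Pi.single B p.2 := by
    simp only [emb]; congr
  rw [e, Pi.add_apply, Pi.single_eq_same, Pi.single_eq_of_ne h, add_zero]

lemma emb_right {A B : Alcove P} (h : A ≠ B) (p : M.carrier A × M.carrier B) :
    M.emb A B p B = p.2 := by
  classical
  have e : M.emb A B p = Pi.single A p.1 + Pi.single B p.2 := by
    simp only [emb]; congr
  rw [e, Pi.add_apply, Pi.single_eq_same, Pi.single_eq_of_ne h.symm, zero_add]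

lemma emb_other {A B C : Alcove P} (h : C ≠ A) (h' : C ≠ B) (p : M.carrier A × M.carrier B) :
    M.emb A B p C = 0 := by
  classical
  have e : M.emb A B p = Pi.single A p.1 + Pi.single B p.2 := by
    simp only [emb]; congr
  rw [e, Pi.add_apply, Pi.single_eq_of_ne h, Pi.single_eq_of_ne h', add_zero]

/-- The values of two families at `A` and at `β ↑ A` form an element of `M(A, β)`. Families in the
product of all `M(C)` are used in place of elements of single modules, because equal alcoves `C = D`
then need no identification of `M(C)` with `M(D)`. -/
def OnEdge (M : Obj k b) (A : Alcove P) (β : PosRoot b) (f g : ∀ C, M.carrier C) : Prop :=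
  (f A, g (up P β A)) ∈ M.edge A β

lemma OnEdge.congr {A : Alcove P} {β : PosRoot b} {f g f' g' : ∀ C, M.carrier C}
    (h : M.OnEdge A β f g) (hf : f' = f) (hg : g' = g) : M.OnEdge A β f' g' := by
  rw [hf, hg]; exact h

lemma OnEdge.map {A : Alcove P} {β : PosRoot b} {f g : ∀ C, M.carrier C} (h : M.OnEdge A β f g)
    (φ : M ⟶ M') : M'.OnEdge A β (fun C => ap φ C (f C)) (fun C => ap φ C (g C)) := ap_edge φ h

lemma mem_hat_iff {A : Alcove P} {β : PosRoot b} {h : ∀ C, M.carrier C} :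
    h ∈ M.hat A β ↔ M.OnEdge A β h h ∧ ∀ C, C ≠ A → C ≠ up P β A → h C = 0 := by
  have hne := (up_ne β.1 A).symm
  constructor
  · rintro ⟨p, hp, rfl⟩
    refine ⟨?_, fun C h1 h2 => M.emb_other h1 h2 p⟩
    change (M.emb A _ p A, M.emb A _ p _) ∈ _
    rw [emb_left hne, emb_right hne]
    exact hp
  · rintro ⟨h1, h2⟩
    refine ⟨_, h1, funext fun C => ?_⟩
    change M.emb A (up P β A) (h A, h (up P β A)) C = h C
    by_cases c1 : C = A
    · subst c1; rw [emb_left hne]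
    by_cases c2 : C = up P β A
    · subst c2; rw [emb_right hne]
    · rw [emb_other c1 c2, h2 C c1 c2]

/-- The projection from the product of all `M(C)` to `𝒯_s M(A)`. -/
def res (M : Obj k b) (s : simpleRefl b) (A : Alcove P) :
    (∀ C, M.carrier C) →ₗ[S0 k b] (M.trans s).carrier A :=
  (LinearMap.proj (negAlcove b s A)).prod (LinearMap.proj (posAlcove b s A))

/-- An element of `𝒯_s M(A)` as an element of the product of all `M(C)`. -/
def coord (M : Obj k b) (s : simpleRefl b) (A : Alcove P) :
    (M.trans s).carrier A →ₗ[S0 k b] (∀ C, M.carrier C) := M.transEmb s A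

variable {s : simpleRefl b} {A : Alcove P}

lemma coord_neg (p : (M.trans s).carrier A) : M.coord s A p (negAlcove b s A) = p.1 :=
  emb_left (neg_ne_pos s A) p

lemma coord_pos (p : (M.trans s).carrier A) : M.coord s A p (posAlcove b s A) = p.2 :=
  emb_right (neg_ne_pos s A) p

lemma res_coord (p : (M.trans s).carrier A) : M.res s A (M.coord s A p) = p :=
  Prod.ext (coord_neg p) (coord_pos p)

lemma coord_other {C : Alcove P} (h1 : C ≠ A) (h2 : C ≠ nbr s A) (p : (M.trans s).carrier A) :
    M.coord s A p C = 0 := by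
  rcases neg_pos_cases s A with ⟨-, e1, e2⟩ | ⟨-, e1, e2⟩
  · exact emb_other (by rw [e1]; exact h1) (by rw [e2]; exact h2) p
  · exact emb_other (by rw [e1]; exact h2) (by rw [e2]; exact h1) p

lemma coord_res {C : Alcove P} (h : C = A ∨ C = nbr s A) (f : ∀ C, M.carrier C) :
    M.coord s A (M.res s A f) C = f C := by
  have h1 : C = negAlcove b s A ∨ C = posAlcove b s A := by
    rcases neg_pos_cases s A with ⟨-, e1, e2⟩ | ⟨-, e1, e2⟩ <;> rw [e1, e2]
    · exact h
    · exact h.symm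
  rcases h1 with rfl | rfl
  · exact emb_left (neg_ne_pos s A) _
  · exact emb_right (neg_ne_pos s A) _

lemma coord_res_eq {f : ∀ C, M.carrier C} (hf : ∀ C, C ≠ A → C ≠ nbr s A → f C = 0) :
    M.coord s A (M.res s A f) = f := by
  funext C
  by_cases h : C = A ∨ C = nbr s A
  · exact coord_res h f
  · push Not at h
    rw [coord_other h.1 h.2, hf C h.1 h.2]

lemma trans_ext {p q : (M.trans s).carrier A} (h1 : M.coord s A p A = M.coord s A q A)
    (h2 : M.coord s A p (nbr s A) = M.coord s A q (nbr s A)) : p = q := by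
  rw [← res_coord p, ← res_coord q]
  congr 1
  funext C
  by_cases c1 : C = A
  · rw [c1, h1]
  by_cases c2 : C = nbr s A
  · rw [c2, h2]
  · rw [coord_other c1 c2, coord_other c1 c2]

lemma neg_pos_and (Q : Alcove P → Prop) :
    (Q (negAlcove b s A) ∧ Q (posAlcove b s A)) ↔ (Q A ∧ Q (nbr s A)) := by
  rcases neg_pos_cases s A with ⟨-, e1, e2⟩ | ⟨-, e1, e2⟩ <;> rw [e1, e2]
  exact and_comm

lemma mem_trans_deg {n : ℤ} {p : (M.trans s).carrier A} :
    p ∈ (M.trans s).deg A n ↔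
      M.coord s A p A ∈ M.deg A n ∧ M.coord s A p (nbr s A) ∈ M.deg (nbr s A) n := by
  have key : p ∈ (M.trans s).deg A n ↔
      M.coord s A p (negAlcove b s A) ∈ M.deg (negAlcove b s A) n ∧
        M.coord s A p (posAlcove b s A) ∈ M.deg (posAlcove b s A) n := by
    rw [coord_neg, coord_pos]
    rfl
  rw [key]
  exact neg_pos_and fun C => M.coord s A p C ∈ M.deg C n

lemma transEdge_neg {β : PosRoot b} (h : β.1 = negIdx P (wallIdx s A)) :
    M.transEdge s A β = M.edgeNeg s A β := by
  have h1 : ¬ b.IsPos (wallIdx s A) := by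
    have := β.2
    rwa [h, isPos_negIdx] at this
  rw [transEdge, if_pos (upSet_wall_eq_iff.mpr (Or.inr h)), if_pos (negAlcove_of_not_pos h1).symm]

lemma transEdge_pos {β : PosRoot b} (h : β.1 = wallIdx s A) :
    M.transEdge s A β = M.edgePos s A β := by
  have h1 : b.IsPos (wallIdx s A) := h ▸ β.2
  rw [transEdge, if_pos (upSet_wall_eq_iff.mpr (Or.inl h)), if_neg]
  rw [negAlcove_of_pos h1]
  exact (nbr_ne s A).symm

lemma transEdge_cross {β : PosRoot b} (h1 : β.1 ≠ wallIdx s A) (h2 : β.1 ≠ negIdx P (wallIdx s A)) :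
    M.transEdge s A β = M.edgeCross s A β := by
  rw [transEdge, if_neg]
  rw [upSet_wall_eq_iff]
  tauto

lemma smul_rinv (i : ι) (f : ∀ C, M.carrier C) : root0 k b i • rinv k b i • f = f := by
  rw [smul_smul, root_mul_rinv, one_smul]

lemma rinv_smul (i : ι) (f : ∀ C, M.carrier C) : rinv k b i • root0 k b i • f = f := by
  rw [smul_smul, rinv_mul_root, one_smul]

/-- The submodule `𝒯_s M(A, β)` when `A` lies on the negative side of its wall in some `H_{β,n}`:
the pairs `(β x + y, y)` with `x` and `y` in `M(A, β)`. -/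
lemma mem_trans_edge_neg {β : PosRoot b} (h : β.1 = negIdx P (wallIdx s A))
    {p : (M.trans s).carrier A × (M.trans s).carrier (up P β A)} : p ∈ (M.trans s).edge A β ↔
    M.OnEdge A β (rinv k b β • (M.coord s A p.1 - M.coord s (up P β A) p.2))
      (rinv k b β • (M.coord s A p.1 - M.coord s (up P β A) p.2)) ∧
    M.OnEdge A β (M.coord s (up P β A) p.2) (M.coord s (up P β A) p.2) := by
  change p ∈ M.transEdge s A β ↔ _
  rw [transEdge_neg h]
  have hup := up_of_negIdx_wallIdx h
  have hs1 : ∀ C, C ≠ A → C ≠ up P β A → M.coord s A p.1 C = 0 := fun C h1 h2 =>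
    coord_other h1 (hup ▸ h2) _
  have hs2 : ∀ C, C ≠ A → C ≠ up P β A → M.coord s (up P β A) p.2 C = 0 := fun C h1 h2 =>
    coord_other h2 (by rw [hup, nbr_nbr]; exact h1) _
  constructor
  · rintro ⟨x, hx, y, hy, h1, h2⟩
    replace h1 : M.coord s A p.1 = _ := h1
    replace h2 : M.coord s _ p.2 = _ := h2
    rw [h1, h2, add_sub_cancel_right, rinv_smul]
    exact ⟨(mem_hat_iff.mp hx).1, (mem_hat_iff.mp hy).1⟩
  · rintro ⟨h1, h2⟩
    refine ⟨_, mem_hat_iff.mpr ⟨h1, fun C c1 c2 => ?_⟩, _, mem_hat_iff.mpr ⟨h2, hs2⟩, ?_, rfl⟩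
    · rw [Pi.smul_apply, Pi.sub_apply, hs1 C c1 c2, hs2 C c1 c2, sub_zero, smul_zero]
    · rw [smul_rinv, sub_add_cancel]; rfl

lemma nbr_up_of_wallIdx {β : ι} (h : β = wallIdx s A) : nbr s (up P β A) = up P β (up P β A) := by
  refine (up_of_negIdx_wallIdx ?_).symm
  rw [wallIdx_up, ← h]
  exact (negIdx_negIdx P β).symm

lemma up_nbr_of_wallIdx {β : ι} (h : β = wallIdx s A) : up P β (nbr s A) = A := by
  rw [← down_of_wallIdx h, up_down]

/-- The submodule `𝒯_s M(A, β)` when `A` lies on the positive side of its wall in some `H_{β,n}`: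
here `β ↓ A` is the neighbour of `A`, and `β ↑ A` is the one on the negative side of its wall. -/
lemma mem_trans_edge_pos {β : PosRoot b} (h : β.1 = wallIdx s A)
    {p : (M.trans s).carrier A × (M.trans s).carrier (up P β A)} : p ∈ (M.trans s).edge A β ↔
    M.OnEdge (nbr s A) β (rinv k b β • M.coord s A p.1) (rinv k b β • M.coord s A p.1) ∧
    M.OnEdge (up P β A) β (M.coord s (up P β A) p.2) (M.coord s (up P β A) p.2) := by
  change p ∈ M.transEdge s A β ↔ _
  rw [transEdge_pos h]
  have hd := down_of_wallIdx h
  constructor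
  · rintro ⟨x, hx, y, hy, h1, h2⟩
    replace h1 : M.coord s A p.1 = _ := h1
    replace h2 : M.coord s _ p.2 = _ := h2
    rw [h1, h2, rinv_smul, ← hd]
    exact ⟨(mem_hat_iff.mp hx).1, (mem_hat_iff.mp hy).1⟩
  · rintro ⟨h1, h2⟩
    rw [← hd] at h1
    refine ⟨_, mem_hat_iff.mpr ⟨h1, fun C c1 c2 => ?_⟩, _, mem_hat_iff.mpr ⟨h2, fun C c1 c2 => ?_⟩,
      ?_, rfl⟩
    · rw [up_down] at c2
      rw [Pi.smul_apply, coord_other c2 (hd ▸ c1), smul_zero]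
    · exact coord_other c1 (by rw [nbr_up_of_wallIdx h]; exact c2) _
    · rw [smul_rinv]; rfl

/-- The submodule `𝒯_s M(A, β)` when the wall of `A` lies in no `H_{β,n}`: then `β ↑` maps the two
alcoves at the wall of `A` to those at the wall of `β ↑ A`, but possibly interchanges the negative
and the positive one. Indexing by `A` and its neighbour makes the crosswise identification the
evident one. -/
lemma mem_trans_edge_cross {β : PosRoot b} (h1 : β.1 ≠ wallIdx s A)
    (h2 : β.1 ≠ negIdx P (wallIdx s A))
    {p : (M.trans s).carrier A × (M.trans s).carrier (up P β A)} : p ∈ (M.trans s).edge A β ↔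
    M.OnEdge A β (M.coord s A p.1) (M.coord s (up P β A) p.2) ∧
    M.OnEdge (nbr s A) β (M.coord s A p.1) (M.coord s (up P β A) p.2) := by
  have hnp := neg_ne_pos s A
  have hup := nbr_up h1 h2
  have key : p ∈ M.edgeCross s A β ↔
      M.OnEdge (negAlcove b s A) β (M.coord s A p.1) (M.coord s (up P β A) p.2) ∧
      M.OnEdge (posAlcove b s A) β (M.coord s A p.1) (M.coord s (up P β A) p.2) := by
    have hne : up P β.1 (negAlcove b s A) ≠ up P β.1 (posAlcove b s A) := fun e =>
      hnp ((upEquiv P β.1).injective e)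
    constructor
    · rintro ⟨x, hx, y, hy, e1, e2⟩
      have f1 : M.coord s A p.1 = M.emb (negAlcove b s A) (posAlcove b s A) (x.1, y.1) := by
        rw [e1]; rfl
      replace e2 : M.coord s _ p.2 = _ := e2
      unfold OnEdge
      rw [f1, e2, emb_left hnp, emb_right hnp, emb_left hne, emb_right hne]
      exact ⟨hx, hy⟩
    · rintro ⟨e1, e2⟩
      refine ⟨_, e1, _, e2, (res_coord p.1).symm, funext fun C => ?_⟩
      by_cases c1 : C = up P β.1 (negAlcove b s A)
      · subst c1; exact (M.emb_left hne (_, _)).symm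
      by_cases c2 : C = up P β.1 (posAlcove b s A)
      · subst c2; exact (M.emb_right hne (_, _)).symm
      rw [emb_other c1 c2]
      rcases neg_pos_cases s A with ⟨-, e1, e2⟩ | ⟨-, e1, e2⟩ <;> rw [e1] at c1 <;> rw [e2] at c2
      · exact coord_other c1 (by rw [hup]; exact c2) _
      · exact coord_other c2 (by rw [hup]; exact c1) _
  change p ∈ M.transEdge s A β ↔ _
  rw [transEdge_cross h1 h2, key]
  exact neg_pos_and fun C => M.OnEdge C β (M.coord s A p.1) (M.coord s (up P β A) p.2)

/-- The components of the translation functor on morphisms. -/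
def transApp (s : simpleRefl b) (f : M ⟶ M') (A : Alcove P) :
    (M.trans s).carrier A →ₗ[S0 k b] (M'.trans s).carrier A :=
  (ap f (negAlcove b s A)).prodMap (ap f (posAlcove b s A))

lemma coord_transApp (f : M ⟶ M') (p : (M.trans s).carrier A) :
    M'.coord s A (transApp s f A p) = fun C => ap f C (M.coord s A p C) := by
  funext C
  by_cases c1 : C = negAlcove b s A
  · subst c1
    rw [coord_neg, coord_neg]; rfl
  by_cases c2 : C = posAlcove b s A
  · subst c2
    rw [coord_pos, coord_pos]; rfl
  · exact (emb_other c1 c2 _).trans ((congrArg _ (emb_other c1 c2 _)).trans (map_zero _)).symm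

/-- The translation functor on morphisms. -/
def transMap (s : simpleRefl b) (f : M ⟶ M') : M.trans s ⟶ M'.trans s := by
  refine ⟨transApp s f, fun A n x h => ⟨ap_deg f h.1, ap_deg f h.2⟩, fun A β p h => ?_⟩
  by_cases h1 : β.1 = wallIdx s A
  · have h := (mem_trans_edge_pos h1).mp h
    refine (mem_trans_edge_pos h1).mpr
      ⟨?_, (h.2.map f).congr (coord_transApp _ _) (coord_transApp _ _)⟩
    have e : rinv k b β • M'.coord s A (transApp s f A p.1) =
          fun C => ap f C ((rinv k b β • M.coord s A p.1) C) := by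
      funext C
      rw [Pi.smul_apply, Pi.smul_apply, map_smul, coord_transApp]
    exact (h.1.map f).congr e e
  by_cases h2 : β.1 = negIdx P (wallIdx s A)
  · have h := (mem_trans_edge_neg h2).mp h
    refine (mem_trans_edge_neg h2).mpr
      ⟨?_, (h.2.map f).congr (coord_transApp _ _) (coord_transApp _ _)⟩
    have e : rinv k b β • (M'.coord s A (transApp s f A p.1) -
          M'.coord s (up P β A) (transApp s f _ p.2)) =
          fun C => ap f C ((rinv k b β • (M.coord s A p.1 - M.coord s (up P β A) p.2)) C) := by
      funext C
      rw [Pi.smul_apply, Pi.smul_apply, map_smul, Pi.sub_apply, Pi.sub_apply, map_sub,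
        coord_transApp, coord_transApp]
    exact (h.1.map f).congr e e
  · have h := (mem_trans_edge_cross h1 h2).mp h
    exact (mem_trans_edge_cross h1 h2).mpr
      ⟨(h.1.map f).congr (coord_transApp _ _) (coord_transApp _ _),
      (h.2.map f).congr (coord_transApp _ _) (coord_transApp _ _)⟩

/-- Translation functors preserve retracts. -/
def transRetract (s : simpleRefl b) (ρ : Retract M M') : Retract (M.trans s) (M'.trans s) where
  i := transMap s ρ.i
  r := transMap s ρ.r
  retract := by
    have hr : ∀ A x, ap ρ.r A (ap ρ.i A x) = x := fun A x => by rw [← ap_comp, ρ.retract, ap_id]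
    exact hom_ext fun A x => Prod.ext (hr _ _) (hr _ _)

/-- The composition of translation functors along a word. -/
def transWord (M : Obj k b) (u : List (simpleRefl b)) : Obj k b := u.foldl (fun M s => M.trans s) M

lemma transWord_concat (M : Obj k b) (u : List (simpleRefl b)) (s : simpleRefl b) :
    M.transWord (u ++ [s]) = (M.transWord u).trans s := by simp [transWord]

lemma transWord_append (M : Obj k b) (u w : List (simpleRefl b)) :
    M.transWord (u ++ w) = (M.transWord u).transWord w := by simp [transWord]

lemma bottSamelson_eq (u : List (simpleRefl b)) : bottSamelson k b u = (unit k b).transWord u := rfl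

lemma transWord_retract (u : List (simpleRefl b)) : ∀ {M M' : Obj k b}, Nonempty (Retract M M') →
    Nonempty (Retract (M.transWord u) (M'.transWord u)) := by
  induction u with
  | nil => exact fun h => h
  | cons s u ih => exact fun ⟨ρ⟩ => ih ⟨transRetract s ρ⟩

end Obj

end Translation



/-! ### Objects of finite rank -/

section Finiteness

variable {ι N : Type*} {V : Type v} [Finite ι] [AddCommGroup V] [Module ℚ V] [AddCommGroup N]
  [Module ℚ N]
variable {k : Type u} [Field k] {P : RootPairing ι ℚ V N} [P.IsRootSystem] [P.IsCrystallographic]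
  [P.IsReduced] [P.IsIrreducible] {b : P.Base}

/-- The alcove `β ↑ A` is the neighbour of `A` only across a wall in some `H_{β,n}`. -/
lemma up_ne_nbr {s : simpleRefl b} {A : Alcove P} {i : ι} (h1 : i ≠ wallIdx s A)
    (h2 : i ≠ negIdx P (wallIdx s A)) : up P i A ≠ nbr s A := fun h => by
  have e1 := (isWallAt s A).fl_other i h1 h2
  have e2 := fl_up i A
  rw [h] at e2
  omega

namespace Obj

variable {M : Obj k b}

/-- A pair in `M(A) ⊕ M(β ↑ A)` as an element of the product of all `M(C)`. -/
def lift (M : Obj k b) (A : Alcove P) (β : PosRoot b) :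
    M.carrier A × M.carrier (up P β A) →ₗ[S0 k b] ∀ C, M.carrier C := M.emb A (up P β A)

variable {s : simpleRefl b} {A : Alcove P} {β : PosRoot b}

lemma lift_left (p : M.carrier A × M.carrier (up P β A)) : M.lift A β p A = p.1 :=
  emb_left (up_ne β.1 A).symm p

lemma lift_right (p : M.carrier A × M.carrier (up P β A)) : M.lift A β p (up P β A) = p.2 :=
  emb_right (up_ne β.1 A).symm p

lemma lift_other {C : Alcove P} (h1 : C ≠ A) (h2 : C ≠ up P β A)
    (p : M.carrier A × M.carrier (up P β A)) : M.lift A β p C = 0 := emb_other h1 h2 p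

lemma lift_eq {f : ∀ C, M.carrier C} (h : ∀ C, C ≠ A → C ≠ up P β A → f C = 0) :
    M.lift A β (f A, f (up P β A)) = f := by
  funext C
  by_cases c1 : C = A
  · subst c1; exact lift_left _
  by_cases c2 : C = up P β A
  · subst c2; exact lift_right _
  · rw [lift_other c1 c2, h C c1 c2]

lemma onEdge_lift {p : M.carrier A × M.carrier (up P β A)} (h : p ∈ M.edge A β) :
    M.OnEdge A β (M.lift A β p) (M.lift A β p) := by
  unfold OnEdge
  rw [lift_left, lift_right]
  exact h

/-- The submodule `𝒯_s M(A, β)` consists of the sums of an element from each of two submodules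
`M(A₁, β)` and `M(A₂, β)`, embedded by linear maps that are jointly surjective. -/
lemma exists_edge_decomp (M : Obj k b) (s : simpleRefl b) (A : Alcove P) (β : PosRoot b) :
    ∃ (A₁ A₂ : Alcove P)
      (Λ₁ : M.carrier A₁ × M.carrier (up P β A₁) →ₗ[S0 k b]
        (M.trans s).carrier A × (M.trans s).carrier (up P β A))
      (Λ₂ : M.carrier A₂ × M.carrier (up P β A₂) →ₗ[S0 k b]
        (M.trans s).carrier A × (M.trans s).carrier (up P β A)),
      (∀ p ∈ M.edge A₁ β, Λ₁ p ∈ (M.trans s).edge A β) ∧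
      (∀ p ∈ M.edge A₂ β, Λ₂ p ∈ (M.trans s).edge A β) ∧
      ∀ q, ∃ p₁ p₂, q = Λ₁ p₁ + Λ₂ p₂ ∧
        (q ∈ (M.trans s).edge A β → p₁ ∈ M.edge A₁ β ∧ p₂ ∈ M.edge A₂ β) := by
  by_cases h1 : β.1 = wallIdx s A
  · -- the two summands `β M(β ↓ A, β)` and `M(β ↑ A, β)`
    have hnb := up_nbr_of_wallIdx h1
    have hup := nbr_up_of_wallIdx h1
    have hc1 : ∀ p : M.carrier (nbr s A) × M.carrier (up P β (nbr s A)),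
        M.coord s A (M.res s A (root0 k b β • M.lift (nbr s A) β p)) =
          root0 k b β • M.lift (nbr s A) β p := fun p => coord_res_eq fun C c1 c2 => by
      rw [Pi.smul_apply, lift_other c2 (by rw [hnb]; exact c1), smul_zero]
    have hc2 : ∀ p : M.carrier (up P β A) × M.carrier (up P β (up P β A)),
        M.coord s (up P β A) (M.res s _ (M.lift (up P β A) β p)) = M.lift (up P β A) β p :=
      fun p => coord_res_eq fun C c1 c2 => lift_other c1 (by rw [← hup]; exact c2) _
    refine ⟨nbr s A, up P β A, LinearMap.inl _ _ _ ∘ₗ M.res s A ∘ₗ (root0 k b β • M.lift _ β),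
      LinearMap.inr _ _ _ ∘ₗ M.res s _ ∘ₗ M.lift _ β, fun p hp => ?_, fun p hp => ?_, fun q => ?_⟩
    · refine (mem_trans_edge_pos h1).mpr ⟨?_, ?_⟩
      · have e : rinv k b β • M.coord s A (M.res s A (root0 k b β • M.lift (nbr s A) β p)) =
          M.lift (nbr s A) β p := by rw [hc1, rinv_smul]
        exact (onEdge_lift hp).congr e e
      · have e : M.coord s (up P β A) (0 : (M.trans s).carrier (up P β A)) = 0 := map_zero _
        exact OnEdge.congr (f := 0) (g := 0) (M.edge _ β).zero_mem e e
    · refine (mem_trans_edge_pos h1).mpr ⟨?_, (onEdge_lift hp).congr (hc2 p) (hc2 p)⟩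
      have e : rinv k b β • M.coord s A (0 : (M.trans s).carrier A) = 0 := by
        rw [map_zero, smul_zero]
      exact OnEdge.congr (f := 0) (g := 0) (M.edge _ β).zero_mem e e
    · set f := rinv k b β • M.coord s A q.1 with hf
      set g := M.coord s _ q.2 with hg
      refine ⟨(f _, f _), (g _, g _), ?_, fun hq => (mem_trans_edge_pos h1).mp hq⟩
      have e1 : M.lift (nbr s A) β (f _, f _) = f := lift_eq fun C c1 c2 => by
        rw [hf, Pi.smul_apply, coord_other (by rw [hnb] at c2; exact c2) c1, smul_zero]
      have e2 : M.lift (up P β A) β (g _, g _) = g := lift_eq fun C c1 c2 => by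
        rw [hg, coord_other c1 (by rw [hup]; exact c2)]
      refine Prod.ext ?_ ?_
      · change q.1 = M.res s A (root0 k b β • M.lift (nbr s A) β (f _, f _)) + 0
        rw [e1, hf, smul_rinv, res_coord, add_zero]
      · change q.2 = 0 + M.res s _ (M.lift (up P β A) β (g _, g _))
        rw [e2, res_coord, zero_add]
  by_cases h2 : β.1 = negIdx P (wallIdx s A)
  · -- the elements `(β x, 0)` and `(y, y)`
    have hup := up_of_negIdx_wallIdx h2
    have hc1 : ∀ f : ∀ C, M.carrier C, (∀ C, C ≠ A → C ≠ up P β A → f C = 0) →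
        M.coord s A (M.res s A f) = f := fun f hf => coord_res_eq fun C c1 c2 =>
      hf C c1 (by rw [hup]; exact c2)
    have hc2 : ∀ f : ∀ C, M.carrier C, (∀ C, C ≠ A → C ≠ up P β A → f C = 0) →
        M.coord s (up P β A) (M.res s _ f) = f := fun f hf => coord_res_eq fun C c1 c2 =>
      hf C (by rw [hup, nbr_nbr] at c2; exact c2) c1
    have hsm : ∀ p : M.carrier A × M.carrier (up P β A), ∀ C, C ≠ A → C ≠ up P β A →
        (root0 k b β • M.lift A β p) C = 0 := fun p C c1 c2 => by
      rw [Pi.smul_apply, lift_other c1 c2, smul_zero]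
    refine ⟨A, A, LinearMap.inl _ _ _ ∘ₗ M.res s A ∘ₗ (root0 k b β • M.lift A β),
      (M.res s A ∘ₗ M.lift A β).prod (M.res s _ ∘ₗ M.lift A β),
      fun p hp => ?_, fun p hp => ?_, fun q => ?_⟩
    · refine (mem_trans_edge_neg h2).mpr ⟨?_, ?_⟩
      · have e : rinv k b β • (M.coord s A (M.res s A (root0 k b β • M.lift A β p)) -
            M.coord s (up P β A) (0 : (M.trans s).carrier (up P β A))) = M.lift A β p := by
          rw [hc1 _ (hsm p), map_zero, sub_zero, rinv_smul]
        exact (onEdge_lift hp).congr e e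
      · have e : M.coord s (up P β A) (0 : (M.trans s).carrier (up P β A)) = 0 := map_zero _
        exact OnEdge.congr (f := 0) (g := 0) (M.edge _ β).zero_mem e e
    · have e1 := hc1 (M.lift A β p) fun C c1 c2 => lift_other c1 c2 p
      have e2 := hc2 (M.lift A β p) fun C c1 c2 => lift_other c1 c2 p
      refine (mem_trans_edge_neg h2).mpr ⟨?_, (onEdge_lift hp).congr e2 e2⟩
      have e : rinv k b β • (M.coord s A (M.res s A (M.lift A β p)) -
          M.coord s (up P β A) (M.res s _ (M.lift A β p))) = 0 := by
        rw [e1, e2, sub_self, smul_zero]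
      exact OnEdge.congr (f := 0) (g := 0) (M.edge _ β).zero_mem e e
    · set g := M.coord s _ q.2 with hg
      set f := rinv k b β • (M.coord s A q.1 - g) with hf
      have g0 : ∀ C, C ≠ A → C ≠ up P β A → g C = 0 := fun C c1 c2 =>
        coord_other c2 (by rw [hup, nbr_nbr]; exact c1) _
      have e2 : M.lift A β (g _, g _) = g := lift_eq g0
      have e1 : M.lift A β (f _, f _) = f := lift_eq fun C c1 c2 => by
        rw [hf, Pi.smul_apply, Pi.sub_apply, coord_other c1 (by rw [← hup]; exact c2), g0 C c1 c2,
          sub_zero, smul_zero]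
      refine ⟨(f _, f _), (g _, g _), ?_, fun hq => (mem_trans_edge_neg h2).mp hq⟩
      refine Prod.ext ?_ ?_
      · change q.1 = M.res s A (root0 k b β • M.lift A β (f _, f _)) +
          M.res s A (M.lift A β (g _, g _))
        rw [e1, e2, hf, smul_rinv, ← map_add, sub_add_cancel, res_coord]
      · change q.2 = 0 + M.res s _ (M.lift A β (g _, g _))
        rw [e2, res_coord, zero_add]
  · -- the summands indexed by `A` and by its neighbour
    have hup := nbr_up h1 h2
    have hne := up_ne_nbr h1 h2
    have hnA := nbr_ne s A
    have hne2 : up P β (nbr s A) ≠ A := fun h => by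
      rw [← hup] at h
      exact hne (by rw [← nbr_nbr s (up P β A), h])
    have hne3 : up P β (nbr s A) ≠ up P β A := fun h => hnA ((upEquiv P β.1).injective h)
    refine ⟨A, nbr s A, (M.res s A ∘ₗ M.lift A β).prod (M.res s _ ∘ₗ M.lift A β),
      (M.res s A ∘ₗ M.lift _ β).prod (M.res s _ ∘ₗ M.lift _ β),
      fun p hp => ?_, fun p hp => ?_, fun q => ?_⟩
    · refine (mem_trans_edge_cross h1 h2).mpr ⟨?_, ?_⟩
      · change (M.coord s A (M.res s A (M.lift A β p)) A,
          M.coord s (up P β A) (M.res s _ (M.lift A β p)) (up P β A)) ∈ _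
        rw [coord_res (Or.inl rfl), coord_res (Or.inl rfl), lift_left, lift_right]
        exact hp
      · change (M.coord s A (M.res s A (M.lift A β p)) (nbr s A),
          M.coord s (up P β A) (M.res s _ (M.lift A β p)) (up P β (nbr s A))) ∈ _
        rw [coord_res (Or.inr rfl), coord_res (Or.inr hup.symm), lift_other hnA hne.symm,
          lift_other hne2 hne3]
        exact (M.edge _ β).zero_mem
    · refine (mem_trans_edge_cross h1 h2).mpr ⟨?_, ?_⟩
      · change (M.coord s A (M.res s A (M.lift _ β p)) A,
          M.coord s (up P β A) (M.res s _ (M.lift _ β p)) (up P β A)) ∈ _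
        rw [coord_res (Or.inl rfl), coord_res (Or.inl rfl), lift_other hnA.symm hne2.symm,
          lift_other hne hne3.symm]
        exact (M.edge _ β).zero_mem
      · change (M.coord s A (M.res s A (M.lift _ β p)) (nbr s A),
          M.coord s (up P β A) (M.res s _ (M.lift _ β p)) (up P β (nbr s A))) ∈ _
        rw [coord_res (Or.inr rfl), coord_res (Or.inr hup.symm), lift_left, lift_right]
        exact hp
    · set f := M.coord s A q.1 with hf
      set g := M.coord s _ q.2 with hg
      refine ⟨(f _, g _), (f _, g _), ?_, fun hq => (mem_trans_edge_cross h1 h2).mp hq⟩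
      refine Prod.ext (trans_ext ?_ ?_) (trans_ext ?_ ?_)
      · change f A = M.coord s A (M.res s A (M.lift A β (f _, g _)) +
          M.res s A (M.lift (nbr s A) β (f _, g _))) A
        rw [← map_add, coord_res (Or.inl rfl), Pi.add_apply, lift_left,
          lift_other hnA.symm hne2.symm, add_zero]
      · change f (nbr s A) = M.coord s A (M.res s A (M.lift A β (f _, g _)) +
          M.res s A (M.lift (nbr s A) β (f _, g _))) (nbr s A)
        rw [← map_add, coord_res (Or.inr rfl), Pi.add_apply, lift_left,
          lift_other hnA hne.symm, zero_add]
      · change g (up P β A) = M.coord s _ (M.res s _ (M.lift A β (f _, g _)) +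
          M.res s _ (M.lift (nbr s A) β (f _, g _))) (up P β A)
        rw [← map_add, coord_res (Or.inl rfl), Pi.add_apply, lift_right,
          lift_other hne hne3.symm, add_zero]
      · rw [hup]
        change g (up P β (nbr s A)) = M.coord s _ (M.res s _ (M.lift A β (f _, g _)) +
          M.res s _ (M.lift (nbr s A) β (f _, g _))) (up P β (nbr s A))
        rw [← map_add, coord_res (Or.inr hup.symm), Pi.add_apply, lift_right,
          lift_other hne2 hne3, zero_add]

/-- Objects of finite rank: almost all `M(A)` vanish, all `M(A)` are free of finite rank, and
`M(A, β)` is a finitely generated `S_k^β`-lattice in `M(A) ⊕ M(β ↑ A)`. -/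
structure FinObj (M : Obj k b) : Prop where
  finite : ∀ A, Module.Finite (S0 k b) (M.carrier A)
  free : ∀ A, Module.Free (S0 k b) (M.carrier A)
  supp : M.supp.Finite
  edge_fg : ∀ A (β : PosRoot b), (M.edge A β).FG
  span_edge : ∀ A (β : PosRoot b),
    Submodule.span (S0 k b) (M.edge A β : Set (M.carrier A × M.carrier (up P β A))) = ⊤

lemma mem_supp_trans (h : A ∈ (M.trans s).supp) : A ∈ M.supp ∨ nbr s A ∈ M.supp := by
  have h1 : Nontrivial (M.carrier (negAlcove b s A) × M.carrier (posAlcove b s A)) := h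
  by_contra! hc
  have h2 : ∀ C, (C = A ∨ C = nbr s A) → Subsingleton (M.carrier C) := by
    rintro C (rfl | rfl)
    · exact not_nontrivial_iff_subsingleton.mp hc.1
    · exact not_nontrivial_iff_subsingleton.mp hc.2
  have h3 : Subsingleton (M.carrier (negAlcove b s A)) := h2 _ (by
    rcases neg_pos_cases s A with ⟨-, e, -⟩ | ⟨-, e, -⟩ <;> rw [e] <;> simp)
  have h4 : Subsingleton (M.carrier (posAlcove b s A)) := h2 _ (by
    rcases neg_pos_cases s A with ⟨-, -, e⟩ | ⟨-, -, e⟩ <;> rw [e] <;> simp)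
  exact not_nontrivial_iff_subsingleton.mpr inferInstance h1

lemma FinObj.trans (h : M.FinObj) (s : simpleRefl b) : (M.trans s).FinObj where
  finite A := by
    have := h.finite
    exact inferInstanceAs (Module.Finite _ (M.carrier (negAlcove b s A) × M.carrier (posAlcove b s A)))
  free A := by
    have := h.free
    exact inferInstanceAs (Module.Free _ (M.carrier (negAlcove b s A) × M.carrier (posAlcove b s A)))
  supp := by
    refine (h.supp.union (h.supp.image (nbr s))).subset fun A hA => ?_
    rcases mem_supp_trans hA with h1 | h1
    · exact Or.inl h1
    · exact Or.inr ⟨_, h1, nbr_nbr s A⟩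
  edge_fg A β := by
    obtain ⟨A₁, A₂, Λ₁, Λ₂, h1, h2, h3⟩ := M.exists_edge_decomp s A β
    have : (M.trans s).edge A β = (M.edge A₁ β).map (Λ₁.restrictScalars (Sβ k b β)) ⊔
        (M.edge A₂ β).map (Λ₂.restrictScalars (Sβ k b β)) := by
      refine le_antisymm (fun q hq => ?_) (sup_le ?_ ?_)
      · obtain ⟨p₁, p₂, hp, hm⟩ := h3 q
        rw [hp]
        exact add_mem (Submodule.mem_sup_left ⟨_, (hm hq).1, rfl⟩)
          (Submodule.mem_sup_right ⟨_, (hm hq).2, rfl⟩)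
      · rintro _ ⟨p, hp, rfl⟩; exact h1 p hp
      · rintro _ ⟨p, hp, rfl⟩; exact h2 p hp
    rw [this]
    exact ((h.edge_fg A₁ β).map _).sup ((h.edge_fg A₂ β).map _)
  span_edge A β := by
    obtain ⟨A₁, A₂, Λ₁, Λ₂, h1, h2, h3⟩ := M.exists_edge_decomp s A β
    have key : ∀ (C : Alcove P) (Λ : M.carrier C × M.carrier (up P β C) →ₗ[S0 k b]
        (M.trans s).carrier A × (M.trans s).carrier (up P β A)),
        (∀ p ∈ M.edge C β, Λ p ∈ (M.trans s).edge A β) → ∀ p,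
        Λ p ∈ Submodule.span (S0 k b) ((M.trans s).edge A β :
          Set ((M.trans s).carrier A × (M.trans s).carrier (up P β A))) := by
      intro C Λ hΛ p
      have hle : Submodule.span (S0 k b) (M.edge C β : Set (M.carrier C × M.carrier (up P β C))) ≤
          (Submodule.span (S0 k b) ((M.trans s).edge A β :
          Set ((M.trans s).carrier A × (M.trans s).carrier (up P β A)))).comap Λ :=
        Submodule.span_le.mpr fun p hp => Submodule.subset_span (hΛ p hp)
      rw [h.span_edge] at hle
      exact hle trivial
    refine eq_top_iff.mpr fun q _ => ?_
    obtain ⟨p₁, p₂, hp, -⟩ := h3 q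
    rw [hp]
    exact add_mem (key _ _ h1 _) (key _ _ h2 _)

lemma finObj_transWord (u : List (simpleRefl b)) : ∀ {M : Obj k b}, M.FinObj → (M.transWord u).FinObj := by
  induction u with
  | nil => exact fun h => h
  | cons s u ih => exact fun h => ih (h.trans s)

lemma unitSub_eq_top (A : Alcove P) (h : A = fundAlcove b) : unitSub k b A = ⊤ := if_pos h

lemma unitSub_eq_bot (A : Alcove P) (h : A ≠ fundAlcove b) : unitSub k b A = ⊥ := if_neg h

/-- The submodule of pairs with entries in `S_k^β`, in a sum of two modules each of which is `S_k^∅`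
or `0`, is a lattice. -/
lemma FG_unit_edge (β : PosRoot b) (U W : Submodule (S0 k b) (S0 k b)) (hU : U = ⊤ ∨ U = ⊥)
    (hW : W = ⊤ ∨ W = ⊥) (E : Submodule (Sβ k b β) (U × W))
    (hE : ∀ p : U × W, p ∈ E ↔ (p.1 : S0 k b) ∈ Sβ k b β ∧ (p.2 : S0 k b) ∈ Sβ k b β) :
    E.FG ∧ Submodule.span (S0 k b) (E : Set (U × W)) = ⊤ := by
  have h1 : ∀ U : Submodule (S0 k b) (S0 k b), U = ⊤ ∨ U = ⊥ → ∃ u : U, (u : S0 k b) ∈ Sβ k b β ∧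
      ∀ x : U, x = (x : S0 k b) • u := by
    rintro U (rfl | rfl)
    · exact ⟨⟨1, trivial⟩, one_mem _, fun x => Subtype.ext (by simp)⟩
    · exact ⟨0, zero_mem _, fun x => Subsingleton.elim _ _⟩
  obtain ⟨u, hu, hu'⟩ := h1 U hU
  obtain ⟨w, hw, hw'⟩ := h1 W hW
  constructor
  · classical
    refine ⟨{((u, 0) : U × W), ((0, w) : U × W)}, le_antisymm ?_ ?_⟩
    · refine Submodule.span_le.mpr ?_
      intro p hp
      simp only [Finset.coe_insert, Finset.coe_singleton, Set.mem_insert_iff, Set.mem_singleton_iff] at hp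
      rcases hp with rfl | rfl
      · exact (hE _).mpr ⟨hu, zero_mem _⟩
      · exact (hE _).mpr ⟨zero_mem _, hw⟩
    · rintro ⟨x, y⟩ hp
      obtain ⟨hx, hy⟩ := (hE _).mp hp
      have : ((x, y) : U × W) = (⟨x, hx⟩ : Sβ k b β) • ((u, 0) : U × W) +
          (⟨y, hy⟩ : Sβ k b β) • ((0, w) : U × W) := by
        refine Prod.ext ?_ ?_
        · change x = (x : S0 k b) • u + (y : S0 k b) • 0
          rw [smul_zero, add_zero]; exact hu' x
        · change y = (x : S0 k b) • 0 + (y : S0 k b) • w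
          rw [smul_zero, zero_add]; exact hw' y
      rw [this]
      exact add_mem (Submodule.smul_mem _ _ (Submodule.subset_span (by simp)))
        (Submodule.smul_mem _ _ (Submodule.subset_span (by simp)))
  · refine eq_top_iff.mpr ?_
    rintro ⟨x, y⟩ -
    have : ((x, y) : U × W) = (x : S0 k b) • ((u, 0) : U × W) + (y : S0 k b) • ((0, w) : U × W) := by
      refine Prod.ext ?_ ?_
      · change x = (x : S0 k b) • u + (y : S0 k b) • 0
        rw [smul_zero, add_zero]; exact hu' x
      · change y = (x : S0 k b) • 0 + (y : S0 k b) • w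
        rw [smul_zero, zero_add]; exact hw' y
    rw [this]
    exact add_mem (Submodule.smul_mem _ _ (Submodule.subset_span ((hE _).mpr ⟨hu, zero_mem _⟩)))
        (Submodule.smul_mem _ _ (Submodule.subset_span ((hE _).mpr ⟨zero_mem _, hw⟩)))

lemma finObj_unit : (unit k b).FinObj := by
  have hcase : ∀ A, unitSub k b A = ⊤ ∨ unitSub k b A = ⊥ := fun A => by
    by_cases h : A = fundAlcove b
    · exact Or.inl (unitSub_eq_top A h)
    · exact Or.inr (unitSub_eq_bot A h)
  have hff : ∀ U : Submodule (S0 k b) (S0 k b), U = ⊤ ∨ U = ⊥ → Module.Finite (S0 k b) U ∧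
      Module.Free (S0 k b) U := by
    rintro U (rfl | rfl)
    · exact ⟨Module.Finite.equiv Submodule.topEquiv.symm, Module.Free.of_equiv Submodule.topEquiv.symm⟩
    · exact ⟨inferInstance, inferInstance⟩
  refine ⟨fun A => (hff _ (hcase A)).1, fun A => (hff _ (hcase A)).2, ?_, fun A β => ?_, fun A β => ?_⟩
  · refine (Set.finite_singleton (fundAlcove b)).subset fun A hA => ?_
    by_contra h
    have h1 : Nontrivial (unitSub k b A) := hA
    rw [unitSub_eq_bot A h] at h1
    exact not_nontrivial_iff_subsingleton.mpr inferInstance h1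
  · exact (FG_unit_edge β _ _ (hcase _) (hcase _) ((unit k b).edge A β) fun p => Iff.rfl).1
  · exact (FG_unit_edge β _ _ (hcase _) (hcase _) ((unit k b).edge A β) fun p => Iff.rfl).2

open Polynomial in
/-- An endomorphism of an object of finite rank is integral over `k`: on each lattice `M(A, β)` it
is integral over `S_k^β`, hence its minimal polynomial at `A` has coefficients in the intersection
`S_k` of the rings `S_k^β`, and one takes the components of degree `0`. -/
lemma FinObj.algEnd (hk : GKM k b) (h : M.FinObj) : M.AlgEnd := by
  intro f
  have hA : ∀ A, ∃ q : k[X], q.Monic ∧ ∀ x, polyAt f q A x = 0 := by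
    intro A
    have := h.finite A
    have := h.free A
    obtain ⟨p, hp, hp0⟩ := hk.exists_monic (ap f A) fun β => by
      -- Cayley-Hamilton for the endomorphism of the lattice `M(A, β)`, which spans
      -- `M(A) ⊕ M(β ↑ A)`
      let F : Module.End (S0 k b) (M.carrier A × M.carrier (up P β A)) :=
        (ap f A).prodMap (ap f (up P β A))
      let E := M.edge A β
      have : Module.Finite (Sβ k b β) E := Module.Finite.iff_fg.mpr (h.edge_fg A β)
      let G : Module.End (Sβ k b β) E :=
        (F.restrictScalars (Sβ k b β)).restrict (fun p hp => ap_edge f hp)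
      obtain ⟨p, hp, hp0⟩ := LinearMap.exists_monic_and_aeval_eq_zero (M := E) (Sβ k b β) G
      have hpow : ∀ (n : ℕ) (x : E), ((G ^ n) x : M.carrier A × M.carrier (up P β A)) =
          (((ap f A : Module.End (S0 k b) _) ^ n) x.1.1,
            ((ap f (up P β A) : Module.End (S0 k b) _) ^ n) x.1.2) := by
        intro n
        induction n with
        | zero => exact fun x => rfl
        | succ n ih =>
          intro x
          rw [pow_succ, pow_succ, pow_succ, Module.End.mul_apply, ih]
          rfl
      have haev : ∀ (q : (Sβ k b β)[X]) (x : E), ((aeval G q) x).1.1 =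
          (aeval (ap f A : Module.End (S0 k b) _) (q.map (algebraMap _ (S0 k b)))) x.1.1 := by
        intro q x
        rw [aeval_eq_sum_range, aeval_map_algebraMap, aeval_eq_sum_range]
        simp only [LinearMap.sum_apply, LinearMap.smul_apply, Submodule.coe_sum, Submodule.coe_smul,
          Prod.fst_sum, Prod.smul_fst, hpow]
      refine ⟨p, hp, LinearMap.ext fun x => ?_⟩
      have hle : Submodule.span (S0 k b) (E : Set (M.carrier A × M.carrier (up P β A))) ≤
          (LinearMap.ker (aeval (ap f A : Module.End (S0 k b) _) (p.map (algebraMap _ (S0 k b))))).comap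
            (LinearMap.fst _ _ _) := by
        refine Submodule.span_le.mpr fun y hy => ?_
        have := haev p ⟨y, hy⟩
        rw [hp0] at this
        exact this.symm
      rw [h.span_edge] at hle
      exact hle (show ((x, 0) : M.carrier A × M.carrier (up P β A)) ∈ ⊤ from trivial)
    refine ⟨_, hp.map (augm k P : Sk k P →+* k), fun x => ?_⟩
    exact LinearMap.congr_fun (M.aeval_augm _ (fun n x hx => ap_deg f hx) hp0) x
  choose q hq h0 using hA
  -- one polynomial for all alcoves of the finite support
  refine ⟨∏ A ∈ h.supp.toFinset, q A, monic_prod_of_monic _ _ fun A _ => hq A, fun A x => ?_⟩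
  by_cases hA : A ∈ M.supp
  · obtain ⟨r, hr⟩ := Finset.dvd_prod_of_mem q (h.supp.mem_toFinset.mpr hA)
    rw [hr, mul_comm, polyAt_mul, h0, map_zero]
  · have : Subsingleton (M.carrier A) := not_nontrivial_iff_subsingleton.mp hA
    exact Subsingleton.elim _ _

end Obj

end Finiteness



/-! ### Ranks of modules over a domain -/

section Rank

variable {R : Type u} [CommRing R] [IsDomain R] {X K T : Type v} [AddCommGroup X] [Module R X]
  [AddCommGroup K] [Module R K] [AddCommGroup T] [Module R T]

/-- A proper direct summand of a finitely generated torsion-free module has smaller rank. -/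
lemma finrank_lt_of_retract [Module.Finite R X] [Module.IsTorsionFree R X] {i : K →ₗ[R] X}
    {r : X →ₗ[R] K} (h : ∀ x, r (i x) = x) (hr : ∃ x, r x = 0 ∧ x ≠ 0) :
    Module.finrank R K < Module.finrank R X := by
  have h1 := Submodule.finrank_quotient_add_finrank (LinearMap.ker r)
  have h2 := (r.quotKerEquivOfSurjective fun x => ⟨i x, h x⟩).finrank_eq
  have : Module.Finite R (LinearMap.ker r) := by
    have hk : ∀ x, (LinearMap.id - i ∘ₗ r : X →ₗ[R] X) x ∈ LinearMap.ker r := fun x => by simp [h]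
    refine Module.Finite.of_surjective ((LinearMap.id - i ∘ₗ r).codRestrict (LinearMap.ker r) hk)
      fun y => ⟨y.1, Subtype.ext ?_⟩
    have : r y.1 = 0 := y.2
    simp [this]
  have : Nontrivial (LinearMap.ker r) := by
    obtain ⟨x, hx, h0⟩ := hr
    exact ⟨⟨⟨x, hx⟩, 0, fun e => h0 (congrArg Subtype.val e)⟩⟩
  have h3 : 0 < Module.finrank R (LinearMap.ker r) := Module.finrank_pos
  omega

/-- The rank of a (twisted) submodule of the dual of a finitely generated module is at most the rank
of the module. -/
lemma finrank_le_of_dual [Module.Finite R X] {σ σ' : R →+* R} (h1 : ∀ c, σ' (σ c) = c)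
    (h2 : ∀ c, σ (σ' c) = c) (D : T →+ (X →ₗ[R] R)) (hD : ∀ c t, D (c • t) = σ c • D t)
    (hinj : Function.Injective D) : Module.finrank R T ≤ Module.finrank R X := by
  obtain ⟨s, hs, hli⟩ := exists_finset_linearIndependent_of_le_finrank (le_refl (Module.finrank R X))
  let ev : T →ₗ[R] (s → R) :=
    { toFun := fun t e => σ' (D t e)
      map_add' := fun t t' => funext fun e => by simp
      map_smul' := fun c t => funext fun e => by simp [hD, h1] }
  have hspan := Submodule.finrank_quotient_add_finrank (Submodule.span R (s : Set X))
  have hcard : Module.finrank R (Submodule.span R (s : Set X)) = s.card :=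
    finrank_span_finset_eq_card hli
  -- a linear form on `X` is determined by its values on a maximal independent family `s`
  have htor : Module.IsTorsion R (X ⧸ Submodule.span R (s : Set X)) :=
    Module.finrank_eq_zero_iff_isTorsion.mp (by omega)
  have hev : Function.Injective ev := by
    refine (injective_iff_map_eq_zero ev).mpr fun t ht => ?_
    refine (injective_iff_map_eq_zero D).mp hinj t (LinearMap.ext fun x => ?_)
    have hs0 : ∀ e ∈ s, D t e = 0 := fun e he => by
      have := congrArg σ (congrFun ht ⟨e, he⟩)
      change σ (σ' (D t e)) = σ 0 at this
      rwa [h2, map_zero] at this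
    have hle : Submodule.span R (s : Set X) ≤ LinearMap.ker (D t) := Submodule.span_le.mpr hs0
    obtain ⟨c, hc⟩ := @htor (Submodule.Quotient.mk x)
    have hc' : (Submodule.Quotient.mk ((c : R) • x) : X ⧸ Submodule.span R (s : Set X)) = 0 := hc
    have h0 : D t ((c : R) • x) = 0 := hle ((Submodule.Quotient.mk_eq_zero _).mp hc')
    rw [map_smul, smul_eq_mul] at h0
    exact (mul_eq_zero.mp h0).resolve_left (nonZeroDivisors.coe_ne_zero c)
  have := LinearMap.finrank_le_finrank_of_injective hev
  rw [Module.finrank_fintype_fun_eq_card, Fintype.card_coe, hs] at this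
  exact this

end Rank

/-! ### Existence of indecomposable summands -/

section Existence

variable {ι N : Type*} {V : Type v} [Finite ι] [AddCommGroup V] [Module ℚ V] [AddCommGroup N]
  [Module ℚ N]
variable {k : Type u} [Field k] {P : RootPairing ι ℚ V N} [P.IsRootSystem] [P.IsCrystallographic]
  [P.IsReduced] [P.IsIrreducible] {b : P.Base}

namespace Obj

variable {M X Y : Obj k b}

/-- Almost all `M(A)` vanish, and all `M(A)` are finitely generated and torsion-free. -/
structure TorsionFreeObj (M : Obj k b) : Prop where
  finite : ∀ A, Module.Finite (S0 k b) (M.carrier A)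
  torsionFree : ∀ A, Module.IsTorsionFree (S0 k b) (M.carrier A)
  supp : M.supp.Finite

lemma FinObj.torsionFreeObj (hk : GKM k b) (h : M.FinObj) : M.TorsionFreeObj where
  finite := h.finite
  torsionFree A := by
    have := hk.isDomain
    have := h.free A
    infer_instance
  supp := h.supp

lemma retract_apply (ρ : Retract X M) (A : Alcove P) (x : X.carrier A) :
    ap ρ.r A (ap ρ.i A x) = x := by rw [← ap_comp, ρ.retract, ap_id]

lemma retract_injective (ρ : Retract X M) (A : Alcove P) : Function.Injective (ap ρ.i A) :=
  Function.LeftInverse.injective (retract_apply ρ A)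

lemma supp_retract (ρ : Retract X M) : X.supp ⊆ M.supp := fun A hA =>
  @Function.Injective.nontrivial _ _ hA _ (retract_injective ρ A)

lemma TorsionFreeObj.retract (h : M.TorsionFreeObj) (ρ : Retract X M) : X.TorsionFreeObj where
  finite A := by
    have := h.finite A
    exact Module.Finite.of_surjective (ap ρ.r A) fun x => ⟨_, retract_apply ρ A x⟩
  torsionFree A := by
    have := h.torsionFree A
    exact (retract_injective ρ A).moduleIsTorsionFree _ fun c x => map_smul _ c x
  supp := h.supp.subset (supp_retract ρ)

lemma supp_sum : (X.sum Y).supp = X.supp ∪ Y.supp := by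
  ext A
  constructor
  · intro h
    by_contra hc
    rw [Set.mem_union, not_or] at hc
    have h1 : Subsingleton (X.carrier A) := not_nontrivial_iff_subsingleton.mp hc.1
    have h2 : Subsingleton (Y.carrier A) := not_nontrivial_iff_subsingleton.mp hc.2
    have h3 : Nontrivial (X.carrier A × Y.carrier A) := h
    exact not_nontrivial_iff_subsingleton.mpr inferInstance h3
  · rintro (h | h)
    · have : Nontrivial (X.carrier A) := h
      exact inferInstanceAs (Nontrivial (X.carrier A × Y.carrier A))
    · have : Nontrivial (Y.carrier A) := h
      exact inferInstanceAs (Nontrivial (X.carrier A × Y.carrier A))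

lemma supp_iso (e : X ≅ Y) : X.supp = Y.supp :=
  (supp_retract (Retract.ofIso e)).antisymm (supp_retract (Retract.ofIso e.symm))

/-- The total rank of an object. -/
def rk (F : Finset (Alcove P)) (X : Obj k b) : ℕ := ∑ A ∈ F, Module.finrank (S0 k b) (X.carrier A)

/-- Induction on the total rank: if `X` is decomposable, one of the two summands is nonzero at `A`
and has smaller rank. The finite set `F` of alcoves is fixed in order to compare the ranks. -/
lemma exists_indecomposable_aux (hk : GKM k b) (F : Finset (Alcove P)) (A : Alcove P) (n : ℕ) :
    ∀ X : Obj k b, X.TorsionFreeObj → X.supp ⊆ F → X.rk F = n → A ∈ X.supp →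
      ∃ Y : Obj k b, Y.Indecomposable ∧ A ∈ Y.supp ∧ Nonempty (Retract Y X) := by
  have := hk.isDomain
  induction n using Nat.strong_induction_on with
  | _ n ih =>
    intro X hX hF hn hA
    by_cases hind : X.Indecomposable
    · exact ⟨X, hind, hA, ⟨Retract.refl X⟩⟩
    have hnz : ¬ X.IsZeroObj := fun h => not_nontrivial_iff_subsingleton.mpr (h A) hA
    simp only [Indecomposable, not_and, not_forall, not_or] at hind
    obtain ⟨K, L, ⟨e⟩, hK, hL⟩ := hind hnz
    -- a summand with a nonzero complement has smaller rank
    have key : ∀ (Z W : Obj k b) (ρ : Retract Z X) (σ : Retract W X),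
        (∀ A x, ap ρ.r A (ap σ.i A x) = 0) → ¬ W.IsZeroObj → A ∈ Z.supp →
        ∃ Y : Obj k b, Y.Indecomposable ∧ A ∈ Y.supp ∧ Nonempty (Retract Y X) := by
      intro Z W ρ σ hρσ hW hAZ
      have hZ := hX.retract ρ
      have hlt : Z.rk F < X.rk F := by
        unfold IsZeroObj at hW
        push Not at hW
        obtain ⟨B, hB⟩ := hW
        obtain ⟨w, hw⟩ := @exists_ne _ hB (0 : W.carrier B)
        have hw' : ap σ.i B w ≠ 0 := fun h => hw (retract_injective σ B (by rw [h, map_zero]))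
        refine Finset.sum_lt_sum (fun C _ => ?_) ⟨B, hF ?_, ?_⟩
        · have := hX.finite C
          exact LinearMap.finrank_le_finrank_of_injective (retract_injective ρ C)
        · exact ⟨⟨_, _, hw'⟩⟩
        · have := hX.finite B
          have := hX.torsionFree B
          exact finrank_lt_of_retract (retract_apply ρ B) ⟨_, hρσ B w, hw'⟩
      obtain ⟨Y, h1, h2, ⟨τ⟩⟩ := ih _ (hn ▸ hlt) Z hZ ((supp_retract ρ).trans hF) rfl hAZ
      exact ⟨Y, h1, h2, ⟨τ.trans ρ⟩⟩
    let iK : K ⟶ K.sum L := ⟨fun A => LinearMap.inl _ _ _, fun A n x h => ⟨h, zero_mem _⟩,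
      fun A β p h => ⟨h, zero_mem _⟩⟩
    let rK : K.sum L ⟶ K := ⟨fun A => LinearMap.fst _ _ _, fun A n x h => h.1, fun A β p h => h.1⟩
    let iL : L ⟶ K.sum L := ⟨fun A => LinearMap.inr _ _ _, fun A n x h => ⟨zero_mem _, h⟩,
      fun A β p h => ⟨zero_mem _, h⟩⟩
    let rL : K.sum L ⟶ L := ⟨fun A => LinearMap.snd _ _ _, fun A n x h => h.2, fun A β p h => h.2⟩
    let ρK : Retract K X := ⟨iK ≫ e.inv, e.hom ≫ rK, by
      have h : iK ≫ rK = 𝟙 K := rfl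
      simp [h]⟩
    let ρL : Retract L X := ⟨iL ≫ e.inv, e.hom ≫ rL, by
      have h : iL ≫ rL = 𝟙 L := rfl
      simp [h]⟩
    have he : ∀ A x, ap e.hom A (ap e.inv A x) = x := fun A x => by
      rw [← ap_comp, e.inv_hom_id, ap_id]
    rw [supp_iso e, supp_sum] at hA
    rcases hA with hA | hA
    · refine key K L ρK ρL (fun A x => ?_) hL hA
      change (ap e.hom A (ap e.inv A (ap iL A x))).1 = 0
      rw [he]; rfl
    · refine key L K ρL ρK (fun A x => ?_) hK hA
      change (ap e.hom A (ap e.inv A (ap iK A x))).2 = 0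
      rw [he]; rfl

/-- An object of finite rank has an indecomposable direct summand that is nonzero at a given alcove
of the support. -/
lemma TorsionFreeObj.exists_indecomposable (hk : GKM k b) (h : M.TorsionFreeObj) {A : Alcove P}
    (hA : A ∈ M.supp) :
    ∃ Y : Obj k b, Y.Indecomposable ∧ A ∈ Y.supp ∧ Nonempty (Retract Y M) :=
  exists_indecomposable_aux hk h.supp.toFinset A _ M h (by simp) rfl hA

end Obj

end Existence


/-! ### The alcoves around the origin -/

section Star

variable {ι V N : Type*} [Finite ι] [AddCommGroup V] [Module ℚ V] [AddCommGroup N] [Module ℚ N]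
variable {P : RootPairing ι ℚ V N} [P.IsRootSystem] [P.IsCrystallographic] [P.IsReduced]
  [P.IsIrreducible] {b : P.Base}

open Obj (weylMove)

lemma weylMove_mul (x y : P.weylGroup) (A : Alcove P) :
    weylMove (x * y) A = weylMove x (weylMove y A) := by
  apply Subtype.ext
  change weylAff P (x * y) '' A.1 = weylAff P x '' (weylAff P y '' A.1)
  rw [Set.image_image, weylAff_mul]
  rfl

lemma weylMove_one (A : Alcove P) : weylMove (1 : P.weylGroup) A = A := by
  apply Subtype.ext
  change weylAff P 1 '' A.1 = A.1
  rw [weylAff_one]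
  simp

lemma weylMove_inv_weylMove (w : P.weylGroup) (A : Alcove P) : weylMove w⁻¹ (weylMove w A) = A := by
  rw [← weylMove_mul, inv_mul_cancel, weylMove_one]

/-- The reflection `s_α` as an element of the finite Weyl group. -/
def weylRefl (i : ι) : P.weylGroup := ⟨_, P.reflection_mem_weylGroup i⟩

lemma weylMove_weylRefl (b : P.Base) (i : ι) (A : Alcove P) :
    weylMove (weylRefl i) A = act b (refl b i 0) A := by
  apply Subtype.ext
  change weylAff P (weylRefl i) '' A.1 = affRefl P i 0 '' A.1
  rw [weylRefl, weylAff_reflection]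

lemma fl_weylMove (w : P.weylGroup) (i : ι) (A : Alcove P) :
    fl (weylIdx P w i) (weylMove w A) = fl i A := by
  have := fl_move_of_actsBy (weylAff_mem P w) (actsBy_weylAff w) i A
  rwa [add_zero] at this

lemma weylIdx_negIdx (w : P.weylGroup) (i : ι) :
    weylIdx P w (negIdx P i) = negIdx P (weylIdx P w i) := (actsBy_weylAff w).negIdx i

lemma weylIdx_surjective (w : P.weylGroup) : Function.Surjective (weylIdx P w) :=
  (w : P.Aut).indexEquiv.surjective

lemma nbr_weylMove (s : simpleRefl b) (w : P.weylGroup) (A : Alcove P) :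
    nbr s (weylMove w A) = weylMove w (nbr s A) := nbr_act s (weylEl b w) A

lemma up_weylMove (w : P.weylGroup) (i : ι) (A : Alcove P) :
    up P (weylIdx P w i) (weylMove w A) = weylMove w (up P i A) := by
  have hb : Nonempty P.Base := P.nonempty_base
  obtain ⟨b⟩ := hb
  have h1 := (actsBy_weylAff w).conj (P := P) i (fl i A + 1)
  rw [add_zero] at h1
  have h2 : weylEl b w * refl b i (fl i A + 1) = refl b (weylIdx P w i) (fl i A + 1) * weylEl b w := by
    rw [← mul_inv_eq_iff_eq_mul]
    exact Subtype.ext h1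
  rw [up_eq b, up_eq b, fl_weylMove, weylMove_eq, weylMove_eq, ← act_mul, ← act_mul, h2]

variable (b) in
/-- The alcoves `v.A_e` with `v` in the finite Weyl group, that is, the alcoves with `0` in their
closure. -/
def IsStar (A : Alcove P) : Prop := ∃ v : P.weylGroup, weylMove v (fundAlcove b) = A

lemma isStar_fund : IsStar b (fundAlcove b) := ⟨1, weylMove_one _⟩

variable {A : Alcove P}

lemma IsStar.weylMove (h : IsStar b A) (v : P.weylGroup) : IsStar b (weylMove v A) := by
  obtain ⟨w, rfl⟩ := h
  exact ⟨v * w, weylMove_mul v w _⟩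

lemma isStar_weylMove_iff (v : P.weylGroup) : IsStar b (weylMove v A) ↔ IsStar b A :=
  ⟨fun h => by simpa only [weylMove_inv_weylMove] using h.weylMove v⁻¹, fun h => h.weylMove v⟩

/-- At the alcoves around the origin all roots take values between `-1` and `1`. -/
lemma IsStar.fl (h : IsStar b A) (i : ι) : fl i A = 0 ∨ fl i A = -1 := by
  obtain ⟨w, rfl⟩ := h
  obtain ⟨j, rfl⟩ := weylIdx_surjective w i
  rw [fl_weylMove]
  by_cases hj : b.IsPos j
  · exact Or.inl (fl_fund_of_pos b hj)
  · exact Or.inr (fl_fund_of_not_pos b hj)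

/-- If `⟨α_i, ·⟩` takes values between `-1` and `0` on `A`, then `α_i ↑ A` is the image of `A` under
the linear reflection. -/
lemma up_of_fl (h : AJS.fl i A = -1) : up P i A = weylMove (weylRefl i) A := by
  have hb : Nonempty P.Base := P.nonempty_base
  obtain ⟨b⟩ := hb
  rw [up_eq b, h, weylMove_weylRefl b]
  rfl

lemma isStar_up {i : ι} (h : AJS.fl i A = -1) : IsStar b (up P i A) ↔ IsStar b A := by
  rw [up_of_fl h, isStar_weylMove_iff]

/-- The map `β ↑` leaves the star from an alcove of the star on the positive side of `H_{β,0}`. -/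
lemma IsStar.not_up {i : ι} (hA : IsStar b A) (h : AJS.fl i A ≠ -1) : ¬ IsStar b (up P i A) := by
  intro hu
  have h1 := hu.fl i
  rw [fl_up] at h1
  rcases hA.fl i with h2 | h2
  · omega
  · exact h h2

variable (b) in
/-- The simple reflections in the finite Weyl group. -/
def IsFin (s : simpleRefl b) : Prop := ∃ i ∈ b.support, s.1 = affRefl P i 0

variable {s : simpleRefl b}

lemma nbr_fund_of_isFin {i : ι} (hs : s.1 = affRefl P i 0) :
    nbr s (fundAlcove b) = weylMove (weylRefl i) (fundAlcove b) := by
  rw [← alcoveOf_one b, nbr_alcoveOf, one_mul, alcoveOf_one, weylMove_weylRefl b, alcoveOf_eq_act]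
  congr 1
  exact Subtype.ext hs

lemma IsStar.nbr (hA : IsStar b A) (hs : IsFin b s) : IsStar b (nbr s A) := by
  obtain ⟨v, rfl⟩ := hA
  obtain ⟨i, -, hs⟩ := hs
  rw [nbr_weylMove, nbr_fund_of_isFin hs]
  exact (isStar_fund.weylMove _).weylMove _

lemma isStar_nbr_iff (hs : IsFin b s) : IsStar b (AJS.nbr s A) ↔ IsStar b A :=
  ⟨fun h => by simpa only [nbr_nbr] using h.nbr hs, fun h => h.nbr hs⟩

lemma IsStar.fl_wallIdx (hA : IsStar b A) (hs : IsFin b s) : AJS.fl (wallIdx s A) A = 0 := by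
  have h1 := (isWallAt s A).fl_self
  have h2 := (isWallAt s A).fl_nbr
  have h3 := hA.fl (wallIdx s A)
  have h4 := (hA.nbr hs).fl (wallIdx s A)
  omega

lemma alcoveOf_weylEl (v : P.weylGroup) : alcoveOf b (weylEl b v) = weylMove v (fundAlcove b) := rfl

/-- Reduced words of elements of the finite Weyl group consist of reflections in the finite Weyl
group. -/
lemma isFin_of_reduced (u : List (simpleRefl b)) : ∀ v : P.weylGroup, wordEl b u = weylEl b v →
    u.length = len b (wordEl b u) → ∀ s ∈ u, IsFin b s := by
  induction u using List.reverseRecOn with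
  | nil => simp
  | append_singleton u s ih =>
    intro v hv hlen
    have hlt : dist (fundAlcove b) (alcoveOf b (wordEl b u)) <
        dist (fundAlcove b) (alcoveOf b (wordEl b (u ++ [s]))) := by
      rw [dist_alcoveOf, dist_alcoveOf, ← hlen]
      have := len_wordEl_le b u
      rw [List.length_append, List.length_singleton]
      omega
    have hu : wordEl b u = weylEl b v * sEl s := by
      rw [← hv, wordEl_concat, mul_assoc, sEl_mul_self, mul_one]
    have hs : IsFin b s := by
      rcases s.2 with hs | ⟨θ, hθ, hs⟩
      · exact hs
      exfalso
      -- the affine reflection leads out of the star, hence away from `A_e`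
      have h := (isWallOf_affine hθ hs).dist_translate (g := weylEl b v) (actsBy_weylAff v)
        (fundAlcove b)
      rw [if_pos, ← hu, ← hv] at h
      · omega
      · have := isStar_fund.fl (b := b) ((v : P.Aut).indexEquiv (negIdx P θ))
        omega
    intro s' hs'
    rw [List.mem_append, List.mem_singleton] at hs'
    rcases hs' with hs' | rfl
    · obtain ⟨i, -, hi⟩ := hs
      have hv' : wordEl b u = weylEl b (v * weylRefl i) := by
        rw [hu]
        refine Subtype.ext ?_
        change weylAff P v * s.1 = weylAff P (v * weylRefl i)
        rw [hi, weylAff_mul, weylRefl, weylAff_reflection]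
      refine ih _ hv' ?_ s' hs'
      have h1 := dist_mul_sEl (fundAlcove b) (wordEl b u) s
      rw [← wordEl_concat, dist_alcoveOf, dist_alcoveOf, ← hlen] at h1
      have := len_wordEl_le b u
      rw [List.length_append, List.length_singleton] at h1
      push_cast at h1
      omega
    · exact hs

/-- The longest element of the finite Weyl group maps positive roots to negative roots. -/
lemma IsLongest.not_isPos {w₀ : P.weylGroup} (h : IsLongest b w₀) {i : ι} (hi : b.IsPos i) :
    ¬ b.IsPos (weylIdx P w₀ i) := by
  have hsimple : ∀ i ∈ b.support, ¬ b.IsPos (weylIdx P w₀ i) := by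
    intro i hi hpos
    let s : simpleRefl b := ⟨affRefl P i 0, Or.inl ⟨i, hi, rfl⟩⟩
    have h1 := (isWallOf_simple (s := s) hi rfl).dist_translate (g := weylEl b w₀)
      (actsBy_weylAff w₀) (fundAlcove b)
    have h2 : weylEl b w₀ * sEl s = weylEl b (w₀ * weylRefl i) := by
      refine Subtype.ext ?_
      change weylAff P w₀ * affRefl P i 0 = weylAff P (w₀ * weylRefl i)
      rw [weylAff_mul, weylRefl, weylAff_reflection]
    have h3 := h (w₀ * weylRefl i)
    rw [if_pos, h2, dist_alcoveOf, dist_alcoveOf] at h1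
    · have h4 : len b (weylEl b (w₀ * weylRefl i)) ≤ len b (weylEl b w₀) := h3
      omega
    · exact (fl_fund_of_pos b hpos).symm.le
  -- `-w₀⁻¹ v` is dominant, where `v` is the vector at which each root takes its height as value
  obtain ⟨v, hv⟩ := exists_heightVec b
  have key : ∀ j, P.root' j (weylAff P w₀⁻¹ v) = b.height (weylIdx P w₀ j) := by
    intro j
    have h1 := (actsBy_weylAff w₀).1 j (weylAff P w₀⁻¹ v)
    have h2 : weylAff P w₀ (weylAff P w₀⁻¹ v) = v := by
      change (weylAff P w₀ * weylAff P w₀⁻¹) v = v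
      rw [← weylAff_mul, mul_inv_cancel, weylAff_one]; rfl
    rw [h2, hv] at h1
    push_cast at h1
    rw [add_zero] at h1
    exact h1.symm
  have h0 := nonneg_of_mem_closure b (v := -weylAff P w₀⁻¹ v) (fun j hj => by
    rw [map_neg, key]
    have : ¬ 0 < b.height (weylIdx P w₀ j) := hsimple j hj
    have : (b.height (weylIdx P w₀ j) : ℚ) ≤ 0 := by exact_mod_cast not_lt.mp this
    linarith) (root_mem_closure b hi)
  have h1 : P.toLinearMap (P.root i) (-weylAff P w₀⁻¹ v) = -(b.height (weylIdx P w₀ i) : ℚ) := by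
    rw [← key, map_neg]
  rw [h1] at h0
  intro hpos
  have h2 : (0 : ℚ) < b.height (weylIdx P w₀ i) := by exact_mod_cast hpos
  linarith

lemma IsLongest.isPos_iff {w₀ : P.weylGroup} (h : IsLongest b w₀) {i : ι} :
    b.IsPos (weylIdx P w₀ i) ↔ ¬ b.IsPos i := by
  refine ⟨fun h1 h2 => h.not_isPos h2 h1, fun h1 => ?_⟩
  have h2 := h.not_isPos ((isPos_negIdx b i).mpr h1)
  rw [weylIdx_negIdx, isPos_negIdx] at h2
  exact not_not.mp h2

lemma IsLongest.fl {w₀ : P.weylGroup} (h : IsLongest b w₀) (i : ι) :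
    AJS.fl i (weylMove w₀ (fundAlcove b)) = - AJS.fl i (fundAlcove b) - 1 := by
  obtain ⟨j, rfl⟩ := weylIdx_surjective w₀ i
  rw [fl_weylMove]
  by_cases hj : b.IsPos j
  · rw [fl_fund_of_pos b hj, fl_fund_of_not_pos b (h.not_isPos hj)]; rfl
  · rw [fl_fund_of_not_pos b hj, fl_fund_of_pos b (h.isPos_iff.mpr hj)]; rfl

instance : Fintype (PosRoot b) := Fintype.ofFinite _

/-- The length of the longest element is the number of positive roots. -/
lemma IsLongest.len_eq {w₀ : P.weylGroup} (h : IsLongest b w₀) :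
    len b (weylAff P w₀) = Fintype.card (PosRoot b) := by
  classical
  let := Fintype.ofFinite ι
  have h1 := dist_alcoveOf (b := b) (weylEl b w₀)
  have h2 : dist (fundAlcove b) (alcoveOf b (weylEl b w₀)) = ∑ i : ι, 1 := by
    unfold dist
    refine Finset.sum_congr (by congr) fun i _ => ?_
    rw [alcoveOf_weylEl, h.fl]
    rcases isStar_fund.fl (b := b) i with h3 | h3 <;> rw [h3] <;> rfl
  have h3 : Fintype.card ι = 2 * Fintype.card (PosRoot b) := by
    have e1 := Fintype.card_subtype_compl (fun i => b.IsPos i)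
    have e2 : Fintype.card {i // ¬ b.IsPos i} = Fintype.card {i // b.IsPos i} :=
      Fintype.card_congr
        { toFun := fun i => ⟨negIdx P i.1, (isPos_negIdx b _).mpr i.2⟩
          invFun := fun i => ⟨negIdx P i.1, by rw [isPos_negIdx]; exact not_not.mpr i.2⟩
          left_inv := fun i => Subtype.ext (negIdx_negIdx P _)
          right_inv := fun i => Subtype.ext (negIdx_negIdx P _) }
    have e3 := Fintype.card_subtype_le (fun i => b.IsPos i)
    have e4 : Fintype.card (PosRoot b) = Fintype.card {i // b.IsPos i} := Fintype.card_congr (Equiv.refl _)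
    omega
  rw [h2, Finset.sum_const, Finset.card_univ, h3, nsmul_eq_mul, mul_one] at h1
  have h4 : len b (weylAff P w₀) = len b (weylEl b w₀) := rfl
  rw [h4]
  push_cast at h1
  omega

end Star



/-! ### The star object and its sections -/

section StarObj

variable {ι N : Type*} {V : Type v} [Finite ι] [AddCommGroup V] [Module ℚ V] [AddCommGroup N]
  [Module ℚ N]
variable {k : Type u} [Field k] {P : RootPairing ι ℚ V N} [P.IsRootSystem] [P.IsCrystallographic]
  [P.IsReduced] [P.IsIrreducible] {b : P.Base}

/-- The reflection of roots in `S_k^∅`. -/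
lemma root0_reflectionPerm (i j : ι) : root0 k b (P.reflectionPerm i j) =
    root0 k b j - algebraMap k (S0 k b) (P.pairingIn ℤ j i : k) * root0 k b i := by
  have h : rootX P (P.reflectionPerm i j) = rootX P j - P.pairingIn ℤ j i • rootX P i := by
    apply Subtype.ext
    change P.root (P.reflectionPerm i j) = P.root j - P.pairingIn ℤ j i • P.root i
    rw [RootPairing.root_reflectionPerm, RootPairing.reflection_apply_root,
      ← P.algebraMap_pairingIn ℤ]
    exact congrArg (P.root j - ·) (Int.cast_smul_eq_zsmul ℚ _ _)
  have h2 : rootK k P (P.reflectionPerm i j) =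
      rootK k P j - (P.pairingIn ℤ j i : k) • rootK k P i := by
    unfold rootK
    rw [h, TensorProduct.tmul_sub, TensorProduct.tmul_smul, Int.cast_smul_eq_zsmul]
  rw [root0, rootS_eq, h2, map_sub, map_smul, map_sub, Algebra.smul_def, map_mul]
  rfl

lemma comp_root_mul (i : ι) (n : ℤ) (z : S0 k b) :
    comp (internal0 k b) n (root0 k b i * z) = root0 k b i * comp (internal0 k b) (n - 2) z := by
  induction z using graded_induction (internal0 k b) with
  | hom l y hy =>
    rw [comp_of_mem _ hy, comp_of_mem _ (mul_mem_deg0 k b (Obj.root_mem_deg0 i) hy)]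
    by_cases h : l = n - 2
    · rw [if_pos h, if_pos (by omega)]
    · rw [if_neg h, if_neg (by omega), mul_zero]
  | zero => simp
  | add y z hy hz => rw [mul_add, map_add, hy, hz, map_add, mul_add]

section Submodule

variable {U : Submodule (S0 k b) (S0 k b)}

lemma comp_mem_of_top_or_bot (hU : U = ⊤ ∨ U = ⊥) (n : ℤ) {x : S0 k b} (hx : x ∈ U) :
    comp (internal0 k b) n x ∈ U := by
  rcases hU with rfl | rfl
  · trivial
  · rw [(Submodule.mem_bot _).mp hx, map_zero]
    exact zero_mem _

/-- The submodules `0` and `S_k^∅` are graded. -/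
lemma internal_of_top_or_bot (hU : U = ⊤ ∨ U = ⊥) : DirectSum.IsInternal (fun n =>
    (deg0 k b n).comap U.subtype.toAddMonoidHom) := by
  refine internal_of_comp (fun n => ((comp (internal0 k b) n).comp
    U.subtype.toAddMonoidHom).codRestrict U.toAddSubgroup
      (fun x => comp_mem_of_top_or_bot hU n x.2)) ?_ ?_
  · intro m n x hx
    apply Subtype.ext
    refine (comp_of_mem (internal0 k b) (hx : (x : S0 k b) ∈ deg0 k b m) n).trans ?_
    split_ifs <;> rfl
  · intro x
    obtain ⟨s, hs⟩ := Obj.exists_sum_comp (internal0 k b) x.1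
    have : x = ∑ n ∈ s, ⟨comp (internal0 k b) n x.1, comp_mem_of_top_or_bot hU n x.2⟩ := by
      apply Subtype.ext
      rw [AddSubmonoidClass.coe_finsetSum]
      exact (hs s subset_rfl).symm
    rw [this]
    exact sum_mem fun n _ => AddSubgroup.mem_iSup_of_mem
      (S := fun n => (deg0 k b n).comap U.subtype.toAddMonoidHom) n
      (comp_mem (internal0 k b) n x.1)

lemma comp_coe_submodule (h : DirectSum.IsInternal (fun n =>
    (deg0 k b n).comap U.subtype.toAddMonoidHom)) (n : ℤ) (x : U) :
    (comp h n x : S0 k b) = comp (internal0 k b) n x := by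
  induction x using graded_induction h with
  | hom l y hy =>
    have h2 : (y : S0 k b) ∈ deg0 k b l := hy
    rw [comp_of_mem h hy]
    refine Eq.trans ?_ (comp_of_mem (internal0 k b) h2 n).symm
    split_ifs <;> rfl
  | zero => simp
  | add y z hy hz => simp only [map_add, Submodule.coe_add, hy, hz]

end Submodule

variable (k b) in
open Classical in
/-- `S_k^∅` for `A` in the finite Weyl group orbit of `A_e`, and `0` otherwise. -/
def starSub (A : Alcove P) : Submodule (S0 k b) (S0 k b) := if IsStar b A then ⊤ else ⊥

lemma starSub_cases (A : Alcove P) : starSub k b A = ⊤ ∨ starSub k b A = ⊥ := by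
  unfold starSub
  split_ifs <;> simp

lemma mem_starSub {A : Alcove P} (h : IsStar b A) (x : S0 k b) : x ∈ starSub k b A := by
  rw [starSub, if_pos h]; trivial

lemma eq_zero_of_mem_starSub {A : Alcove P} (h : ¬ IsStar b A) {x : S0 k b}
    (hx : x ∈ starSub k b A) : x = 0 := by
  rw [starSub, if_neg h] at hx; exact hx

open Classical in
/-- The condition that describes the pairs in the submodule of the star object at `(A, β)`: if
`A` and `β ↑ A` are both in the star, the entries are congruent modulo `β`. -/
def StarEdge (A : Alcove P) (β : PosRoot b) (x y : S0 k b) : Prop :=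
  y ∈ Sβ k b β ∧ ∃ z ∈ Sβ k b β, x - (if fl β.1 A = -1 then y else 0) = root0 k b β * z

lemma starEdge_of_eq {A : Alcove P} {β : PosRoot b} (h : fl β.1 A = -1) {x y : S0 k b} :
    StarEdge A β x y ↔ y ∈ Sβ k b β ∧ ∃ z ∈ Sβ k b β, x - y = root0 k b β * z := by
  rw [StarEdge, if_pos h]

lemma starEdge_of_ne {A : Alcove P} {β : PosRoot b} (h : fl β.1 A ≠ -1) {x y : S0 k b} :
    StarEdge A β x y ↔ y ∈ Sβ k b β ∧ ∃ z ∈ Sβ k b β, x = root0 k b β * z := by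
  rw [StarEdge, if_neg h, sub_zero]

lemma starEdge_zero (A : Alcove P) (β : PosRoot b) : StarEdge (k := k) A β 0 0 :=
  ⟨zero_mem _, 0, zero_mem _, by simp⟩

namespace Obj

variable (k b) in
/-- The object of the category `𝒦_k` supported on the star of `0`: `S_k^∅` at each alcove of the
star, and pairs of elements of `S_k^β` congruent modulo `β` at each pair of alcoves of the star. -/
def star : Obj k b where
  carrier A := starSub k b A
  deg A n := (deg0 k b n).comap (starSub k b A).subtype.toAddMonoidHom
  internal A := internal_of_top_or_bot (starSub_cases A)
  smul_mem_deg A m n c x hc hx := mul_mem_deg0 k b hc hx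
  edge A β :=
    { carrier := {p | StarEdge A β (p.1 : S0 k b) (p.2 : S0 k b)}
      zero_mem' := starEdge_zero A β
      add_mem' := by
        rintro p q ⟨h1, z, hz, e⟩ ⟨h1', z', hz', e'⟩
        refine ⟨add_mem h1 h1', z + z', add_mem hz hz', ?_⟩
        rw [mul_add, ← e, ← e']
        change (p.1 : S0 k b) + q.1 - (if _ then (p.2 : S0 k b) + q.2 else 0) = _
        split_ifs <;> ring
      smul_mem' := by
        rintro c p ⟨h1, z, hz, e⟩
        refine ⟨mul_mem c.2 h1, c * z, mul_mem c.2 hz, ?_⟩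
        rw [mul_left_comm, ← e]
        change (c : S0 k b) * (p.1 : S0 k b) - (if _ then (c : S0 k b) * (p.2 : S0 k b) else 0) = _
        split_ifs <;> ring }
  edge_homog A β p hp n := by
    obtain ⟨h1, z, hz, e⟩ := hp
    simp only [Submodule.mem_mk, AddSubmonoid.mem_mk, AddSubsemigroup.mem_mk, Set.mem_ofPred_eq,
      comp_coe_submodule]
    refine ⟨Sβ_homog k b β h1 n, comp (internal0 k b) (n - 2) z, Sβ_homog k b β hz _, ?_⟩
    rw [← comp_root_mul, ← e, map_sub]
    split_ifs <;> simp

/-- Compatible elements `m_A ∈ M(A)` that define a morphism from the star object to `M`. -/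
structure IsSection (M : Obj k b) (m : ∀ A, M.carrier A) : Prop where
  deg : ∀ A, m A ∈ M.deg A 0
  zero : ∀ A, ¬ IsStar b A → m A = 0
  both : ∀ A (β : PosRoot b), fl β.1 A = -1 → M.OnEdge A β m m
  left : ∀ A (β : PosRoot b), M.OnEdge A β (root0 k b β • m) 0
  right : ∀ A (β : PosRoot b), fl β.1 A ≠ -1 → M.OnEdge A β 0 m

/-- Linear forms on the `M(A)`, homogeneous of degree `d`, that define a morphism of degree `d` from
`M` to the star object. -/
structure IsCosection (M : Obj k b) (φ : ∀ A, M.carrier A →ₗ[S0 k b] S0 k b) (d : ℤ) : Prop where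
  deg : ∀ A n x, x ∈ M.deg A n → φ A x ∈ deg0 k b (d + n)
  zero : ∀ A, ¬ IsStar b A → ∀ x, φ A x = 0
  edge : ∀ A (β : PosRoot b) (f g : ∀ C, M.carrier C), M.OnEdge A β f g →
    StarEdge A β (φ A (f A)) (φ _ (g (up P β A)))

variable {M : Obj k b} {m : ∀ A, M.carrier A} {φ : ∀ A, M.carrier A →ₗ[S0 k b] S0 k b} {d : ℤ}
  {s : simpleRefl b}

lemma onEdge_zero (A : Alcove P) (β : PosRoot b) : M.OnEdge A β 0 0 := (M.edge A β).zero_mem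

lemma OnEdge.congr_of {A : Alcove P} {β : PosRoot b} {f g f' g' : ∀ C, M.carrier C}
    (h : M.OnEdge A β f g) (hf : f' A = f A) (hg : g' (up P β A) = g (up P β A)) :
    M.OnEdge A β f' g' := by
  unfold OnEdge
  rw [hf, hg]; exact h

/-- Translation functors of the finite Weyl group preserve sections: the entries of the new section
at `A` are the values of the old one at `A` and at its neighbour. The cases are those of the
submodules of `𝒯_s M`, for each of the three kinds of generators of the submodules of the star
object. -/
lemma IsSection.trans (h : IsSection M m) (hs : IsFin b s) :
    IsSection (M.trans s) (fun A => M.res s A m) := by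
  have hco : ∀ A C, (C = A ∨ C = nbr s A) → M.coord s A (M.res s A m) C = m C :=
    fun A C hC => coord_res hC m
  have hz : ∀ A, ¬ IsStar b A → M.res s A m = 0 := fun A hA => by
    have hA' := (isStar_nbr_iff hs).not.mpr hA
    refine trans_ext ?_ ?_
    · rw [hco A A (Or.inl rfl), h.zero A hA, map_zero]; rfl
    · rw [hco A _ (Or.inr rfl), h.zero _ hA', map_zero]; rfl
  have hcz : ∀ A, ¬ IsStar b A → M.coord s A (M.res s A m) = 0 := fun A hA => by
    rw [hz A hA, map_zero]
  -- outside the star the section vanishes, and so do all its multiples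
  have hself : ∀ A (β : PosRoot b), ¬ IsStar b A → ¬ IsStar b (up P β A) → ∀ c e : S0 k b,
      M.OnEdge A β (c • m) (e • m) := fun A β h1 h2 c e => by
    refine (onEdge_zero A β).congr_of ?_ ?_
    · rw [Pi.smul_apply, h.zero A h1, smul_zero]; rfl
    · rw [Pi.smul_apply, h.zero _ h2, smul_zero]; rfl
  refine ⟨fun A => ?_, hz, fun A β hfl => ?_, fun A β => ?_, fun A β hfl => ?_⟩
  · refine mem_trans_deg.mpr ⟨?_, ?_⟩
    · rw [hco A A (Or.inl rfl)]; exact h.deg A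
    · rw [hco A _ (Or.inr rfl)]; exact h.deg _
  · by_cases h1 : β.1 = wallIdx s A
    · -- an alcove of the star with `⟨β, ·⟩ < 0` does not lie on the positive side of a wall in
      -- `H_{β,0}`
      have hA : ¬ IsStar b A := fun hA => by
        have := hA.fl_wallIdx hs
        rw [← h1] at this
        omega
      have hB : ¬ IsStar b (up P β A) := fun hB => hA ((isStar_up hfl).mp hB)
      refine (mem_trans_edge_pos h1).mpr ⟨?_, ?_⟩
      · have e : rinv k b β • M.coord s A (M.res s A m) = 0 := by rw [hcz A hA, smul_zero]
        exact (onEdge_zero _ β).congr e e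
      · exact (onEdge_zero _ β).congr (hcz _ hB) (hcz _ hB)
    by_cases h2 : β.1 = negIdx P (wallIdx s A)
    · have hup := up_of_negIdx_wallIdx h2
      have e : M.coord s A (M.res s A m) = M.coord s (up P β A) (M.res s _ m) := by
        funext C
        by_cases hC : C = A ∨ C = nbr s A
        · rw [hco A C hC, hco _ C (by rw [hup, nbr_nbr]; exact hC.symm)]
        · push Not at hC
          rw [coord_other hC.1 hC.2, coord_other (by rw [hup]; exact hC.2)
            (by rw [hup, nbr_nbr]; exact hC.1)]
      refine (mem_trans_edge_neg h2).mpr ⟨?_, ?_⟩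
      · have e' : rinv k b β • (M.coord s A (M.res s A m) -
            M.coord s (up P β A) (M.res s _ m)) = 0 := by rw [e, sub_self, smul_zero]
        exact (onEdge_zero _ β).congr e' e'
      · refine (h.both A β hfl).congr_of ?_ ?_
        · exact hco _ A (Or.inr (by rw [hup, nbr_nbr]))
        · exact hco _ _ (Or.inl rfl)
    · have hup := nbr_up h1 h2
      refine (mem_trans_edge_cross h1 h2).mpr ⟨?_, ?_⟩
      · exact (h.both A β hfl).congr_of (hco _ _ (Or.inl rfl)) (hco _ _ (Or.inl rfl))
      · exact (h.both (nbr s A) β (by rw [(isWallAt s A).fl_other _ h1 h2]; exact hfl)).congr_of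
          (hco _ _ (Or.inr rfl)) (hco _ _ (Or.inr hup.symm))
  · have hz2 : M.coord s (up P β A) (0 : (M.trans s).carrier (up P β A)) = 0 := map_zero _
    have hsm : M.coord s A (root0 k b β • M.res s A m) = root0 k b β • M.coord s A (M.res s A m) :=
      map_smul _ _ _
    by_cases h1 : β.1 = wallIdx s A
    · refine (mem_trans_edge_pos h1).mpr ⟨?_, (onEdge_zero _ β).congr hz2 hz2⟩
      have e : rinv k b β • M.coord s A (root0 k b β • M.res s A m) = M.coord s A (M.res s A m) := by
        rw [hsm, rinv_smul]
      have hnb := up_nbr_of_wallIdx h1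
      have hm : M.OnEdge (nbr s A) β m m := by
        by_cases hA : IsStar b A
        · refine h.both _ β ?_
          rw [h1, (isWallAt s A).fl_nbr, ← (isWallAt s A).fl_self, hA.fl_wallIdx hs]; rfl
        · have := hself (nbr s A) β ((isStar_nbr_iff hs).not.mpr hA) (by rw [hnb]; exact hA) 1 1
          rwa [one_smul] at this
      exact (hm.congr_of (hco _ _ (Or.inr rfl)) (hco _ _ (Or.inl hnb))).congr e e
    by_cases h2 : β.1 = negIdx P (wallIdx s A)
    · have hup := up_of_negIdx_wallIdx h2
      refine (mem_trans_edge_neg h2).mpr ⟨?_, (onEdge_zero _ β).congr hz2 hz2⟩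
      have e : rinv k b β • (M.coord s A (root0 k b β • M.res s A m) -
          M.coord s (up P β A) (0 : (M.trans s).carrier (up P β A))) =
            M.coord s A (M.res s A m) := by
        rw [hsm, hz2, sub_zero, rinv_smul]
      have hm : M.OnEdge A β m m := by
        by_cases hA : IsStar b A
        · refine h.both _ β ?_
          rw [h2, fl_negIdx, hA.fl_wallIdx hs]; rfl
        · have := hself A β hA (by rw [hup]; exact (isStar_nbr_iff hs).not.mpr hA) 1 1
          rwa [one_smul] at this
      exact (hm.congr_of (hco _ _ (Or.inl rfl)) (hco _ _ (Or.inr hup))).congr e e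
    · refine (mem_trans_edge_cross h1 h2).mpr ⟨?_, ?_⟩
      · refine (h.left A β).congr_of ?_ (congrFun hz2 _)
        refine (congrFun hsm A).trans ?_
        rw [Pi.smul_apply, hco A A (Or.inl rfl)]; rfl
      · refine (h.left (nbr s A) β).congr_of ?_ (congrFun hz2 _)
        refine (congrFun hsm _).trans ?_
        rw [Pi.smul_apply, hco A _ (Or.inr rfl)]; rfl
  · have hz1 : M.coord s A (0 : (M.trans s).carrier A) = 0 := map_zero _
    by_cases h1 : β.1 = wallIdx s A
    · have hup := nbr_up_of_wallIdx h1
      refine (mem_trans_edge_pos h1).mpr ⟨?_, ?_⟩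
      · have e : rinv k b β • M.coord s A (0 : (M.trans s).carrier A) = 0 := by
          rw [hz1, smul_zero]
        exact (onEdge_zero _ β).congr e e
      · have hm : M.OnEdge (up P β A) β m m := by
          by_cases hB : IsStar b (up P β A)
          · refine h.both _ β ?_
            have := hB.fl_wallIdx hs
            rw [wallIdx_up, ← h1, fl_negIdx] at this
            omega
          · have := hself (up P β A) β hB (by rw [← hup]; exact (isStar_nbr_iff hs).not.mpr hB) 1 1
            rwa [one_smul] at this
        exact hm.congr_of (hco _ _ (Or.inl rfl)) (hco _ _ (Or.inr hup.symm))
    by_cases h2 : β.1 = negIdx P (wallIdx s A)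
    · have hA : ¬ IsStar b A := fun hA => hfl (by
        rw [h2, fl_negIdx, hA.fl_wallIdx hs]; rfl)
      have hB : ¬ IsStar b (up P β A) := by
        rw [up_of_negIdx_wallIdx h2]
        exact (isStar_nbr_iff hs).not.mpr hA
      refine (mem_trans_edge_neg h2).mpr ⟨?_, (onEdge_zero _ β).congr (hcz _ hB) (hcz _ hB)⟩
      have e : rinv k b β • (M.coord s A (0 : (M.trans s).carrier A) -
          M.coord s (up P β A) (M.res s _ m)) = 0 := by
        rw [hz1, hcz _ hB, sub_zero, smul_zero]
      exact (onEdge_zero _ β).congr e e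
    · have hup := nbr_up h1 h2
      refine (mem_trans_edge_cross h1 h2).mpr ⟨?_, ?_⟩
      · exact (h.right A β hfl).congr_of (congrFun hz1 _) (hco _ _ (Or.inl rfl))
      · exact (h.right (nbr s A) β (by rw [(isWallAt s A).fl_other _ h1 h2]; exact hfl)).congr_of
          (congrFun hz1 _) (hco _ _ (Or.inr hup.symm))

end Obj

end StarObj



/-! ### The star object as a direct summand -/

section StarRetract

variable {ι N : Type*} {V : Type v} [Finite ι] [AddCommGroup V] [Module ℚ V] [AddCommGroup N]
  [Module ℚ N]
variable {k : Type u} [Field k] {P : RootPairing ι ℚ V N} [P.IsRootSystem] [P.IsCrystallographic]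
  [P.IsReduced] [P.IsIrreducible] {b : P.Base}

namespace Obj

variable {M : Obj k b} {m : ∀ A, M.carrier A} {φ : ∀ A, M.carrier A →ₗ[S0 k b] S0 k b} {d : ℤ}
  {s : simpleRefl b}

/-- The linear forms on `𝒯_s M` that arise from linear forms `φ_A` on the `M(A)`: on `𝒯_s M(A)`,
the divided difference of `φ_A` and `φ_{As}`. -/
def coform (s : simpleRefl b) (φ : ∀ A, M.carrier A →ₗ[S0 k b] S0 k b) (A : Alcove P) :
    (M.trans s).carrier A →ₗ[S0 k b] S0 k b :=
  rinv k b (wallIdx s A) • (φ A ∘ₗ LinearMap.proj A ∘ₗ M.coord s A -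
    φ (nbr s A) ∘ₗ LinearMap.proj (nbr s A) ∘ₗ M.coord s A)

lemma coform_apply (φ : ∀ A, M.carrier A →ₗ[S0 k b] S0 k b) (A : Alcove P)
    (p : (M.trans s).carrier A) : coform s φ A p = rinv k b (wallIdx s A) *
      (φ A (M.coord s A p A) - φ (nbr s A) (M.coord s A p (nbr s A))) := rfl

lemma map_congr {C D : Alcove P} (h : C = D) (φ : ∀ A, M.carrier A →ₗ[S0 k b] S0 k b)
    (f : ∀ C, M.carrier C) : φ C (f C) = φ D (f D) := by rw [h]

/-- Translation functors of the finite Weyl group preserve cosections, and the divided difference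
lowers the degree by `2`. In the two wall cases the divided difference lies in `S_k^β` by the
congruences modulo `β`. Otherwise the root of the wall is invertible in `S_k^β`, and its reflection
in `β` differs from it by a multiple of `β`. -/
lemma IsCosection.trans (h : IsCosection M φ d) (hs : IsFin b s) :
    IsCosection (M.trans s) (coform s φ) (d - 2) := by
  refine ⟨fun A n x hx => ?_, fun A hA x => ?_, fun A β f' g' hfg => ?_⟩
  · have h1 := mem_trans_deg.mp hx
    have h2 := mul_mem_deg0 k b (rinv_mem_deg0 (wallIdx s A))
      (sub_mem (h.deg _ _ _ h1.1) (h.deg _ _ _ h1.2))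
    rw [coform_apply]
    rwa [show d - 2 + n = -2 + (d + n) by ring]
  · rw [coform_apply, h.zero A hA, h.zero _ ((isStar_nbr_iff hs).not.mpr hA), sub_zero, mul_zero]
  rw [coform_apply, coform_apply]
  change (f' A, g' (up P β A)) ∈ _ at hfg
  generalize f' A = p at hfg ⊢
  generalize g' (up P β A) = q at hfg ⊢
  by_cases h1 : β.1 = wallIdx s A
  · have hnb := up_nbr_of_wallIdx h1
    have hup := nbr_up_of_wallIdx h1
    obtain ⟨hf, hg⟩ := (mem_trans_edge_pos h1).mp hfg
    have hj : wallIdx s (up P β A) = negIdx P β.1 := by rw [h1, wallIdx_up]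
    rw [hj, rinv_negIdx, ← h1]
    replace hf := h.edge _ _ _ _ hf
    replace hg := h.edge _ _ _ _ hg
    rw [map_congr hnb φ] at hf
    rw [map_congr hup φ]
    simp only [Pi.smul_apply, map_smul, smul_eq_mul] at hf
    by_cases hA : IsStar b A
    · have hfl : fl β.1 A = 0 := h1 ▸ hA.fl_wallIdx hs
      have hB : ¬ IsStar b (up P β A) := hA.not_up (by omega)
      have hB' : ¬ IsStar b (up P β (up P β A)) := by
        rw [← hup]; exact (isStar_nbr_iff hs).not.mpr hB
      rw [starEdge_of_ne (by omega), h.zero _ hB, h.zero _ hB']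
      have hfl' : fl β.1 (nbr s A) = -1 := by
        rw [h1, (isWallAt s A).fl_nbr, ← (isWallAt s A).fl_self, hA.fl_wallIdx hs]; rfl
      obtain ⟨-, z, hz, e⟩ := (starEdge_of_eq hfl').mp hf
      exact ⟨by simp, -z, neg_mem hz, by rw [mul_neg, ← e]; ring⟩
    · have hA' := (isStar_nbr_iff hs).not.mpr hA
      rw [h.zero _ hA, h.zero _ hA', sub_zero, mul_zero]
      by_cases hB : IsStar b (up P β A)
      · have hfl := hB.fl_wallIdx hs
        rw [hj, fl_negIdx] at hfl
        obtain ⟨-, z, hz, e⟩ := (starEdge_of_eq (by omega)).mp hg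
        rw [fl_up] at hfl
        rw [starEdge_of_ne (by omega)]
        refine ⟨?_, 0, zero_mem _, by simp⟩
        rw [e, ← mul_assoc, neg_mul, rinv_mul_root, neg_one_mul]
        exact neg_mem hz
      · have hB' : ¬ IsStar b (up P β (up P β A)) := by
          rw [← hup]; exact (isStar_nbr_iff hs).not.mpr hB
        rw [h.zero _ hB, h.zero _ hB', sub_zero, mul_zero]
        exact starEdge_zero A β
  by_cases h2 : β.1 = negIdx P (wallIdx s A)
  · have hup := up_of_negIdx_wallIdx h2
    have hup' : nbr s (up P β A) = A := by rw [hup, nbr_nbr]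
    obtain ⟨hf, hg⟩ := (mem_trans_edge_neg h2).mp hfg
    have hj : wallIdx s (up P β A) = β.1 := by rw [hup, wallIdx_nbr, h2]
    have hj' : wallIdx s A = negIdx P β.1 := by rw [h2, negIdx_negIdx]
    replace hf := h.edge _ _ _ _ hf
    replace hg := h.edge _ _ _ _ hg
    rw [hj, hj', rinv_negIdx, map_congr hup' φ, ← map_congr hup φ]
    simp only [Pi.smul_apply, Pi.sub_apply, map_smul, map_sub, smul_eq_mul] at hf
    by_cases hA : IsStar b A
    · have hfl : fl β.1 A = -1 := by rw [h2, fl_negIdx, hA.fl_wallIdx hs]; rfl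
      obtain ⟨-, z1, hz1, e1⟩ := (starEdge_of_eq hfl).mp hf
      obtain ⟨-, z2, hz2, e2⟩ := (starEdge_of_eq hfl).mp hg
      refine (starEdge_of_eq hfl).mpr ⟨?_, -z1, neg_mem hz1, by rw [mul_neg, ← e1]; ring⟩
      have : rinv k b β.1 * (φ (up P β A) (M.coord s (up P β A) q (up P β A)) -
          φ A (M.coord s (up P β A) q A)) = - z2 := by
        rw [← neg_sub, e2, mul_neg, ← mul_assoc, rinv_mul_root, one_mul]
      rw [this]
      exact neg_mem hz2
    · have hB : ¬ IsStar b (up P β A) := by rw [hup]; exact (isStar_nbr_iff hs).not.mpr hA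
      rw [h.zero _ hA, h.zero _ hA, h.zero _ hB, h.zero _ hB, sub_zero, mul_zero, mul_zero]
      exact starEdge_zero A β
  · have hup := nbr_up h1 h2
    obtain ⟨hf, hg⟩ := (mem_trans_edge_cross h1 h2).mp hfg
    replace hf := h.edge _ _ _ _ hf
    replace hg := h.edge _ _ _ _ hg
    rw [map_congr hup φ]
    have hfl : fl β.1 (nbr s A) = fl β.1 A := (isWallAt s A).fl_other _ h1 h2
    have hr : rinv k b (wallIdx s A) ∈ Sβ k b β :=
      rinv_mem_Sβ (Ne.symm h1) (fun e => h2 (by rw [e, negIdx_negIdx]))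
    have hr' : rinv k b (wallIdx s (up P β A)) ∈ Sβ k b β := by
      rw [wallIdx_up]
      refine rinv_mem_Sβ (fun e => h2 ?_) (fun e => h1 ?_)
      · rw [← P.reflectionPerm_self β.1 (wallIdx s A), e]
        exact (negIdx_negIdx P β.1).symm
      · rw [← P.reflectionPerm_self β.1 (wallIdx s A), e]
        exact (P.reflectionPerm_self β.1 β.1).symm
    have hκ := root0_reflectionPerm (k := k) (b := b) β.1 (wallIdx s A)
    rw [← wallIdx_up] at hκ
    have e1 := root_mul_rinv (k := k) (b := b) (wallIdx s A)
    have e2 := root_mul_rinv (k := k) (b := b) (wallIdx s (up P β A))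
    generalize root0 k b (wallIdx s A) = κ at *
    generalize root0 k b (wallIdx s (up P β A)) = κ' at *
    generalize rinv k b (wallIdx s A) = r at *
    generalize rinv k b (wallIdx s (up P β A)) = r' at *
    have hn := algebraMap_mem_Sβ (k := k) (b := b) (P.pairingIn ℤ (wallIdx s A) β.1 : k) β
    generalize algebraMap k (S0 k b) (P.pairingIn ℤ (wallIdx s A) β.1 : k) = n at *
    refine ⟨mul_mem hr' (sub_mem hf.1 hg.1), ?_⟩
    by_cases hc : fl β.1 A = -1
    · obtain ⟨h3, u, hu, e3⟩ := (starEdge_of_eq hc).mp hf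
      obtain ⟨h4, v, hv, e4⟩ := (starEdge_of_eq (hfl.trans hc)).mp hg
      rw [if_pos hc]
      refine ⟨r * (u - v) - n * (r * r') * (φ (up P β A) (M.coord s (up P β A) q (up P β A)) -
        φ (up P β (nbr s A)) (M.coord s (up P β A) q (up P β (nbr s A)))),
        sub_mem (mul_mem hr (sub_mem hu hv)) (mul_mem (mul_mem hn (mul_mem hr hr'))
          (sub_mem h3 h4)), ?_⟩
      generalize φ (up P β A) (M.coord s (up P β A) q (up P β A)) = x at *
      generalize φ (up P β (nbr s A)) (M.coord s (up P β A) q (up P β (nbr s A))) = y at *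
      linear_combination r * e3 - r * e4 + r' * (x - y) * e1 - r * (x - y) * e2 +
        r * r' * (x - y) * hκ
    · obtain ⟨h3, u, hu, e3⟩ := (starEdge_of_ne hc).mp hf
      obtain ⟨h4, v, hv, e4⟩ := (starEdge_of_ne (hfl ▸ hc)).mp hg
      rw [if_neg hc]
      exact ⟨r * (u - v), mul_mem hr (sub_mem hu hv), by linear_combination r * e3 - r * e4⟩

/-- The section of the unit object that generates it. -/
lemma isSection_unit : ∃ m, IsSection (unit k b) m ∧ (unitSub k b _).subtype (m (fundAlcove b)) = 1 := by
  classical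
  have hm : ∀ A, (if A = fundAlcove b then (1 : S0 k b) else 0) ∈ unitSub k b A := fun A => by
    by_cases h : A = fundAlcove b
    · rw [unitSub_eq_top _ h]; trivial
    · rw [if_neg h]; exact zero_mem _
  let m : ∀ A, (unit k b).carrier A := fun A => ⟨_, hm A⟩
  have hβ : ∀ A (β : PosRoot b), (unitSub k b A).subtype (m A) ∈ Sβ k b β := fun A β => by
    change (if A = fundAlcove b then (1 : S0 k b) else 0) ∈ _
    split_ifs
    · exact one_mem _
    · exact zero_mem _
  refine ⟨m, ⟨fun A => ?_, fun A hA => ?_, fun A β _ => ⟨hβ _ _, hβ _ _⟩, fun A β => ⟨?_, zero_mem _⟩,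
    fun A β _ => ⟨zero_mem _, hβ _ _⟩⟩, if_pos rfl⟩
  · change (if A = fundAlcove b then (1 : S0 k b) else 0) ∈ deg0 k b 0
    split_ifs
    · exact one_mem_deg0 k b
    · exact zero_mem _
  · refine Subtype.ext (if_neg fun e => hA ?_)
    rw [e]; exact isStar_fund
  · exact mul_mem (root0_mem_Sβ _ _) (hβ _ _)

lemma prod_root_mem_deg0 (s : Finset (PosRoot b)) :
    ∏ β ∈ s, root0 k b β.1 ∈ deg0 k b (2 * s.card) := by
  classical
  induction s using Finset.induction_on with
  | empty => exact one_mem_deg0 k b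
  | insert β s h ih =>
    rw [Finset.prod_insert h, Finset.card_insert_of_notMem h]
    have := mul_mem_deg0 k b (root_mem_deg0 β.1) ih
    rwa [show (2 : ℤ) * ((s.card + 1 : ℕ) : ℤ) = 2 + 2 * (s.card : ℤ) by push_cast; ring]

/-- Multiplication by the product of the positive roots maps the unit object to the star object. -/
lemma isCosection_unit : IsCosection (unit k b)
    (fun A => (∏ β : PosRoot b, root0 k b β.1) • (unitSub k b A).subtype)
    (2 * Fintype.card (PosRoot b)) := by
  classical
  refine ⟨fun A n x hx => mul_mem_deg0 k b (prod_root_mem_deg0 Finset.univ) hx, fun A hA x => ?_,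
    fun A β f g h => ?_⟩
  · have : (x : unitSub k b A) = 0 := by
      have hA' : A ≠ fundAlcove b := fun e => hA (e ▸ isStar_fund)
      have h : ∀ y ∈ unitSub k b A, y = 0 := by rw [unitSub_eq_bot _ hA']; exact fun y hy => hy
      exact Subtype.ext (h _ (Subtype.prop _))
    exact (congrArg _ this).trans (map_zero _)
  · obtain ⟨hx, hy⟩ : _ ∧ _ := h
    change StarEdge A β ((∏ β : PosRoot b, root0 k b β.1) * (unitSub k b A).subtype (f A))
      ((∏ β : PosRoot b, root0 k b β.1) * (unitSub k b _).subtype (g (up P β A)))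
    replace hx : (unitSub k b A).subtype (f A) ∈ Sβ k b β := hx
    replace hy : (unitSub k b _).subtype (g (up P β A)) ∈ Sβ k b β := hy
    generalize (unitSub k b A).subtype (f A) = x at hx ⊢
    generalize (unitSub k b _).subtype (g (up P β A)) = y at hy ⊢
    rw [← Finset.mul_prod_erase Finset.univ _ (Finset.mem_univ β)]
    have hp : ∏ γ ∈ Finset.univ.erase β, root0 k b γ.1 ∈ Sβ k b β :=
      prod_mem fun γ _ => root0_mem_Sβ _ _
    generalize ∏ γ ∈ Finset.univ.erase β, root0 k b γ.1 = p at *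
    refine ⟨mul_mem (mul_mem (root0_mem_Sβ _ _) hp) hy,
      p * (x - if fl β.1 A = -1 then y else 0), mul_mem hp (sub_mem hx ?_), ?_⟩
    · split_ifs
      · exact hy
      · exact zero_mem _
    · split_ifs <;> ring

/-- The alcoves in the support of `𝒯_{s_j} ∘ ⋯ ∘ 𝒯_{s_1} P_0` are of the form `g.A_e` with `l(g) ≤
j`. -/
lemma len_le_of_mem_supp (u : List (simpleRefl b)) : ∀ {A : Alcove P},
    A ∈ ((unit k b).transWord u).supp → len b (elOf b A) ≤ u.length := by
  induction u using List.reverseRecOn with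
  | nil =>
    intro A hA
    by_cases h : A = fundAlcove b
    · rw [h, ← alcoveOf_one b, elOf_alcoveOf]
      exact len_wordEl_le b []
    · have hA : Nontrivial (unitSub k b A) := hA
      rw [unitSub_eq_bot _ h] at hA
      exact absurd hA (not_nontrivial _)
  | append_singleton u s ih =>
    intro A hA
    rw [transWord_concat] at hA
    rw [List.length_append, List.length_singleton]
    rcases mem_supp_trans hA with h | h
    · exact (ih h).trans (Nat.le_succ _)
    · have h1 := ih h
      have h2 := dist_mul_sEl (fundAlcove b) (elOf b A) s
      have h3 : alcoveOf b (elOf b A * sEl s) = nbr s A := rfl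
      have h4 := dist_alcoveOf (b := b) (elOf b A * sEl s)
      have h5 := dist_alcoveOf (b := b) (elOf b A)
      have h6 : elOf b (nbr s A) = elOf b A * sEl s := elOf_alcoveOf b _
      rw [h6] at h1
      omega

lemma eq_zero_of_len_lt {u : List (simpleRefl b)} {A : Alcove P} (h : u.length < len b (elOf b A))
    (x : ((unit k b).transWord u).carrier A) : x = 0 := by
  by_contra hx
  exact absurd (len_le_of_mem_supp u (A := A) ⟨x, 0, hx⟩) (not_le.mpr h)

/-- For a reduced word in the finite Weyl group there are a section and a cosection of the
Bott-Samelson object whose composition is nonzero: the value at the alcove of the word is, up to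
sign, the product of the positive roots divided by a root for each letter. -/
lemma exists_section (u : List (simpleRefl b)) (hfin : ∀ s ∈ u, IsFin b s)
    (hlen : u.length = len b (wordEl b u)) :
    ∃ m φ, IsSection ((unit k b).transWord u) m ∧
      IsCosection ((unit k b).transWord u) φ (2 * Fintype.card (PosRoot b) - 2 * u.length) ∧
      IsUnit (φ _ (m (alcoveOf b (wordEl b u)))) := by
  induction u using List.reverseRecOn with
  | nil =>
    obtain ⟨m, hm, h1⟩ := isSection_unit (k := k) (b := b)
    refine ⟨m, _, hm, by
      rw [List.length_nil, Nat.cast_zero, mul_zero, sub_zero]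
      exact isCosection_unit, ?_⟩
    have h0 : alcoveOf b (wordEl b ([] : List (simpleRefl b))) = fundAlcove b := alcoveOf_one b
    rw [h0]
    change IsUnit ((∏ β : PosRoot b, root0 k b β.1) * (unitSub k b _).subtype (m (fundAlcove b)))
    rw [h1, mul_one]
    exact IsUnit.prod_univ_iff.mpr fun β => isUnit_root0 k b β
  | append_singleton u s ih =>
    have h1 := len_wordEl_le b u
    have h2 := dist_mul_sEl (fundAlcove b) (wordEl b u) s
    rw [← wordEl_concat, dist_alcoveOf, dist_alcoveOf, ← hlen, List.length_append,
      List.length_singleton] at h2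
    obtain ⟨m, φ, hm, hφ, hu⟩ := ih (fun s hs => hfin s (List.mem_append_left _ hs))
      (by push_cast at h2; omega)
    have hs := hfin s (by simp)
    rw [transWord_concat]
    refine ⟨_, coform s φ, hm.trans hs, ?_, ?_⟩
    · have := hφ.trans hs
      rw [List.length_append, List.length_singleton]
      rwa [show (2 : ℤ) * Fintype.card (PosRoot b) - 2 * ((u.length + 1 : ℕ) : ℤ) =
        2 * Fintype.card (PosRoot b) - 2 * u.length - 2 by push_cast; ring]
    · rw [wordEl_concat, ← nbr_alcoveOf]
      generalize hX : alcoveOf b (wordEl b u) = X at *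
      have h3 : nbr s (nbr s X) = X := nbr_nbr s X
      rw [coform_apply, coord_res (Or.inl rfl), coord_res (Or.inr rfl)]
      -- only one term of the divided difference survives, since the new alcove is longer than all
      -- those in the support of the previous object
      have h4 : m (nbr s X) = 0 := by
        refine eq_zero_of_len_lt ?_ _
        rw [← hX, nbr_alcoveOf, elOf_alcoveOf, ← wordEl_concat, ← hlen]
        simp
      rw [h4, map_zero, map_congr h3 φ, zero_sub]
      exact (IsUnit.of_mul_eq_one _ (rinv_mul_root _)).mul hu.neg

/-- If the composition of a section and a cosection of degree `0` is the identity on the star, then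
the star object is a retract. -/
lemma nonempty_retract_star (hm : IsSection M m) (hφ : IsCosection M φ 0)
    (h : ∀ A, IsStar b A → φ A (m A) = 1) : Nonempty (Retract (star k b) M) := by
  let i : star k b ⟶ M := by
    refine ⟨fun A => (LinearMap.toSpanSingleton _ _ (m A)).comp (starSub k b A).subtype,
      fun A n x hx => ?_, fun A β p hp => ?_⟩
    · have := M.smul_mem_deg A n 0 _ _ hx (hm.deg A)
      rwa [add_zero] at this
    · change M.OnEdge A β ((starSub k b A).subtype p.1 • m) ((starSub k b _).subtype p.2 • m)
      obtain ⟨hy, z, hz, e⟩ : StarEdge A β ((starSub k b A).subtype p.1)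
        ((starSub k b _).subtype p.2) := hp
      generalize (starSub k b A).subtype p.1 = x at *
      generalize (starSub k b _).subtype p.2 = y at *
      -- the pair is a combination of `(β, 0)` and of `(1, 1)` or `(0, 1)`
      have h1 := (M.edge A β).smul_mem ⟨z, hz⟩ (hm.left A β)
      by_cases hfl : fl β.1 A = -1
      · have h2 := (M.edge A β).add_mem h1 ((M.edge A β).smul_mem ⟨y, hy⟩ (hm.both A β hfl))
        rw [if_pos hfl] at e
        rw [sub_eq_iff_eq_add.mp e]
        unfold OnEdge
        convert h2 using 1
        refine Prod.ext ?_ ?_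
        · change (root0 k b β * z + y) • m A = z • root0 k b β • m A + y • m A
          rw [add_smul, mul_comm, mul_smul]
        · change y • m _ = z • (0 : M.carrier _) + y • m _
          rw [smul_zero, zero_add]
      · have h2 := (M.edge A β).add_mem h1 ((M.edge A β).smul_mem ⟨y, hy⟩ (hm.right A β hfl))
        rw [if_neg hfl, sub_zero] at e
        rw [e]
        unfold OnEdge
        convert h2 using 1
        refine Prod.ext ?_ ?_
        · change (root0 k b β * z) • m A = z • root0 k b β • m A + y • (0 : M.carrier _)
          rw [smul_zero, add_zero, mul_comm, mul_smul]
        · change y • m _ = z • (0 : M.carrier _) + y • m _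
          rw [smul_zero, zero_add]
  have hmem : ∀ A x, φ A x ∈ starSub k b A := fun A x => by
    by_cases hA : IsStar b A
    · exact mem_starSub hA _
    · rw [hφ.zero A hA]; exact zero_mem _
  let r : M ⟶ star k b := by
    refine ⟨fun A => (φ A).codRestrict _ (hmem A), fun A n x hx => ?_, fun A β p hp => ?_⟩
    · have := hφ.deg A n x hx
      rwa [zero_add] at this
    · have h1 := hφ.edge A β _ _ (onEdge_lift hp)
      rw [lift_left, lift_right] at h1
      exact h1
  refine ⟨⟨i, r, hom_ext fun A x => Subtype.ext ?_⟩⟩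
  change φ A ((starSub k b A).subtype x • m A) = (starSub k b A).subtype x
  rw [map_smul]
  by_cases hA : IsStar b A
  · rw [h A hA, smul_eq_mul, mul_one]
  · have hx : (starSub k b A).subtype x = 0 := eq_zero_of_mem_starSub hA (Subtype.prop _)
    rw [hx, zero_smul]

lemma IsSection.smul (hm : IsSection M m) (c : k) :
    IsSection M (fun A => algebraMap k (S0 k b) c • m A) := by
  have hsm : ∀ {A β f g}, M.OnEdge A β f g → M.OnEdge A β (algebraMap k (S0 k b) c • f)
      (algebraMap k (S0 k b) c • g) := fun {A β f g} h =>
    (M.edge A β).smul_mem ⟨_, algebraMap_mem_Sβ c β⟩ h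
  refine ⟨fun A => ?_, fun A hA => by rw [hm.zero A hA, smul_zero],
    fun A β h => hsm (hm.both A β h), fun A β => ?_, fun A β h => ?_⟩
  · have := M.smul_mem_deg A 0 0 _ _ (algebraMap_mem_deg0 c) (hm.deg A)
    rwa [add_zero] at this
  · exact (hsm (hm.left A β)).congr (smul_comm (root0 k b β.1) (algebraMap k (S0 k b) c) m) (smul_zero _).symm
  · exact (hsm (hm.right A β h)).congr (smul_zero _).symm rfl

/-- The composition of a section and a cosection of degree `0` is a constant. -/
lemma IsCosection.exists_const (hφ : IsCosection M φ 0) (hm : IsSection M m) (hk : GKM k b) :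
    ∃ c : k, ∀ A, IsStar b A → φ A (m A) = algebraMap k (S0 k b) c := by
  have hedge : ∀ A (β : PosRoot b), fl β.1 A = -1 → φ _ (m (up P β A)) ∈ Sβ k b β ∧
      ∃ z ∈ Sβ k b β, φ A (m A) - φ _ (m (up P β A)) = root0 k b β * z := fun A β h =>
    (starEdge_of_eq h).mp (hφ.edge A β _ _ (hm.both A β h))
  have hconst : ∀ A, IsStar b A → ∃ c : k, algebraMap k (S0 k b) c = φ A (m A) := by
    intro A hA
    refine hk.exists_const (by simpa using hφ.deg A 0 _ (hm.deg A)) fun β => ?_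
    rcases hA.fl β.1 with h | h
    · have h1 := (hedge (down P β.1 A) β (by rw [fl_down, h]; rfl)).1
      rwa [up_down] at h1
    · obtain ⟨h1, z, hz, e⟩ := hedge A β h
      rw [sub_eq_iff_eq_add.mp e]
      exact add_mem (mul_mem (root0_mem_Sβ _ _) hz) h1
  choose! c hc using hconst
  -- constants that are congruent modulo `β` are equal
  have hup : ∀ A, IsStar b A → ∀ β : PosRoot b, fl β.1 A = -1 → c (up P β A) = c A := by
    intro A hA β h
    obtain ⟨-, z, hz, e⟩ := hedge A β h
    rw [← hc A hA, ← hc _ ((isStar_up h).mpr hA), ← map_sub] at e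
    by_contra hne
    have hne' : c A - c (up P β A) ≠ 0 := sub_ne_zero.mpr (Ne.symm hne)
    refine hk.not_isUnit β (mul_mem hz (algebraMap_mem_Sβ (c A - c (up P β A))⁻¹ β)) ?_
    rw [← mul_assoc, ← e, ← map_mul, mul_inv_cancel₀ hne', map_one]
  have hrefl : ∀ A, IsStar b A → ∀ i, c (weylMove (weylRefl i) A) = c A := by
    intro A hA i
    have hpos : ∀ A, IsStar b A → ∀ β : PosRoot b, c (weylMove (weylRefl β.1) A) = c A := by
      intro A hA β
      rcases hA.fl β.1 with h | h
      · have h1 : fl β.1 (down P β.1 A) = -1 := by rw [fl_down, h]; rfl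
        have h2 := hup _ ((isStar_up h1).mp (by rwa [up_down])) β h1
        have h3 : weylMove (weylRefl β.1) A = down P β.1 A := by
          rw [weylMove_weylRefl b, down_eq b, h]
        rw [h3, ← h2, up_down]
      · rw [← up_of_fl h, hup A hA β h]
    have h4 : ∀ A, weylMove (weylRefl (negIdx P i)) A = weylMove (weylRefl i) A := fun A => by
      rw [weylMove_weylRefl b, weylMove_weylRefl b]
      apply Subtype.ext
      change affRefl P (negIdx P i) 0 '' A.1 = affRefl P i 0 '' A.1
      congr 1
      funext v
      rw [affRefl_apply, affRefl_apply, root'_negIdx]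
      simp
    rcases RootPairing.Base.IsPos.or_neg b i with h | h
    · exact hpos A hA ⟨i, h⟩
    · rw [← h4]; exact hpos A hA ⟨negIdx P i, h⟩
  have hall : ∀ v : P.weylGroup, ∀ A, IsStar b A → c (weylMove v A) = c A := by
    rintro ⟨v, hv⟩
    induction hv using RootPairing.weylGroup.induction with
    | mem i => exact fun A hA => hrefl A hA i
    | one => exact fun A hA => congrArg c (weylMove_one A)
    | mul x y hx hy h1 h2 =>
      intro A hA
      have := weylMove_mul ⟨x, hx⟩ ⟨y, hy⟩ A
      refine (congrArg c this).trans ?_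
      rw [h1 _ (hA.weylMove _), h2 A hA]
  refine ⟨c (fundAlcove b), fun A hA => ?_⟩
  rw [← hc A hA]
  obtain ⟨v, rfl⟩ := hA
  rw [hall v _ isStar_fund]

/-- The star object is a direct summand of the Bott-Samelson object of a reduced word of the longest
element of the finite Weyl group. -/
lemma star_retract (hk : GKM k b) {w₀ : P.weylGroup} (hw₀ : IsLongest b w₀)
    {u : List (simpleRefl b)} (hu : IsReducedExpr b u (weylAff P w₀)) :
    Nonempty (Retract (star k b) ((unit k b).transWord u)) := by
  have := hk.isDomain
  have hu1 : wordEl b u = weylEl b w₀ := Subtype.ext ((coe_wordEl b u).trans hu.1)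
  have hlen : u.length = len b (wordEl b u) := by rw [hu.2, hu1]; rfl
  obtain ⟨m, φ, hm, hφ, hun⟩ := exists_section (k := k) u (isFin_of_reduced u w₀ hu1 hlen) hlen
  rw [hu.2, hw₀.len_eq, sub_self] at hφ
  obtain ⟨c, hc⟩ := hφ.exists_const hm hk
  rw [hu1, hc (alcoveOf b (weylEl b w₀)) ⟨w₀, rfl⟩] at hun
  have hc0 : c ≠ 0 := by
    rintro rfl
    rw [map_zero] at hun
    exact not_isUnit_zero hun
  refine nonempty_retract_star (hm.smul c⁻¹) hφ fun A hA => ?_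
  rw [map_smul, hc A hA, smul_eq_mul, ← map_mul, inv_mul_cancel₀ hc0, map_one]

end Obj

end StarRetract



/-! ### Geodesics into the anti-fundamental box -/

section Geodesics

variable {ι V N : Type*} [Finite ι] [AddCommGroup V] [Module ℚ V] [AddCommGroup N] [Module ℚ N]
variable {P : RootPairing ι ℚ V N} [P.IsRootSystem] [P.IsCrystallographic] [P.IsReduced]
  [P.IsIrreducible] {b : P.Base}

open Obj (weylMove)

lemma weylIdx_mul (x y : P.weylGroup) (i : ι) : weylIdx P (x * y) i = weylIdx P x (weylIdx P y i) :=
  rfl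

lemma weylIdx_weylRefl (i : ι) : weylIdx P (weylRefl i) i = negIdx P i := rfl

lemma len_nbr_le (s : simpleRefl b) (A : Alcove P) : len b (elOf b (nbr s A)) ≤ len b (elOf b A) + 1 := by
  have h2 := dist_mul_sEl (fundAlcove b) (elOf b A) s
  have h4 := dist_alcoveOf (b := b) (elOf b A * sEl s)
  have h5 := dist_alcoveOf (b := b) (elOf b A)
  have h6 : elOf b (nbr s A) = elOf b A * sEl s := elOf_alcoveOf b _
  rw [h6]
  omega

lemma len_mul_sEl_le (g : affineWeyl b) (s : simpleRefl b) : len b ↑(g * sEl s) ≤ len b g + 1 := by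
  have := len_nbr_le s (alcoveOf b g)
  rwa [nbr_alcoveOf, elOf_alcoveOf, elOf_alcoveOf] at this

lemma len_mul_wordEl_le (g : affineWeyl b) (u : List (simpleRefl b)) :
    len b ↑(g * wordEl b u) ≤ len b g + u.length := by
  induction u using List.reverseRecOn with
  | nil => simp [wordEl]
  | append_singleton u s ih =>
    rw [wordEl_concat, ← mul_assoc, List.length_append, List.length_singleton]
    have := len_mul_sEl_le (g * wordEl b u) s
    omega

lemma reduced_append_left {u v : List (simpleRefl b)}
    (h : (u ++ v).length = len b (wordEl b (u ++ v))) : u.length = len b (wordEl b u) := by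
  have h1 := len_wordEl_le b u
  have h2 := len_mul_wordEl_le (wordEl b u) v
  rw [← wordEl_append, ← h, List.length_append] at h2
  omega

/-- The alcoves along a reduced word form a geodesic: each hyperplane is crossed at most once. -/
lemma fl_between {u v : List (simpleRefl b)} (h : (u ++ v).length = len b (wordEl b (u ++ v)))
    (i : ι) :
    |fl i (fundAlcove b) - fl i (alcoveOf b (wordEl b u))| +
      |fl i (alcoveOf b (wordEl b u)) - fl i (alcoveOf b (wordEl b (u ++ v)))| =
    |fl i (fundAlcove b) - fl i (alcoveOf b (wordEl b (u ++ v)))| := by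
  let := Fintype.ofFinite ι
  have h1 := dist_alcoveOf (b := b) (wordEl b u)
  have h2 := dist_alcoveOf (b := b) (wordEl b (u ++ v))
  have h3 : dist (alcoveOf b (wordEl b u)) (alcoveOf b (wordEl b (u ++ v))) ≤ 2 * v.length := by
    have h4 := dist_alcoveOf (b := b) (wordEl b v)
    have h5 := len_wordEl_le b v
    have h6 := dist_act (b := b) (wordEl b u) (fundAlcove b) (alcoveOf b (wordEl b v))
    rw [← alcoveOf_mul, ← alcoveOf_eq_act, ← wordEl_append] at h6
    omega
  have h4 := reduced_append_left h
  rw [← h4] at h1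
  rw [← h, List.length_append] at h2
  have hle : ∀ j ∈ Finset.univ, |fl j (fundAlcove b) - fl j (alcoveOf b (wordEl b (u ++ v)))| ≤
      |fl j (fundAlcove b) - fl j (alcoveOf b (wordEl b u))| +
      |fl j (alcoveOf b (wordEl b u)) - fl j (alcoveOf b (wordEl b (u ++ v)))| :=
    fun j _ => abs_sub_le _ _ _
  -- the triangle inequalities for all roots add up to an equality of lengths
  refine ((Finset.sum_eq_sum_iff_of_le hle).mp (le_antisymm (Finset.sum_le_sum hle) ?_) i
    (Finset.mem_univ i)).symm
  rw [Finset.sum_add_distrib]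
  unfold dist at h1 h2 h3
  push_cast at h2
  omega

lemma fl_of_mem_antiFundBox {A : Alcove P} (hA : A ∈ antiFundBox b) {i : ι} (hi : i ∈ b.support) :
    fl i A = -1 := by
  obtain ⟨v, hv⟩ := alcove_nonempty A
  obtain ⟨h1, h2⟩ := hA i hi v hv
  exact fl_eq_of_lt hv (by push_cast; linarith) (by push_cast; linarith)

/-- The alcoves on a geodesic from `A_{w₀}` to an alcove of the anti-fundamental box lie in the
anti-fundamental box. -/
lemma fl_prefix {w₀ : P.weylGroup} {s t t' : List (simpleRefl b)} (hw₀ : IsLongest b w₀)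
    (hs : wordEl b s = weylEl b w₀)
    (hst : (s ++ (t ++ t')).length = len b (wordEl b (s ++ (t ++ t'))))
    (hbox : alcoveOf b (wordEl b (s ++ (t ++ t'))) ∈ antiFundBox b) {i : ι} (hi : i ∈ b.support) :
    fl i (alcoveOf b (wordEl b (s ++ t))) = -1 := by
  have h1 := fl_of_mem_antiFundBox hbox hi
  rw [← List.append_assoc] at hst h1
  have h2 := fl_between hst i
  have h3 := fl_between (reduced_append_left hst) i
  have h4 := hw₀.fl i
  rw [← alcoveOf_weylEl, ← hs, fl_fund_of_pos b (b.isPos_of_mem_support hi),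
    neg_zero, zero_sub] at h4
  rw [h1, fl_fund_of_pos b (b.isPos_of_mem_support hi)] at h2
  rw [h4, fl_fund_of_pos b (b.isPos_of_mem_support hi)] at h3
  generalize fl i (alcoveOf b (wordEl b (s ++ t))) = x at *
  have e0 : |(0 : ℤ) - -1| = 1 := rfl
  rw [e0] at h2 h3
  rcases abs_cases (0 - x) with h | h <;> rcases abs_cases (x - -1) with h' | h' <;>
    rcases abs_cases (-1 - x) with h'' | h'' <;> omega

end Geodesics

/-! ### The orbit of the top alcove -/

section TopAlcoves

variable {ι N : Type*} {V : Type v} [Finite ι] [AddCommGroup V] [Module ℚ V] [AddCommGroup N]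
  [Module ℚ N]
variable {k : Type u} [Field k] {P : RootPairing ι ℚ V N} [P.IsRootSystem] [P.IsCrystallographic]
  [P.IsReduced] [P.IsIrreducible] {b : P.Base}

namespace Obj

variable {M Y : Obj k b} {A : Alcove P} {σ : simpleRefl b} {w₀ : P.weylGroup}
  {s t : List (simpleRefl b)}

/-- If `M` has rank `1` at `A` and vanishes at the neighbour of `A`, then `𝒯_s M` has rank `1` at
the neighbour. -/
lemma RankOne.trans (h : M.RankOne A) (hA : nbr σ A ∉ M.supp) : (M.trans σ).RankOne (nbr σ A) := by
  classical
  obtain ⟨x, h1, h2⟩ := h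
  have h0 : Subsingleton (M.carrier (nbr σ A)) := not_nontrivial_iff_subsingleton.mp hA
  have hA' : A = nbr σ (nbr σ A) := (nbr_nbr σ A).symm
  have hx : M.coord σ (nbr σ A) (M.res σ (nbr σ A) (Pi.single A x)) A = x := by
    rw [coord_res (Or.inr hA'), Pi.single_eq_same]
  refine ⟨M.res σ _ (Pi.single A x), fun y => ?_, fun c hc => h2 c ?_⟩
  · obtain ⟨c, hc⟩ := h1 (M.coord σ _ y A)
    refine ⟨c, trans_ext (Subsingleton.elim _ _) ?_⟩
    rw [← hA', map_smul, Pi.smul_apply, hx, hc]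
  · have := congrFun (congrArg (M.coord σ (nbr σ A)) hc) A
    rwa [map_smul, Pi.smul_apply, hx, map_zero] at this

lemma RankOne.mem_supp [Nontrivial (S0 k b)] (h : M.RankOne A) : A ∈ M.supp := by
  obtain ⟨x, -, h2⟩ := h
  refine ⟨x, 0, fun e => one_ne_zero (α := S0 k b) (h2 1 ?_)⟩
  rw [e, smul_zero]

/-- The Bott-Samelson object of a reduced word has rank `1` at the alcove of the word. -/
lemma rankOne_unit (u : List (simpleRefl b)) (hu : u.length = len b (wordEl b u)) :
    ((unit k b).transWord u).RankOne (alcoveOf b (wordEl b u)) := by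
  induction u using List.reverseRecOn with
  | nil =>
    have h0 : alcoveOf b (wordEl b ([] : List (simpleRefl b))) = fundAlcove b := alcoveOf_one b
    rw [h0]
    have hmem : ∀ x, x ∈ unitSub k b (fundAlcove b) := fun x => by
      rw [unitSub_eq_top _ rfl]; trivial
    refine ⟨(⟨1, hmem 1⟩ : unitSub k b _), fun y => ⟨(unitSub k b _).subtype y, ?_⟩, fun c hc => ?_⟩
    · refine Subtype.ext ?_
      change (unitSub k b _).subtype y = (unitSub k b _).subtype y * 1
      rw [mul_one]
    · have h1 : c * 1 = 0 := congrArg (unitSub k b (fundAlcove b)).subtype hc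
      rwa [mul_one] at h1
  | append_singleton u σ ih =>
    rw [transWord_concat, wordEl_concat, ← nbr_alcoveOf]
    refine (ih (reduced_append_left hu)).trans fun h => ?_
    have h1 := len_le_of_mem_supp u h
    rw [nbr_alcoveOf, elOf_alcoveOf, ← wordEl_concat, ← hu, List.length_append,
      List.length_singleton] at h1
    omega

lemma mem_supp_star (h : A ∈ (star k b).supp) : IsStar b A := by
  by_contra hA
  have h1 : Nontrivial (starSub k b A) := h
  rw [starSub, if_neg hA] at h1
  exact not_nontrivial _ h1

/-- The support of `𝒯_t` of the star object consists of alcoves all of whose images under the finite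
Weyl group have length at most `l(w₀)` plus the length of `t`. -/
lemma len_le_of_mem_supp_star (hw₀ : IsLongest b w₀) (t : List (simpleRefl b)) :
    ∀ {A : Alcove P}, A ∈ ((star k b).transWord t).supp → ∀ v : P.weylGroup,
      len b (elOf b (weylMove v A)) ≤ len b (weylAff P w₀) + t.length := by
  induction t using List.reverseRecOn with
  | nil =>
    intro A hA v
    obtain ⟨v', rfl⟩ := mem_supp_star hA
    rw [← weylMove_mul, ← alcoveOf_weylEl, elOf_alcoveOf]
    exact hw₀ _
  | append_singleton u σ ih =>
    intro A hA v
    rw [transWord_concat] at hA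
    rw [List.length_append, List.length_singleton]
    rcases mem_supp_trans hA with h | h
    · have := ih h v; omega
    · have h1 := ih h v
      have h2 := len_nbr_le σ (weylMove v (nbr σ A))
      rw [nbr_weylMove, nbr_nbr] at h2
      omega

/-- If `w₀` times the word `t` is reduced, then `𝒯_t` applied to the star object has rank `1` at the
alcoves in the finite Weyl group orbit of the top alcove. -/
lemma rankOne_star (hw₀ : IsLongest b w₀) (hs : wordEl b s = weylEl b w₀)
    (hst : (s ++ t).length = len b (wordEl b (s ++ t))) (v : P.weylGroup) :
    ((star k b).transWord t).RankOne (weylMove v (alcoveOf b (wordEl b (s ++ t)))) := by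
  induction t using List.reverseRecOn with
  | nil =>
    rw [List.append_nil, hs, alcoveOf_weylEl]
    have hstar : IsStar b (weylMove v (weylMove w₀ (fundAlcove b))) :=
      (isStar_fund.weylMove _).weylMove _
    refine ⟨(⟨1, mem_starSub hstar 1⟩ : starSub k b _),
      fun y => ⟨(starSub k b _).subtype y, ?_⟩, fun c hc => ?_⟩
    · refine Subtype.ext ?_
      change (starSub k b _).subtype y = (starSub k b _).subtype y * 1
      rw [mul_one]
    · have h1 : c * 1 = 0 := congrArg (starSub k b _).subtype hc
      rwa [mul_one] at h1
  | append_singleton t σ ih =>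
    have hlen := hst
    rw [← List.append_assoc] at hst hlen ⊢
    have hred := reduced_append_left hst
    have h1 := reduced_append_left hred
    rw [transWord_concat, wordEl_concat, ← nbr_alcoveOf, ← nbr_weylMove]
    refine (ih hred).trans fun h => ?_
    have h2 := len_le_of_mem_supp_star hw₀ t h v⁻¹
    rw [nbr_weylMove, weylMove_inv_weylMove, nbr_alcoveOf, elOf_alcoveOf, ← wordEl_concat, ← hst,
      List.length_append, List.length_append, List.length_singleton, h1, hs] at h2
    have h3 : len b (weylEl b w₀) = len b (weylAff P w₀) := rfl
    omega

/-- If `M(A, β)` is not the direct sum of its intersections with `M(A)` and `M(β ↑ A)`, and the wall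
of `A` lies in no `H_{β,n}`, then `𝒯_s M` has the same property at the neighbour of `A`. -/
lemma exists_not_split_trans {β : PosRoot b} (h1 : β.1 ≠ wallIdx σ A)
    (h2 : β.1 ≠ negIdx P (wallIdx σ A))
    (h : ∃ x y, (x, y) ∈ M.edge A β ∧ (x, 0) ∉ M.edge A β) :
    ∃ x y, (x, y) ∈ (M.trans σ).edge (nbr σ A) β ∧ (x, 0) ∉ (M.trans σ).edge (nbr σ A) β := by
  classical
  obtain ⟨x, y, hxy, hx⟩ := h
  have c1 : β.1 ≠ wallIdx σ (nbr σ A) := by rw [wallIdx_nbr]; exact h2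
  have c2 : β.1 ≠ negIdx P (wallIdx σ (nbr σ A)) := by rw [wallIdx_nbr, negIdx_negIdx]; exact h1
  have hA : nbr σ (nbr σ A) = A := nbr_nbr σ A
  have hup : nbr σ (up P β (nbr σ A)) = up P β A := by rw [nbr_up c1 c2, hA]
  have e1 : M.coord σ (nbr σ A) (M.res σ _ (Pi.single A x)) = Pi.single A x :=
    coord_res_eq fun C _ hC => Pi.single_eq_of_ne (by rwa [hA] at hC) _
  have e2 : M.coord σ (up P β (nbr σ A)) (M.res σ _ (Pi.single (up P β A) y)) =
      Pi.single (up P β A) y :=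
    coord_res_eq fun C _ hC => Pi.single_eq_of_ne (by rwa [hup] at hC) _
  have hone : ∀ y, M.OnEdge A β (Pi.single A x) (Pi.single (up P β A) y) ↔ (x, y) ∈ M.edge A β :=
    fun y => by rw [OnEdge, Pi.single_eq_same, Pi.single_eq_same]
  refine ⟨M.res σ _ (Pi.single A x), M.res σ _ (Pi.single (up P β A) y), ?_, fun hc => ?_⟩
  · refine (mem_trans_edge_cross c1 c2).mpr ⟨?_, ?_⟩
    · refine (onEdge_zero _ β).congr_of ?_ ?_
      · exact (congrFun e1 _).trans (Pi.single_eq_of_ne (nbr_ne σ A) _)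
      · refine (congrFun e2 _).trans (Pi.single_eq_of_ne (fun e => ?_) _)
        exact nbr_ne σ A ((upEquiv P β.1).injective e)
    · rw [hA]
      exact ((hone y).mpr hxy).congr e1 e2
  · have h3 := ((mem_trans_edge_cross c1 c2).mp hc).2
    rw [hA] at h3
    refine hx ((hone 0).mp (h3.congr e1.symm ?_))
    rw [Pi.single_zero]
    exact (map_zero _).symm

/-- The submodules of `𝒯_t` of the star object between two alcoves `A` and `β ↑ A` of the orbit of
the top alcove are not direct sums, if the gallery that leads to the top alcove does not cross the
hyperplanes of the corresponding root. -/
lemma exists_not_split (hk : GKM k b) (hs : wordEl b s = weylEl b w₀)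
    (t : List (simpleRefl b)) (v : P.weylGroup) (β : PosRoot b)
    (hfl : ∀ t₁ t₂, t₁ ++ t₂ = t → fl β.1 (weylMove v (alcoveOf b (wordEl b (s ++ t₁)))) = -1) :
    ∃ x y, (x, y) ∈ ((star k b).transWord t).edge (weylMove v (alcoveOf b (wordEl b (s ++ t)))) β ∧
      (x, 0) ∉ ((star k b).transWord t).edge (weylMove v (alcoveOf b (wordEl b (s ++ t)))) β := by
  induction t using List.reverseRecOn with
  | nil =>
    have h1 := hfl [] [] rfl
    rw [List.append_nil, hs, alcoveOf_weylEl] at h1 ⊢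
    have hstar : IsStar b (weylMove v (weylMove w₀ (fundAlcove b))) :=
      (isStar_fund.weylMove _).weylMove _
    generalize weylMove v (weylMove w₀ (fundAlcove b)) = A at *
    refine ⟨(⟨1, mem_starSub hstar 1⟩ : starSub k b _),
      (⟨1, mem_starSub ((isStar_up h1).mpr hstar) 1⟩ : starSub k b _), ?_, fun hc => ?_⟩
    · exact (starEdge_of_eq h1).mpr ⟨one_mem _, 0, zero_mem _, by simp⟩
    · obtain ⟨-, z, hz, e⟩ := (starEdge_of_eq (x := (1 : S0 k b)) (y := 0) h1).mp hc
      rw [sub_zero] at e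
      exact hk.not_isUnit β hz e.symm
  | append_singleton t σ ih =>
    have h1 := hfl (t ++ [σ]) [] (by simp)
    have h2 := hfl t [σ] rfl
    have ih := ih fun t₁ t₂ h => hfl t₁ (t₂ ++ [σ]) (by rw [← h, List.append_assoc])
    rw [transWord_concat]
    rw [← List.append_assoc, wordEl_concat, ← nbr_alcoveOf, ← nbr_weylMove] at h1 ⊢
    generalize weylMove v (alcoveOf b (wordEl b (s ++ t))) = A at *
    have h3 := (isWallAt σ A).fl_self
    have h4 := (isWallAt σ A).fl_nbr
    refine exists_not_split_trans (fun e => ?_) (fun e => ?_) ih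
    · rw [e] at h1 h2; omega
    · rw [e, fl_negIdx] at h1 h2; omega

/-- A direct summand of `𝒯_t` of the star object that is nonzero at the top alcove is nonzero at all
alcoves of its orbit: the idempotent is `0` or `1` at each of them, and the submodules between two
of them that differ by a simple reflection do not split. -/
lemma weylMove_mem_supp (hk : GKM k b) (hw₀ : IsLongest b w₀) (hs : wordEl b s = weylEl b w₀)
    (hst : (s ++ t).length = len b (wordEl b (s ++ t)))
    (hbox : alcoveOf b (wordEl b (s ++ t)) ∈ antiFundBox b)
    (ρ : Retract Y ((star k b).transWord t)) (hY : alcoveOf b (wordEl b (s ++ t)) ∈ Y.supp)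
    (v : P.weylGroup) : weylMove v (alcoveOf b (wordEl b (s ++ t))) ∈ Y.supp := by
  have := hk.isDomain
  have hrank := fun v => rankOne_star (k := k) hw₀ hs hst v
  have hfl : ∀ i ∈ b.support, ∀ t₁ t₂, t₁ ++ t₂ = t → fl i (alcoveOf b (wordEl b (s ++ t₁))) = -1 := by
    rintro i hi t₁ t₂ rfl
    exact fl_prefix hw₀ hs hst hbox hi
  have hsplit := exists_not_split (k := k) hk hs t
  generalize hX : alcoveOf b (wordEl b (s ++ t)) = X at *
  have hflX : ∀ i ∈ b.support, fl i X = -1 := fun i hi => hX ▸ hfl i hi t [] (by simp)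
  have hid : ∀ v, weylMove v X ∈ Y.supp → ∀ y, ap ρ.i _ (ap ρ.r (weylMove v X) y) = y :=
    fun v hv y => (hrank v).retract_id ρ hv y
  have hzero : ∀ A, A ∉ Y.supp → ∀ y, ap ρ.i _ (ap ρ.r A y) = 0 := fun A hA y => by
    have : Subsingleton (Y.carrier A) := not_nontrivial_iff_subsingleton.mp hA
    rw [Subsingleton.elim (ap ρ.r A y) 0, map_zero]
  -- if the idempotent were `1` at one and `0` at the other of two such alcoves, it would split the
  -- submodule between them
  have hpos : ∀ i ∈ b.support, ∀ v : P.weylGroup, b.IsPos (weylIdx P v i) →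
      (weylMove v X ∈ Y.supp ↔ weylMove (v * weylRefl i) X ∈ Y.supp) := by
    intro i hi v hv
    obtain ⟨x, y, hxy, hx⟩ := hsplit v ⟨_, hv⟩ fun t₁ t₂ h => by
      rw [fl_weylMove]; exact hfl i hi t₁ t₂ h
    have hup : up P (weylIdx P v i) (weylMove v X) = weylMove (v * weylRefl i) X := by
      rw [up_weylMove, up_of_fl (hflX i hi), weylMove_mul]
    have he := ap_edge ρ.i (ap_edge ρ.r hxy)
    rw [← hup]
    by_contra hc
    rw [not_iff] at hc
    by_cases hB : up P (weylIdx P v i) (weylMove v X) ∈ Y.supp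
    · have hA := fun h => hc.mpr hB h
      have hA' : weylMove v X ∉ Y.supp := hA
      have hB' : ap ρ.i _ (ap ρ.r (up P (weylIdx P v i) (weylMove v X)) y) = y := by
        have := (hrank (v * weylRefl i))
        rw [← hup] at this
        exact this.retract_id ρ hB y
      simp only [hzero _ hA'] at he
      have h3 := sub_mem hxy he
      refine hx ?_
      convert h3 using 1
      refine Prod.ext (sub_zero x).symm ?_
      change 0 = y - ap ρ.i _ (ap ρ.r _ y)
      rw [hB', sub_self]
    · have hA' : weylMove v X ∈ Y.supp := by
        by_contra h; exact hB (hc.mp h)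
      simp only [hid v hA'] at he
      refine hx ?_
      convert he using 2
      exact (hzero _ hB y).symm
  have hrefl : ∀ i, (weylRefl i : P.weylGroup) * weylRefl i = 1 := fun i =>
    Subtype.ext (by
      change RootPairing.Equiv.reflection P i * RootPairing.Equiv.reflection P i = 1
      rw [mul_eq_one_iff_eq_inv, RootPairing.Equiv.reflection_inv])
  -- the case of a negative root `v(α_i)` follows by exchanging the two alcoves
  have hadj : ∀ i ∈ b.support, ∀ v : P.weylGroup,
      (weylMove v X ∈ Y.supp ↔ weylMove (v * weylRefl i) X ∈ Y.supp) := by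
    intro i hi v
    by_cases h : b.IsPos (weylIdx P v i)
    · exact hpos i hi v h
    · have h1 := hpos i hi (v * weylRefl i) (by
        rw [weylIdx_mul, weylIdx_weylRefl, weylIdx_negIdx, isPos_negIdx]; exact h)
      rw [mul_assoc, hrefl, mul_one] at h1
      exact h1.symm
  -- an element of the finite Weyl group is reached by simple reflections on the right
  have hword : ∀ u : List (simpleRefl b), (∀ σ ∈ u, IsFin b σ) → ∀ v, weylEl b v = wordEl b u →
      weylMove v X ∈ Y.supp := by
    intro u
    induction u using List.reverseRecOn with
    | nil =>
      intro _ v hv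
      have : weylMove v X = X := by
        rw [weylMove_eq (b := b), hv]; exact act_one b X
      rwa [this]
    | append_singleton u σ ih =>
      intro hu v hv
      obtain ⟨i, hi, hσ⟩ := hu σ (by simp)
      rw [hadj i hi]
      refine ih (fun τ hτ => hu τ (List.mem_append_left _ hτ)) _ ?_
      rw [wordEl_concat] at hv
      have h1 : weylEl b (v * weylRefl i) = weylEl b v * sEl σ := by
        refine Subtype.ext ?_
        change weylAff P _ = weylAff P v * σ.1
        rw [hσ, weylAff_mul, weylRefl, weylAff_reflection]
      rw [h1, hv, mul_assoc, sEl_mul_self, mul_one]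
  obtain ⟨u, hu, hlen⟩ := exists_reduced b (weylEl b v)
  exact hword u (isFin_of_reduced u v hu (by rw [hlen, hu])) v hu.symm

end Obj

end TopAlcoves



/-! ### The sign of an alcove -/

section Sign

variable {ι V N : Type*} [Finite ι] [AddCommGroup V] [Module ℚ V] [AddCommGroup N] [Module ℚ N]
variable {P : RootPairing ι ℚ V N} [P.IsRootSystem] [P.IsCrystallographic] [P.IsReduced]
  [P.IsIrreducible] {b : P.Base}

variable (b) in
/-- The determinant of the linear part of the element `g` of the affine Weyl group with
`A = g.A_e`. -/
def alcoveDet (A : Alcove P) : ℚ := LinearMap.det (elOf b A).1.linear.toLinearMap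

lemma det_affRefl (i : ι) (n : ℤ) : LinearMap.det (affRefl P i n).linear.toLinearMap = -1 := by
  have hfin : Module.Finite ℚ N := Module.finite_def.mpr
    (Submodule.fg_def.mpr ⟨_, Set.finite_range P.coroot, RootPairing.IsRootSystem.span_coroot_eq_top⟩)
  have h : (affRefl P i n).linear.toLinearMap =
      LinearMap.transvection (P.root' i) (-P.coroot i) := by
    ext v
    change P.coreflection i v = v + P.root' i v • -P.coroot i
    rw [P.coreflection_apply, smul_neg, sub_eq_add_neg]
  rw [h, LinearMap.transvection.det, map_neg]
  have h2 : P.root' i (P.coroot i) = 2 := P.root_coroot_two i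
  rw [h2]; norm_num

lemma alcoveDet_up (i : ι) (A : Alcove P) : alcoveDet b (up P i A) = - alcoveDet b A := by
  rw [alcoveDet, up_eq b, elOf_act, alcoveDet, ← neg_one_mul, ← det_affRefl (P := P) i (fl i A + 1),
    ← LinearMap.det_comp]
  rfl

/-- The determinant is `1` or `-1`, as the affine Weyl group is generated by reflections. -/
lemma alcoveDet_eq (A : Alcove P) : alcoveDet b A = 1 ∨ alcoveDet b A = -1 := by
  have key : ∀ g ∈ affineWeyl b, LinearMap.det g.linear.toLinearMap = 1 ∨
      LinearMap.det g.linear.toLinearMap = -1 := by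
    intro g hg
    have hgen : ∀ s : simpleRefl b, LinearMap.det s.1.linear.toLinearMap = -1 := fun s => by
      obtain ⟨i, n, h⟩ := simpleRefl_eq b s
      rw [h, det_affRefl]
    obtain ⟨u, hu⟩ := exists_word b ⟨g, hg⟩
    have hg' : g = wordProd b u := by rw [← coe_wordEl, hu]
    rw [hg']
    clear hu hg'
    induction u with
    | nil => exact Or.inl LinearMap.det_id
    | cons s u ih =>
      have h : wordProd b (s :: u) = s.1 * wordProd b u := by simp [wordProd]
      have h2 : (s.1 * wordProd b u).linear.toLinearMap =
        s.1.linear.toLinearMap ∘ₗ (wordProd b u).linear.toLinearMap := rfl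
      rw [h, h2, LinearMap.det_comp, hgen]
      rcases ih with h | h <;> rw [h] <;> norm_num
  exact key _ (elOf b A).2

end Sign

/-! ### Semilinear pairings and the star object -/

section Pairing

variable {ι N : Type*} {V : Type v} [Finite ι] [AddCommGroup V] [Module ℚ V] [AddCommGroup N]
  [Module ℚ N]
variable {k : Type u} [Field k] {P : RootPairing ι ℚ V N} [P.IsRootSystem] [P.IsCrystallographic]
  [P.IsReduced] [P.IsIrreducible] {b : P.Base}

open Obj (weylMove)

variable (k b) in
/-- The sign of an alcove: `1` at `A_e`, and opposite at alcoves that are mapped to each other by a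
reflection. -/
def sgn (A : Alcove P) : S0 k b := if alcoveDet b A = 1 then 1 else -1

lemma sgn_up (i : ι) (A : Alcove P) : sgn k b (up P i A) = - sgn k b A := by
  unfold sgn
  rw [alcoveDet_up]
  rcases alcoveDet_eq (b := b) A with h | h <;> rw [h] <;> norm_num

lemma sgn_mul_self (A : Alcove P) : sgn k b A * sgn k b A = 1 := by
  unfold sgn; split_ifs <;> norm_num

lemma sgn_mem_deg0 (A : Alcove P) : sgn k b A ∈ deg0 k b 0 := by
  unfold sgn; split_ifs
  · exact one_mem_deg0 k b
  · exact neg_mem (one_mem_deg0 k b)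

lemma sgn_mem_Sβ (A : Alcove P) (β : PosRoot b) : sgn k b A ∈ Sβ k b β := by
  unfold sgn; split_ifs
  · exact one_mem _
  · exact neg_mem (one_mem _)

lemma weylX_inv (w : P.weylGroup) (x : weightLattice P) : weylX P w⁻¹ (weylX P w x) = x := by
  apply Subtype.ext
  change ((w⁻¹ : P.weylGroup) : P.Aut).weightMap ((w : P.Aut).weightMap x) = x
  change (((w : P.Aut)⁻¹) * (w : P.Aut)).weightMap x = x
  rw [inv_mul_cancel]; rfl

lemma weylS_inv (w : P.weylGroup) (x : Sk k P) : weylS k P w⁻¹ (weylS k P w x) = x := by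
  have h : (weylS k P w⁻¹).comp (weylS k P w) = AlgHom.id k _ := by
    refine SymmetricAlgebra.algHom_ext (LinearMap.ext fun ξ => ?_)
    change weylS k P w⁻¹ (weylS k P w (SymmetricAlgebra.ι k (Xk k P) ξ)) =
      SymmetricAlgebra.ι k (Xk k P) ξ
    rw [weylS, weylS, SymmetricAlgebra.lift_ι_apply]
    change SymmetricAlgebra.lift _ (SymmetricAlgebra.ι k (Xk k P) _) = _
    rw [SymmetricAlgebra.lift_ι_apply]
    change SymmetricAlgebra.ι k (Xk k P) _ = _
    congr 1
    induction ξ using TensorProduct.induction_on with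
    | zero => simp
    | tmul c x =>
      change c ⊗ₜ[ℤ] (weylX P w⁻¹ (weylX P w x)) = _
      rw [weylX_inv]
    | add x y hx hy => rw [map_add, map_add, hx, hy]
  exact DFunLike.congr_fun h x

lemma weyl0_inv_weyl0 (w : P.weylGroup) (x : S0 k b) : weyl0 k b w⁻¹ (weyl0 k b w x) = x := by
  have h : (weyl0 k b w⁻¹).comp (weyl0 k b w) = RingHom.id _ := by
    refine IsLocalization.ringHom_ext (rootMonoid k b) (RingHom.ext fun x => ?_)
    change weyl0 k b w⁻¹ (weyl0 k b w (algebraMap _ _ x)) = algebraMap _ _ x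
    rw [weyl0_of, weyl0_of, weylS_inv]
  exact DFunLike.congr_fun h x

lemma weyl0_weyl0_inv (w : P.weylGroup) (x : S0 k b) : weyl0 k b w (weyl0 k b w⁻¹ x) = x := by
  have := weyl0_inv_weyl0 w⁻¹ x
  rwa [inv_inv] at this

lemma weylIdx_inv (w : P.weylGroup) (i : ι) : weylIdx P w⁻¹ (weylIdx P w i) = i := by
  rw [← weylIdx_mul, inv_mul_cancel]; rfl

lemma up_negIdx (i : ι) (A : Alcove P) : up P (negIdx P i) A = down P i A := by
  have hb : Nonempty P.Base := P.nonempty_base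
  obtain ⟨b⟩ := hb
  rw [up_eq b, down_eq b, fl_negIdx]
  congr 1
  refine Subtype.ext ?_
  change affRefl P (negIdx P i) _ = affRefl P i _
  ext v
  rw [affRefl_apply, affRefl_apply, root'_negIdx, coroot_negIdx]
  push_cast
  module

/-- The positive root `-w₀(β)`. -/
def opp (w₀ : P.weylGroup) (β : PosRoot b) : PosRoot b := posOf b (weylIdx P w₀ β)

variable {w₀ : P.weylGroup}

lemma opp_val (hw₀ : IsLongest b w₀) (β : PosRoot b) :
    (opp w₀ β).1 = negIdx P (weylIdx P w₀ β.1) := by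
  rw [opp, posOf, dif_neg (hw₀.not_isPos β.2)]

lemma weylIdx_eq_opp (hw₀ : IsLongest b w₀) (β : PosRoot b) :
    weylIdx P w₀ β.1 = negIdx P (opp w₀ β).1 := by
  rw [opp_val hw₀, negIdx_negIdx]

/-- The twisted dual relates `M(A, β)` to the submodule at `w₀.(β ↑ A)`, which `-w₀(β) ↑` maps to
`w₀.A`. -/
lemma up_opp (hw₀ : IsLongest b w₀) (β : PosRoot b) (A : Alcove P) :
    up P (opp w₀ β) (weylMove w₀ (up P β A)) = weylMove w₀ A := by
  rw [opp_val hw₀, up_negIdx, ← up_weylMove, down_up]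

lemma fl_opp (hw₀ : IsLongest b w₀) (β : PosRoot b) (A : Alcove P) :
    fl (opp w₀ β).1 (weylMove w₀ (up P β A)) = - fl β.1 A - 2 := by
  rw [opp_val hw₀, fl_negIdx, fl_weylMove, fl_up]; ring

lemma weyl0_root_opp (hw₀ : IsLongest b w₀) (β : PosRoot b) :
    weyl0 k b w₀ (root0 k b β.1) = - root0 k b (opp w₀ β).1 := by
  rw [weyl0_root, weylIdx_eq_opp hw₀, root0_negIdx]

lemma weyl0_rinv_opp (hw₀ : IsLongest b w₀) (β : PosRoot b) :
    weyl0 k b w₀ (rinv k b β.1) = - rinv k b (opp w₀ β).1 := by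
  rw [weyl0_rinv, weylIdx_eq_opp hw₀, rinv_negIdx]

lemma weyl0_mem_opp (β : PosRoot b) {x : S0 k b} :
    weyl0 k b w₀ x ∈ Sβ k b (opp w₀ β) ↔ x ∈ Sβ k b β := by
  refine ⟨fun h => ?_, weyl0_Sβ k b w₀ β⟩
  have h1 := weyl0_Sβ k b w₀⁻¹ _ h
  rw [weyl0_inv_weyl0] at h1
  have h2 : posOf b (weylIdx P w₀⁻¹ (opp w₀ β)) = β := by
    apply Subtype.ext
    have hpos := β.2
    rcases posOf_eq (b := b) (weylIdx P w₀ β) with h | h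
    · rw [opp, h, weylIdx_inv, posOf, dif_pos hpos]
    · rw [opp, h, weylIdx_negIdx, weylIdx_inv, posOf, dif_neg]
      · exact negIdx_negIdx P _
      · rw [isPos_negIdx]; exact not_not.mpr hpos
  rwa [h2] at h1

/-- The condition that describes the submodules of the star object, after application of `w₀`. -/
lemma starEdge_iff_weyl0 (hw₀ : IsLongest b w₀) {A : Alcove P} {β : PosRoot b} {x y : S0 k b} :
    StarEdge A β x y ↔ weyl0 k b w₀ y ∈ Sβ k b (opp w₀ β) ∧ ∃ z ∈ Sβ k b (opp w₀ β),
      weyl0 k b w₀ x - (if fl β.1 A = -1 then weyl0 k b w₀ y else 0) = root0 k b (opp w₀ β) * z := by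
  have hif : weyl0 k b w₀ x - (if fl β.1 A = -1 then weyl0 k b w₀ y else 0) =
      weyl0 k b w₀ (x - if fl β.1 A = -1 then y else 0) := by
    rw [map_sub]; split_ifs
    · rfl
    · rw [map_zero]
  rw [StarEdge, weyl0_mem_opp, hif]
  refine and_congr_right fun _ => ⟨?_, ?_⟩
  · rintro ⟨z, hz, e⟩
    refine ⟨-weyl0 k b w₀ z, neg_mem ((weyl0_mem_opp β).mpr hz), ?_⟩
    rw [e, map_mul, weyl0_root_opp hw₀]; ring
  · rintro ⟨z, hz, e⟩
    have hz' : weyl0 k b w₀ (weyl0 k b w₀⁻¹ (-z)) = -z := weyl0_weyl0_inv w₀ _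
    refine ⟨weyl0 k b w₀⁻¹ (-z), (weyl0_mem_opp (w₀ := w₀) β).mp ?_, ?_⟩
    · rw [hz']; exact neg_mem hz
    · refine Function.LeftInverse.injective (weyl0_inv_weyl0 w₀) ?_
      rw [e, map_mul, weyl0_root_opp hw₀, hz', neg_mul_neg]

namespace Obj

/-- The data of an isomorphism between `M` and the twisted dual `𝒞 𝒟 M`, shifted by `n`: pairings
between `M(A)` and `M(w₀.A)` that are `w₀`-semilinear in the first variable, perfect, and for which
the submodules `M(A, β)` and `M(w₀.(β ↑ A), -w₀(β))` are dual to each other. The last condition, that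
`(x, y) ∈ M(A, β)` implies `(β x, 0) ∈ M(A, β)`, is needed to pass the duality through the translation
functors. -/
structure SelfPairing (w₀ : P.weylGroup) (M : Obj k b) (n : ℤ) where
  form : ∀ A, M.carrier A →ₛₗ[weyl0 k b w₀] (M.carrier (weylMove w₀ A) →ₗ[S0 k b] S0 k b)
  bijective : ∀ A, Function.Bijective (form A)
  form_deg : ∀ A i j x y, x ∈ M.deg A i → y ∈ M.deg _ j → form A x y ∈ deg0 k b (i + j - n)
  edge_iff : ∀ A (β : PosRoot b) (f g : ∀ C, M.carrier C), M.OnEdge A β f g ↔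
    ∀ h e : ∀ C, M.carrier C, M.OnEdge (weylMove w₀ (up P β A)) (opp w₀ β) h e →
      form A (f A) (e _) + form (up P β A) (g _) (h _) ∈ Sβ k b (opp w₀ β)
  smul_left : ∀ A (β : PosRoot b) (f g : ∀ C, M.carrier C), M.OnEdge A β f g →
    M.OnEdge A β (root0 k b β • f) 0

/-- A constant as an element of the product of all modules of the star object. -/
def starFam (k : Type u) [Field k] (b : P.Base) (c : S0 k b) : ∀ A, (star k b).carrier A := by
  classical
  exact fun A => if h : IsStar b A then (⟨c, mem_starSub h c⟩ : starSub k b A) else 0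

/-- An element of a module of the star object as an element of `S_k^∅`. -/
def starVal (A : Alcove P) : (star k b).carrier A →ₗ[S0 k b] S0 k b := (starSub k b A).subtype

lemma starVal_injective (A : Alcove P) : Function.Injective (starVal (k := k) (b := b) A) :=
  Subtype.val_injective

lemma starVal_fam {A : Alcove P} (h : IsStar b A) (c : S0 k b) :
    starVal A (starFam k b c A) = c := by
  have e : starFam k b c A = (⟨c, mem_starSub h c⟩ : starSub k b A) := dif_pos h
  rw [e]; rfl

lemma starVal_eq_zero {A : Alcove P} (h : ¬ IsStar b A) (x : (star k b).carrier A) :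
    starVal A x = 0 := eq_zero_of_mem_starSub h (Subtype.prop _)

lemma starVal_congr {C D : Alcove P} (h : C = D) (f : ∀ C, (star k b).carrier C) :
    starVal C (f C) = starVal D (f D) := by rw [h]

lemma onEdge_star {A : Alcove P} {β : PosRoot b} {f g : ∀ C, (star k b).carrier C} :
    (star k b).OnEdge A β f g ↔ StarEdge A β (starVal A (f A)) (starVal _ (g (up P β A))) := Iff.rfl

lemma prod_rinv_mem_deg0 (s : Finset (PosRoot b)) :
    ∏ β ∈ s, rinv k b β.1 ∈ deg0 k b (-(2 * s.card)) := by
  classical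
  induction s using Finset.induction_on with
  | empty => exact one_mem_deg0 k b
  | insert β s h ih =>
    rw [Finset.prod_insert h, Finset.card_insert_of_notMem h]
    have := mul_mem_deg0 k b (rinv_mem_deg0 β.1) ih
    rwa [show -((2 : ℤ) * ((s.card + 1 : ℕ) : ℤ)) = -2 + -(2 * (s.card : ℤ)) by push_cast; ring]

variable (k b) in
/-- The inverse of the product of the positive roots. -/
def invProd : S0 k b := ∏ β : PosRoot b, rinv k b β.1

/-- Up to a unit of `S_k^β`, the product of the positive roots is `β`. -/
lemma exists_invProd (β : PosRoot b) : ∃ x ∈ Sβ k b β, ∃ y ∈ Sβ k b β,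
    root0 k b β * invProd k b = x ∧ x * y = 1 := by
  classical
  refine ⟨_, ?_, ∏ γ ∈ Finset.univ.erase β, root0 k b γ.1, prod_mem fun γ _ => root0_mem_Sβ _ _,
    rfl, ?_⟩
  · rw [invProd, ← Finset.mul_prod_erase Finset.univ _ (Finset.mem_univ β), ← mul_assoc,
      root_mul_rinv, one_mul]
    refine prod_mem fun γ hγ => rinv_mem_Sβ (fun e => (Finset.ne_of_mem_erase hγ) (Subtype.ext e))
      fun e => ?_
    have := γ.2
    rw [e, isPos_negIdx] at this
    exact this β.2
  · rw [mul_right_comm, Finset.mul_prod_erase Finset.univ (fun γ : PosRoot b => root0 k b γ.1)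
      (Finset.mem_univ β), invProd, ← Finset.prod_mul_distrib]
    exact Finset.prod_eq_one fun γ _ => root_mul_rinv _

/-- The pairing on the star object: `(x, y) ↦ ± w₀(x) y / ∏ α`. -/
def starForm (w₀ : P.weylGroup) (A : Alcove P) : (star k b).carrier A →ₛₗ[weyl0 k b w₀]
    ((star k b).carrier (weylMove w₀ A) →ₗ[S0 k b] S0 k b) where
  toFun x := (sgn k b A * weyl0 k b w₀ (starVal A x) * invProd k b) • starVal _
  map_add' x y := by rw [map_add, map_add, mul_add, add_mul, add_smul]
  map_smul' c x := by
    rw [map_smul, smul_eq_mul, map_mul, smul_smul]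
    congr 1; ring

lemma starForm_apply (A : Alcove P) (x : (star k b).carrier A)
    (y : (star k b).carrier (weylMove w₀ A)) :
    starForm w₀ A x y = sgn k b A * weyl0 k b w₀ (starVal A x) * invProd k b * starVal _ y := rfl

/-- The star object is isomorphic to its twisted dual. -/
def starPairing (hw₀ : IsLongest b w₀) :
    SelfPairing w₀ (star k b) (2 * Fintype.card (PosRoot b)) where
  form := starForm w₀
  bijective A := by
    obtain ⟨β⟩ : Nonempty (PosRoot b) := by
      obtain ⟨i, -⟩ := exists_isHighestRoot b
      exact ⟨posOf b i⟩
    obtain ⟨x, -, y, -, e1, e2⟩ := exists_invProd (k := k) (b := b) β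
    have hunit : invProd k b * (root0 k b β * y) = 1 := by rw [← e2, ← e1]; ring
    by_cases hA : IsStar b A
    · have hA' := hA.weylMove w₀
      constructor
      · intro x x' h
        have h1 := DFunLike.congr_fun h (starFam k b 1 _)
        rw [starForm_apply, starForm_apply, starVal_fam hA', mul_one, mul_one] at h1
        refine starVal_injective A ?_
        rw [← weyl0_inv_weyl0 w₀ (starVal A x), ← weyl0_inv_weyl0 w₀ (starVal A x')]
        congr 1
        linear_combination (sgn k b A * (root0 k b β * y)) * h1 -
          ((weyl0 k b w₀ (starVal A x) - weyl0 k b w₀ (starVal A x')) * sgn k b A * sgn k b A) * hunit -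
          (weyl0 k b w₀ (starVal A x) - weyl0 k b w₀ (starVal A x')) * sgn_mul_self (k := k) (b := b) A
      · intro ψ
        refine ⟨starFam k b (weyl0 k b w₀⁻¹ (sgn k b A * ψ (starFam k b 1 _) * (root0 k b β * y))) A,
          LinearMap.ext fun z => ?_⟩
        have hz : z = starVal _ z • starFam k b 1 _ := by
          refine starVal_injective _ ?_
          rw [map_smul, starVal_fam hA', smul_eq_mul, mul_one]
        rw [starForm_apply, starVal_fam hA, weyl0_weyl0_inv]
        conv_rhs => rw [hz, map_smul, smul_eq_mul]
        linear_combination (starVal _ z * ψ (starFam k b 1 _) * sgn k b A * sgn k b A) * hunit +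
          (starVal _ z * ψ (starFam k b 1 _)) * sgn_mul_self (k := k) (b := b) A
    · have hA' : ¬ IsStar b (weylMove w₀ A) := (isStar_weylMove_iff w₀).not.mpr hA
      have h0 : ∀ {C : Alcove P}, ¬ IsStar b C → ∀ x : (star k b).carrier C, x = 0 := fun hC x =>
        starVal_injective _ (by rw [starVal_eq_zero hC, map_zero])
      refine ⟨fun x x' _ => by rw [h0 hA x, h0 hA x'], fun ψ => ⟨0, LinearMap.ext fun z => ?_⟩⟩
      rw [h0 hA' z, map_zero, map_zero]
  form_deg A i j x y hx hy := by
    have h1 := mul_mem_deg0 k b (mul_mem_deg0 k b (mul_mem_deg0 k b (sgn_mem_deg0 (k := k) (b := b) A)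
      (weyl0_deg k b w₀ hx)) (prod_rinv_mem_deg0 Finset.univ)) hy
    rw [show i + j - 2 * (Fintype.card (PosRoot b) : ℤ) =
      0 + i + -(2 * ((Finset.univ : Finset (PosRoot b)).card : ℤ)) + j by
        rw [Finset.card_univ]; ring]
    exact h1
  edge_iff A β f g := by
    rw [onEdge_star, starEdge_iff_weyl0 hw₀]
    obtain ⟨ν, hν, μ, hμ, e1, e2⟩ := exists_invProd (k := k) (opp w₀ β)
    have hsA := sgn_mem_Sβ (k := k) A (opp w₀ β)
    have hsB := sgn_mem_Sβ (k := k) (up P β A) (opp w₀ β)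
    have hD := up_opp hw₀ β A
    have hfl := fl_opp hw₀ β A
    have hs := sgn_mul_self (k := k) (b := b) A
    have hs' := sgn_mul_self (k := k) (b := b) (up P β A)
    have hform : ∀ h e : ∀ C, (star k b).carrier C,
        starForm w₀ A (f A) (e _) + starForm w₀ (up P β A) (g _) (h _) =
        sgn k b A * weyl0 k b w₀ (starVal A (f A)) * invProd k b *
          starVal _ (e (up P (opp w₀ β) (weylMove w₀ (up P β A)))) +
        sgn k b (up P β A) * weyl0 k b w₀ (starVal _ (g (up P β A))) * invProd k b *
          starVal _ (h (weylMove w₀ (up P β A))) := fun h e => by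
      rw [starForm_apply, starForm_apply, starVal_congr hD e]
    have hx0 : ¬ IsStar b A → weyl0 k b w₀ (starVal A (f A)) = 0 := fun h => by
      rw [starVal_eq_zero h, map_zero]
    have hx0' : ¬ IsStar b (up P β A) → weyl0 k b w₀ (starVal _ (g (up P β A))) = 0 := fun h => by
      rw [starVal_eq_zero h, map_zero]
    simp only [hform]
    clear hform
    generalize weyl0 k b w₀ (starVal A (f A)) = x at *
    generalize weyl0 k b w₀ (starVal _ (g (up P β A))) = x' at *
    constructor
    · rintro ⟨hx', z, hz, e⟩ h' e' hE
      obtain ⟨hy', u, hu, ey⟩ := onEdge_star.mp hE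
      generalize starVal _ (e' (up P (opp w₀ β) (weylMove w₀ (up P β A)))) = y' at *
      generalize starVal _ (h' (weylMove w₀ (up P β A))) = y at *
      by_cases hc : fl β.1 A = -1
      · rw [if_pos hc] at e
        rw [if_pos (by omega)] at ey
        have : sgn k b A * x * invProd k b * y' + sgn k b (up P β A) * x' * invProd k b * y =
            sgn k b A * ν * (z * y' - x' * u) := by
          rw [sgn_up]
          linear_combination (sgn k b A * invProd k b * y') * e - (sgn k b A * invProd k b * x') * ey +
            sgn k b A * (z * y' - x' * u) * e1
        rw [this]
        exact mul_mem (mul_mem hsA hν) (sub_mem (mul_mem hz hy') (mul_mem hx' hu))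
      · rw [if_neg hc, sub_zero] at e
        rw [if_neg (by omega), sub_zero] at ey
        have : sgn k b A * x * invProd k b * y' + sgn k b (up P β A) * x' * invProd k b * y =
            ν * (sgn k b A * z * y' + sgn k b (up P β A) * x' * u) := by
          rw [e, ey]
          linear_combination (sgn k b A * z * y' + sgn k b (up P β A) * x' * u) * e1
        rw [this]
        exact mul_mem hν (add_mem (mul_mem (mul_mem hsA hz) hy') (mul_mem (mul_mem hsB hx') hu))
    · intro hall
      -- the test pair `(β', 0)`
      have hx' : x' ∈ Sβ k b (opp w₀ β) := by
        by_cases hB : IsStar b (up P β A)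
        · have h1 := hall (starFam k b (root0 k b (opp w₀ β))) 0 (onEdge_star.mpr ⟨?_, 1, one_mem _, ?_⟩)
          · rw [starVal_fam (hB.weylMove w₀), Pi.zero_apply, map_zero, mul_zero, zero_add] at h1
            have h2 := mul_mem (mul_mem hμ hsB) h1
            rwa [show μ * sgn k b (up P β A) * (sgn k b (up P β A) * x' * invProd k b *
              root0 k b (opp w₀ β)) = x' by
                linear_combination (x' * μ * invProd k b * root0 k b (opp w₀ β)) * hs' +
                  (x' * μ) * e1 + x' * e2] at h2
          · rw [Pi.zero_apply, map_zero]; exact zero_mem _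
          · rw [starVal_fam (hB.weylMove w₀), Pi.zero_apply, map_zero]; simp
        · rw [hx0' hB]; exact zero_mem _
      refine ⟨hx', ?_⟩
      by_cases hA : IsStar b A
      · have hDs : IsStar b (up P (opp w₀ β) (weylMove w₀ (up P β A))) := by
          rw [hD]; exact hA.weylMove w₀
        by_cases hc : fl β.1 A = -1
        · have hB : IsStar b (weylMove w₀ (up P β A)) := ((isStar_up hc).mpr hA).weylMove w₀
          have h1 := hall (starFam k b 1) (starFam k b 1) (onEdge_star.mpr ⟨?_, 0, zero_mem _, ?_⟩)
          · rw [starVal_fam hDs, starVal_fam hB, mul_one, mul_one, sgn_up] at h1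
            rw [if_pos hc]
            refine ⟨_, mul_mem (mul_mem hμ hsA) h1, ?_⟩
            linear_combination (-(x - x') * root0 k b (opp w₀ β) * invProd k b * μ) * hs -
              (x - x') * μ * e1 - (x - x') * e2
          · rw [starVal_fam hDs]; exact one_mem _
          · rw [starVal_fam hDs, starVal_fam hB, if_pos (by omega), sub_self, mul_zero]
        · have h1 := hall 0 (starFam k b 1) (onEdge_star.mpr ⟨?_, 0, zero_mem _, ?_⟩)
          · rw [starVal_fam hDs, mul_one, Pi.zero_apply, map_zero, mul_zero, add_zero] at h1
            rw [if_neg hc, sub_zero]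
            refine ⟨_, mul_mem (mul_mem hμ hsA) h1, ?_⟩
            linear_combination (-x * root0 k b (opp w₀ β) * invProd k b * μ) * hs -
              x * μ * e1 - x * e2
          · rw [starVal_fam hDs]; exact one_mem _
          · rw [Pi.zero_apply, map_zero, if_neg (by omega), sub_self, mul_zero]
      · rw [hx0 hA]
        by_cases hc : fl β.1 A = -1
        · rw [hx0' ((isStar_up hc).not.mpr hA)]
          exact ⟨0, zero_mem _, by simp⟩
        · rw [if_neg hc]
          exact ⟨0, zero_mem _, by simp⟩
  smul_left A β f g h := by
    obtain ⟨h1, z, hz, e⟩ := onEdge_star.mp h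
    refine onEdge_star.mpr ⟨?_, starVal A (f A), ?_, ?_⟩
    · rw [Pi.zero_apply, map_zero]; exact zero_mem _
    · rw [sub_eq_iff_eq_add.mp e]
      refine add_mem (mul_mem (root0_mem_Sβ _ _) hz) ?_
      split_ifs
      · exact h1
      · exact zero_mem _
    · rw [Pi.smul_apply, map_smul, Pi.zero_apply, map_zero, ite_self, sub_zero]; rfl

end Obj

end Pairing



/-! ### Pairings and translation functors -/

section PairingTrans

variable {ι N : Type*} {V : Type v} [Finite ι] [AddCommGroup V] [Module ℚ V] [AddCommGroup N]
  [Module ℚ N]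
variable {k : Type u} [Field k] {P : RootPairing ι ℚ V N} [P.IsRootSystem] [P.IsCrystallographic]
  [P.IsReduced] [P.IsIrreducible] {b : P.Base}

namespace Obj

variable {M : Obj k b} {w₀ : P.weylGroup} {n : ℤ} {s : simpleRefl b}

section Res

variable {A : Alcove P} {β : PosRoot b} {F G : ∀ C, M.carrier C}

/-- The submodules of `𝒯_s M` in terms of families, for `A` on the positive side of a wall in some
`H_{β,n}`. -/
lemma onEdge_res_pos (h : β.1 = wallIdx s A) :
    (M.trans s).OnEdge A β (fun C => M.res s C F) (fun C => M.res s C G) ↔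
      M.OnEdge (nbr s A) β (rinv k b β.1 • F) (rinv k b β.1 • F) ∧ M.OnEdge (up P β A) β G G := by
  have hnb := up_nbr_of_wallIdx h
  have hup := nbr_up_of_wallIdx h
  have h1 : ∀ C, C = A ∨ C = nbr s A →
      (rinv k b β.1 • M.coord s A (M.res s A F)) C = (rinv k b β.1 • F) C := fun C hC => by
    rw [Pi.smul_apply, Pi.smul_apply, coord_res hC]
  have h2 : ∀ C, C = up P β A ∨ C = nbr s (up P β A) →
      M.coord s (up P β A) (M.res s _ G) C = G C := fun C hC => coord_res hC G
  refine (mem_trans_edge_pos h).trans (and_congr ⟨fun t => ?_, fun t => ?_⟩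
    ⟨fun t => ?_, fun t => ?_⟩)
  · exact t.congr_of (h1 _ (Or.inr rfl)).symm (h1 _ (Or.inl hnb)).symm
  · exact t.congr_of (h1 _ (Or.inr rfl)) (h1 _ (Or.inl hnb))
  · exact t.congr_of (h2 _ (Or.inl rfl)).symm (h2 _ (Or.inr hup.symm)).symm
  · exact t.congr_of (h2 _ (Or.inl rfl)) (h2 _ (Or.inr hup.symm))

/-- The submodules of `𝒯_s M` in terms of families, for `A` on the negative side of a wall in some
`H_{β,n}`. -/
lemma onEdge_res_neg (h : β.1 = negIdx P (wallIdx s A)) :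
    (M.trans s).OnEdge A β (fun C => M.res s C F) (fun C => M.res s C G) ↔
      M.OnEdge A β (rinv k b β.1 • (F - G)) (rinv k b β.1 • (F - G)) ∧ M.OnEdge A β G G := by
  have hup := up_of_negIdx_wallIdx h
  have h2 : ∀ C, C = A ∨ C = nbr s A →
      M.coord s (up P β A) (M.res s _ G) C = G C := fun C hC =>
    coord_res (by rw [hup, nbr_nbr]; exact hC.symm) G
  have h1 : ∀ C, C = A ∨ C = nbr s A → (rinv k b β.1 • (M.coord s A (M.res s A F) -
      M.coord s (up P β A) (M.res s _ G))) C = (rinv k b β.1 • (F - G)) C := fun C hC => by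
    rw [Pi.smul_apply, Pi.smul_apply, Pi.sub_apply, Pi.sub_apply, coord_res hC, h2 C hC]
  refine (mem_trans_edge_neg h).trans (and_congr ⟨fun t => ?_, fun t => ?_⟩
    ⟨fun t => ?_, fun t => ?_⟩)
  · exact t.congr_of (h1 _ (Or.inl rfl)).symm (h1 _ (Or.inr hup)).symm
  · exact t.congr_of (h1 _ (Or.inl rfl)) (h1 _ (Or.inr hup))
  · exact t.congr_of (h2 _ (Or.inl rfl)).symm (h2 _ (Or.inr hup)).symm
  · exact t.congr_of (h2 _ (Or.inl rfl)) (h2 _ (Or.inr hup))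

/-- The submodules of `𝒯_s M` in terms of families, for a wall that lies in no `H_{β,n}`. -/
lemma onEdge_res_cross (h1 : β.1 ≠ wallIdx s A) (h2 : β.1 ≠ negIdx P (wallIdx s A)) :
    (M.trans s).OnEdge A β (fun C => M.res s C F) (fun C => M.res s C G) ↔
      M.OnEdge A β F G ∧ M.OnEdge (nbr s A) β F G := by
  have hup := nbr_up h1 h2
  have hF : ∀ C, C = A ∨ C = nbr s A → M.coord s A (M.res s A F) C = F C :=
    fun C hC => coord_res hC F
  have hG : ∀ C, C = up P β A ∨ C = nbr s (up P β A) →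
      M.coord s (up P β A) (M.res s _ G) C = G C := fun C hC => coord_res hC G
  refine (mem_trans_edge_cross h1 h2).trans (and_congr ⟨fun t => ?_, fun t => ?_⟩
    ⟨fun t => ?_, fun t => ?_⟩)
  · exact t.congr_of (hF _ (Or.inl rfl)).symm (hG _ (Or.inl rfl)).symm
  · exact t.congr_of (hF _ (Or.inl rfl)) (hG _ (Or.inl rfl))
  · exact t.congr_of (hF _ (Or.inr rfl)).symm (hG _ (Or.inr hup.symm)).symm
  · exact t.congr_of (hF _ (Or.inr rfl)) (hG _ (Or.inr hup.symm))

lemma onEdge_trans_iff {f g : ∀ C, (M.trans s).carrier C} : (M.trans s).OnEdge A β f g ↔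
    (M.trans s).OnEdge A β (fun C => M.res s C (M.coord s A (f A)))
      (fun C => M.res s C (M.coord s (up P β A) (g (up P β A)))) :=
  ⟨fun t => t.congr_of (res_coord _) (res_coord _),
    fun t => t.congr_of (res_coord _).symm (res_coord _).symm⟩

end Res

namespace SelfPairing

variable (Θ : SelfPairing w₀ M n)

/-- The pairing between `M(A)` and `M(w₀.A)`, evaluated on two sections. -/
def eval (A : Alcove P) (f e : ∀ C, M.carrier C) : S0 k b := Θ.form A (f A) (e (weylMove w₀ A))

lemma eval_congr_right {A : Alcove P} {f e e' : ∀ C, M.carrier C}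
    (h : e (weylMove w₀ A) = e' (weylMove w₀ A)) : Θ.eval A f e = Θ.eval A f e' := by
  rw [eval, h]; rfl

lemma eval_congr_left {A : Alcove P} {f f' e : ∀ C, M.carrier C}
    (h : f A = f' A) : Θ.eval A f e = Θ.eval A f' e := by
  rw [eval, h]; rfl

lemma eval_zero_right (A : Alcove P) (f : ∀ C, M.carrier C) : Θ.eval A f 0 = 0 := map_zero _

lemma eval_sub_left (A : Alcove P) (f f' e : ∀ C, M.carrier C) :
    Θ.eval A (f - f') e = Θ.eval A f e - Θ.eval A f' e := by
  simp only [eval, Pi.sub_apply, map_sub, LinearMap.sub_apply]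

lemma eval_sub_right (A : Alcove P) (f e e' : ∀ C, M.carrier C) :
    Θ.eval A f (e - e') = Θ.eval A f e - Θ.eval A f e' := by
  simp only [eval, Pi.sub_apply, map_sub]

lemma eval_smul_left (A : Alcove P) (c : S0 k b) (f e : ∀ C, M.carrier C) :
    Θ.eval A (c • f) e = weyl0 k b w₀ c * Θ.eval A f e := by
  simp only [eval, Pi.smul_apply, LinearMap.map_smulₛₗ, LinearMap.smul_apply, smul_eq_mul]

lemma eval_smul_right (A : Alcove P) (c : S0 k b) (f e : ∀ C, M.carrier C) :
    Θ.eval A f (c • e) = c * Θ.eval A f e := by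
  simp only [eval, Pi.smul_apply, map_smul, smul_eq_mul]

/-- The submodules `M(A, β)` are determined by the pairing, tested on single sections. -/
lemma onEdge_iff (hw₀ : IsLongest b w₀) {A : Alcove P} {β : PosRoot b} {f g : ∀ C, M.carrier C} :
    M.OnEdge A β f g ↔
    ∀ e : ∀ C, M.carrier C, M.OnEdge (weylMove w₀ (up P β A)) (opp w₀ β) e e →
      Θ.eval A f e + Θ.eval (up P β A) g e ∈ Sβ k b (opp w₀ β) := by
  refine (Θ.edge_iff A β f g).trans ⟨fun h e he => h e e he, fun h h' e' he => ?_⟩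
  have hD := up_opp hw₀ β A
  have key := h (M.lift _ (opp w₀ β) (h' _, e' _)) ((show M.OnEdge _ _ h' e' from he).congr_of
    (lift_left _) (lift_right _))
  have e1 : M.lift _ (opp w₀ β) (h' (weylMove w₀ (up P β A)), e' _) (weylMove w₀ A) =
      e' (weylMove w₀ A) := by
    rw [← hD]; exact lift_right _
  rw [eval, eval, e1, lift_left] at key
  exact key

variable (s) in
/-- The pairing between `𝒯_s M(A)` and `𝒯_s M(w₀.A)`: the sum of the pairings on the summands,
divided by the root of the wall. -/
def transForm (A : Alcove P) : (M.trans s).carrier A →ₛₗ[weyl0 k b w₀]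
    ((M.trans s).carrier (weylMove w₀ A) →ₗ[S0 k b] S0 k b) where
  toFun x := rinv k b (wallIdx s (weylMove w₀ A)) •
    (Θ.form A (M.coord s A x A) ∘ₗ LinearMap.proj (weylMove w₀ A) ∘ₗ M.coord s (weylMove w₀ A) +
      Θ.form (nbr s A) (M.coord s A x (nbr s A)) ∘ₗ LinearMap.proj (weylMove w₀ (nbr s A)) ∘ₗ
        M.coord s (weylMove w₀ A))
  map_add' x y := by
    ext z
    simp only [map_add, Pi.add_apply, LinearMap.smul_apply, LinearMap.add_apply,
      LinearMap.comp_apply, smul_eq_mul]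
    ring
  map_smul' c x := by
    ext z
    simp only [map_smul, Pi.smul_apply, LinearMap.map_smulₛₗ, LinearMap.smul_apply,
      LinearMap.add_apply, LinearMap.comp_apply, smul_eq_mul]
    ring

lemma transForm_apply (A : Alcove P) (x : (M.trans s).carrier A)
    (y : (M.trans s).carrier (weylMove w₀ A)) : Θ.transForm s A x y =
      rinv k b (wallIdx s (weylMove w₀ A)) *
        (Θ.eval A (M.coord s A x) (M.coord s (weylMove w₀ A) y) +
          Θ.eval (nbr s A) (M.coord s A x) (M.coord s (weylMove w₀ A) y)) := rfl

lemma transForm_res (A : Alcove P) (F E : ∀ C, M.carrier C) :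
    Θ.transForm s A (M.res s A F) (M.res s (weylMove w₀ A) E) =
      rinv k b (wallIdx s (weylMove w₀ A)) * (Θ.eval A F E + Θ.eval (nbr s A) F E) := by
  rw [transForm_apply, Θ.eval_congr_left (coord_res (Or.inl rfl) F),
    Θ.eval_congr_left (coord_res (Or.inr rfl) F), Θ.eval_congr_right (coord_res (Or.inl rfl) E),
    Θ.eval_congr_right (coord_res (Or.inr (nbr_weylMove s w₀ A).symm) E)]

/-- The pairing on `𝒯_s M` is perfect, because it is a unit multiple of an orthogonal sum of perfect
pairings. -/
lemma transForm_bijective (A : Alcove P) : Function.Bijective (Θ.transForm s A) := by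
  classical
  have hne : weylMove w₀ (nbr s A) ≠ weylMove w₀ A := by
    rw [← nbr_weylMove]; exact nbr_ne s _
  have hsplit : ∀ y : (M.trans s).carrier (weylMove w₀ A), y = M.res s _
      (Pi.single (weylMove w₀ A) (M.coord s _ y (weylMove w₀ A)) +
        Pi.single (weylMove w₀ (nbr s A)) (M.coord s _ y (weylMove w₀ (nbr s A)))) := fun y => by
    refine trans_ext ?_ ?_
    · rw [coord_res (Or.inl rfl), Pi.add_apply, Pi.single_eq_same, Pi.single_eq_of_ne hne.symm,
        add_zero]
    · rw [coord_res (Or.inr rfl), nbr_weylMove, Pi.add_apply, Pi.single_eq_same,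
        Pi.single_eq_of_ne hne, zero_add]
  constructor
  · rw [injective_iff_map_eq_zero]
    intro x hx
    have hE : ∀ E, Θ.eval A (M.coord s A x) E + Θ.eval (nbr s A) (M.coord s A x) E = 0 := fun E => by
      have h1 := DFunLike.congr_fun hx (M.res s _ E)
      conv at h1 => lhs; rw [← res_coord x]
      rw [transForm_res] at h1
      rw [← one_mul (_ + _), ← root_mul_rinv (wallIdx s (weylMove w₀ A)), mul_assoc, h1]
      exact mul_zero _
    refine trans_ext ?_ ?_
    · rw [map_zero]
      refine (injective_iff_map_eq_zero _).mp (Θ.bijective A).1 _ (LinearMap.ext fun z => ?_)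
      have h2 := hE (Pi.single (weylMove w₀ A) z)
      simp only [eval] at h2
      rw [Pi.single_eq_same, Pi.single_eq_of_ne hne, map_zero, add_zero] at h2
      exact h2
    · rw [map_zero]
      refine (injective_iff_map_eq_zero _).mp (Θ.bijective _).1 _ (LinearMap.ext fun z => ?_)
      have h2 := hE (Pi.single (weylMove w₀ (nbr s A)) z)
      simp only [eval] at h2
      rw [Pi.single_eq_same, Pi.single_eq_of_ne hne.symm, map_zero, zero_add] at h2
      exact h2
  · intro ψ
    have hψ : ∀ X, ∃ x, Θ.form X x = root0 k b (wallIdx s (weylMove w₀ A)) •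
        (ψ ∘ₗ M.res s _ ∘ₗ LinearMap.single (S0 k b) _ (weylMove w₀ X)) :=
      fun X => (Θ.bijective X).2 _
    choose F hF using hψ
    refine ⟨M.res s A F, LinearMap.ext fun y => ?_⟩
    conv_lhs => rw [← res_coord y, transForm_res]
    conv_rhs => rw [hsplit y, map_add, map_add]
    rw [eval, eval, hF, hF]
    simp only [LinearMap.smul_apply, LinearMap.comp_apply, smul_eq_mul, LinearMap.coe_single]
    rw [← mul_add, ← mul_assoc, rinv_mul_root, one_mul]

lemma transForm_deg (A : Alcove P) (i j : ℤ) {x : (M.trans s).carrier A}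
    {y : (M.trans s).carrier (weylMove w₀ A)} (hx : x ∈ (M.trans s).deg A i)
    (hy : y ∈ (M.trans s).deg _ j) : Θ.transForm s A x y ∈ deg0 k b (i + j - (n + 2)) := by
  obtain ⟨h1, h2⟩ := mem_trans_deg.mp hx
  obtain ⟨h3, h4⟩ := mem_trans_deg.mp hy
  rw [nbr_weylMove] at h4
  have := mul_mem_deg0 k b (rinv_mem_deg0 (wallIdx s (weylMove w₀ A)))
    (add_mem (Θ.form_deg _ _ _ _ _ h1 h3) (Θ.form_deg _ _ _ _ _ h2 h4))
  rw [show i + j - (n + 2) = -2 + (i + j - n) by ring]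
  exact this

/-- The duality of the submodules of `𝒯_s M` at a wall in some `H_{β,n}` with `A` on its positive
side. With `β` replaced by `-w₀(β)` on the other side, the condition is the sum of the two
conditions for `M` at `β ↓ A` and at `β ↑ A`; each of them is recovered from test elements with one
entry `0`. -/
lemma trans_edge_pos (hw₀ : IsLongest b w₀) {A : Alcove P} {β : PosRoot b}
    (h : β.1 = wallIdx s A) (F G : ∀ C, M.carrier C) :
    (M.trans s).OnEdge A β (fun C => M.res s C F) (fun C => M.res s C G) ↔
    ∀ H E : ∀ C, M.carrier C, (M.trans s).OnEdge (weylMove w₀ (up P β A)) (opp w₀ β)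
        (fun C => M.res s C H) (fun C => M.res s C E) →
      rinv k b (wallIdx s (weylMove w₀ A)) * (Θ.eval A F E + Θ.eval (nbr s A) F E) +
        rinv k b (wallIdx s (weylMove w₀ (up P β A))) *
          (Θ.eval (up P β A) G H + Θ.eval (nbr s (up P β A)) G H) ∈ Sβ k b (opp w₀ β) := by
  have hnb := up_nbr_of_wallIdx h
  have hup := nbr_up_of_wallIdx h
  have hD := up_opp hw₀ β A
  have hwD : wallIdx s (weylMove w₀ A) = negIdx P (opp w₀ β).1 := by
    rw [wallIdx_weylMove, ← h, weylIdx_eq_opp hw₀]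
  have hwC : (opp w₀ β).1 = wallIdx s (weylMove w₀ (up P β A)) := by
    rw [wallIdx_weylMove, wallIdx_up, ← h, opp_val hw₀]
    exact (weylIdx_negIdx w₀ β.1).symm
  have hC : nbr s (weylMove w₀ (up P β A)) = weylMove w₀ (up P β (up P β A)) := by
    rw [nbr_weylMove, hup]
  rw [hwD, ← hwC, rinv_negIdx]
  simp only [onEdge_res_pos hwC, onEdge_res_pos h, hD, hC]
  have i1 := Θ.onEdge_iff hw₀ (A := nbr s A) (β := β) (f := rinv k b β.1 • F) (g := rinv k b β.1 • F)
  rw [hnb] at i1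
  have i2 := Θ.onEdge_iff hw₀ (A := up P β A) (β := β) (f := G) (g := G)
  rw [← hup] at i2
  rw [← hup]
  simp only [eval_smul_left, weyl0_rinv_opp hw₀] at i1
  rw [i1, i2]
  constructor
  · rintro ⟨h1, h2⟩ H E ⟨hH, hE⟩
    have := add_mem (h1 E hE) (h2 _ hH)
    simp only [eval_smul_right] at this
    convert this using 1
    ring
  · intro hall
    refine ⟨fun e he => ?_, fun e he => ?_⟩
    · have := hall 0 e ⟨(onEdge_zero _ _).congr (smul_zero _) (smul_zero _), he⟩
      simp only [eval_zero_right] at this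
      convert this using 1
      ring
    · have hre := rinv_smul (M := M) (opp w₀ β).1 e
      have := hall (root0 k b (opp w₀ β).1 • e) 0 ⟨he.congr hre hre, onEdge_zero _ _⟩
      simp only [eval_zero_right, eval_smul_right] at this
      convert this using 1
      linear_combination (-(Θ.eval (up P β A) G e + Θ.eval (nbr s (up P β A)) G e)) *
        rinv_mul_root (k := k) (b := b) (opp w₀ β).1

/-- The duality of the submodules of `𝒯_s M` at a wall in some `H_{β,n}` with `A` on its negative
side. If `(F, G)` and `(H, E)` are the two elements, the condition pairs `(F - G) / β` with `E` and
`G` with the divided difference of `H` and `E`. -/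
lemma trans_edge_neg (hw₀ : IsLongest b w₀) {A : Alcove P} {β : PosRoot b}
    (h : β.1 = negIdx P (wallIdx s A)) (F G : ∀ C, M.carrier C) :
    (M.trans s).OnEdge A β (fun C => M.res s C F) (fun C => M.res s C G) ↔
    ∀ H E : ∀ C, M.carrier C, (M.trans s).OnEdge (weylMove w₀ (up P β A)) (opp w₀ β)
        (fun C => M.res s C H) (fun C => M.res s C E) →
      rinv k b (wallIdx s (weylMove w₀ A)) * (Θ.eval A F E + Θ.eval (nbr s A) F E) +
        rinv k b (wallIdx s (weylMove w₀ (up P β A))) *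
          (Θ.eval (up P β A) G H + Θ.eval (nbr s (up P β A)) G H) ∈ Sβ k b (opp w₀ β) := by
  have hup := up_of_negIdx_wallIdx h
  have hwA : wallIdx s A = negIdx P β.1 := by rw [h, negIdx_negIdx]
  have hwD : wallIdx s (weylMove w₀ A) = (opp w₀ β).1 := by
    rw [wallIdx_weylMove, hwA, opp_val hw₀, weylIdx_negIdx]
  have hwC : wallIdx s (weylMove w₀ (up P β A)) = negIdx P (opp w₀ β).1 := by
    rw [hup, ← nbr_weylMove, wallIdx_nbr, hwD]
  have hwC' : (opp w₀ β).1 = negIdx P (wallIdx s (weylMove w₀ (up P β A))) := by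
    rw [hwC, negIdx_negIdx]
  rw [hwD, hwC, rinv_negIdx]
  simp only [onEdge_res_neg hwC', onEdge_res_neg h]
  have hnn : nbr s (up P β A) = A := by rw [hup, nbr_nbr]
  have i1 := Θ.onEdge_iff hw₀ (A := A) (β := β) (f := rinv k b β.1 • (F - G))
    (g := rinv k b β.1 • (F - G))
  simp only [eval_smul_left, eval_sub_left, weyl0_rinv_opp hw₀] at i1
  rw [i1, Θ.onEdge_iff hw₀ (A := A) (β := β) (f := G) (g := G), hnn, ← hup]
  constructor
  · rintro ⟨h1, h2⟩ H E ⟨hH, hE⟩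
    have := neg_mem (add_mem (h1 E hE) (h2 _ hH))
    simp only [eval_smul_right, eval_sub_right] at this
    convert this using 1
    ring
  · intro hall
    refine ⟨fun e he => ?_, fun e he => ?_⟩
    · have h0 : rinv k b (opp w₀ β).1 • (e - e) = 0 := by rw [sub_self, smul_zero]
      have := neg_mem (hall e e ⟨(onEdge_zero _ _).congr h0 h0, he⟩)
      convert this using 1
      ring
    · have hre : rinv k b (opp w₀ β).1 • (root0 k b (opp w₀ β).1 • e - 0) = e := by
        rw [sub_zero, rinv_smul]
      have := neg_mem (hall (root0 k b (opp w₀ β).1 • e) 0 ⟨he.congr hre hre, onEdge_zero _ _⟩)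
      simp only [eval_zero_right, eval_smul_right] at this
      convert this using 1
      linear_combination (-(Θ.eval A G e + Θ.eval (up P β A) G e)) *
        rinv_mul_root (k := k) (b := b) (opp w₀ β).1

/-- A reflection in `β` changes the inverse of a root that is not proportional to `β` by a multiple
of `β`. -/
lemma rinv_wallIdx_up {C : Alcove P} {β : PosRoot b} (h1 : β.1 ≠ wallIdx s C)
    (h2 : β.1 ≠ negIdx P (wallIdx s C)) :
    rinv k b (wallIdx s C) ∈ Sβ k b β ∧ rinv k b (wallIdx s (up P β C)) ∈ Sβ k b β ∧
    ∃ c ∈ Sβ k b β, root0 k b (wallIdx s C) - root0 k b (wallIdx s (up P β C)) =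
      c * root0 k b β.1 := by
  refine ⟨rinv_mem_Sβ (Ne.symm h1) (fun e => h2 (by rw [e, negIdx_negIdx])), ?_, ?_⟩
  · rw [wallIdx_up]
    refine rinv_mem_Sβ (fun e => h2 ?_) (fun e => h1 ?_)
    · rw [← P.reflectionPerm_self β.1 (wallIdx s C), e]
      exact (negIdx_negIdx P β.1).symm
    · rw [← P.reflectionPerm_self β.1 (wallIdx s C), e]
      exact (P.reflectionPerm_self β.1 β.1).symm
  · refine ⟨_, algebraMap_mem_Sβ (P.pairingIn ℤ (wallIdx s C) β.1 : k) β, ?_⟩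
    rw [wallIdx_up, root0_reflectionPerm, sub_sub_cancel]

/-- The duality of the submodules of `𝒯_s M` at a wall that lies in no `H_{β,n}`. The roots of the
walls of `w₀.A` and of `w₀.(β ↑ A)`, by which the two pairings are divided, are invertible in
`S_k^β` for the root `-w₀(β)` in place of `β` and differ by a multiple of this root. -/
lemma trans_edge_cross (hw₀ : IsLongest b w₀) {A : Alcove P} {β : PosRoot b}
    (h1 : β.1 ≠ wallIdx s A) (h2 : β.1 ≠ negIdx P (wallIdx s A)) (F G : ∀ C, M.carrier C) :
    (M.trans s).OnEdge A β (fun C => M.res s C F) (fun C => M.res s C G) ↔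
    ∀ H E : ∀ C, M.carrier C, (M.trans s).OnEdge (weylMove w₀ (up P β A)) (opp w₀ β)
        (fun C => M.res s C H) (fun C => M.res s C E) →
      rinv k b (wallIdx s (weylMove w₀ A)) * (Θ.eval A F E + Θ.eval (nbr s A) F E) +
        rinv k b (wallIdx s (weylMove w₀ (up P β A))) *
          (Θ.eval (up P β A) G H + Θ.eval (nbr s (up P β A)) G H) ∈ Sβ k b (opp w₀ β) := by
  classical
  have hup := nbr_up h1 h2
  have hD := up_opp hw₀ β A
  have hwD : wallIdx s (weylMove w₀ A) =
      P.reflectionPerm (opp w₀ β).1 (wallIdx s (weylMove w₀ (up P β A))) := by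
    rw [← wallIdx_up, hD]
  have hinj : Function.Injective (weylIdx P w₀) := (w₀ : P.Aut).indexEquiv.injective
  have hC1 : (opp w₀ β).1 ≠ wallIdx s (weylMove w₀ (up P β A)) := fun e => h1 (hinj (by
    rw [← wallIdx_weylMove, hwD, ← e, weylIdx_eq_opp hw₀]))
  have hC2 : (opp w₀ β).1 ≠ negIdx P (wallIdx s (weylMove w₀ (up P β A))) := fun e => by
    refine h2 (hinj ?_)
    rw [weylIdx_negIdx, ← wallIdx_weylMove, hwD, weylIdx_eq_opp hw₀]
    congr 1
    have e' : wallIdx s (weylMove w₀ (up P β A)) = negIdx P (opp w₀ β).1 := by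
      rw [e, negIdx_negIdx]
    rw [e']
    exact (P.reflectionPerm_self (opp w₀ β).1 (opp w₀ β).1).symm
  have hC : nbr s (weylMove w₀ (up P β A)) = weylMove w₀ (up P β (nbr s A)) := by
    rw [nbr_weylMove, hup]
  have hD' := up_opp hw₀ β (nbr s A)
  obtain ⟨hr, hr', c, hc, e0⟩ := rinv_wallIdx_up (k := k) hC1 hC2
  rw [hD] at hr' e0
  have e1 := root_mul_rinv (k := k) (b := b) (wallIdx s (weylMove w₀ (up P β A)))
  have e2 := root_mul_rinv (k := k) (b := b) (wallIdx s (weylMove w₀ A))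
  have hκ := root0_mem_Sβ (k := k) (wallIdx s (weylMove w₀ (up P β A))) (opp w₀ β)
  have hκ' := root0_mem_Sβ (k := k) (wallIdx s (weylMove w₀ A)) (opp w₀ β)
  simp only [onEdge_res_cross hC1 hC2, onEdge_res_cross h1 h2, hC, hup]
  generalize root0 k b (wallIdx s (weylMove w₀ (up P β A))) = κ at *
  generalize root0 k b (wallIdx s (weylMove w₀ A)) = κ' at *
  generalize rinv k b (wallIdx s (weylMove w₀ (up P β A))) = r at *
  generalize rinv k b (wallIdx s (weylMove w₀ A)) = r' at *
  constructor
  · rintro ⟨hf, hg⟩ H E ⟨hH, hE⟩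
    -- besides the sum of the two pairings, the second one alone lies in the ring after
    -- multiplication by the root
    have hz : ∀ X, M.OnEdge X β F G → M.OnEdge (weylMove w₀ (up P β X)) (opp w₀ β) H E →
        Θ.eval X F E + Θ.eval (up P β X) G H ∈ Sβ k b (opp w₀ β) ∧
        root0 k b (opp w₀ β).1 * Θ.eval (up P β X) G H ∈ Sβ k b (opp w₀ β) := fun X hX hX' => by
      refine ⟨(Θ.edge_iff X β F G).mp hX H E hX', ?_⟩
      have := (Θ.edge_iff X β F G).mp hX _ _ (Θ.smul_left _ _ _ _ hX')
      change Θ.eval X F 0 + Θ.eval (up P β X) G (_ • H) ∈ _ at this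
      rwa [eval_zero_right, eval_smul_right, zero_add] at this
    obtain ⟨u1, u2⟩ := hz A hf hH
    obtain ⟨u3, u4⟩ := hz _ hg hE
    have := sub_mem (mul_mem hr' (add_mem u1 u3))
      (mul_mem (mul_mem hc (mul_mem hr hr')) (add_mem u2 u4))
    convert this using 1
    linear_combination (Θ.eval (up P β A) G H + Θ.eval (up P β (nbr s A)) G H) *
      (r' * e1 - r * e2 - r * r' * e0)
  · intro hall
    have key : ∀ X, (X = A ∨ X = nbr s A) → M.OnEdge X β F G := fun X hX => by
      refine (Θ.onEdge_iff hw₀).mpr fun e he => ?_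
      have hw : ∀ {Y Z : Alcove P}, Y ≠ Z → weylMove w₀ Y ≠ weylMove w₀ Z := fun h e =>
        h ((Function.LeftInverse.injective (weylMove_inv_weylMove w₀)) e)
      have hu : ∀ {Y Z : Alcove P}, Y ≠ Z → up P β Y ≠ up P β Z := fun h e =>
        h ((upEquiv P β.1).injective e)
      -- test elements that are supported on a single summand
      let H : ∀ C, M.carrier C := Pi.single (weylMove w₀ (up P β X)) (e _)
      let E : ∀ C, M.carrier C := Pi.single (weylMove w₀ X) (e _)
      have hHE : ∀ Y, M.OnEdge (weylMove w₀ (up P β Y)) (opp w₀ β) H E := fun Y => by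
        have hDY := up_opp hw₀ β Y
        by_cases hY : Y = X
        · subst hY
          refine he.congr_of (Pi.single_eq_same _ _) ?_
          rw [hDY]; exact Pi.single_eq_same _ _
        · refine (onEdge_zero _ _).congr_of (Pi.single_eq_of_ne (hw (hu hY)) _) ?_
          rw [hDY]; exact Pi.single_eq_of_ne (hw hY) _
      have hE : ∀ Y, Θ.eval Y F E = if Y = X then Θ.eval X F e else 0 := fun Y => by
        split_ifs with hY
        · subst hY; exact Θ.eval_congr_right (Pi.single_eq_same _ _)
        · rw [← Θ.eval_zero_right Y F]
          exact Θ.eval_congr_right (Pi.single_eq_of_ne (hw hY) _)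
      have hH : ∀ Y, Θ.eval (up P β Y) G H = if Y = X then Θ.eval (up P β X) G e else 0 := fun Y => by
        split_ifs with hY
        · subst hY; exact Θ.eval_congr_right (Pi.single_eq_same _ _)
        · rw [← Θ.eval_zero_right (up P β Y) G]
          exact Θ.eval_congr_right (Pi.single_eq_of_ne (hw (hu hY)) _)
      have hsum : ∀ z : S0 k b, (if A = X then z else 0) + (if nbr s A = X then z else 0) = z :=
        fun z => by
          rcases hX with rfl | rfl
          · rw [if_pos rfl, if_neg (nbr_ne s X), add_zero]
          · rw [if_pos rfl, if_neg (nbr_ne s A).symm, zero_add]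
      have k1 := hall H E ⟨hHE _, hHE _⟩
      have k2 := hall _ 0 ⟨Θ.smul_left _ _ _ _ (hHE A), Θ.smul_left _ _ _ _ (hHE (nbr s A))⟩
      simp only [eval_smul_right, eval_zero_right, ← mul_add, hE, hH, hsum, add_zero, mul_zero,
        zero_add] at k1 k2
      -- by `k2` the second summand has at most a simple pole along the root, which `c` times the
      -- root cancels
      have := add_mem (mul_mem hκ' k1) (mul_mem hc k2)
      convert this using 1
      linear_combination (-(Θ.eval X F e)) * e2 + (Θ.eval (up P β X) G e) * (r * e0 - e1)
    exact ⟨key _ (Or.inl rfl), key _ (Or.inr rfl)⟩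

lemma trans_edge (hw₀ : IsLongest b w₀) (A : Alcove P) (β : PosRoot b) (F G : ∀ C, M.carrier C) :
    (M.trans s).OnEdge A β (fun C => M.res s C F) (fun C => M.res s C G) ↔
    ∀ H E : ∀ C, M.carrier C, (M.trans s).OnEdge (weylMove w₀ (up P β A)) (opp w₀ β)
        (fun C => M.res s C H) (fun C => M.res s C E) →
      Θ.transForm s A (M.res s A F) (M.res s _ E) +
        Θ.transForm s (up P β A) (M.res s _ G) (M.res s _ H) ∈ Sβ k b (opp w₀ β) := by
  simp only [transForm_res]
  by_cases h1 : β.1 = wallIdx s A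
  · exact Θ.trans_edge_pos hw₀ h1 _ _
  by_cases h2 : β.1 = negIdx P (wallIdx s A)
  · exact Θ.trans_edge_neg hw₀ h2 _ _
  · exact Θ.trans_edge_cross hw₀ h1 h2 _ _

/-- A self-duality of `M` induces one of `𝒯_s M`. -/
def trans (hw₀ : IsLongest b w₀) (s : simpleRefl b) : SelfPairing w₀ (M.trans s) (n + 2) where
  form := Θ.transForm s
  bijective := Θ.transForm_bijective
  form_deg A i j _ _ := Θ.transForm_deg A i j
  edge_iff A β f g := by
    have hD := up_opp hw₀ β A
    rw [onEdge_trans_iff, Θ.trans_edge hw₀, res_coord, res_coord]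
    refine ⟨fun h H E hHE => ?_, fun h H E hHE => h (fun C => M.res s C H) (fun C => M.res s C E) hHE⟩
    have := h _ _ (onEdge_trans_iff.mp hHE)
    rw [res_coord] at this
    have e : M.res s (weylMove w₀ A) (M.coord s _ (E (up P (opp w₀ β)
        (weylMove w₀ (up P β A))))) = E (weylMove w₀ A) := by
      rw [hD, res_coord]
    rwa [e] at this
  smul_left A β f g h := by
    rw [onEdge_trans_iff] at h ⊢
    have e1 : M.coord s A (root0 k b β.1 • f A) = root0 k b β.1 • M.coord s A (f A) :=
      map_smul _ _ _
    have e2 : M.coord s (up P β A) ((0 : ∀ C, (M.trans s).carrier C) (up P β A)) = 0 := map_zero _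
    rw [Pi.smul_apply, e1, e2]
    generalize M.coord s A (f A) = F at *
    generalize M.coord s (up P β A) (g (up P β A)) = G at *
    by_cases h1 : β.1 = wallIdx s A
    · obtain ⟨h3, -⟩ := (onEdge_res_pos h1).mp h
      refine (onEdge_res_pos h1).mpr ⟨?_, onEdge_zero _ _⟩
      have h4 : M.OnEdge (nbr s A) β (root0 k b β.1 • rinv k b β.1 • F)
          (root0 k b β.1 • rinv k b β.1 • F) :=
        (M.edge _ β).smul_mem (⟨_, root0_mem_Sβ _ _⟩ : Sβ k b β) h3
      exact h4.congr (smul_comm _ _ _) (smul_comm _ _ _)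
    by_cases h2 : β.1 = negIdx P (wallIdx s A)
    · obtain ⟨h3, h4⟩ := (onEdge_res_neg h2).mp h
      refine (onEdge_res_neg h2).mpr ⟨?_, onEdge_zero _ _⟩
      have h5 : M.OnEdge A β (root0 k b β.1 • rinv k b β.1 • (F - G) + G)
          (root0 k b β.1 • rinv k b β.1 • (F - G) + G) :=
        (M.edge _ β).add_mem
          ((M.edge _ β).smul_mem (⟨_, root0_mem_Sβ _ _⟩ : Sβ k b β) h3) h4
      have e : rinv k b β.1 • (root0 k b β.1 • F - 0) =
          root0 k b β.1 • rinv k b β.1 • (F - G) + G := by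
        rw [sub_zero, rinv_smul, smul_rinv, sub_add_cancel]
      exact h5.congr e e
    · obtain ⟨h3, h4⟩ := (onEdge_res_cross h1 h2).mp h
      exact (onEdge_res_cross h1 h2).mpr ⟨Θ.smul_left _ _ _ _ h3, Θ.smul_left _ _ _ _ h4⟩

/-- Each translation functor raises the shift of the self-duality by `2`. -/
lemma transWord (hw₀ : IsLongest b w₀) (u : List (simpleRefl b)) : ∀ {M : Obj k b} {n : ℤ},
    Nonempty (SelfPairing w₀ M n) → Nonempty (SelfPairing w₀ (M.transWord u) (n + 2 * u.length)) := by
  induction u with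
  | nil =>
    intro M n h
    rw [List.length_nil, Nat.cast_zero, mul_zero, add_zero]
    exact h
  | cons s u ih =>
    rintro M n ⟨Θ⟩
    have := ih ⟨Θ.trans hw₀ s⟩
    rw [show n + 2 * ((s :: u).length : ℤ) = n + 2 + 2 * (u.length : ℤ) by
      rw [List.length_cons]; push_cast; ring]
    exact this

end SelfPairing

end Obj

end PairingTrans



/-! ### Self-duality of the indecomposable summand -/

section SelfDual

variable {ι N : Type*} {V : Type v} [Finite ι] [AddCommGroup V] [Module ℚ V] [AddCommGroup N]
  [Module ℚ N]
variable {k : Type u} [Field k] {P : RootPairing ι ℚ V N} [P.IsRootSystem] [P.IsCrystallographic]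
  [P.IsReduced] [P.IsIrreducible] {b : P.Base}

namespace Obj

variable {M M' X Y Z : Obj k b} {w₀ : P.weylGroup} {l : ℤ}

/-- A morphism with bijective components that reflects the submodules `M(A, β)` is an isomorphism. -/
lemma nonempty_iso_of_bijective (f : X ⟶ Y) (hf : ∀ A, Function.Bijective (ap f A))
    (he : ∀ A (β : PosRoot b) p, (ap f A p.1, ap f (up P β A) p.2) ∈ Y.edge A β → p ∈ X.edge A β) :
    Nonempty (X ≅ Y) := by
  refine ⟨isoOfEquiv (fun A => LinearEquiv.ofBijective (ap f A) (hf A)) (fun A n x =>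
    ⟨fun h => ap_deg f h, fun h => ?_⟩) fun A β p => ⟨fun h => ap_edge f h, he A β p⟩⟩
  have h1 : comp (Y.internal A) n (ap f A x) = ap f A x := by
    rw [comp_of_mem _ (show ap f A x ∈ Y.deg A n from h), if_pos rfl]
  rw [ap_comp_deg] at h1
  rw [← (hf A).1 h1]
  exact comp_mem _ _ _

/-- Shifts can be moved to the other side of an isomorphism. -/
lemma iso_shift_neg (e : X ≅ Y.shift l) : Nonempty (Y ≅ X.shift (-l)) := by
  refine ⟨⟨⟨fun A => ap e.inv A, fun A n x h => ?_, fun A β p h => ap_edge e.inv h⟩,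
    ⟨fun A => ap e.hom A, fun A n x h => ?_, fun A β p h => ap_edge e.hom h⟩,
    hom_ext fun A x => ?_, hom_ext fun A x => ?_⟩⟩
  · refine ap_deg e.inv (n := n - -l) ?_
    change x ∈ Y.deg A (n - -l - l)
    rwa [show n - -l - l = n by ring]
  · have h1 : ap e.hom A x ∈ Y.deg A (n - -l - l) := ap_deg e.hom (n := n - -l) h
    rwa [show n - -l - l = n by ring] at h1
  · exact retract_apply (Retract.ofIso e.symm) A x
  · exact retract_apply (Retract.ofIso e) A x

/-- The twisted dual `𝒞 𝒟 M`, shifted by `l`. -/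
def twist (w₀ : P.weylGroup) (l : ℤ) (M : Obj k b) : Obj k b := (M.dual.tilt w₀).shift l

/-- An element of a module of the twisted dual as a linear form. -/
def twistVal (M : Obj k b) (w₀ : P.weylGroup) (l : ℤ) (A : Alcove P) :
    (M.twist w₀ l).carrier A →+ (M.carrier (weylMove w₀ A) →ₗ[S0 k b] S0 k b) :=
  (M.gradedHom (weylMove w₀ A)).subtype.toAddMonoidHom

lemma twistVal_injective (A : Alcove P) : Function.Injective (M.twistVal w₀ l A) :=
  Subtype.val_injective

lemma twistVal_smul {A : Alcove P} (c : S0 k b) (ψ : (M.twist w₀ l).carrier A) :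
    M.twistVal w₀ l A (c • ψ) = weyl0 k b w₀ c • M.twistVal w₀ l A ψ := rfl

/-- The submodules of the twisted dual: pairs of linear forms on `M(w₀.A)` and `M(w₀.(β ↑ A))` whose
sum is integral on `M(w₀.(β ↑ A), -w₀(β))`. -/
lemma mem_twist_edge (hw₀ : IsLongest b w₀) {A : Alcove P} {β : PosRoot b}
    {p : (M.twist w₀ l).carrier A × (M.twist w₀ l).carrier (up P β A)} :
    p ∈ (M.twist w₀ l).edge A β ↔
    ∀ e : ∀ C, M.carrier C, M.OnEdge (weylMove w₀ (up P β A)) (opp w₀ β) e e →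
      M.twistVal w₀ l A p.1 (e _) + M.twistVal w₀ l _ p.2 (e _) ∈ Sβ k b (opp w₀ β) := by
  have hne : weylMove w₀ A ≠ weylMove w₀ (up P β A) := fun e => up_ne β.1 A
    (Function.LeftInverse.injective (weylMove_inv_weylMove w₀) e).symm
  have hD := up_opp hw₀ β A
  have hbase : tiltBase b w₀ A β = weylMove w₀ (up P β A) := if_neg (hw₀.not_isPos β.2)
  have h1 : p ∈ (M.twist w₀ l).edge A β ↔
      M.dual.emb (weylMove w₀ A) (weylMove w₀ (up P β A)) p ∈
        M.dual.hat (tiltBase b w₀ A β) (opp w₀ β) := Iff.rfl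
  rw [h1, hbase, mem_hat_iff]
  have h2 : ∀ C, C ≠ weylMove w₀ (up P β A) → C ≠ up P (opp w₀ β) (weylMove w₀ (up P β A)) →
      M.dual.emb (weylMove w₀ A) (weylMove w₀ (up P β A)) p C = 0 := fun C c1 c2 =>
    emb_other (M := M.dual) (fun e => c2 (e.trans hD.symm)) c1 p
  have hval : ∀ (h : ∀ C, M.dual.carrier C) (e : ∀ C, M.carrier C) {C D : Alcove P}, C = D →
      (M.gradedHom C).subtype (h C) (e C) = (M.gradedHom D).subtype (h D) (e D) := by
    rintro h e C D rfl; rfl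
  have e1 := emb_left hne (M := M.dual) p
  have e2 := emb_right hne (M := M.dual) p
  generalize M.dual.emb (weylMove w₀ A) (weylMove w₀ (up P β A)) p = h at *
  have e1' : (M.gradedHom _).subtype (h (weylMove w₀ A)) = M.twistVal w₀ l A p.1 := by
    rw [e1]; rfl
  have e2' : (M.gradedHom _).subtype (h (weylMove w₀ (up P β A))) = M.twistVal w₀ l _ p.2 := by
    rw [e2]; rfl
  rw [← e1', ← e2']
  constructor
  · rintro ⟨h3, -⟩ e he
    have := h3 _ he
    change (M.gradedHom _).subtype (h _) (e _) + (M.gradedHom _).subtype (h _) (e _) ∈ _ at this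
    rwa [hval h e hD, add_comm] at this
  · intro h3
    refine ⟨fun m hm => ?_, h2⟩
    have := h3 _ (onEdge_lift hm)
    rw [← hval h _ hD, add_comm, lift_left, lift_right] at this
    exact this

/-- The duals consist of sums of homogeneous linear forms. -/
lemma SelfPairing.form_mem (Θ : SelfPairing w₀ M l) (A : Alcove P) (x : M.carrier A) :
    Θ.form A x ∈ M.gradedHom (weylMove w₀ A) := by
  induction x using graded_induction (M.internal A) with
  | hom i x hx =>
    refine Submodule.subset_span ⟨i - l, fun j y hy => ?_⟩
    rw [show i - l + j = i + j - l by ring]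
    exact Θ.form_deg A i j x y hx hy
  | zero => rw [map_zero]; exact zero_mem _
  | add x y hx hy => rw [map_add]; exact add_mem hx hy

/-- The morphism from `M` to its twisted dual that is given by a pairing. -/
def SelfPairing.hom (Θ : SelfPairing w₀ M l) (hw₀ : IsLongest b w₀) : M ⟶ M.twist w₀ l where
  app A :=
    { toFun := fun x => (⟨Θ.form A x, Θ.form_mem A x⟩ : M.gradedHom (weylMove w₀ A))
      map_add' := fun _ _ => Subtype.ext (map_add _ _ _)
      map_smul' := fun _ _ => Subtype.ext (LinearMap.map_smulₛₗ _ _ _) }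
  map_deg A n x hx := fun j y hy => by
    rw [show n - l + j = n + j - l by ring]
    exact Θ.form_deg A n j x y hx hy
  map_edge A β p hp := (mem_twist_edge hw₀).mpr fun e he => by
    have := (Θ.onEdge_iff hw₀).mp (onEdge_lift hp) e he
    rwa [SelfPairing.eval, SelfPairing.eval, lift_left, lift_right] at this

lemma SelfPairing.nonempty_iso (Θ : SelfPairing w₀ M l) (hw₀ : IsLongest b w₀) :
    Nonempty (M ≅ M.twist w₀ l) := by
  refine nonempty_iso_of_bijective (Θ.hom hw₀) (fun A => ⟨fun x y h => (Θ.bijective A).1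
    (congrArg (M.twistVal w₀ l A) h), fun ψ => ?_⟩) fun A β p hp => ?_
  · obtain ⟨x, hx⟩ := (Θ.bijective A).2 (M.twistVal w₀ l A ψ)
    exact ⟨x, twistVal_injective A hx⟩
  · have key : M.OnEdge A β (M.lift A β p) (M.lift A β p) := (Θ.onEdge_iff hw₀).mpr fun e he => by
      rw [SelfPairing.eval, SelfPairing.eval, lift_left, lift_right]
      exact (mem_twist_edge hw₀).mp hp e he
    rw [OnEdge, lift_left, lift_right] at key
    exact key

lemma comp_mem_gradedHom (f : X ⟶ Y) (A : Alcove P) {φ : Y.carrier A →ₗ[S0 k b] S0 k b}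
    (hφ : φ ∈ Y.gradedHom A) : φ ∘ₗ ap f A ∈ X.gradedHom A := by
  induction hφ using Submodule.span_induction with
  | mem φ h =>
    obtain ⟨i, hi⟩ := h
    exact Submodule.subset_span ⟨i, fun n x hx => hi n _ (ap_deg f hx)⟩
  | zero => rw [LinearMap.zero_comp]; exact zero_mem _
  | add φ ψ _ _ h1 h2 => rw [LinearMap.add_comp]; exact add_mem h1 h2
  | smul c φ _ h => rw [LinearMap.smul_comp]; exact Submodule.smul_mem _ _ h

/-- The twisted dual of a morphism. -/
def twistMap (hw₀ : IsLongest b w₀) (l : ℤ) (f : X ⟶ Y) : Y.twist w₀ l ⟶ X.twist w₀ l where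
  app A :=
    { toFun := fun ψ => (⟨Y.twistVal w₀ l A ψ ∘ₗ ap f _, comp_mem_gradedHom f _ (Subtype.prop _)⟩ :
        X.gradedHom (weylMove w₀ A))
      map_add' := fun _ _ => rfl
      map_smul' := fun _ _ => rfl }
  map_deg _ _ _ hψ := fun j _ hx => hψ j _ (ap_deg f hx)
  map_edge _ _ _ hp := (mem_twist_edge hw₀).mpr fun _ he => (mem_twist_edge hw₀).mp hp _ (he.map f)

lemma twistVal_twistMap (hw₀ : IsLongest b w₀) (f : X ⟶ Y) (A : Alcove P)
    (ψ : (Y.twist w₀ l).carrier A) :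
    X.twistVal w₀ l A (ap (twistMap hw₀ l f) A ψ) = Y.twistVal w₀ l A ψ ∘ₗ ap f _ := rfl

lemma twistMap_comp (hw₀ : IsLongest b w₀) (f : X ⟶ Y) (g : Y ⟶ Z) :
    twistMap hw₀ l g ≫ twistMap hw₀ l f = twistMap hw₀ l (f ≫ g) := rfl

lemma twistMap_id (hw₀ : IsLongest b w₀) : twistMap hw₀ l (𝟙 X) = 𝟙 _ := rfl

/-- The twisted duals of isomorphic objects are isomorphic. -/
def twistIso (hw₀ : IsLongest b w₀) (l : ℤ) (e : X ≅ Y) : Y.twist w₀ l ≅ X.twist w₀ l where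
  hom := twistMap hw₀ l e.hom
  inv := twistMap hw₀ l e.inv
  hom_inv_id := by rw [twistMap_comp, e.inv_hom_id, twistMap_id]
  inv_hom_id := by rw [twistMap_comp, e.hom_inv_id, twistMap_id]

/-- The twisted dual of a direct summand. -/
def twistRetract (hw₀ : IsLongest b w₀) (l : ℤ) (ρ : Retract X Y) :
    Retract (X.twist w₀ l) (Y.twist w₀ l) where
  i := twistMap hw₀ l ρ.r
  r := twistMap hw₀ l ρ.i
  retract := by rw [twistMap_comp, ρ.retract, twistMap_id]

/-- The elements of the finite Weyl group act on the alcoves with finite order. -/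
lemma exists_pow_weylMove (w : P.weylGroup) : ∃ n : ℕ, ∀ A, weylMove (w ^ (n + 1)) A = A := by
  obtain ⟨n, hn, h⟩ := (isOfFinOrder_of_finite (P.weylGroupToPerm w)).exists_pow_eq_one
  obtain ⟨n, rfl⟩ := Nat.exists_eq_succ_of_ne_zero hn.ne'
  refine ⟨n, fun A => alcove_ext fun i => ?_⟩
  have h1 := fl_weylMove (w ^ (n + 1)) i A
  have h2 : weylIdx P (w ^ (n + 1)) i = i := by
    rw [← map_pow] at h
    exact DFunLike.congr_fun h i
  rwa [h2] at h1

lemma finrank_twist_le [IsDomain (S0 k b)] (h : X.TorsionFreeObj) (A : Alcove P) :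
    Module.finrank (S0 k b) ((X.twist w₀ l).carrier A) ≤
      Module.finrank (S0 k b) (X.carrier (weylMove w₀ A)) := by
  have := h.finite (weylMove w₀ A)
  exact finrank_le_of_dual (weyl0_inv_weyl0 w₀) (weyl0_weyl0_inv w₀) (X.twistVal w₀ l A)
    (fun c ψ => twistVal_smul c ψ) (twistVal_injective A)

/-- An indecomposable direct summand `X` of a self-dual object `M` is self-dual if it is nonzero at two
alcoves `A` and `w₀.A` and `M(w₀.A)` has rank `1`: then `X ⟶ M ≅ 𝒞 𝒟 M ⟶ 𝒞 𝒟 X` is a split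
monomorphism, and a comparison of ranks shows that it is an isomorphism. -/
lemma nonempty_iso_twist_of_retract [IsDomain (S0 k b)] (hw₀ : IsLongest b w₀) (hM : M.AlgEnd)
    (ht : M.TorsionFreeObj) (Φ : M ≅ M.twist w₀ l) (ρ : Retract X M) (hX : X.Indecomposable)
    {A : Alcove P} (h : M.RankOne (weylMove w₀ A)) (hA : A ∈ X.supp)
    (hA' : weylMove w₀ A ∈ X.supp) : Nonempty (X ≅ X.twist w₀ l) := by
  let α : X ⟶ X.twist w₀ l := ρ.i ≫ Φ.hom ≫ twistMap hw₀ l ρ.i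
  let γ : X.twist w₀ l ⟶ X := twistMap hw₀ l ρ.r ≫ Φ.inv ≫ ρ.r
  have hid : ∀ x, ap (α ≫ γ) A x = x := fun x => by
    -- the idempotent of `X` is the identity at `w₀.A`, so it can be dropped in the dual
    have e1 : ap (twistMap hw₀ l ρ.r) A (ap (twistMap hw₀ l ρ.i) A (ap Φ.hom A (ap ρ.i A x))) =
        ap Φ.hom A (ap ρ.i A x) := by
      refine twistVal_injective A (LinearMap.ext fun z => ?_)
      rw [twistVal_twistMap, twistVal_twistMap, LinearMap.comp_apply, LinearMap.comp_apply,
        h.retract_id ρ hA']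
    change ap ρ.r A (ap Φ.inv A (ap (twistMap hw₀ l ρ.r) A
      (ap (twistMap hw₀ l ρ.i) A (ap Φ.hom A (ap ρ.i A x))))) = x
    rw [e1, ← ap_comp Φ.hom, Φ.hom_inv_id, ap_id, retract_apply]
  have hiso : IsIso (α ≫ γ) := by
    refine (hX.fitting (hM.retract ρ) _).resolve_left ?_
    rintro ⟨n, hn⟩
    obtain ⟨x, hx⟩ := @exists_ne _ hA (0 : X.carrier A)
    exact hx (by rw [← hn A x, pow_eq_self_of_id hid])
  let τ : Retract X (X.twist w₀ l) := ⟨α, γ ≫ inv (α ≫ γ), by rw [← Category.assoc, IsIso.hom_inv_id]⟩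
  have htX := ht.retract ρ
  have htG : (X.twist w₀ l).TorsionFreeObj :=
    ht.retract ((twistRetract hw₀ l ρ).trans (Retract.ofIso Φ.symm))
  -- the ranks do not decrease along the orbit of an alcove under the powers of `w₀`, so they are
  -- constant on it
  have hle : ∀ B, Module.finrank (S0 k b) (X.carrier B) ≤
      Module.finrank (S0 k b) ((X.twist w₀ l).carrier B) := fun B => by
    have := htG.finite B
    have := htG.torsionFree B
    exact LinearMap.finrank_le_finrank_of_injective (retract_injective τ B)
  have hpow : ∀ B (j : ℕ), Module.finrank (S0 k b) (X.carrier (weylMove w₀ B)) ≤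
      Module.finrank (S0 k b) (X.carrier (weylMove (w₀ ^ (j + 1)) B)) := fun B j => by
    induction j with
    | zero => rw [zero_add, pow_one]
    | succ j ih =>
      rw [pow_succ' w₀ (j + 1), weylMove_mul]
      exact ih.trans ((hle _).trans (finrank_twist_le htX _))
  have hinj : ∀ B, Function.Injective (ap τ.r B) := fun B => by
    rw [injective_iff_map_eq_zero]
    intro x hx
    by_contra h0
    have := htG.finite B
    have := htG.torsionFree B
    have hlt := finrank_lt_of_retract (retract_apply τ B) ⟨x, hx, h0⟩
    obtain ⟨n, hn⟩ := exists_pow_weylMove w₀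
    have h3 := hpow B n
    rw [hn] at h3
    have h4 := finrank_twist_le (w₀ := w₀) (l := l) htX B
    omega
  exact ⟨⟨τ.i, τ.r, τ.retract, hom_ext fun B x => hinj B (retract_apply τ B (ap τ.r B x))⟩⟩

variable {s t : List (simpleRefl b)}

/-- The star object absorbs the part of the reduced word that belongs to `w₀`. -/
lemma star_transWord_retract (hk : GKM k b) (hw₀ : IsLongest b w₀)
    (hs : IsReducedExpr b s (weylAff P w₀)) :
    Nonempty (Retract ((star k b).transWord t) ((unit k b).transWord (s ++ t))) := by
  rw [transWord_append]
  exact transWord_retract t (star_retract hk hw₀ hs)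

/-- The object `𝒯_t` of the star object is isomorphic to its twisted dual, shifted by twice the length
of `w₀ t`. -/
lemma nonempty_iso_twist_star (hw₀ : IsLongest b w₀) (hs : IsReducedExpr b s (weylAff P w₀)) :
    Nonempty ((star k b).transWord t ≅
      ((star k b).transWord t).twist w₀ (2 * (s ++ t).length)) := by
  obtain ⟨Θ⟩ := SelfPairing.transWord hw₀ t ⟨starPairing (k := k) hw₀⟩
  rw [show 2 * (((s ++ t).length : ℕ) : ℤ) = 2 * (Fintype.card (PosRoot b) : ℤ) + 2 * (t.length : ℤ) by
    rw [List.length_append, hs.2, hw₀.len_eq]; push_cast; ring]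
  exact Θ.nonempty_iso hw₀

/-- An indecomposable direct summand of a Bott-Samelson object that is nonzero at the top alcove is
isomorphic to its twisted dual. -/
lemma nonempty_iso_twist (hk : GKM k b) (hw₀ : IsLongest b w₀)
    (hs : IsReducedExpr b s (weylAff P w₀))
    (hst : (s ++ t).length = len b (wordEl b (s ++ t)))
    (hbox : alcoveOf b (wordEl b (s ++ t)) ∈ antiFundBox b)
    (σ : Retract Y ((unit k b).transWord (s ++ t))) (hY : Y.Indecomposable)
    (hYA : alcoveOf b (wordEl b (s ++ t)) ∈ Y.supp) :
    Nonempty (Y ≅ Y.twist w₀ (2 * (s ++ t).length)) := by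
  have := hk.isDomain
  have hs' : wordEl b s = weylEl b w₀ := Subtype.ext ((coe_wordEl b s).trans hs.1)
  have hfin := finObj_transWord (s ++ t) (finObj_unit (k := k) (b := b))
  have hend := hfin.algEnd hk
  obtain ⟨ρ⟩ := star_transWord_retract (t := t) hk hw₀ hs
  have htf := (hfin.torsionFreeObj hk).retract ρ
  have hrank := rankOne_star (k := k) hw₀ hs' hst
  have hrank1 := hrank 1
  rw [weylMove_one] at hrank1
  -- by uniqueness, `Y` may be replaced by a summand of `𝒯_t` of the star object
  obtain ⟨X, hX, hXA, ⟨τ⟩⟩ := htf.exists_indecomposable hk hrank1.mem_supp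
  obtain ⟨e⟩ := iso_of_rankOne hend (rankOne_unit _ hst) σ (τ.trans ρ) hY hX hYA hXA
  obtain ⟨Φ⟩ := nonempty_iso_twist_star (k := k) (t := t) hw₀ hs
  obtain ⟨e'⟩ := nonempty_iso_twist_of_retract hw₀ (hend.retract ρ) htf Φ τ hX (hrank w₀) hXA
    (weylMove_mem_supp hk hw₀ hs' hst hbox τ hXA w₀)
  exact ⟨e ≪≫ e' ≪≫ twistIso hw₀ _ e⟩

end Obj

end SelfDual

end AJS

end

theorem theorem5 {k : Type*} [Field k] [IsAlgClosed k]
    {ι V N : Type*} [Finite ι]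
    [AddCommGroup V] [Module ℚ V] [AddCommGroup N] [Module ℚ N]
    (P : RootPairing ι ℚ V N) [P.IsRootSystem] [P.IsCrystallographic] [P.IsReduced]
    [P.IsIrreducible] (b : P.Base)
    (h2 : ringChar k ≠ 2) (h3 : P.IsG2 ∨ AJS.IsTypeA2 b → ringChar k ≠ 3)
    (w₀ : P.weylGroup) (hw₀ : AJS.IsLongest b w₀)
    (w : AJS.affineWeyl b) (hw : AJS.alcoveOf b w ∈ AJS.antiFundBox b)
    (s t : List (AJS.simpleRefl b))
    (hs : AJS.IsReducedExpr b s (AJS.weylAff P w₀)) (hst : AJS.IsReducedExpr b (s ++ t) w) :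
    (∃ Q : AJS.Obj k b, Q.IsSummand (AJS.Obj.bottSamelson k b (s ++ t)) ∧ Q.Indecomposable ∧
      AJS.alcoveOf b w ∈ Q.supp) ∧
    (∀ Q Q' : AJS.Obj k b,
      Q.IsSummand (AJS.Obj.bottSamelson k b (s ++ t)) → Q.Indecomposable →
      AJS.alcoveOf b w ∈ Q.supp →
      Q'.IsSummand (AJS.Obj.bottSamelson k b (s ++ t)) → Q'.Indecomposable →
      AJS.alcoveOf b w ∈ Q'.supp → Nonempty (Q ≅ Q')) ∧
    (∀ Q : AJS.Obj k b, Q.IsSummand (AJS.Obj.bottSamelson k b (s ++ t)) → Q.Indecomposable →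
      AJS.alcoveOf b w ∈ Q.supp →
      Nonempty (Q.dual.tilt w₀ ≅ Q.shift (-2 * (AJS.len b w : ℤ)))) := by
  have hk := AJS.gkm_of_char (b := b) h2 h3
  have hdom := hk.isDomain
  have hfin := AJS.Obj.finObj_transWord (s ++ t) (AJS.Obj.finObj_unit (k := k) (b := b))
  have hw' : w = AJS.wordEl b (s ++ t) :=
    Subtype.ext ((AJS.coe_wordEl b (s ++ t)).trans hst.1).symm
  subst hw'
  have hrank := AJS.Obj.rankOne_unit (k := k) (s ++ t) hst.2
  simp only [AJS.Obj.isSummand_iff, AJS.Obj.bottSamelson_eq]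
  refine ⟨?_, ?_, ?_⟩
  · obtain ⟨Q, h1, h4, h5⟩ := (hfin.torsionFreeObj hk).exists_indecomposable hk hrank.mem_supp
    exact ⟨Q, h5, h1, h4⟩
  · rintro Q Q' ⟨ρ⟩ hQ hQA ⟨σ⟩ hQ' hQA'
    exact AJS.Obj.iso_of_rankOne (hfin.algEnd hk) hrank ρ σ hQ hQ' hQA hQA'
  · rintro Q ⟨ρ⟩ hQ hQA
    obtain ⟨e⟩ := AJS.Obj.nonempty_iso_twist hk hw₀ hs hst.2 hw ρ hQ hQA
    have h := AJS.Obj.iso_shift_neg e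
    rwa [← neg_mul, hst.2] at h
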